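/- For a real number $\omega$ and an integer $k\ge 2$ let $$x_k = k\prod_{j=2}^{k}\bigl((5-2j)+(j-2)\omega\bigr),\qquad y_k=(3-\omega)^{k-2}+\sum_{j=2}^{k-1}(3-\omega)^{k-1-j}x_j,\qquad \alpha_k=\frac{x_k}{y_k},$$ and let $\gamma_2=0$ and $\gamma_k=k\Bigl(1-\frac{3-\omega}{k-\alpha_k}\Bigr)$ for $k\ge 3$. Algorithms are randomized algorithms on a word RAM with words of $O(\log n)$ bits and unit-cost word operations and coin flips. An algorithm lists all $k$-cliques of $n$-node graphs ($n\ge1$) in time $T$ with high probability if, given the adjacency matrix of a graph, it outputs all $k$-cliques, each exactly once, within $T$ steps with probability at least $1-n^{-d}$; here $d$ is an arbitrary constant, on which the algorithm and the constants hidden in its running time may depend. $\tilde O$ hides a constant factor and a fixed power of $\log(n+2)$. Matrix multiplication time refers to (errorless) multiplication of two $n\times n$ integer matrices with entries in $\{0,\dots,n\}$ on the same machine, and the matrix multiplication exponent is the infimum of all $\tau$ such that this can be done in $\tilde O(n^\tau)$ time. **Theorem.** Let $k\ge 2$ be a constant. 1. Let $2\le\omega<3$ be such that $n\times n$ matrices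 can be multiplied in $\tilde O(n^{\omega})$ time. There is an algorithm that, on $n$-node graphs whose number $t$ of $k$-cliques satisfies $t\ge n^{\gamma_k}$ ($t$ is not part of the input), lists all $t$ $k$-cliques with high probability in time $$\tilde O\bigl(n^{\alpha_k}\,t^{\,1-\alpha_k/k}\bigr).$$ If $\omega$ is the matrix multiplication exponent itself (an infimum that need not be attained), the same holds, for every fixed $\varepsilon>0$, with time $\tilde O(n^{\alpha_k+\varepsilon}t^{1-\alpha_k/k})$. 2. If $\omega=2$, then $x_k=k$ and $y_k=\frac{k(k-1)}2$. Hence, for $k\ge 3$, if $n\times n$ matrices can be multiplied in $\tilde O(n^2)$ time, all $t$ $k$-cliques of $n$-node graphs with $t\ge n^{\,k-1-\frac{2}{k^2-k-2}}$ can be listed with high probability in time $$\tilde O\bigl(n^{\frac{2}{k-1}}\,t^{\,1-\frac{2}{k(k-1)}}\bigr),$$ and if the matrix multiplication exponent is $2$, in time $\tilde O\bigl(n^{\frac{2}{k-1}+\varepsilon}t^{1-\frac{2}{k(k-1)}}\bigr)$ for every fixed $\varepsilon>0$. -/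

import Mathlib

open scoped ENNReal

namespace CliqueListing

/-! ### A randomized word RAM

Programs are structured programs over finitely many registers and finitely many memory banks
(the ones they mention), each bank being an array addressed by words. Every elementary step costs
one unit of time. Words are natural numbers below a bound `B`; a program that produces a larger
number crashes. Below, `B` is always `(n + 2) ^ c` for a constant `c`, that is, words have
`O(log n)` bits. -/

/-- The binary word operations, with truncated subtraction; comparisons return `0` or `1`. -/
inductive BinOp
  | add | sub | mul | div | mod | lt | eq | land | lor | xor | shl | shr

/-- The value of a binary operation, before the overflow test. -/
def BinOp.eval : BinOp → ℕ → ℕ → ℕ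
  | .add, a, b => a + b
  | .sub, a, b => a - b
  | .mul, a, b => a * b
  | .div, a, b => a / b
  | .mod, a, b => a % b
  | .lt, a, b => if a < b then 1 else 0
  | .eq, a, b => if a = b then 1 else 0
  | .land, a, b => a &&& b
  | .lor, a, b => a ||| b
  | .xor, a, b => a ^^^ b
  | .shl, a, b => a <<< b
  | .shr, a, b => a >>> b

/-- Programs. Registers and memory banks are named by natural numbers fixed in the program text. -/
inductive Cmd
  /-- do nothing -/
  | skip
  /-- `r := v` -/
  | const (r v : ℕ)
  /-- `r := x o y` for registers `x`, `y` -/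
  | op (o : BinOp) (r x y : ℕ)
  /-- `r := bank[x]`, where the address is the content of register `x` -/
  | load (r bank x : ℕ)
  /-- `bank[x] := y`, where the address is the content of register `x` -/
  | store (bank x y : ℕ)
  /-- `r :=` a fresh fair coin flip, `0` or `1` -/
  | flip (r : ℕ)
  /-- first `p`, then `q` -/
  | seq (p q : Cmd)
  /-- if register `r` is nonzero then `p` else `q` -/
  | ite (r : ℕ) (p q : Cmd)
  /-- while register `r` is nonzero do `p` -/
  | loop (r : ℕ) (p : Cmd)

/-- The contents of the registers and of the memory banks. -/
structure State where
  reg : ℕ → ℕ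
  mem : ℕ → ℕ → ℕ

/-- A state together with the stack of commands that remain to be executed; the machine has halted
when the stack is empty. -/
structure Config where
  todo : List Cmd
  state : State

/-- Write the word `v` into register `r`; `none` is the crash caused by an overflow. -/
def State.writeReg (B : ℕ) (s : State) (r v : ℕ) : Option State :=
  if v < B then some ⟨Function.update s.reg r v, s.mem⟩ else none

/-- Write the word `v` into cell `a` of a memory bank. -/
def State.writeMem (s : State) (bank a v : ℕ) : State :=
  ⟨s.reg, Function.update s.mem bank (Function.update (s.mem bank) a v)⟩

/-- One step of the machine with word bound `B`; `b` is the coin that is used if the step is a coin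
flip. A halted machine stays as it is. -/
def step (B : ℕ) (b : Bool) : Config → Option Config
  | ⟨[], s⟩ => some ⟨[], s⟩
  | ⟨.skip :: K, s⟩ => some ⟨K, s⟩
  | ⟨.const r v :: K, s⟩ => (s.writeReg B r v).map (Config.mk K)
  | ⟨.op o r x y :: K, s⟩ => (s.writeReg B r (o.eval (s.reg x) (s.reg y))).map (Config.mk K)
  | ⟨.load r bank x :: K, s⟩ => (s.writeReg B r (s.mem bank (s.reg x))).map (Config.mk K)
  | ⟨.store bank x y :: K, s⟩ => some ⟨K, s.writeMem bank (s.reg x) (s.reg y)⟩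
  | ⟨.flip r :: K, s⟩ => (s.writeReg B r b.toNat).map (Config.mk K)
  | ⟨.seq p q :: K, s⟩ => some ⟨p :: q :: K, s⟩
  | ⟨.ite r p q :: K, s⟩ => some ⟨if s.reg r ≠ 0 then p :: K else q :: K, s⟩
  | ⟨.loop r p :: K, s⟩ => some ⟨if s.reg r ≠ 0 then p :: .loop r p :: K else K, s⟩

/-- The distribution of the configuration after `T` steps, with independent fair coins. -/
noncomputable def runDist (B : ℕ) : ℕ → Option Config → PMF (Option Config)
  | 0, c => PMF.pure c
  | T + 1, c => (PMF.uniformOfFintype Bool).bind fun b => runDist B T (c.bind (step B b))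

/-- The probability that program `p`, started in state `s` with word bound `B`, has **not** halted
within `T` steps in a state that satisfies `Good`. -/
noncomputable def failureProb (B T : ℕ) (p : Cmd) (s : State) (Good : State → Prop) : ℝ≥0∞ :=
  (runDist B T (some ⟨[p], s⟩)).toOuterMeasure {c | ¬ ∃ f : State, c = some ⟨[], f⟩ ∧ Good f}

/-! ### Input and output -/

/-- The row-major array of an `n × n` matrix, followed by zeros. -/
def flatten {n : ℕ} (M : Matrix (Fin n) (Fin n) ℕ) (a : ℕ) : ℕ :=
  if h : a < n * n then
    M ⟨a / n, Nat.div_lt_of_lt_mul h⟩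
      ⟨a % n, Nat.mod_lt a (Nat.pos_of_ne_zero fun h0 => by simp [h0] at h)⟩
  else 0

/-- The input state that holds `n` in register `0`, the first matrix in bank `0`, the second one in
bank `1`, and zeros elsewhere. -/
def matrixInput {n : ℕ} (A A₂ : Matrix (Fin n) (Fin n) ℕ) : State where
  reg r := if r = 0 then n else 0
  mem bank a := if bank = 0 then flatten A a else if bank = 1 then flatten A₂ a else 0

open Classical in
/-- The input state that holds `n` in register `0`, the adjacency matrix of the graph in bank `0`,
and zeros elsewhere. -/
noncomputable def graphInput {n : ℕ} (G : SimpleGraph (Fin n)) : State where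
  reg r := if r = 0 then n else 0
  mem bank a := if bank = 0 then flatten (G.adjMatrix ℕ) a else 0

/-- The final state holds `M` as a row-major array in bank `2`. -/
def HoldsMatrix {n : ℕ} (M : Matrix (Fin n) (Fin n) ℕ) (s : State) : Prop :=
  ∀ i j : Fin n, s.mem 2 (i * n + j) = M i j

/-- The list of vertex sets that a final state encodes: register `0` holds their number, and the
`i`-th one consists of the cells `k * i, …, k * i + k - 1` of bank `1`. -/
def outputList (k : ℕ) (s : State) : List (Finset ℕ) :=
  (List.range (s.reg 0)).map fun i => (Finset.range k).image fun j => s.mem 1 (k * i + j)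

/-- The final state lists all `k`-cliques of `G`, each exactly once. -/
def ListsCliques {n : ℕ} (G : SimpleGraph (Fin n)) (k : ℕ) (s : State) : Prop :=
  (outputList k s).Nodup ∧
    ∀ S : Finset ℕ, S ∈ outputList k s ↔
      ∃ K : Finset (Fin n), G.IsNClique k K ∧ S = K.map Fin.valEmbedding

/-! ### Matrix multiplication and its exponent -/

/-- Two `n × n` integer matrices can be multiplied in `Õ(n ^ τ)` time: some program, with words of
`O(log n)` bits, computes the product without error whenever the entries are in `{0, …, n}`.
(Longer entries of `O(log n)` bits reduce to this by splitting them into digits.) -/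
def MatMulTime (τ : ℝ) : Prop :=
  ∃ (p : Cmd) (c : ℕ) (C : ℝ) (e : ℕ), ∀ n : ℕ, 1 ≤ n →
    ∀ A A₂ : Matrix (Fin n) (Fin n) ℕ, (∀ i j, A i j ≤ n) → (∀ i j, A₂ i j ≤ n) →
      failureProb ((n + 2) ^ c) ⌊C * (n : ℝ) ^ τ * Real.log (n + 2) ^ e⌋₊ p (matrixInput A A₂)
        (HoldsMatrix (A * A₂)) = 0

/-- The matrix multiplication exponent. -/
noncomputable def matMulExponent : ℝ := sInf {τ : ℝ | MatMulTime τ}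

/-! ### The clique listing problem -/

/-- The `k`-cliques of an `n`-vertex graph with `t ≥ n ^ γ` of them (`t` is not given to the
algorithm) can be listed in `Õ(f n t)` time with high probability: for every constant `d` there is
a program, with words of `O(log n)` bits, that within this time lists all of them with probability
at least `1 - n ^ (-d)`. -/
def CliqueListTime (k : ℕ) (γ : ℝ) (f : ℕ → ℕ → ℝ) : Prop :=
  ∀ d : ℕ, ∃ (p : Cmd) (c : ℕ) (C : ℝ) (e : ℕ), ∀ n : ℕ, 1 ≤ n →
    ∀ (G : SimpleGraph (Fin n)) (t : ℕ), (G.cliqueSet k).ncard = t → (n : ℝ) ^ γ ≤ t →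
      failureProb ((n + 2) ^ c) ⌊C * f n t * Real.log (n + 2) ^ e⌋₊ p (graphInput G)
        (ListsCliques G k) ≤ ((n : ℝ≥0∞) ^ d)⁻¹

/-- `x_k = k ∏_{j=2}^k ((5 - 2j) + (j - 2) ω)`. -/
noncomputable def xNum (ω : ℝ) (k : ℕ) : ℝ :=
  k * ∏ j ∈ Finset.Icc 2 k, ((5 - 2 * (j : ℝ)) + ((j : ℝ) - 2) * ω)

/-- `y_k = (3 - ω)^(k-2) + ∑_{j=2}^{k-1} (3 - ω)^(k-1-j) x_j`, for `k ≥ 2`. -/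
noncomputable def yDen (ω : ℝ) (k : ℕ) : ℝ :=
  (3 - ω) ^ (k - 2) + ∑ j ∈ Finset.Icc 2 (k - 1), (3 - ω) ^ (k - 1 - j) * xNum ω j

/-- `α_k = x_k / y_k`. -/
noncomputable def alpha (ω : ℝ) (k : ℕ) : ℝ := xNum ω k / yDen ω k

/-- `γ_2 = 0` and `γ_k = k (1 - (3 - ω) / (k - α_k))` for `k ≥ 3`. -/
noncomputable def gamma (ω : ℝ) (k : ℕ) : ℝ :=
  if k = 2 then 0 else k * (1 - (3 - ω) / (k - alpha ω k))

end CliqueListing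

open CliqueListing

namespace CliqueListing

open Finset (range sum_congr sum_const card_range sum_mul card_filter mul_sum sum_le_sum mem_filter mem_range card_le_card univ mem_image coe_range image_congr card_filter_le Icc mem_Icc mem_coe mem_product mem_univ sum_range_succ sum_le_card_nsmul)
open Real (log_mul log_rpow log one_le_rpow rpow_mul rpow_add mul_rpow rpow_natCast log_nonneg rpow_le_rpow_of_exponent_le)
open Nat (exists_eq_add_of_le lt_succ_iff_lt_or_eq clog one_le_two_pow count)
open Function (update update_apply update_of_ne)
open List (mem_cons mem_map map_cons range_succ map_append)
open Fin (valEmbedding)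

noncomputable section

/-! ### Failure probabilities along a run -/

/-- The probability that a run of `T` steps from `c` does not end halted in a state in `G`. -/
def failFrom (B : ℕ) (G : State → Prop) (T : ℕ) (c : Option Config) : ℝ≥0∞ :=
  (runDist B T c).toOuterMeasure {c | ¬ ∃ f : State, c = some ⟨[], f⟩ ∧ G f}

theorem failFrom_succ (B : ℕ) (G : State → Prop) (T : ℕ) (c : Config) : failFrom B G (T + 1) (some c) =
      2⁻¹ * failFrom B G T (step B false c) + 2⁻¹ * failFrom B G T (step B true c) := by
  simp only [failFrom, runDist, PMF.toOuterMeasure_bind_apply, tsum_bool, PMF.uniformOfFintype_apply, Fintype.card_bool, Option.bind_some]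
  norm_num

theorem failFrom_halted (B : ℕ) (G : State → Prop) (T : ℕ) (s : State) (h : G s) : failFrom B G T (some ⟨[], s⟩) = 0 := by
  induction T with
  | zero =>
    simp only [failFrom, runDist, PMF.toOuterMeasure_pure_apply]; rw [if_neg]; simpa using h
  | succ T ih => rw [failFrom_succ]; simp [step, ih]

/-- `c` reaches `c'` in exactly `q` steps, whatever the coins. -/
def DReach (B q : ℕ) (c c' : Config) : Prop := ∀ G T, failFrom B G (q + T) (some c) = failFrom B G T (some c')

theorem DReach.refl (B : ℕ) (c : Config) : DReach B 0 c c := fun G T => by rw [zero_add]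

theorem DReach.trans {B q q' : ℕ} {c c' c'' : Config} (h : DReach B q c c')
    (h' : DReach B q' c' c'') : DReach B (q + q') c c'' := fun G T => by
  rw [add_assoc, h, h']

theorem DReach.one {B : ℕ} {c c' : Config} (h : ∀ b, step B b c = some c') : DReach B 1 c c' := fun G T => by
  rw [add_comm, failFrom_succ, h, h, ← add_mul, ENNReal.inv_two_add_inv_two, one_mul]

theorem DReach.seq (B : ℕ) (p q : Cmd) (K : List Cmd) (s : State) : DReach B 1 ⟨.seq p q :: K, s⟩ ⟨p :: q :: K, s⟩ := .one fun _ => rfl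

theorem ite01_eq_zero {p : Prop} [Decidable p] : (if p then 1 else 0) = 0 ↔ ¬p := by simp

/-! ### An abstract machine with named variables and arrays -/

/-- Names of variables and arrays. -/
abbrev Var := ℕ × ℕ

@[ext] structure St where
  r : Var → ℕ
  a : Var → ℕ → ℕ

def St.set (v : St) (x : Var) (n : ℕ) : St := ⟨update v.r x n, v.a⟩

def St.put (v : St) (b : Var) (i n : ℕ) : St := ⟨v.r, update v.a b (update (v.a b) i n)⟩

@[simp] theorem St.set_r (v : St) (x : Var) (n : ℕ) (y : Var) : (v.set x n).r y = if y = x then n else v.r y := by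
  simp [St.set, update_apply]
@[simp] theorem St.set_a (v : St) (x : Var) (n : ℕ) : (v.set x n).a = v.a := rfl
@[simp] theorem St.put_r (v : St) (b : Var) (i n : ℕ) : (v.put b i n).r = v.r := rfl
theorem St.put_a (v : St) (b : Var) (i n : ℕ) (b' : Var) (i' : ℕ) : (v.put b i n).a b' i' = if b' = b ∧ i' = i then n else v.a b' i' := by
  by_cases h : b' = b
  · subst h; simp [St.put, update_apply]
  · simp [St.put, h]
@[simp] theorem St.put_a_ne (v : St) (b : Var) (i n : ℕ) (b' : Var) (h : b' ≠ b) : (v.put b i n).a b' = v.a b' := by simp [St.put, h]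

theorem St.set_ne {v : St} {x y : Var} {n : ℕ} (h : y ≠ x) : (v.set x n).r y = v.r y := by simp [h]

def St.Small (W : ℕ) (v : St) : Prop := (∀ x, v.r x ≤ W) ∧ ∀ b i, v.a b i ≤ W

/-- The register that holds a variable. -/
def en (x : Var) : ℕ := 2 * Nat.pair x.1 x.2
/-- Scratch registers. -/
def sc (d : ℕ) : ℕ := 2 * d + 1
/-- The bank that holds an array. -/
def eb (b : Var) : ℕ := Nat.pair b.1 b.2

theorem en_inj {x y : Var} : en x = en y ↔ x = y := by
  constructor
  · intro h
    have := Nat.pair_eq_pair.1 (Nat.eq_of_mul_eq_mul_left two_pos h)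
    exact Prod.ext this.1 this.2
  · rintro rfl; rfl
theorem eb_inj {x y : Var} : eb x = eb y ↔ x = y := by
  constructor
  · intro h
    have := Nat.pair_eq_pair.1 h
    exact Prod.ext this.1 this.2
  · rintro rfl; rfl
theorem en_ne_sc (x : Var) (d : ℕ) : en x ≠ sc d := by unfold en sc; omega
theorem sc_inj {d d' : ℕ} : sc d = sc d' ↔ d = d' := by unfold sc; omega

/-- The machine state `s` represents the abstract state `v`. -/
structure Rel (W : ℕ) (s : State) (v : St) : Prop where
  reg : ∀ x, s.reg (en x) = v.r x
  mem : ∀ b, s.mem (eb b) = v.a b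
  small : v.Small W

/-- The abstract state that a machine state represents. -/
def State.toSt (s : State) : St := ⟨fun x => s.reg (en x), fun b => s.mem (eb b)⟩

theorem State.rel_toSt {W : ℕ} {s : State} (h : s.toSt.Small W) : Rel W s s.toSt := ⟨fun _ => rfl, fun _ => rfl, h⟩

/-! ### Expressions -/

inductive AOp
  | add | sub | mul | div | mod | lt | eq

def AOp.toBin : AOp → BinOp
  | .add => .add | .sub => .sub | .mul => .mul | .div => .div | .mod => .mod
  | .lt => .lt | .eq => .eq

inductive Ex
  | c (n : ℕ)
  | v (x : Var)
  | bin (o : AOp) (e e' : Ex)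
  | ld (b : Var) (e : Ex)

namespace Ex

instance : Add Ex := ⟨bin .add⟩
instance : Sub Ex := ⟨bin .sub⟩
instance : Mul Ex := ⟨bin .mul⟩
instance : Div Ex := ⟨bin .div⟩
instance : Mod Ex := ⟨bin .mod⟩
instance (n : ℕ) : OfNat Ex n := ⟨c n⟩
def lt (e e' : Ex) : Ex := bin .lt e e'
def eq (e e' : Ex) : Ex := bin .eq e e'

def eval : Ex → St → ℕ
  | c n, _ => n
  | v x, s => s.r x
  | bin o e e', s => o.toBin.eval (e.eval s) (e'.eval s)
  | ld b e, s => s.a b (e.eval s)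

/-- A measure that bounds the number of digits of the value. -/
def size : Ex → ℕ
  | c n => n + 1
  | v _ => 1
  | bin _ e e' => e.size + e'.size
  | ld _ e => e.size + 1

def cost : Ex → ℕ
  | c _ => 1
  | v _ => 1
  | bin _ e e' => e.cost + e'.cost + 3
  | ld _ e => e.cost + 2

def code : Ex → ℕ → Cmd
  | c n, d => .const (sc d) n
  | v x, d => .op .lor (sc d) (en x) (en x)
  | bin o e e', d => .seq (e.code d) (.seq (e'.code (d + 1)) (.op o.toBin (sc d) (sc d) (sc (d + 1))))
  | ld b e, d => .seq (e.code d) (.load (sc d) (eb b) (sc d))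

@[simp] theorem eval_c (n : ℕ) (s : St) : (c n).eval s = n := rfl
@[simp] theorem eval_ofNat (n : ℕ) (s : St) : (no_index (OfNat.ofNat n) : Ex).eval s = OfNat.ofNat n := rfl
@[simp] theorem eval_v (x : Var) (s : St) : (v x).eval s = s.r x := rfl
@[simp] theorem eval_ld (b : Var) (e : Ex) (s : St) : (ld b e).eval s = s.a b (e.eval s) := rfl
@[simp] theorem eval_add (e e' : Ex) (s : St) : (e + e').eval s = e.eval s + e'.eval s := rfl
@[simp] theorem eval_sub (e e' : Ex) (s : St) : (e - e').eval s = e.eval s - e'.eval s := rfl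
@[simp] theorem eval_mul (e e' : Ex) (s : St) : (e * e').eval s = e.eval s * e'.eval s := rfl
@[simp] theorem eval_div (e e' : Ex) (s : St) : (e / e').eval s = e.eval s / e'.eval s := rfl
@[simp] theorem eval_mod (e e' : Ex) (s : St) : (e % e').eval s = e.eval s % e'.eval s := rfl
@[simp] theorem eval_lt (e e' : Ex) (s : St) : (lt e e').eval s = if e.eval s < e'.eval s then 1 else 0 := rfl
@[simp] theorem eval_eq (e e' : Ex) (s : St) : (eq e e').eval s = if e.eval s = e'.eval s then 1 else 0 := rfl

@[simp] theorem size_c (n : ℕ) : (c n).size = n + 1 := rfl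
@[simp] theorem size_ofNat (n : ℕ) : (no_index (OfNat.ofNat n) : Ex).size = OfNat.ofNat n + 1 := rfl
@[simp] theorem size_v (x : Var) : (v x).size = 1 := rfl
@[simp] theorem size_ld (b : Var) (e : Ex) : (ld b e).size = e.size + 1 := rfl
@[simp] theorem size_add (e e' : Ex) : (e + e').size = e.size + e'.size := rfl
@[simp] theorem size_sub (e e' : Ex) : (e - e').size = e.size + e'.size := rfl
@[simp] theorem size_mul (e e' : Ex) : (e * e').size = e.size + e'.size := rfl
@[simp] theorem size_div (e e' : Ex) : (e / e').size = e.size + e'.size := rfl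
@[simp] theorem size_mod (e e' : Ex) : (e % e').size = e.size + e'.size := rfl
@[simp] theorem size_lt (e e' : Ex) : (lt e e').size = e.size + e'.size := rfl
@[simp] theorem size_eq (e e' : Ex) : (eq e e').size = e.size + e'.size := rfl

theorem size_pos (e : Ex) : 1 ≤ e.size := by
  induction e with
  | c n => simp
  | v x => simp
  | bin o e e' h h' => simp only [size]; omega
  | ld b e h => simp

theorem eval_le {W : ℕ} (hW : 2 ≤ W) {s : St} (hs : s.Small W) (e : Ex) : e.eval s ≤ W ^ e.size := by
  induction e with
  | c n =>
    calc n ≤ 2 ^ (n + 1) := (Nat.lt_two_pow_self.trans (Nat.pow_lt_pow_right one_lt_two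
          (Nat.lt_succ_self n))).le
      _ ≤ _ := Nat.pow_le_pow_left hW _
  | v x => simpa using hs.1 x
  | bin o e e' h h' =>
    have hx : 2 ≤ W ^ e.size := hW.trans (Nat.le_self_pow (by have := e.size_pos; omega) W)
    have hy : 2 ≤ W ^ e'.size := hW.trans (Nat.le_self_pow (by have := e'.size_pos; omega) W)
    simp only [eval, size, pow_add]
    generalize e.eval s = x at *
    generalize e'.eval s = y at *
    generalize W ^ e.size = X at *
    generalize W ^ e'.size = Y at *
    cases o <;> simp only [AOp.toBin, BinOp.eval]
    · nlinarith
    · exact (Nat.sub_le _ _).trans (by nlinarith)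
    · exact Nat.mul_le_mul h h'
    · exact (Nat.div_le_self _ _).trans (by nlinarith)
    · exact (Nat.mod_le _ _).trans (by nlinarith)
    · split_ifs <;> nlinarith
    · split_ifs <;> nlinarith
  | ld b e h => exact (hs.2 _ _).trans (Nat.le_self_pow (by simp [size]) W)

end Ex

/-- Parameters of the verification: the bound `W` on the words that the program handles, the word
bound `B` of the machine, the size `S` of the expressions, and the error `ε` of a random choice. -/
structure Par where
  W : ℕ
  B : ℕ
  S : ℕ
  ε : ℝ≥0∞
  hW : 2 ≤ W
  hS : 1 ≤ S
  hB : W ^ S < B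

variable {P : Par} {v v' : St} {k n m i j R W μG τ τm ℓ : ℕ}

theorem Par.eval_lt (P : Par) (hv : v.Small P.W) {e : Ex} (he : e.size ≤ P.S) : e.eval v < P.B := (Ex.eval_le P.hW hv e).trans_lt
    ((Nat.pow_le_pow_right (by have := P.hW; omega) he).trans_lt P.hB)

theorem Par.W_lt (P : Par) : P.W < P.B := (Nat.le_self_pow (by have := P.hS; omega) P.W).trans_lt P.hB

theorem Ex.run (P : Par) (e : Ex) (he : e.size ≤ P.S) :
    ∀ (d : ℕ) (s : State), Rel P.W s v → ∃ s' : State, (∀ r, (∀ d', d ≤ d' → r ≠ sc d') →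
      s'.reg r = s.reg r) ∧ s'.mem = s.mem ∧ s'.reg (sc d) = e.eval v ∧
      ∀ K, DReach P.B e.cost ⟨e.code d :: K, s⟩ ⟨K, s'⟩ := by
  induction e with
  | c n =>
    intro d s h
    refine ⟨⟨update s.reg (sc d) n, s.mem⟩, ?_, rfl, ?_, fun K => .one fun b => ?_⟩
    · intro r hr; simp [update_of_ne (hr d le_rfl)]
    · simp [Ex.eval]
    · have := P.eval_lt h.small he
      simp only [Ex.eval] at this; simp [Ex.code, step, State.writeReg, this]
  | v x =>
    intro d s h
    refine ⟨⟨update s.reg (sc d) (v.r x), s.mem⟩, ?_, rfl, ?_, fun K => .one fun b => ?_⟩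
    · intro r hr; simp [update_of_ne (hr d le_rfl)]
    · simp [Ex.eval]
    · have := P.eval_lt h.small he
      simp only [Ex.eval] at this; simp [Ex.code, step, State.writeReg, BinOp.eval, h.reg, this]
  | bin o e e' ih ih' =>
    intro d s h
    have he1 : e.size ≤ P.S := by simp only [Ex.size] at he; omega
    have he2 : e'.size ≤ P.S := by simp only [Ex.size] at he; omega
    obtain ⟨s1, h1, h2, h3, h4⟩ := ih he1 d s h
    have hr1 : Rel P.W s1 v := ⟨fun x => by rw [h1 _ fun d' _ => en_ne_sc x d', h.reg], fun b => by rw [h2, h.mem], h.small⟩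
    obtain ⟨s2, g1, g2, g3, g4⟩ := ih' he2 (d + 1) s1 hr1
    refine ⟨⟨update s2.reg (sc d) ((Ex.bin o e e').eval v), s2.mem⟩, ?_, ?_, ?_, fun K => ?_⟩
    · intro r hr
      simp only; rw [update_of_ne (hr d le_rfl), g1 _ fun d' hd' => hr d' (by omega), h1 _ hr]
    · simp [g2, h2]
    · simp
    · have e1 : (Ex.bin o e e').cost = 1 + (e.cost + (1 + (e'.cost + 1))) := by simp only [Ex.cost]; omega
      rw [e1]
      refine (DReach.seq _ _ _ _ _).trans ((h4 _).trans ((DReach.seq _ _ _ _ _).trans ((g4 _).trans (.one fun b => ?_))))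
      have := P.eval_lt h.small he
      simp only [Ex.eval] at this
      have h5 : s2.reg (sc d) = e.eval v := by rw [g1 _ fun d' hd' => by rw [Ne, sc_inj]; omega, h3]
      simp [step, State.writeReg, h5, g3, this, Ex.eval]
  | ld b e ih =>
    intro d s h
    have he1 : e.size ≤ P.S := by simp only [Ex.size] at he; omega
    obtain ⟨s1, h1, h2, h3, h4⟩ := ih he1 d s h
    refine ⟨⟨update s1.reg (sc d) ((Ex.ld b e).eval v), s1.mem⟩, ?_, h2, ?_, fun K => ?_⟩
    · intro r hr
      simp only; rw [update_of_ne (hr d le_rfl), h1 _ hr]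
    · simp
    · have e1 : (Ex.ld b e).cost = 1 + (e.cost + 1) := by simp only [Ex.cost]; omega
      rw [e1]
      refine (DReach.seq _ _ _ _ _).trans ((h4 _).trans (.one fun b => ?_))
      have := P.eval_lt h.small he
      simp only [Ex.eval] at this; simp [step, State.writeReg, h2, h3, h.mem, this, Ex.eval]

theorem Rel.of_scratch {s s' : State} (h : Rel W s v) (hr : ∀ r, (∀ d, r ≠ sc d) → s'.reg r = s.reg r) (hm : s'.mem = s.mem) : Rel W s' v :=
  ⟨fun x => by rw [hr _ (en_ne_sc x), h.reg], fun b => by rw [hm, h.mem], h.small⟩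

/-! ### Quantitative triples -/

/-- If the failure probability after `c` is at most `q v'` in the abstract state `v'`, then it is at
most `b` when `c` is started in `v`, with `T` more steps. -/
def Tq (P : Par) (c : Cmd) (v : St) (T : ℕ) (q : St → ℝ≥0∞) (b : ℝ≥0∞) : Prop := ∀ (G : State → Prop) (K : List Cmd) (T' : ℕ),
    (∀ v' s', Rel P.W s' v' → ∀ t, T' ≤ t → failFrom P.B G t (some ⟨K, s'⟩) ≤ q v') →
    ∀ s, Rel P.W s v → ∀ t, T + T' ≤ t → failFrom P.B G t (some ⟨c :: K, s⟩) ≤ b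

theorem Tq.mono {c : Cmd} {T T₂ : ℕ} {q q₂ : St → ℝ≥0∞} {b b₂ : ℝ≥0∞}
    (h : Tq P c v T q b) (hT : T ≤ T₂) (hq : ∀ v', v'.Small P.W → q₂ v' ≤ q v') (hb : b ≤ b₂) :
    Tq P c v T₂ q₂ b₂ := fun G K T' hK s hs t ht =>
  (h G K T' (fun v' s' hs' t ht => (hK v' s' hs' t ht).trans (hq v' hs'.small)) s hs t (by omega)).trans hb

theorem Tq.of_reach {c : Cmd} {T : ℕ} {q : St → ℝ≥0∞} (h : ∀ s, Rel P.W s v → ∃ s', Rel P.W s' v' ∧ ∀ K, DReach P.B T ⟨c :: K, s⟩ ⟨K, s'⟩) :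
    Tq P c v T q (q v') := fun G K T' hK s hs t ht => by
  obtain ⟨s', hs', hr⟩ := h s hs
  obtain ⟨u, rfl⟩ := exists_eq_add_of_le (show T ≤ t by omega)
  rw [hr K G u]
  exact hK v' s' hs' u (by omega)

theorem Tq.seq {c c' : Cmd} {T T' : ℕ} {q q' : St → ℝ≥0∞} {b : ℝ≥0∞}
    (h : Tq P c v T q' b) (h' : ∀ v', v'.Small P.W → Tq P c' v' T' q (q' v')) :
    Tq P (.seq c c') v (T + T' + 1) q b := fun G K T'' hK s hs t ht => by
  obtain ⟨u, rfl⟩ := exists_eq_add_of_le (show 1 ≤ t by omega)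
  rw [DReach.seq _ _ _ _ _ G u]
  exact h G (c' :: K) (T' + T'') (fun v' s' hs' t ht => h' v' hs'.small G K T'' hK s' hs' t ht) s hs u (by omega)

def asg (x : Var) (e : Ex) : Cmd := .seq (e.code 0) (.op .lor (en x) (sc 0) (sc 0))

def sto (b : Var) (e e' : Ex) : Cmd := .seq (e.code 0) (.seq (e'.code 1) (.store (eb b) (sc 0) (sc 1)))

def ifE (e : Ex) (p q : Cmd) : Cmd := .seq (e.code 0) (.ite (sc 0) p q)

def whileE (e : Ex) (p : Cmd) : Cmd := .seq (e.code 0) (.loop (sc 0) (.seq p (e.code 0)))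

theorem asg_run (P : Par) (x : Var) (e : Ex) (he : e.size ≤ P.S) (hs : v.Small P.W → e.eval v ≤ P.W) (s : State) (h : Rel P.W s v) :
    ∃ s', Rel P.W s' (v.set x (e.eval v)) ∧ ∀ K, DReach P.B (e.cost + 2) ⟨asg x e :: K, s⟩ ⟨K, s'⟩ := by
  obtain ⟨s1, h1, h2, h3, h4⟩ := e.run P he 0 s h
  refine ⟨⟨update s1.reg (en x) (e.eval v), s1.mem⟩, ⟨fun y => ?_, fun b => ?_, ?_⟩, fun K => ?_⟩
  · simp only [update_apply, en_inj, St.set_r]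
    split_ifs
    · rfl
    · rw [h1 _ fun d' _ => en_ne_sc y d', h.reg]
  · simp [h2, h.mem]
  · refine ⟨fun y => ?_, h.small.2⟩
    rw [St.set_r]; split_ifs
    · exact hs h.small
    · exact h.small.1 y
  · have e1 : e.cost + 2 = 1 + (e.cost + 1) := by omega
    rw [e1]
    refine (DReach.seq _ _ _ _ _).trans ((h4 _).trans (.one fun b => ?_))
    have := P.eval_lt h.small he
    simp [step, State.writeReg, BinOp.eval, h3, this]

theorem sto_run (P : Par) (b : Var) (e e' : Ex) (he : e.size ≤ P.S) (he' : e'.size ≤ P.S)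
    (hs : v.Small P.W → e'.eval v ≤ P.W) (s : State) (h : Rel P.W s v) :
    ∃ s', Rel P.W s' (v.put b (e.eval v) (e'.eval v)) ∧ ∀ K, DReach P.B (e.cost + e'.cost + 3) ⟨sto b e e' :: K, s⟩ ⟨K, s'⟩ := by
  obtain ⟨s1, h1, h2, h3, h4⟩ := e.run P he 0 s h
  have hr1 : Rel P.W s1 v := h.of_scratch (fun r hr => h1 r fun d _ => hr d) h2
  obtain ⟨s2, g1, g2, g3, g4⟩ := e'.run P he' 1 s1 hr1
  have hr2 : Rel P.W s2 v := hr1.of_scratch (fun r hr => g1 r fun d _ => hr d) g2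
  have g5 : s2.reg (sc 0) = e.eval v := by rw [g1 _ fun d' hd' => by rw [Ne, sc_inj]; omega, h3]
  refine ⟨s2.writeMem (eb b) (e.eval v) (e'.eval v), ⟨fun y => hr2.reg y, fun c => ?_, ?_⟩, fun K => ?_⟩
  · by_cases hc : c = b
    · subst hc; simp [State.writeMem, St.put, hr2.mem]
    · have : eb c ≠ eb b := fun h => hc (eb_inj.1 h)
      simp [State.writeMem, hc, this, hr2.mem]
  · refine ⟨h.small.1, fun c i => ?_⟩
    rw [St.put_a]; split_ifs
    · exact hs h.small
    · exact h.small.2 c i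
  · have e1 : e.cost + e'.cost + 3 = 1 + (e.cost + (1 + (e'.cost + 1))) := by omega
    rw [e1]
    refine (DReach.seq _ _ _ _ _).trans ((h4 _).trans ((DReach.seq _ _ _ _ _).trans ((g4 _).trans (.one fun b => ?_))))
    simp [step, g5, g3]

theorem Tq.ifE {e : Ex} {c c' : Cmd} {T : ℕ} {q : St → ℝ≥0∞} {b : ℝ≥0∞}
    (he : e.size ≤ P.S) (h : e.eval v ≠ 0 → Tq P c v T q b) (h' : e.eval v = 0 → Tq P c' v T q b) :
    Tq P (ifE e c c') v (T + e.cost + 2) q b := fun G K T' hK s hs t ht => by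
  obtain ⟨s1, h1, h2, h3, h4⟩ := e.run P he 0 s hs
  have hr1 : Rel P.W s1 v := hs.of_scratch (fun r hr => h1 r fun d _ => hr d) h2
  obtain ⟨u, rfl⟩ := exists_eq_add_of_le (show 1 + (e.cost + 1) ≤ t by omega)
  by_cases hz : e.eval v = 0
  · have := (DReach.seq P.B (e.code 0) (.ite (sc 0) c c') K s).trans ((h4 _).trans
      (.one (c' := ⟨c' :: K, s1⟩) fun b => by simp [step, h3, hz]))
    rw [CliqueListing.ifE, this G u]; exact h' hz G K T' hK s1 hr1 u (by omega)
  · have := (DReach.seq P.B (e.code 0) (.ite (sc 0) c c') K s).trans ((h4 _).trans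
      (.one (c' := ⟨c :: K, s1⟩) fun b => by simp [step, h3, hz]))
    rw [CliqueListing.ifE, this G u]; exact h hz G K T' hK s1 hr1 u (by omega)

theorem Tq.whileE {e : Ex} {c : Cmd} {q : St → ℝ≥0∞} (φ : St → ℕ) (b : St → ℝ≥0∞) (he : e.size ≤ P.S)
    (hb : ∀ v, v.Small P.W → e.eval v ≠ 0 → b v ≠ ⊤ → ∃ Tb, Tb + e.cost + 3 ≤ φ v ∧ Tq P c v Tb
      (fun v' => ⨅ _ : φ v' + Tb + e.cost + 3 ≤ φ v, b v') (b v))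
    (hq : ∀ v, v.Small P.W → e.eval v = 0 → q v ≤ b v) (v : St) :
    Tq P (whileE e c) v (φ v + e.cost + 3) q (b v) := by
  intro G K T' hK
  have key : ∀ n v s, φ v = n → Rel P.W s v → s.reg (sc 0) = e.eval v → ∀ t, φ v + 1 + T' ≤ t →
      failFrom P.B G t (some ⟨.loop (sc 0) (.seq c (e.code 0)) :: K, s⟩) ≤ b v := by
    intro n
    induction n using Nat.strong_induction_on with
    | _ n ih =>
      intro v s hn hs h0 t ht
      by_cases hz : e.eval v = 0
      · obtain ⟨u, rfl⟩ := exists_eq_add_of_le (show 1 ≤ t by omega)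
        have : DReach P.B 1 ⟨.loop (sc 0) (.seq c (e.code 0)) :: K, s⟩ ⟨K, s⟩ := .one fun b => by simp [step, h0, hz]
        rw [this G u]; exact (hK v s hs u (by omega)).trans (hq v hs.small hz)
      · by_cases hbv : b v = ⊤
        · rw [hbv]; exact le_top
        obtain ⟨Tb, hφ, hTb⟩ := hb v hs.small hz hbv
        have h2 : DReach P.B (1 + 1) ⟨.loop (sc 0) (.seq c (e.code 0)) :: K, s⟩
            ⟨c :: e.code 0 :: .loop (sc 0) (.seq c (e.code 0)) :: K, s⟩ :=
          (DReach.one fun b => by simp [step, h0, hz]).trans (DReach.seq _ _ _ _ _)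
        obtain ⟨u, rfl⟩ := exists_eq_add_of_le (show 1 + 1 ≤ t by omega)
        rw [h2 G u]
        refine hTb G _ (φ v - Tb - 2 + T') (fun v' s' hs' t' ht' => ?_) s hs u (by omega)
        refine le_iInf fun hv' => ?_
        obtain ⟨s1, g1, g2, g3, g4⟩ := e.run P he 0 s' hs'
        have hr1 : Rel P.W s1 v' := hs'.of_scratch (fun r hr => g1 r fun d _ => hr d) g2
        obtain ⟨u', rfl⟩ := exists_eq_add_of_le (show e.cost ≤ t' by omega)
        rw [g4 _ G u']; exact ih (φ v') (by omega) v' s1 rfl hr1 g3 u' (by omega)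
  intro s hs t ht
  obtain ⟨s1, h1, h2, h3, h4⟩ := e.run P he 0 s hs
  have hr1 : Rel P.W s1 v := hs.of_scratch (fun r hr => h1 r fun d _ => hr d) h2
  obtain ⟨u, rfl⟩ := exists_eq_add_of_le (show 1 + e.cost ≤ t by omega)
  rw [CliqueListing.whileE, ((DReach.seq _ _ _ _ _).trans (h4 _)) G u]
  exact key _ v s1 rfl hr1 h3 u (by omega)

/-! ### Triples with time and error -/

/-- Started in `v`, the program `c` reaches a state that satisfies `Q` within `T` steps, except with
probability at most `e * P.ε`. -/
def Tri (P : Par) (c : Cmd) (v : St) (T e : ℕ) (Q : St → Prop) : Prop := ∀ η : ℝ≥0∞, Tq P c v T (fun v' => ⨅ _ : Q v', η) (η + e * P.ε)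

section Tri
variable {T T' e e' : ℕ} {c c' : Cmd} {Q Q' : St → Prop}

theorem Tri.mono (h : Tri P c v T e Q) (hT : T ≤ T') (he : e ≤ e') (hQ : ∀ v', v'.Small P.W → Q v' → Q' v') : Tri P c v T' e' Q' := fun η =>
  (h η).mono hT (fun v' hv' => le_iInf fun h' => iInf_le _ (hQ v' hv' h')) (by gcongr)

theorem Tri.post (h : Tri P c v T e Q) (hQ : ∀ v', v'.Small P.W → Q v' → Q' v') : Tri P c v T e Q' := h.mono le_rfl le_rfl hQ

theorem Tri.le (h : Tri P c v T e Q) (hT : T ≤ T') (he : e ≤ e') : Tri P c v T' e' Q := h.mono hT he fun _ _ h => h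

theorem Tri.time (h : Tri P c v T e Q) (hT : T ≤ T') : Tri P c v T' e Q := h.mono hT le_rfl fun _ _ h => h

theorem Tri.of_small (h : v.Small P.W → Tri P c v T e Q) : Tri P c v T e Q := fun η G K T' hK s hs => h hs.small η G K T' hK s hs

theorem Tri.seq (h : Tri P c v T e Q') (h' : ∀ v', v'.Small P.W → Q' v' → Tri P c' v' T' e' Q) :
    Tri P (.seq c c') v (T + T' + 1) (e + e') Q := fun η => by
  refine (Tq.seq (h (η + e' * P.ε)) fun v' hv' => ?_).mono le_rfl (fun _ _ => le_rfl) ?_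
  · by_cases hQ : Q' v'
    · simpa [hQ] using h' v' hv' hQ η
    · simp only [hQ, iInf_false]
      exact fun G K T hK s hs t ht => le_top
  · push_cast; rw [add_mul, add_assoc, add_comm (e' * P.ε)]

theorem Tri.of_reach (hQ : Q v') (h : ∀ s, Rel P.W s v → ∃ s', Rel P.W s' v' ∧
    ∀ K, DReach P.B T ⟨c :: K, s⟩ ⟨K, s'⟩) : Tri P c v T 0 Q := fun η =>
  (Tq.of_reach (q := fun v' => ⨅ _ : Q v', η) h).mono le_rfl (fun _ _ => le_rfl) (by simp [hQ])

theorem Tri.skip (hQ : Q v) : Tri P .skip v 1 0 Q := .of_reach hQ fun s hs => ⟨s, hs, fun _ => .one fun _ => rfl⟩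

theorem Tri.asg {x : Var} {e : Ex} (he : e.size ≤ P.S) (hs : v.Small P.W → e.eval v ≤ P.W)
    (hQ : Q (v.set x (e.eval v))) : Tri P (asg x e) v (e.cost + 2) 0 Q :=
  .of_reach hQ fun s h => asg_run P x e he hs s h

theorem Tri.sto {b : Var} {i e : Ex} (hi : i.size ≤ P.S) (he : e.size ≤ P.S)
    (hs : v.Small P.W → e.eval v ≤ P.W) (hQ : Q (v.put b (i.eval v) (e.eval v))) :
    Tri P (sto b i e) v (i.cost + e.cost + 3) 0 Q :=
  .of_reach hQ fun s h => sto_run P b i e hi he hs s h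

theorem Tri.ifE {x : Ex} (hx : x.size ≤ P.S) (h : x.eval v ≠ 0 → Tri P c v T e Q)
    (h' : x.eval v = 0 → Tri P c' v T e Q) : Tri P (ifE x c c') v (T + x.cost + 2) e Q :=
  fun η => Tq.ifE hx (fun hz => h hz η) fun hz => h' hz η

theorem Tri.whileE {x : Ex} (φ ψ : St → ℕ) (I : St → Prop) (hx : x.size ≤ P.S) (h0 : I v)
    (hb : ∀ v, I v → v.Small P.W → x.eval v ≠ 0 → ∃ Tb eb, Tb + x.cost + 3 ≤ φ v ∧ eb ≤ ψ v ∧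
      Tri P c v Tb eb fun v' => I v' ∧ φ v' + Tb + x.cost + 3 ≤ φ v ∧ ψ v' + eb ≤ ψ v)
    (hQ : ∀ v, I v → v.Small P.W → x.eval v = 0 → Q v) :
    Tri P (whileE x c) v (φ v + x.cost + 3) (ψ v) Q := fun η => by
  classical
  have := Tq.whileE (e := x) (c := c) (q := fun v' => ⨅ _ : Q v', η) φ (fun v => ⨅ _ : I v, η + ψ v * P.ε) hx ?_ ?_ v
  · refine this.mono le_rfl (fun _ _ => le_rfl) (iInf_le _ h0)
  · intro v hv hz hI
    have hI : I v := by by_contra h; simp [h] at hI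
    obtain ⟨Tb, eb, hT, heb, h⟩ := hb v hI hv hz
    refine ⟨Tb, hT, ?_⟩
    refine (h (η + (ψ v - eb : ℕ) * P.ε)).mono le_rfl (fun v' hv' => ?_) ?_
    · refine le_iInf fun h' => ?_
      simp only [h', iInf_true]
      gcongr
      omega
    · refine le_iInf fun _ => ?_
      rw [add_assoc, ← add_mul, ← Nat.cast_add, Nat.sub_add_cancel heb]
  · intro v hv hz
    refine le_iInf fun hI => ?_
    exact (iInf_le _ (hQ v hI hv hz)).trans le_self_add

/-- `for x < e do c`; the loop variable and the bound may not be changed by `c`. -/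
def forE (x : Var) (e : Ex) (c : Cmd) : Cmd :=
  .seq (CliqueListing.asg x 0) (CliqueListing.whileE (Ex.lt (.v x) e) (.seq c (CliqueListing.asg x (.v x + 1))))

def forCost (e : Ex) : ℕ := 2 * e.cost + 30

theorem Tri.forE {x : Var} {b : Ex} (n : ℕ) (I : ℕ → St → Prop) (hb : b.size + 1 ≤ P.S)
    (h0 : I 0 (v.set x 0)) (hn : n ≤ P.W) (hx : ∀ i v, I i v → v.r x = i)
    (hbe : ∀ i v, I i v → b.eval v = n) (hS : 3 ≤ P.S)
    (hc : ∀ i v, i < n → I i v → v.Small P.W → Tri P c v T e fun v' => v'.r x = i ∧ I (i + 1) (v'.set x (i + 1))) :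
    Tri P (forE x b c) v (n * (T + forCost b) + forCost b) (n * e) (I n) := by
  have key := Tri.whileE (P := P) (c := .seq c (CliqueListing.asg x (.v x + 1))) (x := Ex.lt (.v x) b) (v := v.set x 0)
    (fun v => (n - v.r x) * (T + forCost b)) (fun v => (n - v.r x) * e)
    (fun v => ∃ i, i ≤ n ∧ I i v) (Q := I n) (by simp; omega) ⟨0, Nat.zero_le _, h0⟩ ?_ ?_
  · refine ((Tri.asg (P := P) (x := x) (e := 0) (Q := fun v' => v' = v.set x 0) (by simp; omega)
      (by simp) rfl).seq (T' := n * (T + forCost b) + (Ex.lt (.v x) b).cost + 3) (e' := n * e)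
      fun v' _ hv' => ?_).le ?_ ?_
    · subst hv'; simpa using key
    · simp [forCost, Ex.cost, Ex.lt]
      have : (0 : Ex).cost = 1 := rfl
      omega
    · simp
  · rintro v ⟨i, hi, hI⟩ hv hz
    have h1 := hx i v hI
    have h2 := hbe i v hI
    simp only [Ex.eval_lt, Ex.eval_v, h1, h2, ne_eq, ite01_eq_zero, not_not] at hz
    obtain ⟨m, rfl⟩ := Nat.exists_eq_add_of_lt hz
    refine ⟨_, _, ?_, ?_, (hc i v hz hI hv).seq (e' := 0) fun v' hv' ⟨h3, h4⟩ => Tri.asg (by simp; omega) ?_ ?_⟩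
    · simp only [h1, show i + m + 1 - i = m + 1 by omega, add_mul, one_mul]
      simp [forCost, Ex.cost, Ex.lt]
      have : (Ex.v x + 1).cost = 5 := rfl
      omega
    · simp only [h1, show i + m + 1 - i = m + 1 by omega, add_mul, one_mul]
      omega
    · simp only [Ex.eval_add, Ex.eval_v, h3, Ex.eval_ofNat]; omega
    · simp only [Ex.eval_add, Ex.eval_v, h3, Ex.eval_ofNat]
      refine ⟨⟨i + 1, hz, h4⟩, ?_, ?_⟩
      · simp only [h1, St.set_r, if_true, show i + m + 1 - i = m + 1 by omega, show i + m + 1 - (i + 1) = m by omega, add_mul, one_mul]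
        simp [forCost, Ex.cost, Ex.lt]
        have : (Ex.v x + 1).cost = 5 := rfl
        omega
      · simp only [h1, St.set_r, if_true, show i + m + 1 - i = m + 1 by omega, show i + m + 1 - (i + 1) = m by omega, add_mul, one_mul]
        omega
  · rintro v ⟨i, hi, hI⟩ hv hz
    simp only [Ex.eval_lt, Ex.eval_v, hx i v hI, hbe i v hI, ite01_eq_zero, not_lt] at hz; rwa [le_antisymm hz hi]

end Tri

/-! ### Straight-line programs -/

inductive SL
  | skip
  | asg (x : Var) (e : Ex)
  | sto (b : Var) (i e : Ex)
  | seq (p q : SL)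
  | ite (e : Ex) (p q : SL)

namespace SL

def exec : SL → St → St
  | skip, v => v
  | asg x e, v => v.set x (e.eval v)
  | sto b i e, v => v.put b (i.eval v) (e.eval v)
  | seq p q, v => q.exec (p.exec v)
  | ite e p q, v => if e.eval v ≠ 0 then p.exec v else q.exec v

def ok (W : ℕ) : SL → St → Prop
  | skip, _ => True
  | asg _ e, v => e.eval v ≤ W
  | sto _ _ e, v => e.eval v ≤ W
  | seq p q, v => p.ok W v ∧ q.ok W (p.exec v)
  | ite e p q, v => if e.eval v ≠ 0 then p.ok W v else q.ok W v

def size : SL → ℕ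
  | skip => 0
  | asg _ e => e.size
  | sto _ i e => max i.size e.size
  | seq p q => max p.size q.size
  | ite e p q => max e.size (max p.size q.size)

def cost : SL → ℕ
  | skip => 1
  | asg _ e => e.cost + 2
  | sto _ i e => i.cost + e.cost + 3
  | seq p q => p.cost + q.cost + 1
  | ite e p q => max p.cost q.cost + e.cost + 2

def cmd : SL → Cmd
  | skip => .skip
  | asg x e => CliqueListing.asg x e
  | sto b i e => CliqueListing.sto b i e
  | seq p q => .seq p.cmd q.cmd
  | ite e p q => ifE e p.cmd q.cmd

theorem tri_exec (p : SL) : ∀ {v : St}, p.size ≤ P.S → (v.Small P.W → p.ok P.W v) → Tri P p.cmd v p.cost 0 (· = p.exec v) := by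
  induction p with
  | skip => exact fun _ _ => Tri.skip rfl
  | asg x e => exact fun hs h => Tri.asg hs h rfl
  | sto b i e => exact fun hs h => Tri.sto (by simp [size] at hs; omega) (by simp [size] at hs; omega) h rfl
  | seq p q hp hq =>
    intro v hs h; simp only [size, sup_le_iff] at hs
    refine Tri.of_small fun hv => ?_
    exact (hp hs.1 fun _ => (h hv).1).seq (e' := 0) fun v' _ hv' => by subst hv'; exact hq hs.2 fun _ => (h hv).2
  | ite e p q hp hq =>
    intro v hs h; simp only [size, sup_le_iff] at hs
    refine Tri.of_small fun hv => Tri.ifE hs.1 (fun hz => ?_) fun hz => ?_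
    · exact (hp hs.2.1 fun _ => by simpa [ok, hz] using h hv).mono (le_max_left _ _) le_rfl (by simp [exec, hz])
    · exact (hq hs.2.2 fun _ => by simpa [ok, hz] using h hv).mono (le_max_right _ _) le_rfl (by simp [exec, hz])

def list : List SL → SL
  | [] => skip
  | p :: l => seq p (list l)

end SL

theorem Tri.sl {p : SL} {Q : St → Prop} (hp : p.size ≤ P.S)
    (hok : v.Small P.W → p.ok P.W v) (hQ : (p.exec v).Small P.W → Q (p.exec v)) : Tri P p.cmd v p.cost 0 Q :=
  (p.tri_exec hp hok).post fun v' hv' h => by subst h; exact hQ hv'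

/-! ### Random words -/

theorem Tq.flip (x : Var) (v : St) (q : St → ℝ≥0∞) : Tq P (.flip (en x)) v 1 q (2⁻¹ * q (v.set x 0) + 2⁻¹ * q (v.set x 1)) :=
    fun G K T' hK s hs t ht => by
  obtain ⟨u, rfl⟩ := exists_eq_add_of_le (show 1 ≤ t by omega)
  have h1 : ∀ i ≤ 1, Rel P.W ⟨update s.reg (en x) i, s.mem⟩ (v.set x i) := fun i hi => by
    refine ⟨fun y => ?_, hs.mem, fun y => ?_, hs.small.2⟩
    · simp only [update_apply, en_inj, St.set_r, hs.reg]
    · rw [St.set_r]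
      split_ifs
      · have := P.hW; omega
      · exact hs.small.1 y
  have hB : 1 < P.B := lt_of_lt_of_le (by have := P.hW; omega) P.W_lt.le
  rw [add_comm, failFrom_succ]
  have e0 : step P.B false ⟨.flip (en x) :: K, s⟩ = some ⟨K, ⟨update s.reg (en x) 0, s.mem⟩⟩ := by simp [step, State.writeReg]; omega
  have e1 : step P.B true ⟨.flip (en x) :: K, s⟩ = some ⟨K, ⟨update s.reg (en x) 1, s.mem⟩⟩ := by simp [step, State.writeReg, hB]
  rw [e0, e1]
  gcongr
  · exact hK _ _ (h1 0 (by omega)) u (by omega)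
  · exact hK _ _ (h1 1 le_rfl) u (by omega)

theorem failFrom_le_one (B : ℕ) (G : State → Prop) (T : ℕ) (c : Option Config) : failFrom B G T c ≤ 1 := by
  unfold failFrom
  rw [PMF.toOuterMeasure_apply]
  refine (ENNReal.tsum_le_tsum fun x => ?_).trans (PMF.tsum_coe (runDist B T c)).le
  exact Set.indicator_le_self _ _ _

theorem Tq.min_one {c : Cmd} {T : ℕ} {q : St → ℝ≥0∞} {b : ℝ≥0∞}
    (h : Tq P c v T (fun v' => min (q v') 1) b) : Tq P c v T q b := fun G K T' hK =>
  h G K T' fun v' s' hs' t ht => le_min (hK v' s' hs' t ht) (failFrom_le_one _ _ _ _)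

theorem Tri.toTq {c : Cmd} {w : St} {T : ℕ} (q : St → ℝ≥0∞) (h : Tri P c v T 0 (· = w)) : Tq P c v T q (q w) :=
  (h (q w)).mono le_rfl (fun v' _ => le_iInf fun h => h ▸ le_rfl) (by simp)

theorem Tq.sl {p : SL} (q : St → ℝ≥0∞) (hp : p.size ≤ P.S) (hok : v.Small P.W → p.ok P.W v) : Tq P p.cmd v p.cost q (q (p.exec v)) :=
  (p.tri_exec hp hok).toTq q

theorem Tq.after {c c' : Cmd} {T T' : ℕ} {q : St → ℝ≥0∞} {v1 : St} {b : ℝ≥0∞} (h : Tri P c v T 0 (· = v1))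
    (h' : Tq P c' v1 T' q b) : Tq P (.seq c c') v (T + T' + 1) q b :=
  Tq.seq (q' := fun v' => ⨅ _ : v' = v1, b) ((h b).mono le_rfl (fun _ _ => le_rfl) (by simp)) fun v' _ => by
    by_cases h : v' = v1
    · subst h; simpa using h'
    · simp only [h, iInf_false]; exact fun _ _ _ _ _ _ _ _ => le_top

/-- `v'` agrees with `v` outside of the variables in `X` and the arrays in `Y`. -/
structure Fr (X Y : Var → Prop) (v v' : St) : Prop where
  r : ∀ x, ¬ X x → v'.r x = v.r x
  a : ∀ b, ¬ Y b → v'.a b = v.a b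

theorem Fr.refl (X Y : Var → Prop) (v : St) : Fr X Y v v := ⟨fun _ _ => rfl, fun _ _ => rfl⟩

theorem Fr.trans {X Y : Var → Prop} {v'' : St} (h : Fr X Y v v') (h' : Fr X Y v' v'') : Fr X Y v v'' :=
  ⟨fun x hx => (h'.r x hx).trans (h.r x hx), fun b hb => (h'.a b hb).trans (h.a b hb)⟩

theorem Fr.mono {X Y X' Y' : Var → Prop} (h : Fr X Y v v') (hX : ∀ x, X x → X' x) (hY : ∀ x, Y x → Y' x) : Fr X' Y' v v' :=
  ⟨fun x hx => h.r x fun h => hx (hX x h), fun b hb => h.a b fun h => hb (hY b h)⟩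

theorem Fr.set {X Y : Var → Prop} (h : Fr X Y v v') {x : Var} (hx : X x) (n : ℕ) : Fr X Y v (v'.set x n) := ⟨fun y hy => by
    rw [St.set_r, if_neg (fun e => hy (by rwa [e])), h.r y hy], h.a⟩

theorem Fr.put {X Y : Var → Prop} (h : Fr X Y v v') {b : Var} (hb : Y b) (i n : ℕ) : Fr X Y v (v'.put b i n) :=
  ⟨h.r, fun c hc => by rw [St.put_a_ne _ _ _ _ _ (fun e => hc (by rwa [e])), h.a c hc]⟩

/-- Temporary variables. -/
abbrev tm (i : ℕ) : Var := (7, i)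
/-- The array of random words. -/
abbrev bRnd : Var := (7, 0)

/-- A uniformly random word below `2 ^ w`, where `2 ^ w` is the value of `x`, into `tm 0`. -/
def pickWord (x : Var) : Cmd := .seq (SL.seq (.asg (tm 0) 0) (.asg (tm 1) 1)).cmd (whileE (.lt (.v (tm 1)) (.v x)) (.seq (.flip (en (tm 2)))
        (SL.seq (.asg (tm 0) (2 * .v (tm 0) + .v (tm 2))) (.asg (tm 1) (2 * .v (tm 1)))).cmd))

theorem avg_double (g : ℕ → ℝ≥0∞) (u r : ℕ) : 2⁻¹ * (((2 : ℝ≥0∞) ^ r)⁻¹ * ∑ x ∈ range (2 ^ r), g (2 * u * 2 ^ r + x)) +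
      2⁻¹ * (((2 : ℝ≥0∞) ^ r)⁻¹ * ∑ x ∈ range (2 ^ r), g ((2 * u + 1) * 2 ^ r + x)) =
    ((2 : ℝ≥0∞) ^ (r + 1))⁻¹ * ∑ x ∈ range (2 ^ (r + 1)), g (u * 2 ^ (r + 1) + x) := by
  rw [← mul_add, ← mul_add, ← mul_assoc, pow_succ' (2 : ℝ≥0∞),
    ENNReal.mul_inv (by simp) (by simp), pow_succ' (2 : ℕ), two_mul (2 ^ r), Finset.sum_range_add]
  congr 2
  all_goals exact sum_congr rfl fun x _ => by congr 1; ring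

theorem pickWord_tq (hS : 10 ≤ P.S) {x : Var} (hx : x.1 ≠ 7) {w : ℕ} (hw : v.r x = 2 ^ w) (q : St → ℝ≥0∞) (g : ℕ → ℝ≥0∞)
    (hg : ∀ v' u, Fr (·.1 = 7) (fun _ => False) v v' → (∀ i, 3 ≤ i → v'.r (tm i) = v.r (tm i)) → v'.r (tm 0) = u → u < 2 ^ w → q v' ≤ g u) :
    Tq P (pickWord x) v (60 * w + 60) q (((2 : ℝ≥0∞) ^ w)⁻¹ * ∑ u ∈ range (2 ^ w), g u) := by
  set Y : Var → Prop := fun _ => False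
  let X : Var → Prop := fun y => y = tm 0 ∨ y = tm 1 ∨ y = tm 2
  have hXx : ¬ X x := by rintro (h | h | h) <;> exact hx (by rw [h])
  let I : St → Prop := fun v' => Fr X Y v v' ∧ ∃ i, i ≤ w ∧ v'.r (tm 1) = 2 ^ i ∧ v'.r (tm 0) < 2 ^ i
  let val : St → ℝ≥0∞ := fun v' => ((2 : ℝ≥0∞) ^ (w - Nat.log 2 (v'.r (tm 1))))⁻¹ * ∑ u ∈ range (2 ^ (w - Nat.log 2 (v'.r (tm 1)))),
      g (v'.r (tm 0) * 2 ^ (w - Nat.log 2 (v'.r (tm 1))) + u)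
  let b : St → ℝ≥0∞ := fun v' => ⨅ _ : I v', val v'
  have hval : ∀ (v' : St) i, v'.r (tm 1) = 2 ^ i → val v' = ((2 : ℝ≥0∞) ^ (w - i))⁻¹ *
      ∑ u ∈ range (2 ^ (w - i)), g (v'.r (tm 0) * 2 ^ (w - i) + u) := by
    intro v' i hi; simp only [val, hi, Nat.log_pow one_lt_two]
  have key := Tq.whileE (P := P) (e := .lt (.v (tm 1)) (.v x)) (c := .seq (.flip (en (tm 2)))
        (SL.seq (.asg (tm 0) (2 * .v (tm 0) + .v (tm 2))) (.asg (tm 1) (2 * .v (tm 1)))).cmd)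
    (q := q) (fun v' => (w - Nat.log 2 (v'.r (tm 1))) * 60) b (by simp; omega) ?_ ?_
  · set v1 := (SL.seq (.asg (tm 0) 0) (.asg (tm 1) 1)).exec v with hv1
    have h2 : v1.r (tm 1) = 1 := by simp [hv1, SL.exec]
    have h3 : v1.r (tm 0) = 0 := by simp [hv1, SL.exec]
    have hI : I v1 :=
       ⟨((Fr.refl X Y v).set (x := tm 0) (by simp [X]) _).set (x := tm 1) (by simp [X]) _, 0, Nat.zero_le _, by simp [h2], by simp [h3]⟩
    refine (Tq.after (SL.tri_exec _ (by simp [SL.size]; omega) fun _ => by simp [SL.ok]; have := P.hW; omega) (key v1)).mono ?_ (fun _ _ => le_rfl) ?_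
    · rw [h2, Nat.log_one_right]
      change 7 + ((w - 0) * 60 + 5 + 3) + 1 ≤ _; omega
    · refine (iInf_le _ hI).trans ?_
      rw [hval v1 0 (by simp [h2])]
      simp [h3]
  · intro v' hv' hz hb
    have hI : I v' := by by_contra h; simp [b, h] at hb
    obtain ⟨hF, i, hi, h1, h0⟩ := hI
    have hvx : v'.r x = 2 ^ w := by rw [hF.r x hXx, hw]
    simp only [Ex.eval_lt, Ex.eval_v, h1, hvx, ne_eq, ite01_eq_zero, not_not] at hz
    have hiw : i < w := (Nat.pow_lt_pow_iff_right one_lt_two).1 hz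
    have hW : 2 ^ w ≤ P.W := hvx ▸ hv'.1 x
    have hp : 2 ^ (i + 1) ≤ 2 ^ w := Nat.pow_le_pow_right (by norm_num) hiw
    rw [pow_succ] at hp
    refine ⟨40, ?_, ?_⟩
    · rw [show Ex.cost (.lt (.v (tm 1)) (.v x)) = 5 from rfl, h1, Nat.log_pow one_lt_two]; omega
    · set q2 : St → ℝ≥0∞ := fun v'' => ⨅ _ : (w - Nat.log 2 (v''.r (tm 1))) * 60 + 40 +
        Ex.cost (.lt (.v (tm 1)) (.v x)) + 3 ≤ (w - Nat.log 2 (v'.r (tm 1))) * 60, b v'' with hq2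
      set p := SL.seq (.asg (tm 0) (2 * .v (tm 0) + .v (tm 2))) (.asg (tm 1) (2 * .v (tm 1))) with hpp
      have hexec : ∀ j ≤ 1, q2 (p.exec (v'.set (tm 2) j)) = ((2 : ℝ≥0∞) ^ (w - i - 1))⁻¹ * ∑ u ∈ range (2 ^ (w - i - 1)),
            g ((2 * v'.r (tm 0) + j) * 2 ^ (w - i - 1) + u) := by
        intro j hj
        have e1 : (p.exec (v'.set (tm 2) j)).r (tm 1) = 2 ^ (i + 1) := by simp [hpp, SL.exec, h1, pow_succ']
        have e0 : (p.exec (v'.set (tm 2) j)).r (tm 0) = 2 * v'.r (tm 0) + j := by simp [hpp, SL.exec]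
        have e2 : I (p.exec (v'.set (tm 2) j)) := by
          refine ⟨?_, i + 1, hiw, e1, ?_⟩
          · exact ((hF.set (x := tm 2) (by simp [X]) _).set (x := tm 0) (by simp [X]) _).set (x := tm 1) (by simp [X]) _
          · rw [e0, pow_succ]; omega
        have e3 : Ex.cost (.lt (.v (tm 1)) (.v x)) = 5 := rfl
        simp only [hq2, e1, h1, Nat.log_pow one_lt_two, e3]; rw [iInf_pos (by omega)]; simp only [b]
        rw [iInf_pos e2, hval _ (i + 1) e1, e0, Nat.sub_sub]
      have h5 := (Tq.flip (P := P) (tm 2) v' (fun v'' => ⨅ _ : v'' = v'.set (tm 2) 0 ∨ v'' = v'.set (tm 2) 1,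
        q2 (p.exec v''))).seq (c' := p.cmd) (T' := p.cost) (q := q2) fun v'' hv'' => by
          by_cases h : v'' = v'.set (tm 2) 0 ∨ v'' = v'.set (tm 2) 1
          · rw [iInf_pos h]
            refine Tq.sl _ (by simp [hpp, SL.size]; omega) fun _ => ?_
            rcases h with h | h <;> subst h <;> simp [hpp, SL.ok, SL.exec, h1] <;> omega
          · simp only [h, iInf_false]
            exact fun G K T hK s hs t ht => le_top
      refine h5.mono ?_ (fun _ _ => le_rfl) ?_
      · have : p.cost = 19 := rfl
        omega
      · rw [iInf_pos (Or.inl rfl), iInf_pos (Or.inr rfl), hexec 0 (by omega), hexec 1 le_rfl]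
        simp only [b]
        refine le_iInf fun _ => ?_
        rw [hval v' i h1]
        have := avg_double g (v'.r (tm 0)) (w - i - 1)
        rw [show w - i - 1 + 1 = w - i by omega] at this
        rw [← this]; simp
  · intro v' hv' hz
    refine le_iInf fun hI => ?_
    obtain ⟨hF, i, hi, h1, h0⟩ := hI
    have hvx : v'.r x = 2 ^ w := by rw [hF.r x hXx, hw]
    simp only [Ex.eval_lt, Ex.eval_v, h1, hvx, ite01_eq_zero, not_lt] at hz
    have hiw : i = w := le_antisymm hi ((Nat.pow_le_pow_iff_right one_lt_two).1 hz)
    subst hiw; rw [hval v' i h1]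
    simp only [Nat.sub_self, pow_zero, inv_one, Finset.range_one, mul_one, one_mul, Finset.sum_singleton, add_zero]
    refine hg v' _ (hF.mono ?_ fun _ h => h) ?_ rfl h0
    · rintro y (h | h | h) <;> simp [h]
    · intro i hi
      refine hF.r _ ?_
      rintro (h | h | h) <;> simp at h <;> omega

/-- `R` uniformly random words below `2 ^ w`, where `2 ^ w` is the value of `x` and `R` the value of
`y`, into the array `bRnd`. -/
def pickVec (x y : Var) : Cmd := .seq (asg (tm 3) 0) (whileE (.lt (.v (tm 3)) (.v y)) (.seq (pickWord x)
      (SL.seq (.sto bRnd (.v (tm 3)) (.v (tm 0))) (.asg (tm 3) (.v (tm 3) + 1))).cmd))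

theorem avg_halving {ι : Type*} [DecidableEq ι] (E : Finset ι) (ok : ι → ℕ → Prop) [∀ e u, Decidable (ok e u)]
    (w r : ℕ) (hE : ∀ e ∈ E, 2 * ((range (2 ^ w)).filter (¬ ok e ·)).card ≤ 2 ^ w) (η : ℝ≥0∞) :
    ((2 : ℝ≥0∞) ^ w)⁻¹ * ∑ u ∈ range (2 ^ w),
      (η + (E.filter (¬ ok · u)).card * ((2 : ℝ≥0∞) ^ r)⁻¹) ≤ η + E.card * ((2 : ℝ≥0∞) ^ (r + 1))⁻¹ := by
  have h0 : ((2 : ℝ≥0∞) ^ w) ≠ 0 := by simp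
  have h1 : ((2 : ℝ≥0∞) ^ w) ≠ ⊤ := by simp
  rw [Finset.sum_add_distrib, mul_add, sum_const, card_range, nsmul_eq_mul,
    ← mul_assoc, Nat.cast_pow, Nat.cast_ofNat, ENNReal.inv_mul_cancel h0 h1, one_mul]
  refine add_le_add_right ?_ η
  rw [← sum_mul, ← Nat.cast_sum]
  have h2 : 2 * ∑ u ∈ range (2 ^ w), (E.filter (¬ ok · u)).card ≤ E.card * 2 ^ w := by
    simp only [card_filter]; rw [Finset.sum_comm, mul_sum, ← smul_eq_mul, ← sum_const]
    refine sum_le_sum fun e he => ?_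
    have := hE e he
    rwa [card_filter] at this
  have h3 : (2 : ℝ≥0∞) * (∑ u ∈ range (2 ^ w), (E.filter (¬ ok · u)).card : ℕ) ≤ E.card * 2 ^ w := by exact_mod_cast h2
  rw [pow_succ, ENNReal.mul_inv (by simp) (by simp)]
  calc ((2 : ℝ≥0∞) ^ w)⁻¹ * ((∑ u ∈ range (2 ^ w), (E.filter (¬ ok · u)).card : ℕ) * (2 ^ r)⁻¹)
      = ((2 : ℝ≥0∞) ^ w)⁻¹ * ((2⁻¹ * 2) * (∑ u ∈ range (2 ^ w), (E.filter (¬ ok · u)).card : ℕ) * (2 ^ r)⁻¹) := by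
        rw [ENNReal.inv_mul_cancel (by simp) (by simp), one_mul]
    _ = ((2 : ℝ≥0∞) ^ w)⁻¹ * (2⁻¹ * (2 * (∑ u ∈ range (2 ^ w), (E.filter (¬ ok · u)).card : ℕ)) * (2 ^ r)⁻¹) := by ring
    _ ≤ ((2 : ℝ≥0∞) ^ w)⁻¹ * (2⁻¹ * (E.card * 2 ^ w) * (2 ^ r)⁻¹) := by gcongr
    _ = (((2 : ℝ≥0∞) ^ w)⁻¹ * 2 ^ w) * (E.card * ((2 ^ r)⁻¹ * 2⁻¹)) := by ring
    _ = _ := by rw [ENNReal.inv_mul_cancel h0 h1, one_mul]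

open Classical in
theorem pickVec_tri (hS : 10 ≤ P.S) {x y : Var} (hx : x.1 ≠ 7) (hy : y.1 ≠ 7)
    {w : ℕ} (hw : v.r x = 2 ^ w) (hR : v.r y = R) {ι : Type*} (E : Finset ι)
    (ok : ι → ℕ → Prop)
    (hE : ∀ e ∈ E, 2 * ((range (2 ^ w)).filter (¬ ok e ·)).card ≤ 2 ^ w)
    (hε : E.card * ((2 : ℝ≥0∞) ^ R)⁻¹ ≤ P.ε) :
    Tri P (pickVec x y) v ((60 * w + 100) * (R + 1)) 1 fun v' =>
      Fr (·.1 = 7) (· = bRnd) v v' ∧ (∀ ρ < R, v'.a bRnd ρ < 2 ^ w) ∧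
      ∀ e ∈ E, ∃ ρ < R, ok e (v'.a bRnd ρ) := by
  intro η
  let Bad : St → Finset ι := fun v' => E.filter fun e => ∀ ρ < v'.r (tm 3), ¬ ok e (v'.a bRnd ρ)
  let I : St → Prop := fun v' => Fr (·.1 = 7) (· = bRnd) v v' ∧ v'.r (tm 3) ≤ R ∧ ∀ ρ < v'.r (tm 3), v'.a bRnd ρ < 2 ^ w
  let b : St → ℝ≥0∞ := fun v' => ⨅ _ : I v', η + (Bad v').card * ((2 : ℝ≥0∞) ^ (R - v'.r (tm 3)))⁻¹
  let Q : St → Prop := fun v' => Fr (·.1 = 7) (· = bRnd) v v' ∧ (∀ ρ < R, v'.a bRnd ρ < 2 ^ w) ∧ ∀ e ∈ E, ∃ ρ < R, ok e (v'.a bRnd ρ)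
  set p := SL.seq (.sto bRnd (.v (tm 3)) (.v (tm 0))) (.asg (tm 3) (.v (tm 3) + 1)) with hp
  have c1 : Ex.cost (.lt (.v (tm 3)) (.v y)) = 5 := rfl
  have key := Tq.whileE (P := P) (e := .lt (.v (tm 3)) (.v y)) (c := .seq (pickWord x) p.cmd)
    (q := fun v' => min (⨅ _ : Q v', η) 1) (fun v' => (R - v'.r (tm 3)) * (60 * w + 100)) b
    (by simp; omega) ?_ ?_
  · set v1 := v.set (tm 3) 0 with hv1
    have hI : I v1 := ⟨(Fr.refl (·.1 = 7) (· = bRnd) v).set (x := tm 3) rfl _, by simp [hv1], by simp [hv1]⟩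
    refine Tq.min_one ((Tq.after (Tri.asg (by simp; omega) (by simp) rfl) (key v1)).mono ?_ (fun _ _ => le_rfl) ?_)
    · rw [show v1.r (tm 3) = 0 by simp [hv1], show Ex.cost 0 = 1 from rfl, c1, Nat.sub_zero]; nlinarith
    · refine (iInf_le _ hI).trans ?_
      simp only [hv1, St.set_r, if_true, Nat.sub_zero, Nat.cast_one, one_mul]
      gcongr
      exact le_trans (by gcongr; exact Finset.filter_subset _ _) hε
  · intro v' hv' hz hb
    have hI : I v' := by by_contra h; simp [b, h] at hb
    obtain ⟨hF, hle, hlt⟩ := hI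
    have hvx : v'.r x = 2 ^ w := by rw [hF.r x hx, hw]
    have hvy : v'.r y = R := by rw [hF.r y hy, hR]
    simp only [Ex.eval_lt, Ex.eval_v, hvy, ne_eq, ite01_eq_zero, not_not] at hz
    obtain ⟨m, hm⟩ := Nat.exists_eq_add_of_lt hz
    have hm' : R - v'.r (tm 3) = m + 1 := by omega
    have hRW : R ≤ P.W := hvy ▸ hv'.1 y
    have hwW : 2 ^ w ≤ P.W := hvx ▸ hv'.1 x
    refine ⟨60 * w + 80, ?_, ?_⟩
    · simp only [hm', c1, add_mul]; omega
    · set q2 : St → ℝ≥0∞ := fun v'' => ⨅ _ : (R - v''.r (tm 3)) * (60 * w + 100) + (60 * w + 80) +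
        Ex.cost (.lt (.v (tm 3)) (.v y)) + 3 ≤ (R - v'.r (tm 3)) * (60 * w + 100), b v'' with hq2
      let J : ℕ → St → Prop := fun u v'' => Fr (·.1 = 7) (fun _ => False) v' v'' ∧
        (∀ i, 3 ≤ i → v''.r (tm i) = v'.r (tm i)) ∧ v''.r (tm 0) = u ∧ u < 2 ^ w
      let Bu : ℕ → Finset ι := fun u => (Bad v').filter (¬ ok · u)
      let g : ℕ → ℝ≥0∞ := fun u => η + (Bu u).card * ((2 : ℝ≥0∞) ^ m)⁻¹
      have h1 := pickWord_tq hS hx hvx (fun v'' => ⨅ _ : ∃ u, J u v'', g (v''.r (tm 0))) g (fun v'' u f1 f2 f3 f4 => by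
          rw [iInf_pos ⟨u, f1, f2, f3, f4⟩, f3])
      have h2 := h1.seq (c' := p.cmd) (T' := p.cost) (q := q2) fun v'' hv'' => by
        by_cases h : ∃ u, J u v''
        · rw [iInf_pos h]
          obtain ⟨u, g1, g2, g3, g4⟩ := h
          have e3 : v''.r (tm 3) = v'.r (tm 3) := g2 3 le_rfl
          refine (Tq.sl q2 (by simp [hp, SL.size]; omega) fun _ => ?_).mono le_rfl (fun _ _ => le_rfl) ?_
          · simp only [hp, SL.ok, SL.exec, Ex.eval_v, Ex.eval_add, Ex.eval_ofNat, St.put_r, e3]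
            exact ⟨hv''.1 _, by omega⟩
          · have e4 : (p.exec v'').r (tm 3) = v'.r (tm 3) + 1 := by simp [hp, SL.exec, e3]
            have e5 : ∀ ρ < v'.r (tm 3), (p.exec v'').a bRnd ρ = v'.a bRnd ρ := fun ρ hρ => by
              simp only [hp, SL.exec, Ex.eval_v, St.set_a, St.put_a, e3]; rw [if_neg (by omega), g1.a _ (by simp)]
            have e6 : (p.exec v'').a bRnd (v'.r (tm 3)) = u := by simp [hp, SL.exec, St.put_a, e3, g3]
            have e7 : I (p.exec v'') := by
              refine ⟨?_, by omega, fun ρ hρ => ?_⟩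
              · have : Fr (·.1 = 7) (· = bRnd) v v'' := hF.trans (g1.mono (fun _ h => h) (by simp))
                exact (this.put rfl _ _).set rfl _
              · rw [e4] at hρ
                rcases lt_succ_iff_lt_or_eq.1 hρ with h | h
                · rw [e5 ρ h]; exact hlt ρ h
                · rw [h, e6]; exact g4
            simp only [hq2, e4]
            rw [iInf_pos (by
              rw [hm', c1, show R - (v'.r (tm 3) + 1) = m by omega, add_mul]; omega)]
            simp only [b]; rw [iInf_pos e7, e4, show R - (v'.r (tm 3) + 1) = m by omega, g3]
            simp only [g]
            gcongr
            intro e he; simp only [Bad, Bu, mem_filter, e4] at he ⊢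
            refine ⟨⟨he.1, fun ρ hρ => ?_⟩, ?_⟩
            · rw [← e5 ρ hρ]; exact he.2 ρ (by omega)
            · rw [← e6]; exact he.2 _ (by omega)
        · rw [iInf_neg h]
          exact fun G K T hK s hs t ht => le_top
      refine h2.mono ?_ (fun _ _ => le_rfl) ?_
      · have : p.cost = 13 := rfl
        omega
      · refine le_iInf fun _ => ?_
        rw [hm']
        exact avg_halving (Bad v') ok w m (fun e he => hE e (mem_filter.1 he).1) η
  · intro v' hv' hz
    refine le_iInf fun hI => ?_
    obtain ⟨hF, hle, hlt⟩ := hI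
    have hvy : v'.r y = R := by rw [hF.r y hy, hR]
    simp only [Ex.eval_lt, Ex.eval_v, hvy, ite01_eq_zero, not_lt] at hz
    have e1 : v'.r (tm 3) = R := le_antisymm hle hz
    by_cases hQ : Q v'
    · rw [iInf_pos hQ]; exact (min_le_left _ _).trans le_self_add
    · refine (min_le_right _ _).trans ?_
      have : (Bad v').Nonempty := by
        by_contra h
        rw [Finset.not_nonempty_iff_eq_empty, Finset.filter_eq_empty_iff] at h
        refine hQ ⟨hF, fun ρ hρ => hlt ρ (by omega), fun e he => ?_⟩
        obtain ⟨ρ, h1, h2⟩ := not_forall₂.1 (h he)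
        exact ⟨ρ, by omega, not_not.1 h2⟩
      have h1 : (1 : ℝ≥0∞) ≤ (Bad v').card := by exact_mod_cast this.card_pos
      rw [e1, Nat.sub_self, pow_zero, inv_one, mul_one]; exact h1.trans le_add_self

/-! ### The matrix multiplication program as a subroutine -/

theorem Rel.set {s : State} (h : Rel W s v) (x : Var) (hn : n ≤ W) : Rel W ⟨update s.reg (en x) n, s.mem⟩ (v.set x n) := by
  refine ⟨fun y => ?_, h.mem, fun y => ?_, h.small.2⟩
  · simp only [update_apply, en_inj, St.set_r, h.reg]
  · rw [St.set_r]
    split_ifs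
    · exact hn
    · exact h.small.1 y

theorem Rel.put {s : State} (h : Rel W s v) (b : Var) (i : ℕ) (hn : n ≤ W) : Rel W (s.writeMem (eb b) i n) (v.put b i n) := by
  refine ⟨fun y => h.reg y, fun c => ?_, h.small.1, fun c i => ?_⟩
  · by_cases hc : c = b
    · subst hc; simp [State.writeMem, St.put, h.mem]
    · have : eb c ≠ eb b := fun h => hc (eb_inj.1 h)
      simp [State.writeMem, hc, this, h.mem]
  · rw [St.put_a]; split_ifs
    · exact hn
    · exact h.small.2 _ _

/-- The deterministic run in which all coins are `false`. -/
def runFalse (B : ℕ) : ℕ → Option Config → Option Config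
  | 0, c => c
  | T + 1, c => runFalse B T (c.bind (step B false))

theorem runFalse_of_failFrom {B : ℕ} {G : State → Prop} (T : ℕ) :
    ∀ c : Option Config, failFrom B G T c = 0 → ∃ f, runFalse B T c = some ⟨[], f⟩ ∧ G f := by
  induction T with
  | zero =>
    intro c h; simp only [failFrom, runDist, PMF.toOuterMeasure_pure_apply] at h
    by_contra hn
    rw [if_pos (show c ∈ {c | ¬∃ f : State, c = some ⟨[], f⟩ ∧ G f} from hn)] at h; exact one_ne_zero h
  | succ T ih =>
    intro c h
    refine ih _ ?_
    simp only [failFrom, runDist, PMF.toOuterMeasure_bind_apply, tsum_bool,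
      PMF.uniformOfFintype_apply, Fintype.card_bool, add_eq_zero, mul_eq_zero] at h
    simpa [failFrom] using h.1

abbrev vTick : Var := (22, 0)
abbrev vOne : Var := (22, 1)

def tick : Cmd := .op .add (en vTick) (en vTick) (en vOne)

/-- The program `p` on the registers `(21, _)` and the arrays `(20, _)`, with a step counter, with a
log of the written addresses in the arrays `(23, _)`, and with all coins set to `0`. -/
def ins : Cmd → Cmd
  | .skip => .seq tick .skip
  | .const r v => .seq tick (.const (en (21, r)) v)
  | .op o r x y => .seq tick (.op o (en (21, r)) (en (21, x)) (en (21, y)))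
  | .load r b x => .seq tick (.load (en (21, r)) (eb (20, b)) (en (21, x)))
  | .store b x y => .seq tick (.seq (.store (eb (23, b)) (en vTick) (en (21, x)))
      (.store (eb (20, b)) (en (21, x)) (en (21, y))))
  | .flip r => .seq tick (.const (en (21, r)) 0)
  | .seq p q => .seq tick (.seq (ins p) (ins q))
  | .ite r p q => .seq tick (.ite (en (21, r)) (ins p) (ins q))
  | .loop r p => .seq (.loop (en (21, r)) (.seq tick (ins p))) tick

/-- The stacks of the instrumented program that correspond to a stack. -/
inductive StackRel : List Cmd → List Cmd → Prop
  | nil : StackRel [] []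
  | cons (c : Cmd) {K K' : List Cmd} : StackRel K K' → StackRel (c :: K) (ins c :: K')
  | loop (r : ℕ) (p : Cmd) {K K' : List Cmd} : StackRel K K' →
      StackRel (.loop r p :: K) (.loop (en (21, r)) (.seq tick (ins p)) :: tick :: K')

/-- All registers and banks that a program mentions are below `ρ`. -/
def Cmd.inRange (ρ : ℕ) : Cmd → Prop
  | .skip => True
  | .const r _ => r < ρ
  | .op _ r _ _ => r < ρ
  | .load r _ _ => r < ρ
  | .store b _ _ => b < ρ
  | .flip r => r < ρ
  | .seq p q => p.inRange ρ ∧ q.inRange ρ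
  | .ite _ p q => p.inRange ρ ∧ q.inRange ρ
  | .loop _ p => p.inRange ρ

theorem Cmd.inRange_mono {ρ ρ' : ℕ} (h : ρ ≤ ρ') (p : Cmd) (hp : p.inRange ρ) : p.inRange ρ' := by
  induction p with
  | skip => trivial
  | seq p q hp' hq' => exact ⟨hp' hp.1, hq' hp.2⟩
  | ite r p q hp' hq' => exact ⟨hp' hp.1, hq' hp.2⟩
  | loop r p hp' => exact hp' hp
  | _ => exact lt_of_lt_of_le hp h

theorem Cmd.exists_inRange (p : Cmd) : ∃ ρ, p.inRange ρ := by
  induction p with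
  | skip => exact ⟨0, trivial⟩
  | seq p q hp hq | ite _ p q hp hq =>
    obtain ⟨a, ha⟩ := hp; obtain ⟨b, hb⟩ := hq
    exact ⟨max a b, p.inRange_mono (le_max_left _ _) ha, q.inRange_mono (le_max_right _ _) hb⟩
  | loop r p hp => exact hp
  | _ => exact ⟨_, Nat.lt_succ_self _⟩

/-- The abstract state `v` represents the state `s` of the subroutine, which was started in the state
`s₀`, while the rest of the memory was `v₀`. -/
structure Sim (ρ : ℕ) (s₀ : State) (v₀ : St) (s : State) (v : St) : Prop where
  reg : ∀ r, v.r (21, r) = s.reg r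
  mem : ∀ b, v.a (20, b) = s.mem b
  fr : Fr (fun x => x.1 = 21 ∨ x = vTick) (fun b => b.1 = 20 ∨ b.1 = 23) v₀ v
  log : ∀ b c, s.mem b c ≠ s₀.mem b c → ∃ i ≤ v.r vTick, v.a (23, b) i = c
  reg_eq : ∀ r, ρ ≤ r → s.reg r = s₀.reg r
  mem_eq : ∀ b, ρ ≤ b → s.mem b = s₀.mem b

/-- Deterministic reachability from abstract states. -/
def AReach (P : Par) (q : ℕ) (X : List Cmd) (v : St) (X' : List Cmd) (v' : St) : Prop :=
  ∀ s, Rel P.W s v → ∃ s', Rel P.W s' v' ∧ ∀ K, DReach P.B q ⟨X ++ K, s⟩ ⟨X' ++ K, s'⟩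

theorem AReach.trans {q q' : ℕ} {X X' X'' : List Cmd} {v'' : St} (h : AReach P q X v X' v') (h' : AReach P q' X' v' X'' v'') :
    AReach P (q + q') X v X'' v'' := fun s hs => by
  obtain ⟨s1, h1, h2⟩ := h s hs
  obtain ⟨s2, h3, h4⟩ := h' s1 h1
  exact ⟨s2, h3, fun K => (h2 K).trans (h4 K)⟩

theorem AReach.refl {X : List Cmd} : AReach P 0 X v X v := fun s hs => ⟨s, hs, fun _ => .refl _ _⟩

theorem AReach.seq {p q : Cmd} {X : List Cmd} : AReach P 1 (.seq p q :: X) v (p :: q :: X) v := fun s hs => ⟨s, hs, fun _ => .seq _ _ _ _ _⟩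

theorem AReach.same {c : Cmd} {X X' : List Cmd} (h : ∀ s, Rel P.W s v → ∀ K b, step P.B b ⟨c :: X ++ K, s⟩ = some ⟨X' ++ K, s⟩) :
    AReach P 1 (c :: X) v X' v :=
  fun s hs => ⟨s, hs, fun K => .one fun b => h s hs K b⟩

theorem AReach.write {c : Cmd} {X : List Cmd} (x : Var) (n : ℕ) (hn : n ≤ P.W) (h : ∀ s, Rel P.W s v → ∀ K b, step P.B b ⟨c :: X ++ K, s⟩ =
      (s.writeReg P.B (en x) n).map (Config.mk (X ++ K))) :
    AReach P 1 (c :: X) v X (v.set x n) :=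
  fun s hs => ⟨_, hs.set x hn, fun K => .one fun b => by rw [h s hs K b, State.writeReg, if_pos (hn.trans_lt P.W_lt)]; rfl⟩

theorem AReach.tick {X : List Cmd} (h1 : v.r vOne = 1)
    (ht : v.r vTick + 1 ≤ P.W) : AReach P 1 (tick :: X) v X (v.set vTick (v.r vTick + 1)) :=
  .write _ _ ht fun s hs K b => by simp [CliqueListing.tick, step, BinOp.eval, hs.reg, h1]

theorem sim_step {ρ Bp : ℕ} (hB : Bp ≤ P.W) {s₀ s s' : State} {v₀ : St} {c : Cmd}
    {K K' X : List Cmd} (h : step Bp false ⟨c :: K, s⟩ = some ⟨K', s'⟩) (hX : StackRel (c :: K) X)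
    (hc : ∀ p ∈ c :: K, p.inRange ρ) (hS : Sim ρ s₀ v₀ s v) (h1 : v₀.r vOne = 1)
    (ht : v.r vTick + 1 ≤ P.W) :
    ∃ X' v' q, q ≤ 5 ∧ StackRel K' X' ∧ (∀ p ∈ K', p.inRange ρ) ∧ Sim ρ s₀ v₀ s' v' ∧
      v'.r vTick = v.r vTick + 1 ∧ AReach P q X v X' v' := by
  have h1' : v.r vOne = 1 := by rw [hS.fr.r _ (by simp), h1]
  set v1 := v.set vTick (v.r vTick + 1) with hv1
  have hS1 : Sim ρ s₀ v₀ s v1 := ⟨fun r => by simp [hv1, hS.reg], hS.mem, hS.fr.set (by simp) _, fun b c hbc => by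
      obtain ⟨i, hi, h⟩ := hS.log b c hbc
      exact ⟨i, by simp [hv1]; omega, h⟩, hS.reg_eq, hS.mem_eq⟩
  have htick : ∀ X, AReach P 1 (tick :: X) v X v1 := fun X => .tick h1' ht
  have hst : ∀ (q : Cmd) X, AReach P 2 (.seq tick q :: X) v (q :: X) v1 := fun q X => AReach.seq.trans (htick _)
  obtain ⟨hpc, hpK⟩ := List.forall_mem_cons.1 hc
  have hwr : ∀ (r n : ℕ), r < ρ → Sim ρ s₀ v₀ ⟨update s.reg r n, s.mem⟩ (v1.set (21, r) n) := by
    intro r n hr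
    refine ⟨fun r' => ?_, hS1.mem, hS1.fr.set (by simp) _, fun b c hbc => ?_, fun r' hr' => ?_, hS1.mem_eq⟩
    · simp only [St.set_r, update_apply, Prod.mk.injEq, true_and, hS1.reg]
    · simpa using hS1.log b c hbc
    · simp only
      rw [update_of_ne (by omega), hS1.reg_eq r' hr']
  have hreg : ∀ (q : Cmd) (r n : ℕ) (KX : List Cmd), StackRel K KX → r < ρ → (s.writeReg Bp r n).map (Config.mk K) = some ⟨K', s'⟩ →
      (∀ t, Rel P.W t v1 → ∀ L b, step P.B b ⟨q :: KX ++ L, t⟩ = (t.writeReg P.B (en (21, r)) n).map (Config.mk (KX ++ L))) →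
      ∃ X' v' q', q' ≤ 5 ∧ StackRel K' X' ∧ (∀ p ∈ K', p.inRange ρ) ∧ Sim ρ s₀ v₀ s' v' ∧
      v'.r vTick = v.r vTick + 1 ∧ AReach P q' (.seq tick q :: KX) v X' v' := by
    intro q r n KX hKX hr hw hq; unfold State.writeReg at hw
    split_ifs at hw with hn <;> cases hw
    exact ⟨KX, v1.set (21, r) n, 3, by omega, hKX, hpK, hwr r n hr, by simp [hv1], (hst q KX).trans (.write _ _ (by omega) hq)⟩
  cases hX with
  | loop r p hKX =>
    rename_i KX
    simp only [step, Option.some.injEq, Config.mk.injEq] at h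
    obtain ⟨h2, rfl⟩ := h
    by_cases hz : s.reg r = 0
    · simp only [hz, ne_eq, not_true, if_false] at h2
      subst h2
      refine ⟨KX, v1, 2, by omega, hKX, hpK, hS1, by simp [hv1], AReach.trans (.same fun t ht L b => ?_) (htick _)⟩
      simp [step, ht.reg, hS.reg, hz]
    · simp only [hz, ne_eq, not_false_eq_true, if_true] at h2
      subst h2
      refine ⟨_, v1, 1 + 2, by omega, .cons p (.loop r p hKX), ?_, hS1, by simp [hv1],
        AReach.trans (X' := .seq tick (ins p) :: _) (.same fun t ht L b => ?_) (hst _ _)⟩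
      · exact List.forall_mem_cons.2 ⟨hpc, hc⟩
      · simp [step, ht.reg, hS.reg, hz]
  | cons _ hKX =>
    rename_i KX
    cases c with
    | skip =>
      cases h
      exact ⟨KX, v1, 3, by omega, hKX, hpK, hS1, by simp [hv1], (hst _ KX).trans (.same fun t ht L b => by simp [step])⟩
    | const r n => exact hreg _ r n KX hKX hpc h fun t ht L b => by simp [step]
    | op o r x y => exact hreg _ r _ KX hKX hpc h fun t ht L b => by simp [step, ht.reg, hS1.reg]
    | load r b x => exact hreg _ r _ KX hKX hpc h fun t ht L b => by simp [step, ht.reg, ht.mem, hS1.reg, hS1.mem]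
    | flip r => exact hreg _ r _ KX hKX hpc h fun t ht L b => by simp [step]
    | store b x y =>
      cases h
      set v2 := (v1.put (23, b) (v1.r vTick) (s.reg x)).put (20, b) (s.reg x) (s.reg y) with hv2
      refine ⟨KX, v2, 2 + (1 + (1 + 1)), by omega, hKX, hpK, ?_, by simp [hv2, hv1],
        (hst _ KX).trans (AReach.seq.trans (AReach.trans (v' := v1.put (23, b) (v1.r vTick) (s.reg x))
          (X' := .store (eb (20, b)) (en (21, x)) (en (21, y)) :: KX)
          (fun t ht => ⟨_, ht.put (23, b) (v1.r vTick) (n := s.reg x) ?_, fun L => .one fun b' => ?_⟩)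
          fun t ht => ⟨_, ht.put (20, b) (s.reg x) (n := s.reg y) ?_, fun L => .one fun b' => ?_⟩))⟩
      · refine ⟨fun r => by simp [hv2, hS1.reg, State.writeMem], fun b' => ?_,
          (hS1.fr.put (by simp) _ _).put (by simp) _ _, fun b' c hbc => ?_, hS1.reg_eq, fun b' hb' => ?_⟩
        · by_cases hb : b' = b
          · subst hb; simp [hv2, State.writeMem, St.put, hS1.mem]
          · simp [hv2, State.writeMem, hb, hS1.mem]
        · by_cases hcc : b' = b ∧ c = s.reg x
          · obtain ⟨rfl, rfl⟩ := hcc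
            exact ⟨v1.r vTick, by simp [hv2], by simp [hv2, St.put_a]⟩
          · have h3 : (s.writeMem b (s.reg x) (s.reg y)).mem b' c = s.mem b' c := by
              by_cases hb : b' = b
              · subst hb
                have : c ≠ s.reg x := fun h => hcc ⟨rfl, h⟩
                simp [State.writeMem, this]
              · simp [State.writeMem, hb]
            rw [h3] at hbc
            obtain ⟨i, hi, h4⟩ := hS.log b' c hbc
            refine ⟨i, by simp [hv2, hv1]; omega, ?_⟩
            rw [hv2, St.put_a_ne _ _ _ _ _ (by simp), St.put_a, if_neg]
            · simpa [hv1] using h4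
            · simp [hv1]; omega
        · have : b' ≠ b := by have : b < ρ := hpc; omega
          simp [State.writeMem, this, hS1.mem_eq b' hb']
      · rw [← hS1.reg]; exact ht.small.1 _
      · simp [step, ht.reg, hS1.reg]
      · rw [← hS1.reg]; simpa using ht.small.1 (21, y)
      · simp [step, ht.reg, hS1.reg]
    | seq p q =>
      cases h
      exact ⟨_, v1, 2 + 1, by omega, .cons p (.cons q hKX), by simpa using ⟨hpc.1, hpc.2, hpK⟩, hS1, by simp [hv1], (hst _ KX).trans AReach.seq⟩
    | ite r p q =>
      cases h
      by_cases hz : s.reg r = 0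
      · exact ⟨_, v1, 2 + 1, by omega, by simpa [hz] using .cons q hKX, by simpa [hz] using ⟨hpc.2, hpK⟩, hS1, by simp [hv1],
          (hst _ KX).trans (.same fun t ht L b => by simp [step, ht.reg, hS1.reg, hz])⟩
      · exact ⟨_, v1, 2 + 1, by omega, by simpa [hz] using .cons p hKX, by simpa [hz] using ⟨hpc.1, hpK⟩, hS1, by simp [hv1],
          (hst _ KX).trans (.same fun t ht L b => by simp [step, ht.reg, hS1.reg, hz])⟩
    | loop r p =>
      simp only [step, Option.some.injEq, Config.mk.injEq] at h
      obtain ⟨h2, rfl⟩ := h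
      by_cases hz : s.reg r = 0
      · simp only [hz, ne_eq, not_true, if_false] at h2
        subst h2
        refine ⟨KX, v1, 1 + (1 + 1), by omega, hKX, hpK, hS1, by simp [hv1],
          AReach.seq.trans (AReach.trans (.same fun t ht L b => ?_) (htick _))⟩
        simp [step, ht.reg, hS.reg, hz]
      · simp only [hz, ne_eq, not_false_eq_true, if_true] at h2
        subst h2
        refine ⟨_, v1, 1 + (1 + 2), by omega, .cons p (.loop r p hKX), ?_, hS1, by simp [hv1],
          AReach.seq.trans (AReach.trans (X' := .seq tick (ins p) :: _) (.same fun t ht L b => ?_) (hst _ _))⟩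
        · exact List.forall_mem_cons.2 ⟨hpc, hc⟩
        · simp [step, ht.reg, hS.reg, hz]

theorem runFalse_halted (B T : ℕ) (s : State) : runFalse B T (some ⟨[], s⟩) = some ⟨[], s⟩ := by
  induction T with
  | zero => rfl
  | succ T ih => simpa [runFalse, step] using ih

theorem runFalse_none (B T : ℕ) : runFalse B T none = none := by
  induction T with
  | zero => rfl
  | succ T ih => simpa [runFalse] using ih

def haltTime (B : ℕ) (c : Option Config) : ℕ := sInf {T | ∃ f, runFalse B T c = some ⟨[], f⟩}

theorem haltTime_nil (B : ℕ) (s : State) : haltTime B (some ⟨[], s⟩) = 0 := Nat.sInf_eq_zero.2 (Or.inl ⟨s, rfl⟩)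

theorem haltTime_cons (B : ℕ) (c : Cmd) (K : List Cmd) (s : State) {T : ℕ} {f : State}
    (h : runFalse B T (some ⟨c :: K, s⟩) = some ⟨[], f⟩) :
    haltTime B (some ⟨c :: K, s⟩) = haltTime B (step B false ⟨c :: K, s⟩) + 1 := by
  have hne : {T | ∃ f, runFalse B T (some ⟨c :: K, s⟩) = some ⟨[], f⟩}.Nonempty := ⟨T, f, h⟩
  have h1 : 1 ≤ sInf {T | ∃ f, runFalse B T (some ⟨c :: K, s⟩) = some ⟨[], f⟩} := by
    refine le_csInf hne ?_
    rintro (_ | b) ⟨f, hf⟩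
    · simp [runFalse] at hf
    · exact Nat.succ_le_succ (Nat.zero_le _)
  exact (Nat.sInf_add h1).symm

theorem sim_run {ρ Bp : ℕ} (hB : Bp ≤ P.W) {s₀ f : State} {v₀ : St} (h1 : v₀.r vOne = 1) (T : ℕ) : ∀ {s : State} {v : St} {K X : List Cmd},
    runFalse Bp T (some ⟨K, s⟩) = some ⟨[], f⟩ → StackRel K X →
    (∀ p ∈ K, p.inRange ρ) → Sim ρ s₀ v₀ s v → v.r vTick + T ≤ P.W →
    ∃ v' q n, n = haltTime Bp (some ⟨K, s⟩) ∧ n ≤ T ∧ q ≤ 5 * n ∧ Sim ρ s₀ v₀ f v' ∧ v'.r vTick = v.r vTick + n ∧ AReach P q X v [] v' := by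
  induction T with
  | zero =>
    intro s v K X h hX hK hS ht; simp only [runFalse, Option.some.injEq, Config.mk.injEq] at h
    obtain ⟨rfl, rfl⟩ := h
    cases hX
    exact ⟨v, 0, 0, (haltTime_nil _ _).symm, le_rfl, le_rfl, hS, rfl, .refl⟩
  | succ T ih =>
    intro s v K X h hX hK hS ht
    cases K with
    | nil =>
      rw [runFalse_halted] at h
      obtain rfl : s = f := by simpa using h
      cases hX
      exact ⟨v, 0, 0, (haltTime_nil _ _).symm, Nat.zero_le _, le_rfl, hS, rfl, .refl⟩
    | cons c K =>
      have ht' := haltTime_cons _ _ _ _ h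
      simp only [runFalse, Option.bind_some] at h
      rcases hs : step Bp false ⟨c :: K, s⟩ with _ | ⟨K', s'⟩
      · rw [hs, runFalse_none] at h; simp at h
      · rw [hs] at h
        obtain ⟨X', v1, q, hq, g1, g2, g3, g4, g5⟩ := sim_step hB hs hX hK hS h1 (by omega)
        obtain ⟨v2, q', n, hn', hn, hq', i1, i2, i3⟩ := ih h g1 g2 g3 (by omega)
        exact ⟨v2, q + q', n + 1, by rw [ht', hs, hn'], by omega, by omega, i1, by omega, g5.trans i3⟩

/-- A matrix multiplication program with running time `μ`. -/
structure MMProg where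
  p : Cmd
  c : ℕ
  ρ : ℕ
  μ : ℕ → ℕ
  hρ : p.inRange ρ
  two_le : 2 ≤ ρ
  spec : ∀ N : ℕ, 1 ≤ N → ∀ A A₂ : Matrix (Fin N) (Fin N) ℕ, (∀ i j, A i j ≤ N) → (∀ i j, A₂ i j ≤ N) →
      failureProb ((N + 2) ^ c) (μ N) p (matrixInput A A₂) (HoldsMatrix (A * A₂)) = 0

/-- The registers and arrays of the subroutine are zero. -/
def MMZero (v : St) : Prop := (∀ b i, v.a (20, b) i = 0) ∧ ∀ r, v.r (21, r) = 0

/-- The state after a run of the subroutine on `N × N` matrices: nonzero cells are logged. -/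
structure MMDirty (ρ N : ℕ) (v : St) : Prop where
  reg : ∀ r, ρ ≤ r → v.r (21, r) = 0
  mem : ∀ b i, ρ ≤ b → v.a (20, b) i = 0
  log : ∀ b i, v.a (20, b) i ≠ 0 → (b ≤ 1 ∧ i < N * N) ∨ ∃ l ≤ v.r vTick, v.a (23, b) l = i

/-- Run the subroutine on matrices whose size is the value of `x`. -/
def mmCore (p : Cmd) (x : Var) : Cmd := .seq (SL.seq (.asg (21, 0) (.v x)) (.asg vTick 0)).cmd (ins p)

def MMProg.ticks (M : MMProg) {N : ℕ} (A A₂ : Matrix (Fin N) (Fin N) ℕ) : ℕ := haltTime ((N + 2) ^ M.c) (some ⟨[M.p], matrixInput A A₂⟩)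

theorem MMProg.ticks_le (M : MMProg) {N : ℕ} (hN : 1 ≤ N) (A A₂ : Matrix (Fin N) (Fin N) ℕ)
    (hA : ∀ i j, A i j ≤ N) (hA₂ : ∀ i j, A₂ i j ≤ N) : M.ticks A A₂ ≤ M.μ N := by
  obtain ⟨f, hf, -⟩ := runFalse_of_failFrom _ _ (M.spec N hN A A₂ hA hA₂)
  exact Nat.sInf_le ⟨f, hf⟩

theorem mmCore_tri (M : MMProg) (hS : 10 ≤ P.S) {N : ℕ} (hN : 1 ≤ N)
    (A A₂ : Matrix (Fin N) (Fin N) ℕ) (hA : ∀ i j, A i j ≤ N) (hA₂ : ∀ i j, A₂ i j ≤ N)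
    (hW : (N + 2) ^ M.c ≤ P.W) (hμ : M.μ N ≤ P.W) {x : Var} (hx : v.r x = N)
    (hone : v.r vOne = 1) (hz : ∀ r, v.r (21, r) = 0) (h0 : v.a (20, 0) = flatten A)
    (h1 : v.a (20, 1) = flatten A₂) (h2 : ∀ b i, 2 ≤ b → v.a (20, b) i = 0) :
    Tri P (mmCore M.p x) v (5 * M.ticks A A₂ + 20) 0 fun v' => v'.r vTick = M.ticks A A₂ ∧
      Fr (fun x => x.1 = 21 ∨ x = vTick) (fun b => b.1 = 20 ∨ b.1 = 23) v v' ∧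
      (∀ i j : Fin N, v'.a (20, 2) (i * N + j) = (A * A₂) i j) ∧ MMDirty M.ρ N v' := by
  obtain ⟨f, hf, hG⟩ := runFalse_of_failFrom _ _ (M.spec N hN A A₂ hA hA₂)
  set p := SL.seq (.asg (21, 0) (.v x)) (.asg vTick 0) with hp
  set v1 := p.exec v with hv1
  have hF1 : Fr (fun x => x.1 = 21 ∨ x = vTick) (fun b => b.1 = 20 ∨ b.1 = 23) v v1 :=
    ((Fr.refl _ _ v).set (x := (21, 0)) (by simp) _).set (x := vTick) (by simp) _
  have hone1 : v1.r vOne = 1 := by rw [hF1.r _ (by simp), hone]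
  have ht1 : v1.r vTick = 0 := by simp [hv1, hp, SL.exec]
  have hsim : Sim M.ρ (matrixInput A A₂) v1 (matrixInput A A₂) v1 := by
    refine ⟨fun r => ?_, fun b => ?_, .refl _ _ _, fun b c h => absurd rfl h, fun _ _ => rfl, fun _ _ => rfl⟩
    · by_cases hr : r = 0
      · subst hr; simp [hv1, hp, SL.exec, matrixInput, hx]
      · simp [hv1, hp, SL.exec, matrixInput, hr, hz]
    · rcases b with _ | _ | b
      · simp [hv1, hp, SL.exec, matrixInput, h0]
      · simp [hv1, hp, SL.exec, matrixInput, h1]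
      · funext i; simp [hv1, hp, SL.exec, matrixInput, h2]
  obtain ⟨v', q, n, hn', hn, hq, g1, g2, g3⟩ := sim_run hW hone1 (M.μ N) hf (.cons _ .nil) (by simpa using M.hρ) hsim (by omega)
  rw [show M.ticks A A₂ = n from hn'.symm]
  refine ((Tri.sl (P := P) (p := p) (v := v) (Q := fun w => w = v1) (by simp [hp, SL.size]; omega)
    (fun hv => by simp [hp, SL.ok]; exact hv.1 x) (fun _ => rfl)).seq (e' := 0) fun w _ hw => ?_).time (T := p.cost + q + 1) ?_
  · subst hw
    refine Tri.of_reach (v' := v') ⟨?_, ?_, ?_, ?_⟩ fun s hs => ?_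
    · rw [g2, ht1, zero_add]
    · exact hF1.trans g1.fr
    · rw [g1.mem]; exact hG
    · have hr := M.two_le
      refine ⟨fun r hr' => ?_, fun b i hb => ?_, fun b i hb => ?_⟩
      · rw [g1.reg, g1.reg_eq r hr']
        simp [matrixInput]; omega
      · rw [g1.mem, g1.mem_eq b hb]
        simp only [matrixInput]; rw [if_neg (by omega), if_neg (by omega)]
      · by_cases h : f.mem b i = (matrixInput A A₂).mem b i
        · left
          rw [g1.mem, h] at hb
          simp only [matrixInput] at hb
          split_ifs at hb with h3 h4
          iterate 2 exact ⟨by omega, by by_contra hn; exact hb (by simp [flatten, hn])⟩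
          exact absurd rfl hb
        · exact Or.inr (g1.log b i h)
    · obtain ⟨s', hs', hr⟩ := g3 s hs
      exact ⟨s', hs', fun K => hr K⟩
  · have : p.cost = 7 := rfl
    omega

theorem SL.list_size {l : List SL} (h : ∀ p ∈ l, p.size ≤ n) : (SL.list l).size ≤ n := by
  induction l with
  | nil => exact Nat.zero_le _
  | cons p l ih =>
    simp only [list, size, sup_le_iff]; exact ⟨h p List.mem_cons_self, ih fun q hq => h q (List.mem_cons_of_mem _ hq)⟩

/-- Zero the cells that are logged at position `tm 5`. -/
def unlog (l : List ℕ) : SL := SL.list (l.map fun b => .sto (20, b) (.ld (23, b) (.v (tm 5))) 0)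

theorem unlog_size (l : List ℕ) : (unlog l).size ≤ 2 := by
  refine SL.list_size fun p hp => ?_
  obtain ⟨b, _, rfl⟩ := mem_map.1 hp
  simp [SL.size]

theorem unlog_ok (W : ℕ) (l : List ℕ) : ∀ v : St, (unlog l).ok W v := by
  induction l with
  | nil => exact fun _ => trivial
  | cons b l ih => exact fun v => ⟨by simp [SL.ok], ih _⟩

theorem unlog_exec (l : List ℕ) : ∀ v : St, ((unlog l).exec v).r = v.r ∧ (∀ b, b.1 ≠ 20 → ((unlog l).exec v).a b = v.a b) ∧
    ∀ b i, ((unlog l).exec v).a (20, b) i = if b ∈ l ∧ i = v.a (23, b) (v.r (tm 5)) then 0 else v.a (20, b) i := by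
  induction l with
  | nil => exact fun v => ⟨rfl, fun _ _ => rfl, fun b i => by simp [unlog, SL.list, SL.exec]⟩
  | cons c l ih =>
    intro v
    have e : (unlog (c :: l)).exec v = (unlog l).exec (v.put (20, c) (v.a (23, c) (v.r (tm 5))) 0) := rfl
    obtain ⟨h1, h2, h3⟩ := ih (v.put (20, c) (v.a (23, c) (v.r (tm 5))) 0)
    rw [e]
    refine ⟨by rw [h1]; rfl, fun b hb => ?_, fun b i => ?_⟩
    · rw [h2 b hb, St.put_a_ne _ _ _ _ _ fun h => hb (by rw [h])]
    · rw [h3, St.put_a_ne _ _ _ _ _ (by simp), St.put_a]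
      simp only [St.put_r, mem_cons, Prod.mk.injEq, true_and]
      split_ifs <;> simp_all

def zeroRegs (l : List ℕ) : SL := SL.list (l.map fun r => .asg (21, r) 0)

theorem zeroRegs_size (l : List ℕ) : (zeroRegs l).size ≤ 1 := by
  refine SL.list_size fun p hp => ?_
  obtain ⟨b, _, rfl⟩ := mem_map.1 hp
  simp [SL.size]

theorem zeroRegs_ok (W : ℕ) (l : List ℕ) : ∀ v : St, (zeroRegs l).ok W v := by
  induction l with
  | nil => exact fun _ => trivial
  | cons b l ih => exact fun v => ⟨by simp [SL.ok], ih _⟩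

theorem zeroRegs_exec (l : List ℕ) : ∀ v : St, ((zeroRegs l).exec v).a = v.a ∧ (∀ x, x.1 ≠ 21 → ((zeroRegs l).exec v).r x = v.r x) ∧
    ∀ r, ((zeroRegs l).exec v).r (21, r) = if r ∈ l then 0 else v.r (21, r) := by
  induction l with
  | nil => exact fun v => ⟨rfl, fun _ _ => rfl, fun b => by simp [zeroRegs, SL.list, SL.exec]⟩
  | cons c l ih =>
    intro v
    have e : (zeroRegs (c :: l)).exec v = (zeroRegs l).exec (v.set (21, c) 0) := rfl
    obtain ⟨h1, h2, h3⟩ := ih (v.set (21, c) 0)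
    rw [e]
    refine ⟨by rw [h1]; rfl, fun b hb => ?_, fun b => ?_⟩
    · rw [h2 b hb, St.set_r, if_neg fun h => hb (by rw [h])]
    · rw [h3, St.set_r]
      simp only [mem_cons, Prod.mk.injEq, true_and]
      split_ifs <;> simp_all

def mmClean (ρ : ℕ) (x : Var) : Cmd := .seq (forE (tm 5) (.v x * .v x)
      (SL.seq (.sto (20, 0) (.v (tm 5)) 0) (.sto (20, 1) (.v (tm 5)) 0)).cmd)
    (.seq (forE (tm 5) (.v vTick + 1) (unlog (List.range ρ)).cmd) (zeroRegs (List.range ρ)).cmd)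

theorem mmClean_tri (ρ : ℕ) : ∃ C, ∀ {P : Par} (_ : 10 ≤ P.S) {N n : ℕ} {v : St} {x : Var},
    x ≠ tm 5 → v.r x = N → v.r vTick = n → N * N ≤ P.W → n + 1 ≤ P.W →
    MMDirty ρ N v → Tri P (mmClean ρ x) v (C * (N * N + n + 1)) 0 fun v' =>
      MMZero v' ∧ Fr (fun x => x.1 = 21 ∨ x = tm 5) (fun b => b.1 = 20) v v' := by
  refine ⟨(unlog (List.range ρ)).cost + (zeroRegs (List.range ρ)).cost + 200, ?_⟩
  intro P hS N n v x hx hxN hn hNW hnW hD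
  set X : Var → Prop := fun x => x = tm 5 with hX
  set Y : Var → Prop := fun b => b.1 = 20 with hY
  have t1 := Tri.forE (x := tm 5) (b := .v x * .v x) (v := v) (T := 15) (e := 0)
    (c := (SL.seq (.sto (20, 0) (.v (tm 5)) 0) (.sto (20, 1) (.v (tm 5)) 0)).cmd)
    (N * N) (fun i v' => v'.r (tm 5) = i ∧ Fr X Y v v' ∧ ∀ b c, v'.a (20, b) c ≠ 0 → v.a (20, b) c ≠ 0 ∧ ¬ (b ≤ 1 ∧ c < i)) (by simp; omega)
    ⟨by simp, (Fr.refl X Y v).set (x := tm 5) (by simp [hX]) _, fun b c h => ⟨by simpa using h, by simp⟩⟩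
    hNW (fun i v' h => h.1) (fun i v' h => by simp [h.2.1.r x (by simp [hX, hx]), hxN]) (by omega) ?_
  swap
  · rintro i v' hi ⟨g1, g2, g3⟩ -
    refine (Tri.sl (by simp [SL.size]; omega) (fun _ => by simp [SL.ok]) fun _ => ?_).time (T := SL.cost _) (by decide)
    refine ⟨by simp [SL.exec, g1], by simp, ?_, ?_⟩
    · exact ((g2.put (by simp [hY]) _ _).put (by simp [hY]) _ _).set (by simp [hX]) _
    · intro b c h
      simp only [SL.exec, St.set_a, St.put_a, Ex.eval_v, g1, St.put_r, Ex.eval_ofNat, Prod.mk.injEq, true_and] at h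
      have hb : v'.a (20, b) c ≠ 0 ∧ ¬ (b ≤ 1 ∧ c = i) := by
        split_ifs at h with h1 h2
        · exact absurd rfl h
        · exact absurd rfl h
        · refine ⟨h, ?_⟩
          rintro ⟨h3, rfl⟩
          have : b = 0 ∨ b = 1 := by omega
          rcases this with rfl | rfl <;> simp_all
      have := g3 b c hb.1
      refine ⟨this.1, fun h => ?_⟩
      rcases lt_succ_iff_lt_or_eq.1 h.2 with h' | h'
      · exact this.2 ⟨h.1, h'⟩
      · exact hb.2 ⟨h.1, h'⟩
  refine (t1.seq (e' := 0) (T' := (n + 1) * ((unlog (List.range ρ)).cost + 40) + 40 +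
    (zeroRegs (List.range ρ)).cost + 1) ?_).time (T := N * N * (15 + forCost (.v x * .v x)) +
      forCost (.v x * .v x) + ((n + 1) * ((unlog (List.range ρ)).cost + 40) + 40 +
    (zeroRegs (List.range ρ)).cost + 1) + 1) ?_
  swap
  · rw [show forCost (.v x * .v x) = 40 from rfl]
    generalize (unlog (List.range ρ)).cost = a
    generalize (zeroRegs (List.range ρ)).cost = b
    generalize N * N = c
    nlinarith [Nat.zero_le (a * c), Nat.zero_le (b * c), Nat.zero_le (b * n)]
  rintro v1 - ⟨-, f1, f2⟩
  have t2 := Tri.forE (x := tm 5) (b := .v vTick + 1) (v := v1) (T := (unlog (List.range ρ)).cost) (e := 0)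
    (c := (unlog (List.range ρ)).cmd)
    (n + 1) (fun i v' => v'.r (tm 5) = i ∧ Fr X Y v v' ∧
      ∀ b c, v'.a (20, b) c ≠ 0 → v1.a (20, b) c ≠ 0 ∧ ∀ i' < i, b < ρ → v.a (23, b) i' ≠ c)
    (by simp; omega)
    ⟨by simp, f1.set (x := tm 5) (by simp [hX]) _, fun b c h => ⟨by simpa using h, by simp⟩⟩
    hnW (fun i v' h => h.1) (fun i v' h => by simp [h.2.1.r vTick (by simp [hX]), hn]) (by omega) ?_
  swap
  · rintro i v' hi ⟨g1, g2, g3⟩ -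
    obtain ⟨e1, e2, e3⟩ := unlog_exec (List.range ρ) v'
    refine Tri.sl ((unlog_size _).trans (by omega)) (fun _ => unlog_ok _ _ _) fun _ => ?_
    refine ⟨by rw [e1, g1], by simp, ?_, ?_⟩
    · exact (g2.trans ⟨fun _ _ => by rw [e1], fun b hb => e2 b hb⟩).set (by simp [hX]) _
    · intro b c h
      rw [St.set_a, e3] at h
      split_ifs at h with h1
      · exact absurd rfl h
      · obtain ⟨h2, h3⟩ := g3 b c h
        refine ⟨h2, fun i' hi' hb => ?_⟩
        rcases lt_succ_iff_lt_or_eq.1 hi' with h' | h'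
        · exact h3 i' h' hb
        · subst h'
          intro hc
          refine h1 ⟨List.mem_range.2 hb, ?_⟩
          rw [g1, g2.a _ (by simp [hY]), hc]
  refine (t2.seq (e' := 0) (T' := (zeroRegs (List.range ρ)).cost) ?_).le ?_ (by simp)
  · rintro v2 - ⟨-, g2, g3⟩
    obtain ⟨e1, e2, e3⟩ := zeroRegs_exec (List.range ρ) v2
    refine Tri.sl ((zeroRegs_size _).trans (by omega)) (fun _ => zeroRegs_ok _ _ _) fun _ => ?_
    refine ⟨⟨fun b c => ?_, fun r => ?_⟩, (g2.mono (fun x hx => Or.inr hx) fun _ h => h).trans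
      ⟨fun y hy => e2 y fun h => hy (Or.inl h), fun b _ => by rw [e1]⟩⟩
    · rw [e1]
      by_contra hne
      obtain ⟨h1, h2⟩ := g3 b c hne
      obtain ⟨h3, h4⟩ := f2 b c h1
      have hb : b < ρ := by
        by_contra hb
        exact h3 (hD.mem b c (by omega))
      rcases hD.log b c h3 with h5 | ⟨l, hl, h5⟩
      · exact h4 h5
      · exact h2 l (by omega) hb h5
    · rw [e3]
      split_ifs with h
      · rfl
      · rw [List.mem_range] at h
        rw [g2.r _ (by simp [hX]), hD.reg r (by omega)]
  · rw [show forCost (.v vTick + 1) = 40 from rfl]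

/-! ### Emitting a clique -/

abbrev vC : Var := (0, 0)
abbrev vn : Var := (1, 0)
/-- The vertices of the current candidate. -/
abbrev vV (i : ℕ) : Var := (2, i)
abbrev bA : Var := (0, 0)
abbrev bOut : Var := (0, 1)
/-- Marks at the codes of the tuples whose clique has been output. -/
abbrev bMark : Var := (1, 1)

/-- The value of the digits `f 0, …, f (k - 1)` in base `n`. -/
def hcode (n : ℕ) (f : ℕ → ℕ) : ℕ → ℕ
  | 0 => 0
  | i + 1 => hcode n f i * n + f i

theorem hcode_lt {f : ℕ → ℕ} (hf : ∀ i < k, f i < n) : hcode n f k < n ^ k := by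
  induction k with
  | zero => simp [hcode]
  | succ k ih =>
    have h1 := ih fun i hi => hf i (by omega)
    have h2 := hf k (Nat.lt_succ_self k)
    rw [hcode, pow_succ]; nlinarith

theorem hcode_inj {f g : ℕ → ℕ} (hf : ∀ i < k, f i < n) (hg : ∀ i < k, g i < n) (h : hcode n f k = hcode n g k) : ∀ i < k, f i = g i := by
  induction k with
  | zero => exact fun i hi => absurd hi (Nat.not_lt_zero i)
  | succ k ih =>
    have h1 := hf k (Nat.lt_succ_self k)
    have h2 := hg k (Nat.lt_succ_self k)
    simp only [hcode] at h
    have h3 : f k = g k := by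
      have := congrArg (· % n) h
      simpa [Nat.add_mod, Nat.mod_eq_of_lt h1, Nat.mod_eq_of_lt h2] using this
    have h4 : hcode n f k = hcode n g k := by
      rw [h3] at h; exact Nat.eq_of_mul_eq_mul_right (by omega) (Nat.add_right_cancel h)
    intro i hi
    rcases lt_succ_iff_lt_or_eq.1 hi with hi | rfl
    · exact ih (fun i hi => hf i (by omega)) (fun i hi => hg i (by omega)) h4 i hi
    · exact h3

theorem hcode_congr {f g : ℕ → ℕ} (h : ∀ i < k, f i = g i) : hcode n f k = hcode n g k := by
  induction k with
  | zero => rfl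
  | succ k ih => rw [hcode, hcode, ih fun i hi => h i (by omega), h k (Nat.lt_succ_self k)]

section Emit
variable (n k : ℕ) (A : ℕ → ℕ → Prop)

structure IsClq (S : Finset ℕ) : Prop where
  card : S.card = k
  lt : ∀ a ∈ S, a < n
  adj : ∀ a ∈ S, ∀ b ∈ S, a ≠ b → A a b

def outs (v : St) : List (Finset ℕ) := (List.range (v.r vC)).map fun i => (range k).image fun j => v.a bOut (k * i + j)

open Classical in
/-- The global data of the algorithm: the graph is stored, all outputs are cliques, without
repetition, and they are marked. -/
structure Env (v : St) : Prop where
  n_eq : v.r vn = n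
  one : v.r vOne = 1
  adj : ∀ a < n, ∀ b < n, v.a bA (a * n + b) = if A a b then 1 else 0
  nodup : (outs k v).Nodup
  sound : ∀ S ∈ outs k v, IsClq n k A S
  mark : ∀ f : ℕ → ℕ, (∀ i < k, f i < n) → Set.InjOn f (range k) → (v.a bMark (hcode n f k) ≠ 0 ↔ (range k).image f ∈ outs k v)

variable {n k A}

theorem outs_congr (hC : v'.r vC = v.r vC) (ho : v'.a bOut = v.a bOut) : outs k v' = outs k v := by simp only [outs, hC, ho]

theorem Env.congr (h : Env n k A v) (hn : v'.r vn = v.r vn) (h1 : v'.r vOne = v.r vOne)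
    (hC : v'.r vC = v.r vC) (hA : v'.a bA = v.a bA) (ho : v'.a bOut = v.a bOut)
    (hm : v'.a bMark = v.a bMark) : Env n k A v' := by
  refine ⟨hn.trans h.n_eq, h1.trans h.one, by rw [hA]; exact h.adj, ?_, ?_, ?_⟩
  · rw [outs_congr hC ho]; exact h.nodup
  · rw [outs_congr hC ho]; exact h.sound
  · rw [outs_congr hC ho, hm]; exact h.mark

theorem Env.count_le (h : Env n k A v) : v.r vC ≤ n ^ k := by
  have h1 : (outs k v).toFinset.card = v.r vC := by rw [List.toFinset_card_of_nodup h.nodup]; simp [outs]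
  have h2 : (outs k v).toFinset ⊆ (range n).powersetCard k := fun S hS => by
    have := h.sound S (List.mem_toFinset.1 hS)
    exact Finset.mem_powersetCard.2 ⟨fun a ha => mem_range.2 (this.lt a ha), this.card⟩
  have h3 := card_le_card h2
  rw [h1, Finset.card_powersetCard, card_range] at h3
  exact h3.trans (Nat.choose_le_pow n k)

def adjL (l : List (ℕ × ℕ)) : SL := SL.list (l.map fun p => .asg (tm 10) (.v (tm 10) * .ld bA (.v (vV p.1) * .v vn + .v (vV p.2))))

def adjAll (l : List (ℕ × ℕ)) : SL := .seq (.asg (tm 10) 1) (adjL l)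

theorem adjAll_size (l : List (ℕ × ℕ)) : (adjAll l).size ≤ 5 := by
  have : (adjL l).size ≤ 5 := SL.list_size fun p hp => by
    obtain ⟨b, _, rfl⟩ := mem_map.1 hp
    simp [SL.size]
  simp only [adjAll, SL.size, sup_le_iff]
  exact ⟨by simp, this⟩

open Classical in
theorem adjAll_exec (l : List (ℕ × ℕ)) (hn : v.r vn = n) (hA : ∀ a < n, ∀ b < n, v.a bA (a * n + b) = if A a b then 1 else 0)
    (hl : ∀ p ∈ l, v.r (vV p.1) < n ∧ v.r (vV p.2) < n) :
    Fr (· = tm 10) (fun _ => False) v ((adjAll l).exec v) ∧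
    ((adjAll l).exec v).r (tm 10) = (if ∀ p ∈ l, A (v.r (vV p.1)) (v.r (vV p.2)) then 1 else 0) ∧
    ∀ W, 1 ≤ W → (adjAll l).ok W v := by
  have key : ∀ (l : List (ℕ × ℕ)) (w : St), Fr (· = tm 10) (fun _ => False) v w →
      (∀ p ∈ l, v.r (vV p.1) < n ∧ v.r (vV p.2) < n) → w.r (tm 10) ≤ 1 →
      Fr (· = tm 10) (fun _ => False) v ((adjL l).exec w) ∧ ((adjL l).exec w).r (tm 10) = (if ∀ p ∈ l, A (v.r (vV p.1)) (v.r (vV p.2)) then w.r (tm 10) else 0) ∧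
      ∀ W, 1 ≤ W → (adjL l).ok W w := by
    intro l
    induction l with
    | nil => intro w hw _ _; exact ⟨hw, by simp [adjL, SL.list, SL.exec], fun _ _ => trivial⟩
    | cons q l ih =>
      intro w hw hq hw1
      have h1 : (Ex.v (tm 10) * .ld bA (.v (vV q.1) * .v vn + .v (vV q.2))).eval w =
          if A (v.r (vV q.1)) (v.r (vV q.2)) then w.r (tm 10) else 0 := by
        have := hq q List.mem_cons_self
        simp only [Ex.eval_mul, Ex.eval_v, Ex.eval_ld, Ex.eval_add]
        rw [hw.r vn (by simp), hw.r (vV q.1) (by simp), hw.r (vV q.2) (by simp), hw.a bA (by simp), hn, hA _ this.1 _ this.2]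
        split_ifs <;> simp
      obtain ⟨g1, g2, g3⟩ := ih (w.set (tm 10) (if A (v.r (vV q.1)) (v.r (vV q.2)) then w.r (tm 10) else 0))
        (hw.set rfl _) (fun p hp => hq p (List.mem_cons_of_mem _ hp)) (by rw [St.set_r, if_pos rfl]; split_ifs <;> omega)
      simp only [adjL, map_cons, SL.list, SL.exec, SL.ok, h1] at *
      refine ⟨g1, ?_, fun W hW => ⟨?_, g3 W hW⟩⟩
      · rw [g2]
        simp only [St.set_r, if_true, List.forall_mem_cons]
        by_cases h : A (v.r (vV q.1)) (v.r (vV q.2)) <;> simp [h]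
      · split_ifs <;> omega
  have := key l (v.set (tm 10) 1) ((Fr.refl (· = tm 10) (fun _ => False) v).set (x := tm 10) rfl _) hl (by simp)
  exact ⟨this.1, this.2.1.trans (by simp), fun W hW => ⟨by simpa [SL.ok] using hW, this.2.2 W hW⟩⟩

/-- Compute the code of the tuple `V (g 0), V (g 1), …` of length `k` into `tm 11`. -/
def codeSL (g : ℕ → ℕ) (k : ℕ) : SL := .seq (.asg (tm 11) 0) (SL.list ((List.range k).map fun i =>
    .asg (tm 11) (.v (tm 11) * .v vn + .v (vV (g i)))))

theorem SL.list_append_exec (l l' : List SL) : ∀ v, (SL.list (l ++ l')).exec v = (SL.list l').exec ((SL.list l).exec v) := by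
  induction l with
  | nil => exact fun v => rfl
  | cons p l ih => exact fun v => ih _

theorem SL.list_append_ok (W : ℕ) (l l' : List SL) : ∀ v, (SL.list (l ++ l')).ok W v ↔
    (SL.list l).ok W v ∧ (SL.list l').ok W ((SL.list l).exec v) := by
  induction l with
  | nil => exact fun v => by simp [SL.list, SL.ok, SL.exec]
  | cons p l ih => exact fun v => by simp [SL.list, SL.ok, SL.exec, ih, and_assoc]

theorem codeSL_size (g : ℕ → ℕ) (k : ℕ) : (codeSL g k).size ≤ 3 := by
  simp only [codeSL, SL.size, sup_le_iff]
  exact ⟨by simp, SL.list_size fun p hp => by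
    obtain ⟨b, _, rfl⟩ := mem_map.1 hp
    simp [SL.size]⟩

theorem codeSL_exec (g : ℕ → ℕ) (k : ℕ) (hn : v.r vn = n) (hV : ∀ i < k, v.r (vV (g i)) < n) :
    Fr (· = tm 11) (fun _ => False) v ((codeSL g k).exec v) ∧
    ((codeSL g k).exec v).r (tm 11) = hcode n (fun i => v.r (vV (g i))) k ∧
    ∀ W, n ^ k ≤ W → (codeSL g k).ok W v := by
  induction k with
  | zero =>
    exact ⟨(Fr.refl (· = tm 11) (fun _ => False) v).set (x := tm 11) rfl _, by simp [codeSL, SL.exec, SL.list, hcode], fun W hW => by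
      simp [codeSL, SL.ok, SL.list]⟩
  | succ k ih =>
    obtain ⟨h1, h2, h3⟩ := ih fun i hi => hV i (by omega)
    set w := (codeSL g k).exec v with hw
    have e : (codeSL g (k + 1)).exec v = w.set (tm 11) (w.r (tm 11) * w.r vn + w.r (vV (g k))) := by
      simp only [codeSL, range_succ, map_append, SL.exec, SL.list_append_exec] at hw ⊢; rw [← hw]; rfl
    have e2 : w.r (tm 11) * w.r vn + w.r (vV (g k)) = hcode n (fun i => v.r (vV (g i))) (k + 1) := by
      rw [h2, h1.r vn (by simp), h1.r (vV (g k)) (by simp), hn]; rfl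
    rw [e, e2]
    refine ⟨h1.set rfl _, by simp, fun W hW => ?_⟩
    have h4 := hcode_lt (n := n) (f := fun i => v.r (vV (g i))) hV
    have h5 : n ^ k ≤ W := by
      rcases Nat.eq_zero_or_pos n with rfl | hn0
      · exact absurd (hV k (Nat.lt_succ_self k)) (Nat.not_lt_zero _)
      · exact (Nat.pow_le_pow_right hn0 (Nat.le_succ k)).trans hW
    have h6 := h3 W h5
    simp only [codeSL, range_succ, map_append, SL.ok, SL.list_append_ok] at h6 ⊢
    exact ⟨h6.1, h6.2, show (Ex.v (tm 11) * .v vn + .v (vV (g k))).eval w ≤ W by simp only [Ex.eval_add, Ex.eval_mul, Ex.eval_v, e2]; omega, trivial⟩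

def writeOut (k j : ℕ) : SL := SL.list ((List.range j).map fun i => .sto bOut (.c k * .v vC + .c i) (.v (vV i)))

theorem writeOut_exec (k j : ℕ) (v : St) : let w := (writeOut k j).exec v
    Fr (fun _ => False) (· = bOut) v w ∧ (∀ i < j, w.a bOut (k * v.r vC + i) = v.r (vV i)) ∧
    ∀ l < k * v.r vC, w.a bOut l = v.a bOut l := by
  induction j with
  | zero => exact ⟨.refl _ _ _, by simp, fun _ _ => rfl⟩
  | succ j ih =>
    obtain ⟨h1, h2, h3⟩ := ih
    simp only [writeOut, range_succ, map_append, SL.list_append_exec]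
    rw [← writeOut]
    set w := (writeOut k j).exec v
    simp only [map_cons, List.map_nil, SL.list, SL.exec, Ex.eval_add, Ex.eval_mul, Ex.eval_c, Ex.eval_v, h1.r _ not_false]
    refine ⟨h1.put rfl _ _, fun i hi => ?_, fun l hl => ?_⟩
    · rw [St.put_a]
      split_ifs with h
      · rw [show i = j by omega]
      · exact h2 i (by simp at h; omega)
    · rw [St.put_a, if_neg (by omega), h3 l hl]

theorem writeOut_ok (j : ℕ) (hV : ∀ i < j, v.r (vV i) ≤ W) : (writeOut k j).ok W v := by
  induction j with
  | zero => trivial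
  | succ j ih =>
    simp only [writeOut, range_succ, map_append, SL.list_append_ok]
    refine ⟨ih fun i hi => hV i (by omega), ?_⟩
    simp only [map_cons, List.map_nil, SL.list, SL.ok, Ex.eval_v, and_true]; erw [(writeOut_exec k j v).1.r _ not_false]
    exact hV j (Nat.lt_succ_self j)

/-- Mark the codes of some rearrangements of the candidate. -/
def marks (k : ℕ) (l : List (ℕ → ℕ)) : SL := SL.list (l.map fun g => .seq (codeSL g k) (.sto bMark (.v (tm 11)) 1))

theorem marks_exec (k : ℕ) (l : List (ℕ → ℕ)) : ∀ {v : St}, v.r vn = n → (∀ g ∈ l, ∀ i < k, v.r (vV (g i)) < n) →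
    Fr (· = tm 11) (· = bMark) v ((marks k l).exec v) ∧
    (∀ c, ((marks k l).exec v).a bMark c = if ∃ g ∈ l, c = hcode n (fun i => v.r (vV (g i))) k then 1 else v.a bMark c) ∧
    ∀ W, n ^ k ≤ W → 1 ≤ W → (marks k l).ok W v := by
  induction l with
  | nil => exact fun _ _ => ⟨.refl _ _ _, by simp [marks, SL.list, SL.exec], fun _ _ _ => trivial⟩
  | cons g l ih =>
    intro v hn hV
    obtain ⟨h1, h2, h3⟩ := codeSL_exec g k hn (hV g List.mem_cons_self)
    set w := (codeSL g k).exec v with hw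
    set w' := w.put bMark (w.r (tm 11)) 1 with hw'
    have e : (marks k (g :: l)).exec v = (marks k l).exec w' := rfl
    have hF : Fr (· = tm 11) (· = bMark) v w' := 
      Fr.put (Y := (· = bMark)) (h1.mono (fun _ h => h) (fun _ h => h.elim)) (b := bMark) rfl _ _
    have hg : ∀ i, w'.r (vV i) = v.r (vV i) := fun i => hF.r _ (by simp)
    obtain ⟨g1, g2, g3⟩ := ih (v := w') (by rw [hF.r vn (by simp), hn]) (fun g' hg' i hi => by
      rw [hg]; exact hV g' (List.mem_cons_of_mem _ hg') i hi)
    rw [e]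
    refine ⟨hF.trans g1, fun c => ?_, fun W hW h1W => ⟨⟨h3 W hW, by simpa [SL.ok] using h1W⟩, g3 W hW h1W⟩⟩
    rw [g2]
    have hp : w'.a bMark c = if c = hcode n (fun i => v.r (vV (g i))) k then 1 else v.a bMark c := by
      simp only [hw', St.put_a, h2, h1.a _ not_false, true_and]
    simp only [hg, mem_cons, exists_eq_or_imp, hp]
    split_ifs <;> first | rfl | grind

/-- The permutations of `{0, …, k - 1}` as functions on the natural numbers. -/
def permFuns (k : ℕ) : List (ℕ → ℕ) := (univ : Finset (Equiv.Perm (Fin k))).toList.map fun σ i => if h : i < k then (σ ⟨i, h⟩ : ℕ) else 0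

theorem permFuns_lt {g : ℕ → ℕ} (hg : g ∈ permFuns k) : ∀ i < k, g i < k := by
  obtain ⟨σ, -, rfl⟩ := mem_map.1 hg
  intro i hi
  simp [hi]

theorem image_eq_iff_permFuns {f V : ℕ → ℕ} (hf : Set.InjOn f (range k)) (hV : Set.InjOn V (range k)) :
    (range k).image f = (range k).image V ↔ ∃ g ∈ permFuns k, ∀ i < k, f i = V (g i) := by
  constructor
  · intro h
    have h1 : ∀ i : Fin k, ∃ j : Fin k, V j = f i := fun i => by
      have : f i ∈ (range k).image V := h ▸ Finset.mem_image_of_mem _ (by simp)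
      obtain ⟨j, hj, hj'⟩ := mem_image.1 this
      exact ⟨⟨j, mem_range.1 hj⟩, hj'⟩
    choose s hs using h1
    have hinj : Function.Injective s := fun i j hij => by
      have : f i = f j := by rw [← hs i, ← hs j, hij]
      exact Fin.ext (hf (by simp) (by simp) this)
    refine ⟨_, mem_map.2 ⟨Equiv.ofBijective s (Finite.injective_iff_bijective.1 hinj), by simp, rfl⟩, fun i hi => ?_⟩
    simp [hi, hs]
  · rintro ⟨g, hg, h⟩
    obtain ⟨σ, -, rfl⟩ := mem_map.1 hg
    ext a; simp only [mem_image, mem_range]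
    constructor
    · rintro ⟨i, hi, rfl⟩
      exact ⟨_, permFuns_lt hg i hi, (h i hi).symm⟩
    · rintro ⟨j, hj, rfl⟩
      refine ⟨σ.symm ⟨j, hj⟩, (σ.symm ⟨j, hj⟩).2, ?_⟩
      rw [h _ (σ.symm ⟨j, hj⟩).2]; simp

def pairs (k : ℕ) : List (ℕ × ℕ) := (List.range k).flatMap fun j => (List.range j).map fun i => (i, j)

theorem mem_pairs {p : ℕ × ℕ} : p ∈ pairs k ↔ p.1 < p.2 ∧ p.2 < k := by
  rcases p with ⟨i, j⟩
  simp only [pairs, List.mem_flatMap, List.mem_range, mem_map, Prod.mk.injEq]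
  constructor
  · rintro ⟨j, hj, i, hi, rfl, rfl⟩; exact ⟨hi, hj⟩
  · rintro ⟨h, h'⟩; exact ⟨j, h', i, h, rfl, rfl⟩

/-- Output the candidate if it is a clique that has not been output before. -/
def emit (k : ℕ) : SL := .seq (adjAll (pairs k)) (.ite (.v (tm 10)) (.seq (codeSL id k) (.ite (.ld bMark (.v (tm 11))) .skip
      (.seq (writeOut k k) (.seq (.asg vC (.v vC + 1)) (marks k (permFuns k)))))) .skip)

theorem writeOut_size (k : ℕ) : (writeOut k k).size ≤ 2 * k + 3 := SL.list_size fun p hp => by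
    obtain ⟨b, hb, rfl⟩ := mem_map.1 hp
    have := List.mem_range.1 hb
    simp [SL.size]; omega

theorem marks_size (k : ℕ) (l : List (ℕ → ℕ)) : (marks k l).size ≤ 3 := SL.list_size fun p hp => by
    obtain ⟨b, hb, rfl⟩ := mem_map.1 hp
    have := codeSL_size b k
    simp [SL.size]; omega

theorem emit_size (k : ℕ) : (emit k).size ≤ 2 * k + 5 := by
  have h1 := adjAll_size (pairs k)
  have h2 := codeSL_size id k
  have h3 := writeOut_size k
  have h4 := marks_size k (permFuns k)
  simp only [emit, SL.size, Ex.size_v, Ex.size_ld, Ex.size_add, Ex.size_ofNat, sup_le_iff]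
  omega

def EmX (x : Var) : Prop := x = tm 10 ∨ x = tm 11 ∨ x = vC
def EmY (b : Var) : Prop := b = bOut ∨ b = bMark

theorem Env.output {G : SimpleGraph ℕ} (h : Env n k G.Adj v) {V : ℕ → ℕ} (hV : ∀ i < k, v.r (vV i) = V i) (hVn : ∀ i < k, V i < n)
    (hA : ∀ j < k, ∀ i < j, G.Adj (V i) (V j)) (hm : v.a bMark (hcode n V k) = 0) :
    let w := (SL.seq (writeOut k k) (.seq (.asg vC (.v vC + 1)) (marks k (permFuns k)))).exec v
    Env n k G.Adj w ∧ Fr EmX EmY v w ∧ outs k v ⊆ outs k w ∧ (range k).image V ∈ outs k w := by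
  intro w
  have hinj : Set.InjOn V (range k) := by
    intro i hi j hj hij; simp only [coe_range, Set.mem_Iio] at hi hj
    rcases lt_trichotomy i j with h' | h' | h'
    · exact absurd hij (hA j hj i h').ne
    · exact h'
    · exact absurd hij.symm (hA i hi j h').ne
  have hnew : (range k).image V ∉ outs k v := by rw [← h.mark V hVn hinj]; simpa using hm
  obtain ⟨a1, a2, a3⟩ := writeOut_exec k k v
  set v1 := (writeOut k k).exec v with hv1
  set v2 := v1.set vC (v1.r vC + 1) with hv2
  have hw : w = (marks k (permFuns k)).exec v2 := rfl
  have f2 : Fr EmX EmY v v2 := (a1.mono (fun _ h => h.elim) (fun _ h => Or.inl h)).set (x := vC) (Or.inr (Or.inr rfl)) _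
  have r2 : ∀ x, x ≠ vC → v2.r x = v.r x := fun x hx => by rw [hv2, St.set_r, if_neg hx, a1.r x not_false]
  have hVr : ∀ i, v2.r (vV i) = v.r (vV i) := fun i => r2 _ (by simp)
  obtain ⟨b1, b2, -⟩ := marks_exec (n := n) k (permFuns k) (v := v2) (by rw [r2 _ (by simp), h.n_eq]) (fun g hg i hi => by
      rw [hVr, hV _ (permFuns_lt hg i hi)]; exact hVn _ (permFuns_lt hg i hi))
  rw [← hw] at b1 b2
  have fw : Fr EmX EmY v w := f2.trans (b1.mono (fun _ h => Or.inr (Or.inl h)) (fun _ h => Or.inr h))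
  have hC : w.r vC = v.r vC + 1 := by rw [b1.r vC (by simp), hv2, St.set_r, if_pos rfl, a1.r vC not_false]
  have hO : w.a bOut = v1.a bOut := by rw [b1.a bOut (by simp)]; rfl
  have houts : outs k w = outs k v ++ [(range k).image V] := by
    simp only [outs, hC, hO, range_succ, map_append, map_cons, List.map_nil]; congr 1
    · refine List.map_congr_left fun i hi => image_congr fun j hj => a3 _ ?_
      have := List.mem_range.1 hi
      simp only [coe_range, Set.mem_Iio] at hj
      calc k * i + j < k * (i + 1) := by rw [mul_add]; omega
        _ ≤ _ := Nat.mul_le_mul_left _ this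
    · congr 1
      refine image_congr fun j hj => ?_
      simp only [coe_range, Set.mem_Iio] at hj; simp only [a2 j hj, hV j hj]
  have hclq : IsClq n k G.Adj ((range k).image V) := by
    refine ⟨by rw [Finset.card_image_of_injOn hinj, card_range], ?_, ?_⟩
    · intro a ha
      obtain ⟨i, hi, rfl⟩ := mem_image.1 ha
      exact hVn i (mem_range.1 hi)
    · intro a ha b hb hab
      obtain ⟨i, hi, rfl⟩ := mem_image.1 ha
      obtain ⟨j, hj, rfl⟩ := mem_image.1 hb
      rcases lt_trichotomy i j with h' | h' | h'
      · exact hA j (mem_range.1 hj) i h'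
      · exact absurd (by rw [h']) hab
      · exact (hA i (mem_range.1 hi) j h').symm
  refine ⟨⟨?_, ?_, ?_, ?_, ?_, ?_⟩, fw, by rw [houts]; simp, by rw [houts]; simp⟩
  · rw [fw.r _ (by simp [EmX]), h.n_eq]
  · rw [fw.r _ (by simp [EmX]), h.one]
  · rw [fw.a _ (by simp [EmY])]; exact h.adj
  · rw [houts]
    exact List.nodup_append.2 ⟨h.nodup, List.nodup_singleton _, fun a ha b hb hab =>
      hnew (by rw [List.mem_singleton] at hb; rwa [← hb, ← hab])⟩
  · intro S hS
    rw [houts, List.mem_append, List.mem_singleton] at hS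
    rcases hS with hS | rfl
    · exact h.sound S hS
    · exact hclq
  · intro f hf hfi
    rw [b2, houts, List.mem_append, List.mem_singleton, image_eq_iff_permFuns hfi hinj,
      show v2.a bMark = v.a bMark by rw [hv2, St.set_a, a1.a bMark (by simp)]]
    have e : (∃ g ∈ permFuns k, hcode n f k = hcode n (fun i => v2.r (vV (g i))) k) ↔ ∃ g ∈ permFuns k, ∀ i < k, f i = V (g i) := by
      refine exists_congr fun g => and_congr_right fun hg => ?_
      have e1 : ∀ i < k, v2.r (vV (g i)) = V (g i) := fun i hi => by rw [hVr, hV _ (permFuns_lt hg i hi)]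
      constructor
      · intro h1 i hi
        rw [← e1 i hi]; exact hcode_inj hf (fun i hi => by rw [e1 i hi]; exact hVn _ (permFuns_lt hg i hi)) h1 i hi
      · intro h1
        exact hcode_congr fun i hi => by rw [h1 i hi, e1 i hi]
    simp only [e]
    by_cases hc : ∃ g ∈ permFuns k, ∀ i < k, f i = V (g i)
    · simp [hc]
    · simp only [hc, if_false, or_false]; exact h.mark f hf hfi

theorem emit_tri {G : SimpleGraph ℕ} (hS : 2 * k + 5 ≤ P.S) (hW : n ^ k + 1 ≤ P.W) (h : Env n k G.Adj v) (hV : ∀ i < k, v.r (vV i) < n) :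
    Tri P (emit k).cmd v (emit k).cost 0 fun v' => Env n k G.Adj v' ∧ Fr EmX EmY v v' ∧
      outs k v ⊆ outs k v' ∧ ((∀ j < k, ∀ i < j, G.Adj (v.r (vV i)) (v.r (vV j))) → (range k).image (fun i => v.r (vV i)) ∈ outs k v') := by
  classical
  have hk := h.count_le
  obtain ⟨a1, a2, a3⟩ := adjAll_exec (pairs k) h.n_eq h.adj fun p hp =>
    ⟨hV _ ((mem_pairs.1 hp).1.trans (mem_pairs.1 hp).2), hV _ (mem_pairs.1 hp).2⟩
  set v1 := (adjAll (pairs k)).exec v with hv1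
  have hV1 : ∀ i, v1.r (vV i) = v.r (vV i) := fun i => a1.r _ (by simp)
  have E1 : Env n k G.Adj v1 := h.congr (a1.r _ (by simp)) (a1.r _ (by simp)) (a1.r _ (by simp))
    (a1.a _ not_false) (a1.a _ not_false) (a1.a _ not_false)
  have F1 : Fr EmX EmY v v1 := a1.mono (fun _ h => Or.inl h) (fun _ h => h.elim)
  have O1 : outs k v1 = outs k v := outs_congr (a1.r _ (by simp)) (a1.a _ not_false)
  have hall : (∀ p ∈ pairs k, G.Adj (v.r (vV p.1)) (v.r (vV p.2))) ↔ ∀ j < k, ∀ i < j, G.Adj (v.r (vV i)) (v.r (vV j)) :=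
    ⟨fun H j hj i hi => H (i, j) (mem_pairs.2 ⟨hi, hj⟩), fun H p hp => H _ (mem_pairs.1 hp).2 _ (mem_pairs.1 hp).1⟩
  simp only [hall] at a2
  obtain ⟨b1, b2, b3⟩ := codeSL_exec (n := n) id k (v := v1) E1.n_eq fun i hi => by rw [id, hV1]; exact hV i hi
  set v2 := (codeSL id k).exec v1 with hv2
  have hV2 : ∀ i, v2.r (vV i) = v.r (vV i) := fun i => by rw [b1.r _ (by simp), hV1]
  have E2 : Env n k G.Adj v2 := E1.congr (b1.r _ (by simp)) (b1.r _ (by simp)) (b1.r _ (by simp))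
    (b1.a _ not_false) (b1.a _ not_false) (b1.a _ not_false)
  have F2 : Fr EmX EmY v v2 := F1.trans (b1.mono (fun _ h => Or.inr (Or.inl h)) (fun _ h => h.elim))
  have O2 : outs k v2 = outs k v := by rw [outs_congr (b1.r _ (by simp)) (b1.a _ not_false), O1]
  have hc2 : v2.r (tm 11) = hcode n (fun i => v.r (vV i)) k := by rw [b2]; exact hcode_congr fun i _ => hV1 i
  by_cases hA : ∀ j < k, ∀ i < j, G.Adj (v.r (vV i)) (v.r (vV j))
  · rw [if_pos hA] at a2
    have hmk : (Ex.ld bMark (Ex.v (tm 11))).eval v2 = v2.a bMark (hcode n (fun i => v.r (vV i)) k) := by rw [Ex.eval_ld, Ex.eval_v, hc2]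
    by_cases hm : v2.a bMark (hcode n (fun i => v.r (vV i)) k) = 0
    · refine Tri.sl ((emit_size k).trans hS) (fun hv => ?_) fun _ => ?_
      · simp only [emit, SL.ok, ← hv1, ← hv2, Ex.eval_v, a2, hmk, hm, ne_eq, one_ne_zero,
          not_false_eq_true, if_true, not_true_eq_false, if_false]
        obtain ⟨c1, -, -⟩ := writeOut_exec k k v2
        refine ⟨a3 _ (by omega), b3 _ (by omega), writeOut_ok k fun i _ => ?_, ?_, ?_⟩
        · rw [hV2]; exact hv.1 _
        · simp only [Ex.eval_add, Ex.eval_v, Ex.eval_ofNat]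
          rw [show ((writeOut k k).exec v2).r vC = v2.r vC from c1.r _ not_false]
          have := E2.count_le
          omega
        · refine (marks_exec (n := n) k (permFuns k) ?_ fun g hg i hi => ?_).2.2 _ (by omega) (by omega)
          · rw [SL.exec, St.set_ne (by simp)]
            exact (c1.r _ not_false).trans E2.n_eq
          · rw [SL.exec, St.set_ne (by simp)]
            refine (c1.r _ not_false).trans_lt ?_
            rw [hV2]; exact hV _ (permFuns_lt hg i hi)
      · obtain ⟨c1, c2, c3, c4⟩ := E2.output (fun i _ => hV2 i) hV hA hm
        have he : (emit k).exec v = (SL.seq (writeOut k k) (.seq (.asg vC (.v vC + 1)) (marks k (permFuns k)))).exec v2 := by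
          simp only [emit, SL.exec, ← hv1, ← hv2, Ex.eval_v, a2, hmk, hm, ne_eq, one_ne_zero,
            not_false_eq_true, if_true, not_true_eq_false, if_false]
        rw [he]; exact ⟨c1, F2.trans c2, by rw [← O2]; exact c3, fun _ => c4⟩
    · refine Tri.sl ((emit_size k).trans hS) (fun hv => ?_) fun _ => ?_
      · simp only [emit, SL.ok, ← hv1, ← hv2, Ex.eval_v, a2, hmk, hm, ne_eq, one_ne_zero, not_false_eq_true, if_true]
        exact ⟨a3 _ (by omega), b3 _ (by omega), trivial⟩
      · have he : (emit k).exec v = v2 := by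
          simp only [emit, SL.exec, ← hv1, ← hv2, Ex.eval_v, a2, hmk, hm, ne_eq, one_ne_zero, not_false_eq_true, if_true]
        rw [he]
        refine ⟨E2, F2, by rw [O2]; exact fun _ h => h, fun _ => ?_⟩
        have hinj : Set.InjOn (fun i => v.r (vV i)) (range k) := by
          intro i hi j hj hij; simp only [coe_range, Set.mem_Iio] at hi hj
          rcases lt_trichotomy i j with h' | h' | h'
          · exact absurd hij (hA j hj i h').ne
          · exact h'
          · exact absurd hij.symm (hA i hi j h').ne
        exact (E2.mark _ hV hinj).1 hm
  · rw [if_neg hA] at a2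
    have he : (emit k).exec v = v1 := by rw [emit, SL.exec, ← hv1, SL.exec, Ex.eval_v, a2, if_neg (by simp), SL.exec]
    refine Tri.sl ((emit_size k).trans hS) (fun hv => ?_) fun _ => ?_
    · simp only [emit, SL.ok, ← hv1, Ex.eval_v, a2, ne_eq, not_true_eq_false, if_false]
      exact ⟨a3 _ (by omega), trivial⟩
    · rw [he]
      exact ⟨E1, F1, by rw [O1]; exact fun _ h => h, fun h => absurd h hA⟩

end Emit
/-! ### The data of one pass of the algorithm -/

/-- Variables of level `j` of the recursion: `0` the number of vertices, `1` the time budget, `2` the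
current vertex, `3` the block size of the finest complete pass, `4` the number of codes,
`5` the smallest power of two that is not smaller than the number of vertices. -/
abbrev lv (j c : ℕ) : Var := (30 + j, c)
/-- The vertices at level `j`. -/
abbrev bL (j : ℕ) : Var := (30 + j, 0)
/-- The numbers of cliques on pairs at level `j`. -/
abbrev bCnt (j : ℕ) : Var := (30 + j, 1)
/-- Working variables of a pass. -/
abbrev wv (i : ℕ) : Var := (10, i)
/-- Parameters of a pass. -/
abbrev pv (i : ℕ) : Var := (11, i)

/-- The data of a pass: the codes `x < m ^ (j - 2)` of tuples of vertices are permuted by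
multiplication by `a` modulo `Q`, and cut into blocks of `N` codes; the vertices are cut into `r`
blocks of `N` vertices. -/
structure PD where
  (n j m N r Q a : ℕ)
  L : ℕ → ℕ
  G : SimpleGraph ℕ

namespace PD
variable (D : PD)

/-- The `y`-th code of block `b`. -/
def code (b y : ℕ) : ℕ := D.a * (b * D.N + y) % D.Q

/-- The tuple with first vertices `row` and `col` and other vertices given by a code. -/
def tup (row col x i : ℕ) : ℕ := D.L (if i = 0 then row else if i = 1 then col else x / D.m ^ (i - 2) % D.m)

end PD

/-- The pairs of `e` and of positions `2, …, j - 1`. -/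
def starPairs (j e : ℕ) : List (ℕ × ℕ) := (pairs (j - 2)).map (fun p => (p.1 + 2, p.2 + 2)) ++ (List.range (j - 2)).map fun i => (e, i + 2)

theorem forall_starPairs {e : ℕ} {R : ℕ → ℕ → Prop} : (∀ p ∈ starPairs j e, R p.1 p.2) ↔
    (∀ b < j, ∀ a < b, 2 ≤ a → R a b) ∧ ∀ b < j, 2 ≤ b → R e b := by
  simp only [starPairs, List.mem_append, mem_map, mem_pairs, List.mem_range]
  constructor
  · intro h
    refine ⟨fun b hb a ha ha2 => ?_, fun b hb hb2 => ?_⟩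
    · have := h (a - 2 + 2, b - 2 + 2) (Or.inl ⟨(a - 2, b - 2), ⟨by simp; omega, by simp; omega⟩, rfl⟩)
      rwa [Nat.sub_add_cancel ha2, Nat.sub_add_cancel (by omega)] at this
    · have := h (e, b - 2 + 2) (Or.inr ⟨b - 2, by omega, rfl⟩)
      rwa [Nat.sub_add_cancel hb2] at this
  · rintro ⟨h1, h2⟩ p (⟨q, ⟨hq, hq'⟩, rfl⟩ | ⟨i, hi, rfl⟩)
    · exact h1 _ (by simp; omega) _ (by simp; omega) (by simp)
    · exact h2 _ (by simp; omega) (by simp)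

namespace PD
variable (D : PD)

/-- The code `x` and the vertex `row` in position `e` form a clique. -/
def star (e row x : ℕ) : Prop := row < D.m ∧ x < D.m ^ (D.j - 2) ∧
    ∀ p ∈ starPairs D.j e, D.G.Adj (D.tup row row x p.1) (D.tup row row x p.2)

def clq (row col x : ℕ) : Prop := row < D.m ∧ col < D.m ∧ x < D.m ^ (D.j - 2) ∧
    ∀ b < D.j, ∀ a < b, D.G.Adj (D.tup row col x a) (D.tup row col x b)

theorem clq_iff (hj : 2 ≤ D.j) (row col x : ℕ) : D.clq row col x ↔ D.star 0 row x ∧ D.star 1 col x ∧ D.G.Adj (D.L row) (D.L col) := by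
  simp only [clq, star, forall_starPairs (R := fun a b => D.G.Adj (D.tup row row x a) (D.tup row row x b)),
    forall_starPairs (R := fun a b => D.G.Adj (D.tup col col x a) (D.tup col col x b))]
  have h2 : ∀ r c r' c' a, 2 ≤ a → D.tup r c x a = D.tup r' c' x a := fun r c r' c' a ha => by
    simp only [tup, if_neg (show a ≠ 0 by omega), if_neg (show a ≠ 1 by omega)]
  have t0 : ∀ r c, D.tup r c x 0 = D.L r := fun r c => rfl
  have t1 : ∀ r c, D.tup r c x 1 = D.L c := fun r c => rfl
  constructor
  · rintro ⟨h, h', h'', hA⟩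
    refine ⟨⟨h, h'', fun b hb a ha ha2 => ?_, fun b hb hb2 => ?_⟩, ⟨h', h'', fun b hb a ha ha2 => ?_, fun b hb hb2 => ?_⟩, ?_⟩
    · rw [h2 _ _ row col a ha2, h2 _ _ row col b (by omega)]; exact hA b hb a ha
    · rw [h2 _ _ row col b (by omega)]; exact hA b hb 0 (by omega)
    · rw [h2 _ _ row col a ha2, h2 _ _ row col b (by omega)]; exact hA b hb a ha
    · rw [h2 _ _ row col b (by omega), t1, ← t1 row col]; exact hA b hb 1 (by omega)
    · exact hA 1 (by omega) 0 (by omega)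
  · rintro ⟨⟨h, h'', h3, h4⟩, ⟨h', -, h5, h6⟩, h7⟩
    refine ⟨h, h', h'', fun b hb a ha => ?_⟩
    rcases Nat.lt_or_ge a 2 with ha2 | ha2
    · rcases Nat.lt_or_ge b 2 with hb2 | hb2
      · obtain rfl : a = 0 := by omega
        obtain rfl : b = 1 := by omega
        exact h7
      · rcases (show a = 0 ∨ a = 1 by omega) with rfl | rfl
        · rw [h2 _ _ row row b hb2]; exact h4 b hb hb2
        · rw [h2 _ _ col col b hb2]; exact h6 b hb hb2
    · rw [h2 _ _ row row a ha2, h2 _ _ row row b (by omega)]; exact h3 b hb a ha ha2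

structure Holds (v : St) : Prop where
  m : v.r (lv D.j 0) = D.m
  Q : v.r (lv D.j 4) = D.Q
  N : v.r (pv 0) = D.N
  a : v.r (pv 1) = D.a
  r : v.r (pv 2) = D.r
  L : v.a (bL D.j) = D.L
  lt : ∀ i, D.L i < D.n

end PD

/-- Compute the vertices in positions `2, …, c + 1` from the code in `wv 0`. -/
def digits (j c : ℕ) : SL := .seq (.asg (wv 1) (.v (wv 0))) (SL.list ((List.range c).map fun i =>
    .seq (.asg (vV (2 + i)) (.ld (bL j) (.v (wv 1) % .v (lv j 0)))) (.asg (wv 1) (.v (wv 1) / .v (lv j 0)))))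

theorem digits_size (j c : ℕ) : (digits j c).size ≤ 3 := by
  have := SL.list_size (l := (List.range c).map fun i =>
    SL.seq (.asg (vV (2 + i)) (.ld (bL j) (.v (wv 1) % .v (lv j 0)))) (.asg (wv 1) (.v (wv 1) / .v (lv j 0)))) (n := 3)
    fun p hp => by
      obtain ⟨b, _, rfl⟩ := mem_map.1 hp
      simp [SL.size]
  simp only [digits, SL.size, sup_le_iff]
  exact ⟨by simp, this⟩

def DecX (j : ℕ) (x : Var) : Prop := x = wv 0 ∨ x = wv 1 ∨ x = wv 2 ∨ x = tm 10 ∨ (x.1 = 2 ∧ x.2 < j)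

theorem digits_exec (j c : ℕ) (hc : c + 2 ≤ j) (hv : v.Small W) : Fr (DecX j) (fun _ => False) v ((digits j c).exec v) ∧
    (∀ i < c, ((digits j c).exec v).r (vV (2 + i)) = v.a (bL j) (v.r (wv 0) / v.r (lv j 0) ^ i % v.r (lv j 0))) ∧
    ((digits j c).exec v).r (wv 1) = v.r (wv 0) / v.r (lv j 0) ^ c ∧
    ((digits j c).exec v).r (wv 0) = v.r (wv 0) ∧
    (digits j c).ok W v := by
  induction c with
  | zero =>
    refine ⟨(Fr.refl _ _ v).set (x := wv 1) (by simp [DecX]) _, by simp, ?_, ?_, ?_⟩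
    · simp [digits, SL.exec, SL.list]
    · simp [digits, SL.exec, SL.list]
    · simp [digits, SL.ok, SL.list, hv.1]
  | succ c ih =>
    obtain ⟨h1, h2, h3, h4, h5⟩ := ih (by omega)
    set w := (digits j c).exec v with hw
    set x := v.a (bL j) (v.r (wv 0) / v.r (lv j 0) ^ c % v.r (lv j 0)) with hx
    have e1 : (Ex.ld (bL j) (.v (wv 1) % .v (lv j 0))).eval w = x := by
      rw [Ex.eval_ld, Ex.eval_mod, Ex.eval_v, Ex.eval_v, h3, h1.r (lv j 0) (by simp [DecX]; omega), h1.a _ not_false]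
    have e : (digits j (c + 1)).exec v = (w.set (vV (2 + c)) x).set (wv 1) (v.r (wv 0) / v.r (lv j 0) ^ (c + 1)) := by
      have : (digits j (c + 1)).exec v = (w.set (vV (2 + c)) ((Ex.ld (bL j) (.v (wv 1) % .v (lv j 0))).eval w)).set (wv 1)
          ((Ex.v (wv 1) / .v (lv j 0)).eval (w.set (vV (2 + c))
        ((Ex.ld (bL j) (.v (wv 1) % .v (lv j 0))).eval w))) := by
        simp only [digits, range_succ, map_append, SL.exec, SL.list_append_exec] at hw ⊢; rw [← hw]; rfl
      rw [this, e1, Ex.eval_div, Ex.eval_v, Ex.eval_v, St.set_ne (by simp), St.set_r,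
        if_neg (by simp; omega), h3, h1.r (lv j 0) (by simp [DecX]; omega), Nat.div_div_eq_div_mul, pow_succ]
    rw [e]
    refine ⟨(h1.set (by simp [DecX]; omega) _).set (by simp [DecX]) _, fun i hi => ?_, by simp, ?_, ?_⟩
    · rw [St.set_ne (by simp), St.set_r]
      split_ifs with h
      · simp only [Prod.mk.injEq, true_and] at h
        obtain rfl : i = c := by omega
        rfl
      · exact h2 i (by
          have : i ≠ c := fun h' => h (by rw [h'])
          omega)
    · rw [St.set_ne (by simp), St.set_ne (by simp), h4]
    · simp only [digits, range_succ, map_append, SL.ok, SL.list_append_ok] at h5 ⊢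
      refine ⟨h5.1, h5.2, ?_⟩
      change SL.ok W _ w
      have e2 : (Ex.v (wv 1) / .v (lv j 0)).eval (w.set (vV (2 + c)) x) ≤ W := by
        rw [Ex.eval_div, Ex.eval_v, St.set_ne (by simp), h3]
        exact (Nat.div_le_self _ _).trans ((Nat.div_le_self _ _).trans (hv.1 _))
      refine ⟨⟨e1.trans_le (hv.2 _ _), ?_⟩, trivial⟩
      simp only [SL.exec, e1]; exact e2

/-- Decode the `y`-th code of the block `wv 3`. -/
def dec (j : ℕ) (y : Ex) : SL := .seq (.asg (wv 0) (.v (pv 1) * (.v (wv 3) * .v (pv 0) + y) % .v (lv j 4))) (digits j (j - 2))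

theorem dec_exec (D : PD) (hj : 2 ≤ D.j) (hQ : 1 ≤ D.Q) (hv : v.Small W) (h : D.Holds v) (y : Ex) : let w := (dec D.j y).exec v
    Fr (DecX D.j) (fun _ => False) v w ∧
    (∀ i, 2 ≤ i → i < D.j → ∀ row col, w.r (vV i) = D.tup row col (D.code (v.r (wv 3)) (y.eval v)) i) ∧
    w.r (wv 1) = D.code (v.r (wv 3)) (y.eval v) / D.m ^ (D.j - 2) ∧
    (dec D.j y).ok W v := by
  intro w
  have e1 : (Ex.v (pv 1) * (.v (wv 3) * .v (pv 0) + y) % .v (lv D.j 4)).eval v = D.code (v.r (wv 3)) (y.eval v) := by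
    simp only [Ex.eval_mod, Ex.eval_mul, Ex.eval_add, Ex.eval_v, h.a, h.N, h.Q, PD.code]
  set x := D.code (v.r (wv 3)) (y.eval v) with hx
  have hxQ : x ≤ W := (Nat.mod_lt _ hQ).le.trans (h.Q ▸ hv.1 _)
  have hw : w = (digits D.j (D.j - 2)).exec (v.set (wv 0) x) := by rw [← e1]; rfl
  have hs : (v.set (wv 0) x).Small W := ⟨fun z => by rw [St.set_r]; split_ifs; exacts [hxQ, hv.1 z], hv.2⟩
  obtain ⟨h1, h2, h3, -, h5⟩ := digits_exec D.j (D.j - 2) (by omega) hs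
  rw [← hw] at h1 h2 h3
  have hm : (v.set (wv 0) x).r (lv D.j 0) = D.m := by rw [St.set_ne (by simp; omega), h.m]
  rw [hm, St.set_r, if_pos rfl] at h3
  refine ⟨((Fr.refl (DecX D.j) (fun _ => False) v).set (x := wv 0) (by simp [DecX]) _).trans h1, fun i hi hij row col => ?_, h3, ?_⟩
  · have := h2 (i - 2) (by omega)
    rw [hm, St.set_r, if_pos rfl, St.set_a, h.L, show 2 + (i - 2) = i by omega] at this
    rw [this, PD.tup, if_neg (by omega), if_neg (by omega)]
  · simp only [dec, SL.ok, SL.exec, e1]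
    exact ⟨hxQ, h5⟩

theorem dec_size (j : ℕ) (y : Ex) : (dec j y).size ≤ y.size + 4 := by
  have := digits_size j (j - 2)
  simp only [dec, SL.size, Ex.size_mod, Ex.size_mul, Ex.size_v, Ex.size_add, sup_le_iff]
  have := y.size_pos
  omega

def cell (j e : ℕ) (u y : Ex) : SL := .seq (dec j y) (.seq (.asg (wv 2) (.v (wv (4 + e)) * .v (pv 0) + u))
    (.seq (.asg (vV e) (.ld (bL j) (.v (wv 2)))) (.seq (adjAll (starPairs j e))
        (.asg (tm 10) (.v (tm 10) * .lt (.v (wv 2)) (.v (lv j 0)) * .eq (.v (wv 1)) 0)))))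

theorem cell_size (j e : ℕ) (u y : Ex) : (cell j e u y).size ≤ max (y.size + 4) (u.size + 6) := by
  have h1 := dec_size j y
  have h2 := adjAll_size (starPairs j e)
  have := u.size_pos
  simp only [cell, SL.size, Ex.size_mul, Ex.size_v, Ex.size_add, Ex.size_ld, Ex.size_lt, Ex.size_eq, Ex.size_ofNat, sup_le_iff, le_sup_iff]
  omega

open Classical in
theorem cell_exec (D : PD) (hj : 3 ≤ D.j) (hQ : 1 ≤ D.Q) (hm : 1 ≤ D.m) (hW : 1 ≤ W) (hv : v.Small W) (h : D.Holds v) (hn : v.r vn = D.n)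
    (hA : ∀ a < D.n, ∀ b < D.n, v.a bA (a * D.n + b) = if D.G.Adj a b then 1 else 0)
    {e : ℕ} (he : e < 2) (u y : Ex) (hu : ∀ v', Fr (DecX D.j) (fun _ => False) v v' → u.eval v' = u.eval v)
    (hrow : v.r (wv (4 + e)) * D.N + u.eval v ≤ W) :
    let w := (cell D.j e u y).exec v
    Fr (DecX D.j) (fun _ => False) v w ∧
    w.r (tm 10) = (if D.star e (v.r (wv (4 + e)) * D.N + u.eval v) (D.code (v.r (wv 3)) (y.eval v)) then 1 else 0) ∧
    (cell D.j e u y).ok W v := by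
  intro w
  obtain ⟨a1, a2, a3, a4⟩ := dec_exec D (by omega) hQ hv h y
  set v1 := (dec D.j y).exec v with hv1
  set x := D.code (v.r (wv 3)) (y.eval v) with hx
  set row := v.r (wv (4 + e)) * D.N + u.eval v with hrw
  have e1 : (Ex.v (wv (4 + e)) * .v (pv 0) + u).eval v1 = row := by
    rw [Ex.eval_add, Ex.eval_mul, Ex.eval_v, Ex.eval_v, hu v1 a1, a1.r (wv (4 + e)) (by simp [DecX]; omega),
      a1.r (pv 0) (by simp [DecX]), h.N]
  set v2 := v1.set (wv 2) row with hv2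
  have e2 : (Ex.ld (bL D.j) (.v (wv 2))).eval v2 = D.L row := by
    rw [Ex.eval_ld, Ex.eval_v, hv2, St.set_a, St.set_r, if_pos rfl, a1.a _ not_false, h.L]
  set v3 := v2.set (vV e) (D.L row) with hv3
  have F3 : Fr (DecX D.j) (fun _ => False) v v3 := (a1.set (x := wv 2) (by simp [DecX]) _).set (x := vV e) (by simp [DecX]; omega) _
  have hV3 : v3.r (vV e) = D.tup row row x e := by
    rw [hv3, St.set_r, if_pos rfl, PD.tup]
    rcases (show e = 0 ∨ e = 1 by omega) with rfl | rfl <;> rfl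
  have hV3' : ∀ i, 2 ≤ i → i < D.j → v3.r (vV i) = D.tup row row x i := fun i hi hij => by
    rw [hv3, St.set_ne (by simp; omega), hv2, St.set_ne (by simp), a2 i hi hij row row]
  have hmem : ∀ p ∈ starPairs D.j e, v3.r (vV p.1) = D.tup row row x p.1 ∧ v3.r (vV p.2) = D.tup row row x p.2 := by
    have := (forall_starPairs (j := D.j) (e := e) (R := fun a b => v3.r (vV a) = D.tup row row x a ∧
      v3.r (vV b) = D.tup row row x b)).2 ⟨fun b hb a ha ha2 =>
        ⟨hV3' a ha2 (by omega), hV3' b (by omega) hb⟩, fun b hb hb2 => ⟨hV3, hV3' b hb2 hb⟩⟩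
    exact this
  obtain ⟨b1, b2, b3⟩ := adjAll_exec (n := D.n) (A := D.G.Adj) (starPairs D.j e) (v := v3)
    (by rw [F3.r vn (by simp [DecX]), hn]) (by rw [F3.a bA not_false]; exact hA) fun p hp => by
      rw [(hmem p hp).1, (hmem p hp).2]; exact ⟨h.lt _, h.lt _⟩
  set v4 := (adjAll (starPairs D.j e)).exec v3 with hv4
  have F4 : Fr (DecX D.j) (fun _ => False) v v4 := F3.trans (b1.mono (fun x hx => by simp [DecX, hx]) fun _ h => h)
  have r2 : v4.r (wv 2) = row := by rw [b1.r _ (by simp), hv3, St.set_ne (by simp), hv2, St.set_r, if_pos rfl]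
  have r1 : v4.r (wv 1) = x / D.m ^ (D.j - 2) := by
    rw [b1.r _ (by simp), hv3, St.set_ne (by simp), hv2, St.set_ne (by simp), a3]
  have e4 : (Ex.v (tm 10) * .lt (.v (wv 2)) (.v (lv D.j 0)) * .eq (.v (wv 1)) 0).eval v4 = if D.star e row x then 1 else 0 := by
    simp only [Ex.eval_mul, Ex.eval_v, Ex.eval_lt, Ex.eval_eq, Ex.eval_ofNat, r1, r2, b2]
    rw [F4.r (lv D.j 0) (by simp [DecX]; omega), h.m]
    have hdiv : x / D.m ^ (D.j - 2) = 0 ↔ x < D.m ^ (D.j - 2) := by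
      rw [Nat.div_eq_zero_iff]
      have : D.m ^ (D.j - 2) ≠ 0 := (Nat.pow_pos hm).ne'
      exact ⟨fun h => h.resolve_left this, Or.inr⟩
    have hall : (∀ p ∈ starPairs D.j e, D.G.Adj (v3.r (vV p.1)) (v3.r (vV p.2))) ↔
        ∀ p ∈ starPairs D.j e, D.G.Adj (D.tup row row x p.1) (D.tup row row x p.2) :=
      forall₂_congr fun p hp => by rw [(hmem p hp).1, (hmem p hp).2]
    simp only [hdiv, hall, PD.star]
    by_cases h1 : ∀ p ∈ starPairs D.j e, D.G.Adj (D.tup row row x p.1) (D.tup row row x p.2) <;>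
      by_cases h2 : row < D.m <;> by_cases h3 : x < D.m ^ (D.j - 2) <;>
      simp only [h1, h2, h3, if_true, if_false, and_false, true_and, false_and, mul_one, mul_zero]
  have hw : w = v4.set (tm 10) (if D.star e row x then 1 else 0) := by
    have : w = v4.set (tm 10) ((Ex.v (tm 10) * .lt (.v (wv 2)) (.v (lv D.j 0)) * .eq (.v (wv 1)) 0).eval v4) := by
      rw [hv4, hv3, ← e2, hv2, ← e1]; rfl
    rw [this, e4]
  rw [hw]
  refine ⟨F4.set (by simp [DecX]) _, by rw [St.set_r, if_pos rfl], ?_⟩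
  simp only [cell, SL.ok, SL.exec, ← hv1, e1, ← hv2, e2, ← hv3, ← hv4, e4]
  refine ⟨a4, hrow, ?_, b3 W hW, by split_ifs <;> omega⟩
  have := hv.2 (bL D.j) row
  rwa [h.L] at this

variable {D : PD} {M : MMProg} {G : SimpleGraph ℕ}

/-! ### One block of a pass -/

theorem St.Small.set (h : v.Small W) {x : Var} (hn : n ≤ W) : (v.set x n).Small W :=
  ⟨fun y => by rw [St.set_r]; split_ifs; exacts [hn, h.1 y], h.2⟩

theorem St.Small.put (h : v.Small W) {b : Var} (hn : n ≤ W) : (v.put b i n).Small W :=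
  ⟨h.1, fun c l => by rw [St.put_a]; split_ifs; exacts [hn, h.2 c l]⟩

theorem SL.small_exec (p : SL) : ∀ {v : St}, v.Small W → p.ok W v → (p.exec v).Small W := by
  induction p with
  | skip => exact fun h _ => h
  | asg x e => exact fun h he => h.set he
  | sto b i e => exact fun h he => h.put he
  | seq p q hp hq => exact fun h he => hq (hp h he.1) he.2
  | ite e p q hp hq =>
    intro v h he; simp only [ok, exec] at he ⊢
    split_ifs at he ⊢
    · exact hp h he
    · exact hq h he

def PsX (j : ℕ) (x : Var) : Prop := x.1 = 7 ∨ x.1 = 10 ∨ x.1 = 21 ∨ x = vTick ∨ x = vC ∨ (x.1 = 2 ∧ x.2 < j)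
def PsY (j : ℕ) (b : Var) : Prop := b.1 = 20 ∨ b.1 = 23 ∨ EmY b ∨ b = bCnt j

theorem PD.Holds.of_fr (h : D.Holds v) (F : Fr (PsX D.j) (PsY D.j) v v') : D.Holds v' := by
  refine ⟨?_, ?_, ?_, ?_, ?_, ?_, h.lt⟩
  · rw [F.r _ (by simp [PsX]; omega), h.m]
  · rw [F.r _ (by simp [PsX]; omega), h.Q]
  · rw [F.r _ (by simp [PsX]), h.N]
  · rw [F.r _ (by simp [PsX]), h.a]
  · rw [F.r _ (by simp [PsX]), h.r]
  · rw [F.a _ (by simp [PsY, EmY]; omega), h.L]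

def wt (md : Bool) (y : ℕ) : ℕ := if md then y + 1 else 1

def wtE (md : Bool) : Ex := if md then .v (wv 8) % .v (pv 0) + 1 else 1

def fillBody (j : ℕ) (md : Bool) : SL := .seq (cell j 0 (.v (wv 8) / .v (pv 0)) (.v (wv 8) % .v (pv 0)))
    (.seq (.sto (20, 0) (.v (wv 8)) (.v (tm 10) * wtE md)) (.seq (cell j 1 (.v (wv 8) % .v (pv 0)) (.v (wv 8) / .v (pv 0)))
        (.sto (20, 1) (.v (wv 8)) (.v (tm 10)))))

theorem fillBody_size (j : ℕ) (md : Bool) : (fillBody j md).size ≤ 10 := by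
  have h1 := cell_size j 0 (.v (wv 8) / .v (pv 0)) (.v (wv 8) % .v (pv 0))
  have h2 := cell_size j 1 (.v (wv 8) % .v (pv 0)) (.v (wv 8) / .v (pv 0))
  have h3 : (wtE md).size ≤ 4 := by cases md <;> simp [wtE]
  simp only [fillBody, SL.size, Ex.size_mod, Ex.size_mul, Ex.size_v, Ex.size_div, sup_le_iff, le_sup_iff] at *
  omega

namespace PD
variable (D : PD)

open Classical in
/-- The first matrix for block `b` of the codes and block `I` of the vertices. -/
def matA (md : Bool) (b I u y : ℕ) : ℕ := if D.star 0 (I * D.N + u) (D.code b y) then wt md y else 0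

open Classical in
/-- The second matrix for block `b` of the codes and block `J` of the vertices. -/
def matB (b J y v : ℕ) : ℕ := if D.star 1 (J * D.N + v) (D.code b y) then 1 else 0

/-- The sizes are admissible. -/
structure Ok (M : MMProg) (P : Par) (k : ℕ) : Prop where
  j : 3 ≤ D.j
  jk : D.j ≤ k
  Q : 1 ≤ D.Q
  m : 1 ≤ D.m
  N : 1 ≤ D.N
  r : 1 ≤ D.r
  W : D.n ^ k + 1 ≤ P.W
  rN : D.r * D.N ≤ P.W
  NN : D.N * D.N ≤ P.W
  c : (D.N + 2) ^ M.c ≤ P.W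
  μ : M.μ D.N + 1 ≤ P.W
  S : 2 * k + 20 ≤ P.S

end PD

abbrev FillFr (j : ℕ) : St → St → Prop := Fr (fun x => DecX j x ∨ x = wv 8) fun b => b = (20, 0) ∨ b = (20, 1)

/-- The matrices have been computed up to index `i`. -/
structure FillInv (D : PD) (md : Bool) (b I J : ℕ) (v : St) (i : ℕ) (v' : St) : Prop where
  idx : v'.r (wv 8) = i
  fr : FillFr D.j v v'
  A : ∀ c, v'.a (20, 0) c = if c < i then D.matA md b I (c / D.N) (c % D.N) else 0
  B : ∀ c, v'.a (20, 1) c = if c < i then D.matB b J (c / D.N) (c % D.N) else 0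

theorem DecX.psX {x : Var} (h : DecX j x) : PsX j x := by
  rcases h with rfl | rfl | rfl | rfl | h <;> simp [PsX, *]

theorem fillBody_exec (D : PD) (ok : D.Ok M P k) (md : Bool) {b I J : ℕ}
    (h : D.Holds v) (hE : Env D.n k D.G.Adj v) (hb : v.r (wv 3) = b)
    (hI : v.r (wv 4) = I) (hJ : v.r (wv 5) = J) (hIr : I < D.r) (hJr : J < D.r)
    (hF : FillInv D md b I J v i v') (hi : i < D.N * D.N) (hs : v'.Small P.W) :
    FillInv D md b I J v (i + 1) (((fillBody D.j md).exec v').set (wv 8) (i + 1)) ∧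
    ((fillBody D.j md).exec v').r (wv 8) = i ∧ (fillBody D.j md).ok P.W v' := by
  have hN := ok.N
  have hm1 : i % D.N < D.N := Nat.mod_lt _ hN
  have hd1 : i / D.N < D.N := Nat.div_lt_of_lt_mul hi
  have hW : 1 ≤ P.W := by have := ok.W; omega
  have toPs : ∀ w, FillFr D.j v w →
      D.Holds w ∧ w.r vn = D.n ∧ w.a bA = v.a bA ∧ w.r (wv 3) = b ∧ w.r (wv 4) = I ∧ w.r (wv 5) = J := fun w F => by
    refine ⟨h.of_fr (F.mono (fun x hx => ?_) fun b hb => ?_), ?_, ?_, ?_, ?_, ?_⟩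
    · exact hx.elim DecX.psX fun h => by simp [PsX, h]
    · rcases hb with rfl | rfl <;> simp [PsY]
    · rw [F.r _ (by simp [DecX]), hE.n_eq]
    · rw [F.a _ (by simp)]
    all_goals rw [F.r _ (by simp [DecX])]; assumption
  obtain ⟨h1, h1n, h1A, h1b, h1I, h1J⟩ := toPs v' hF.fr
  have hrow : ∀ K < D.r, ∀ u < D.N, K * D.N + u ≤ P.W := fun K hK u hu => by
    have : (K + 1) * D.N ≤ D.r * D.N := Nat.mul_le_mul_right _ hK
    have := ok.rN
    nlinarith
  have hinvd : ∀ w w' : St, Fr (DecX D.j) (fun _ => False) w w' →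
      (Ex.v (wv 8) / .v (pv 0)).eval w' = (Ex.v (wv 8) / .v (pv 0)).eval w := fun w w' F => by
    rw [Ex.eval_div, Ex.eval_v, Ex.eval_v, F.r (wv 8) (by simp [DecX]), F.r (pv 0) (by simp [DecX])]; rfl
  have hinvm : ∀ w w' : St, Fr (DecX D.j) (fun _ => False) w w' →
      (Ex.v (wv 8) % .v (pv 0)).eval w' = (Ex.v (wv 8) % .v (pv 0)).eval w := fun w w' F => by
    rw [Ex.eval_mod, Ex.eval_v, Ex.eval_v, F.r (wv 8) (by simp [DecX]), F.r (pv 0) (by simp [DecX])]; rfl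
  have hd : ∀ w, D.Holds w → w.r (wv 8) = i → (Ex.v (wv 8) / .v (pv 0)).eval w = i / D.N := fun w hw h8 => by
    rw [Ex.eval_div, Ex.eval_v, Ex.eval_v, hw.N, h8]
  have hmd : ∀ w, D.Holds w → w.r (wv 8) = i → (Ex.v (wv 8) % .v (pv 0)).eval w = i % D.N := fun w hw h8 => by
    rw [Ex.eval_mod, Ex.eval_v, Ex.eval_v, hw.N, h8]
  obtain ⟨a1, a2, a3⟩ := cell_exec D ok.j ok.Q ok.m hW hs h1 h1n (by rw [h1A]; exact hE.adj)
    (e := 0) (by norm_num) _ (.v (wv 8) % .v (pv 0)) (fun w F => hinvd v' w F) (by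
      rw [hd v' h1 hF.idx]; exact hrow _ (h1I ▸ hIr) _ hd1)
  rw [hd v' h1 hF.idx, hmd v' h1 hF.idx, h1I, h1b] at a2
  set v1 := (cell D.j 0 (.v (wv 8) / .v (pv 0)) (.v (wv 8) % .v (pv 0))).exec v' with hv1
  have s1 : v1.Small P.W := SL.small_exec _ hs a3
  have i1 : v1.r (wv 8) = i := by rw [a1.r _ (by simp [DecX]), hF.idx]
  have F1 : FillFr D.j v v1 :=
    hF.fr.trans (a1.mono (fun _ => Or.inl) fun _ h => h.elim)
  have hwt : (wtE md).eval v1 = wt md (i % D.N) := by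
    cases md
    · rfl
    · simp only [wtE, wt, if_true, Ex.eval_add, Ex.eval_mod, Ex.eval_v, Ex.eval_ofNat, i1]
      rw [(toPs v1 F1).1.N]
  have e1 : (Ex.v (tm 10) * wtE md).eval v1 = D.matA md b I (i / D.N) (i % D.N) := by
    rw [Ex.eval_mul, Ex.eval_v, a2, hwt, PD.matA]
    split_ifs <;> simp
  have l1 : D.matA md b I (i / D.N) (i % D.N) ≤ P.W := by
    have : D.N ≤ P.W := by have := ok.NN; nlinarith
    unfold PD.matA wt
    split_ifs <;> omega
  set v2 := v1.put (20, 0) i (D.matA md b I (i / D.N) (i % D.N)) with hv2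
  have F2 : FillFr D.j v v2 := F1.put (by simp) _ _
  have s2 : v2.Small P.W := s1.put l1
  obtain ⟨h2, h2n, h2A, h2b, h2I, h2J⟩ := toPs v2 F2
  have i2 : v2.r (wv 8) = i := i1
  obtain ⟨b1, b2, b3⟩ := cell_exec D ok.j ok.Q ok.m hW s2 h2 h2n (by rw [h2A]; exact hE.adj)
    (e := 1) (by norm_num) _ (.v (wv 8) / .v (pv 0)) (fun w F => hinvm v2 w F) (by
      rw [hmd v2 h2 i2]; exact hrow _ (by rw [h2J]; exact hJr) _ hm1)
  rw [hd v2 h2 i2, hmd v2 h2 i2, h2J, h2b] at b2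
  set v3 := (cell D.j 1 (.v (wv 8) % .v (pv 0)) (.v (wv 8) / .v (pv 0))).exec v2 with hv3
  have i3 : v3.r (wv 8) = i := by rw [b1.r _ (by simp [DecX]), i2]
  have e3 : v3.r (tm 10) = D.matB b J (i / D.N) (i % D.N) := b2
  have F3 : FillFr D.j v v3 :=
    F2.trans (b1.mono (fun _ => Or.inl) fun _ h => h.elim)
  have he : (fillBody D.j md).exec v' = v3.put (20, 1) i (D.matB b J (i / D.N) (i % D.N)) := by
    simp only [fillBody, SL.exec, ← hv1, e1, Ex.eval_v, i1, ← hv2, ← hv3, i3, e3]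
  rw [he]
  refine ⟨⟨by simp, (F3.put (by simp) _ _).set (by simp) _, fun c => ?_, fun c => ?_⟩, i3, ?_⟩
  · rw [St.set_a, St.put_a_ne _ _ _ _ _ (by simp), b1.a _ not_false, hv2, St.put_a]
    by_cases hc : c = i
    · subst hc; simp
    · rw [if_neg (by simp [hc]), a1.a _ not_false, hF.A]; simp only [show c < i + 1 ↔ c < i by omega]
  · rw [St.set_a, St.put_a]
    by_cases hc : c = i
    · subst hc; simp
    · rw [if_neg (by simp [hc]), b1.a _ not_false, hv2, St.put_a_ne _ _ _ _ _ (by simp), a1.a _ not_false, hF.B]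
      simp only [show c < i + 1 ↔ c < i by omega]
  · simp only [fillBody, SL.ok, SL.exec, ← hv1, e1, Ex.eval_v, i1, ← hv2, ← hv3, e3]
    refine ⟨a3, l1, b3, ?_⟩
    unfold PD.matB
    split_ifs <;> omega

theorem fill_tri (D : PD) (ok : D.Ok M P k) (md : Bool) {b I J : ℕ}
    (h : D.Holds v) (hE : Env D.n k D.G.Adj v) (hz : MMZero v) (hb : v.r (wv 3) = b)
    (hI : v.r (wv 4) = I) (hJ : v.r (wv 5) = J) (hIr : I < D.r) (hJr : J < D.r) :
    Tri P (forE (wv 8) (.v (pv 0) * .v (pv 0)) (fillBody D.j md).cmd) v (D.N * D.N * ((fillBody D.j md).cost + 40) + 40) 0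
      (FillInv D md b I J v (D.N * D.N)) := by
  have hS := ok.S
  refine (Tri.forE (x := wv 8) (b := .v (pv 0) * .v (pv 0)) (v := v) (e := 0)
    (T := (fillBody D.j md).cost) (D.N * D.N) (FillInv D md b I J v) (by simp; omega)
    ⟨by simp, (Fr.refl _ _ v).set (by simp) _, fun c => by simp [hz.1], fun c => by simp [hz.1]⟩ ok.NN
    (fun i v' h' => h'.idx) (fun i v' h' => ?_) (by omega) fun i v' hi h' hs => ?_).le le_rfl (by simp)
  · rw [Ex.eval_mul, Ex.eval_v, h'.fr.r _ (by simp [DecX]), h.N]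
  · obtain ⟨c1, c2, c3⟩ := fillBody_exec D ok md h hE hb hI hJ hIr hJr h' hi hs
    exact Tri.sl ((fillBody_size _ _).trans (by omega)) (fun _ => c3) fun _ => ⟨c2, c1⟩

def blk (M : MMProg) (j : ℕ) (md : Bool) (ob : Cmd) : Cmd := .seq (SL.seq (.asg (wv 3) (.v (wv 6) / (.v (pv 2) * .v (pv 2))))
      (.seq (.asg (wv 4) (.v (wv 6) % (.v (pv 2) * .v (pv 2)) / .v (pv 2)))
        (.asg (wv 5) (.v (wv 6) % (.v (pv 2) * .v (pv 2)) % .v (pv 2))))).cmd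
    (.seq (forE (wv 8) (.v (pv 0) * .v (pv 0)) (fillBody j md).cmd) (.seq (mmCore M.p (pv 0)) (.seq (forE (wv 8) (.v (pv 0) * .v (pv 0)) ob)
          (.seq (mmClean M.ρ (pv 0)) (SL.seq (.asg (wv 7) (.v (wv 7) + .v vTick + .v (pv 0) * .v (pv 0) + 1))
              (.asg (wv 6) (.v (wv 6) + 1))).cmd))))

/-- The invariant of a pass. -/
structure PInv (D : PD) (k : ℕ) (v : St) : Prop where
  holds : D.Holds v
  env : Env D.n k D.G.Adj v
  zero : MMZero v

def ObX (j : ℕ) (x : Var) : Prop := DecX j x ∨ x.1 = 7 ∨ x = wv 8 ∨ x = vC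
theorem ObX.psX {x : Var} (h : ObX j x) : PsX j x := by
  rcases h with h | h | rfl | rfl
  · exact h.psX
  all_goals simp [PsX, *]

def ObY (j : ℕ) (b : Var) : Prop := EmY b ∨ b = bCnt j

structure ObPre (D : PD) (k : ℕ) (md : Bool) (b I J : ℕ) (v v' : St) : Prop where
  holds : D.Holds v'
  env : Env D.n k D.G.Adj v'
  out : outs k v' = outs k v
  cnt : v'.a (bCnt D.j) = v.a (bCnt D.j)
  V : ∀ i, D.j ≤ i → v'.r (vV i) = v.r (vV i)
  hb : v'.r (wv 3) = b
  hI : v'.r (wv 4) = I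
  hJ : v'.r (wv 5) = J
  prod : ∀ u < D.N, ∀ y < D.N, v'.a (20, 2) (u * D.N + y) = ∑ z ∈ range D.N, D.matA md b I u z * D.matB b J z y

theorem mul_add_div_mod {N u y : ℕ} (h : y < N) : (u * N + y) / N = u ∧ (u * N + y) % N = y := by
  constructor
  · rw [mul_comm, Nat.mul_add_div (by omega), Nat.div_eq_of_lt h, add_zero]
  · rw [mul_comm, Nat.mul_add_mod, Nat.mod_eq_of_lt h]

theorem mul_add_lt_mul {N r u y : ℕ} (hu : u < r) (h : y < N) : u * N + y < r * N := by
  have : (u + 1) * N ≤ r * N := Nat.mul_le_mul_right _ hu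
  nlinarith

theorem blk_tri (M : MMProg) (j : ℕ) (md : Bool) (Cob : ℕ) : ∃ C, ∀ (D : PD) {P : Par} {k : ℕ}
    (_ : D.Ok M P k) (ob : Cmd) {v : St} {w s : ℕ} (Post : St → Prop), D.j = j → PInv D k v →
    v.r (wv 6) = w → v.r (wv 7) = s → s + M.μ D.N + D.N * D.N + 1 ≤ P.W → w + 1 ≤ P.W →
    (∀ v3 v4 : St, outs k v4 = outs k v3 → v4.a (bCnt j) = v3.a (bCnt j) → Post v3 → Post v4) →
    (∀ v2, v2.Small P.W → ObPre D k md (w / (D.r * D.r)) (w % (D.r * D.r) / D.r) (w % (D.r * D.r) % D.r) v v2 →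
      Tri P (forE (wv 8) (.v (pv 0) * .v (pv 0)) ob) v2 (Cob * (D.N * D.N + 1)) 0 fun v3 =>
        Fr (ObX j) (ObY j) v2 v3 ∧ Env D.n k D.G.Adj v3 ∧ Post v3) →
    ∃ Δ, 1 ≤ Δ ∧ Δ ≤ M.μ D.N + D.N * D.N + 1 ∧ Tri P (blk M j md ob) v (C * Δ) 0 fun v' =>
      PInv D k v' ∧ Fr (PsX j) (PsY j) v v' ∧ v'.r (wv 6) = w + 1 ∧ v'.r (wv 7) = s + Δ ∧ Post v' := by
  obtain ⟨Cc, hCc⟩ := mmClean_tri M.ρ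
  refine ⟨(fillBody j md).cost + Cob + Cc + 300, ?_⟩
  intro D P k ok ob v w s Post hj hI hw hs hsW hwW hPost hob
  subst hj
  set b := w / (D.r * D.r) with hb
  set I := w % (D.r * D.r) / D.r with hI'
  set J := w % (D.r * D.r) % D.r with hJ'
  have hr := ok.r
  have hS := ok.S
  have hrr : 0 < D.r * D.r := Nat.mul_pos hr hr
  have hIr : I < D.r := Nat.div_lt_of_lt_mul (Nat.mod_lt _ hrr)
  have hJr : J < D.r := Nat.mod_lt _ hr
  have hN := ok.N
  set p := (SL.seq (.asg (wv 3) (.v (wv 6) / (.v (pv 2) * .v (pv 2)))) (.seq (.asg (wv 4) (.v (wv 6) % (.v (pv 2) * .v (pv 2)) / .v (pv 2)))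
        (.asg (wv 5) (.v (wv 6) % (.v (pv 2) * .v (pv 2)) % .v (pv 2))))) with hp
  set v1 := ((v.set (wv 3) b).set (wv 4) I).set (wv 5) J with hv1
  have hpe : p.exec v = v1 := by simp [hp, SL.exec, hw, hI.holds.r, hv1, hb, hI', hJ']
  have t1 : Tri P p.cmd v p.cost 0 (· = v1) := by
    refine Tri.sl (by simp [hp, SL.size]; omega) (fun hv => ?_) fun _ => hpe
    have h6 := hv.1 (wv 6)
    rw [hw] at h6; simp only [hp, SL.ok, SL.exec, Ex.eval_div, Ex.eval_mul, Ex.eval_mod, Ex.eval_v, St.set_r, hw,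
      hI.holds.r, Prod.mk.injEq, and_false, if_false, Nat.reduceEqDiff]
    exact ⟨(Nat.div_le_self _ _).trans h6, ((Nat.div_le_self _ _).trans (Nat.mod_le _ _)).trans h6,
      ((Nat.mod_le _ _).trans (Nat.mod_le _ _)).trans h6⟩
  have F1 : Fr (·.1 = 10) (fun _ => False) v v1 :=
    (((Fr.refl (·.1 = 10) (fun _ => False) v).set (x := wv 3) rfl _).set (x := wv 4) rfl _).set (x := wv 5) rfl _
  have H1 : D.Holds v1 := hI.holds.of_fr (F1.mono (fun _ h => by simp [PsX, h]) fun _ h => h.elim)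
  have E1 : Env D.n k D.G.Adj v1 := hI.env.congr (F1.r _ (by simp)) (F1.r _ (by simp))
    (F1.r _ (by simp)) (F1.a _ not_false) (F1.a _ not_false) (F1.a _ not_false)
  have Z1 : MMZero v1 := ⟨fun b i => hI.zero.1 b i, fun r => by rw [F1.r _ (by simp), hI.zero.2]⟩
  have hv1b : v1.r (wv 3) = b := by simp [hv1]
  have hv1I : v1.r (wv 4) = I := by simp [hv1]
  have hv1J : v1.r (wv 5) = J := by simp [hv1]
  have t2 := fill_tri D ok md H1 E1 Z1 hv1b hv1I hv1J hIr hJr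
  let A : Matrix (Fin D.N) (Fin D.N) ℕ := fun u y => D.matA md b I u y
  let B : Matrix (Fin D.N) (Fin D.N) ℕ := fun y u => D.matB b J y u
  have hA : ∀ u y, A u y ≤ D.N := fun u y => by
    have := y.2
    simp only [A, PD.matA, wt]
    split_ifs <;> omega
  have hB : ∀ u y, B u y ≤ D.N := fun u y => by
    simp only [B, PD.matB]
    split_ifs <;> omega
  set n := M.ticks A B with hn
  have hnμ : n ≤ M.μ D.N := M.ticks_le hN A B hA hB
  have t3 : ∀ v2 : St, FillInv D md b I J v1 (D.N * D.N) v2 → Tri P (mmCore M.p (pv 0)) v2 (5 * n + 20) 0 fun v' => v'.r vTick = n ∧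
      Fr (fun x => x.1 = 21 ∨ x = vTick) (fun b => b.1 = 20 ∨ b.1 = 23) v2 v' ∧
      (∀ i j : Fin D.N, v'.a (20, 2) (i * D.N + j) = (A * B) i j) ∧ MMDirty M.ρ D.N v' := by
    intro v2 h2
    refine mmCore_tri M (by omega) hN A B hA hB ok.c (by have := ok.μ; omega) ?_ ?_ ?_ ?_ ?_ ?_
    · rw [h2.fr.r _ (by simp [DecX]), H1.N]
    · rw [h2.fr.r _ (by simp [DecX]), E1.one]
    · intro r; rw [h2.fr.r _ (by simp [DecX]), Z1.2]
    · funext c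
      rw [h2.A]
      by_cases hc : c < D.N * D.N
      · simp [flatten, hc, A]
      · simp [flatten, hc]
    · funext c
      rw [h2.B]
      by_cases hc : c < D.N * D.N
      · simp [flatten, hc, B]
      · simp [flatten, hc]
    · intro b i hb
      rw [h2.fr.a _ (by simp; omega), Z1.1]
  set q := (SL.seq (.asg (wv 7) (.v (wv 7) + .v vTick + .v (pv 0) * .v (pv 0) + 1)) (.asg (wv 6) (.v (wv 6) + 1))) with hq
  refine ⟨n + D.N * D.N + 1, by omega, by omega, ?_⟩
  refine (t1.seq (e' := 0) (T' := D.N * D.N * ((fillBody D.j md).cost + 40) + 40 + (5 * n + 20 +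
    (Cob * (D.N * D.N + 1) + (Cc * (D.N * D.N + n + 1) + q.cost + 1) + 1) + 1) + 1)
    fun v1' _ hv1' => ?_).le ?_ (by simp)
  swap
  · have : p.cost ≤ 100 := by rw [hp]; decide
    have : q.cost ≤ 50 := by rw [hq]; decide
    generalize (fillBody D.j md).cost = x at *
    generalize D.N * D.N = y at *
    nlinarith [Nat.zero_le (x * n), Nat.zero_le (Cob * n)]
  subst hv1'
  refine (t2.seq (e' := 0) fun v2 _ h2 => (t3 v2 h2).seq (e' := 0) fun v3 hv3 ⟨k1, k2, k3, k4⟩ => ?_).le le_rfl (by simp)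
  have F2 : Fr (PsX D.j) (fun b => b.1 = 20 ∨ b.1 = 23) v v2 := by
    refine (F1.mono (fun _ h => by simp [PsX, h]) fun _ h => h.elim).trans (h2.fr.mono (fun x hx => ?_) fun b hb => ?_)
    · exact hx.elim DecX.psX fun h => by simp [PsX, h]
    · rcases hb with rfl | rfl <;> simp
  have F3 : Fr (PsX D.j) (fun b => b.1 = 20 ∨ b.1 = 23) v v3 := by
    refine F2.trans (k2.mono (fun x hx => ?_) fun _ h => h)
    rcases hx with hx | rfl <;> simp [PsX, *]
  have toY : ∀ b : Var, b.1 = 20 ∨ b.1 = 23 → PsY D.j b := fun b h => by rcases h with h | h <;> simp [PsY, h]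
  have H3 : D.Holds v3 := hI.holds.of_fr (F3.mono (fun _ h => h) toY)
  have hC2 : v2.r vC = v.r vC := by rw [h2.fr.r _ (by simp [DecX]), F1.r _ (by simp)]
  have hC3 : v3.r vC = v.r vC := by rw [k2.r _ (by simp), hC2]
  have E3 : Env D.n k D.G.Adj v3 := hI.env.congr (F3.r _ (by simp [PsX])) (F3.r _ (by simp [PsX]))
    hC3 (F3.a _ (by simp)) (F3.a _ (by simp)) (F3.a _ (by simp))
  have pre : ObPre D k md b I J v v3 := by
    refine ⟨H3, E3, outs_congr hC3 (F3.a _ (by simp)), F3.a _ (by simp; omega), fun i hi => ?_, ?_, ?_, ?_, fun u hu y hy => ?_⟩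
    · exact F3.r _ (by simp [PsX]; omega)
    · rw [k2.r _ (by simp), h2.fr.r _ (by simp [DecX]), hv1b]
    · rw [k2.r _ (by simp), h2.fr.r _ (by simp [DecX]), hv1I]
    · rw [k2.r _ (by simp), h2.fr.r _ (by simp [DecX]), hv1J]
    · have := k3 ⟨u, hu⟩ ⟨y, hy⟩
      simp only at this; rw [this, Matrix.mul_apply, Finset.sum_range fun z => D.matA md b I u z * D.matB b J z y]
  refine ((hob v3 hv3 pre).seq (e' := 0) fun v4 _ ⟨l1, l2, l3⟩ => Tri.seq (e' := 0)
    (hCc (N := D.N) (n := n) (x := pv 0) (by omega) (by simp) ?_ ?_ ok.NN ?_ ?_)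
    (Q := fun v' => PInv D k v' ∧ Fr (PsX D.j) (PsY D.j) v v' ∧ v'.r (wv 6) = w + 1 ∧
      v'.r (wv 7) = s + (n + D.N * D.N + 1) ∧ Post v') (T' := q.cost)
    fun v5 _ ⟨m1, m2⟩ => ?_).le le_rfl (by simp)
  · rw [l1.r _ (by simp [ObX, DecX]), H3.N]
  · rw [l1.r _ (by simp [ObX, DecX]), k1]
  · have := ok.μ; omega
  · refine ⟨fun r hr => ?_, fun b i hb => ?_, fun b i hb => ?_⟩
    · rw [l1.r _ (by simp [ObX, DecX]), k4.reg r hr]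
    · rw [l1.a _ (by simp [ObY, EmY]; omega), k4.mem b i hb]
    · rw [l1.a _ (by simp [ObY, EmY]; omega)] at hb
      rw [l1.r _ (by simp [ObX, DecX]), l1.a _ (by simp [ObY, EmY]; omega)]
      exact k4.log b i hb
  · have F5 : Fr (PsX D.j) (PsY D.j) v v5 := by
      refine (F3.mono (fun _ h => h) toY).trans ((l1.mono (fun x hx => ?_) fun b hb => ?_).trans
        (m2.mono (fun x hx => ?_) fun b hb => Or.inl hb))
      · exact hx.psX
      · rcases hb with hb | hb <;> simp [PsY, hb]
      · rcases hx with hx | rfl <;> simp [PsX, *]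
    have h6 : v5.r (wv 6) = w := by
      rw [m2.r _ (by simp), l1.r _ (by simp [ObX, DecX]), k2.r _ (by simp), h2.fr.r _ (by simp [DecX]), ← hw]
      simp [hv1]
    have h7 : v5.r (wv 7) = s := by
      rw [m2.r _ (by simp), l1.r _ (by simp [ObX, DecX]), k2.r _ (by simp), h2.fr.r _ (by simp [DecX]), ← hs]
      simp [hv1]
    have ht : v5.r vTick = n := by rw [m2.r _ (by simp), l1.r _ (by simp [ObX, DecX]), k1]
    have hN5 : v5.r (pv 0) = D.N := (hI.holds.of_fr F5).N
    have e : q.exec v5 = (v5.set (wv 7) (s + (n + D.N * D.N + 1))).set (wv 6) (w + 1) := by simp [hq, SL.exec, h6, h7, ht, hN5, add_assoc]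
    refine Tri.sl (by simp [hq, SL.size]; omega) (fun _ => ?_) fun _ => ?_
    · simp [hq, SL.ok, SL.exec, h6, h7, ht, hN5]; omega
    · rw [e]
      have F6 : Fr (PsX D.j) (PsY D.j) v ((v5.set (wv 7) (s + (n + D.N * D.N + 1))).set (wv 6) (w + 1)) :=
        (F5.set (by simp [PsX]) _).set (by simp [PsX]) _
      have C5 : v5.r vC = v4.r vC := m2.r _ (by simp)
      refine ⟨⟨hI.holds.of_fr F6, ?_, ⟨m1.1, fun r => ?_⟩⟩, F6, by simp, by simp, ?_⟩
      · refine l2.congr ?_ ?_ ?_ ?_ ?_ ?_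
        · simp [m2.r]
        · simp [m2.r]
        · simp [m2.r]
        · simp [m2.a]
        · simp [m2.a]
        · simp [m2.a]
      · simp [m1.2]
      · refine hPost v4 _ (outs_congr ?_ ?_) ?_ l3
        · simp [m2.r]
        · simp [m2.a]
        · simp only [St.set_a]
          exact m2.a _ (by simp; omega)

/-! ### Passes -/

theorem outs_set {x : Var} (hx : x ≠ vC) (n : ℕ) : outs k (v.set x n) = outs k v := outs_congr (by rw [St.set_r, if_neg hx.symm]) rfl

theorem Env.set {A : ℕ → ℕ → Prop} (h : Env n k A v) {x : Var} (hx : x.1 ≠ 0)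
    (hx' : x.1 ≠ 1 ∨ x.2 ≠ 0) (hx'' : x.1 ≠ 22) (c : ℕ) : Env n k A (v.set x c) := by
  refine h.congr ?_ ?_ ?_ rfl rfl rfl
  · rw [St.set_r, if_neg]; rintro rfl; simp at hx'
  · rw [St.set_r, if_neg]; rintro rfl; simp at hx''
  · rw [St.set_r, if_neg]; rintro rfl; simp at hx

def PD.blocks (D : PD) : ℕ := D.Q / D.N * (D.r * D.r)

/-- Process all blocks, as long as the time budget is not exceeded. -/
def pass (M : MMProg) (j : ℕ) (md : Bool) (ob : Cmd) : Cmd := .seq (SL.seq (.asg (wv 6) 0) (.asg (wv 7) 0)).cmd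
    (whileE (.lt (.v (wv 6)) (.v (lv j 4) / .v (pv 0) * (.v (pv 2) * .v (pv 2))) * .lt (.v (wv 7)) (.v (lv j 1))) (blk M j md ob))

theorem PInv.of_fr (h : PInv D k v) (F : Fr (fun x => x.1 = 7 ∨ x.1 = 10) (fun b => b = bCnt D.j) v v') : PInv D k v' := by
  refine ⟨h.holds.of_fr (F.mono (fun x hx => ?_) fun x hx => by simp [PsY, hx]), h.env.congr ?_ ?_ ?_ ?_ ?_ ?_, fun b i => ?_, fun r => ?_⟩
  · rcases hx with hx | hx <;> simp [PsX, hx]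
  iterate 3 rw [F.r _ (by simp)]
  iterate 3 exact F.a _ (by simp only [Prod.mk.injEq]; omega)
  · rw [F.a _ (by simp only [Prod.mk.injEq]; omega), h.zero.1]
  · rw [F.r _ (by simp), h.zero.2]

theorem pass_tri (M : MMProg) (j : ℕ) (md : Bool) (Cob : ℕ) : ∃ C, ∀ (D : PD) {P : Par} {k : ℕ}
    (_ : D.Ok M P k) (ob : Cmd) {v : St} {τ μG : ℕ} (K : ℕ → St → Prop), D.j = j → PInv D k v →
    v.r (lv j 1) = τ → M.μ D.N + D.N * D.N + 1 ≤ μG → τ + μG ≤ P.W → D.blocks + 1 ≤ P.W →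
    (∀ w v3 v4, outs k v4 = outs k v3 → v4.a (bCnt j) = v3.a (bCnt j) → K w v3 → K w v4) → K 0 v →
    (∀ w v1 v2, w < D.blocks → K w v1 → Fr (PsX j) (PsY j) v v1 → v2.Small P.W →
      ObPre D k md (w / (D.r * D.r)) (w % (D.r * D.r) / D.r) (w % (D.r * D.r) % D.r) v1 v2 →
      Tri P (forE (wv 8) (.v (pv 0) * .v (pv 0)) ob) v2 (Cob * (D.N * D.N + 1)) 0 fun v3 =>
        Fr (ObX j) (ObY j) v2 v3 ∧ Env D.n k D.G.Adj v3 ∧ K (w + 1) v3) →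
    Tri P (pass M j md ob) v (C * (τ + μG)) 0 fun v' =>
      PInv D k v' ∧ Fr (PsX j) (PsY j) v v' ∧ v'.r (wv 6) ≤ D.blocks ∧ K (v'.r (wv 6)) v' ∧
      (D.blocks * (M.μ D.N + D.N * D.N + 1) ≤ τ → v'.r (wv 6) = D.blocks) := by
  obtain ⟨C, hC⟩ := blk_tri M j md Cob
  set g : Ex := .lt (.v (wv 6)) (.v (lv j 4) / .v (pv 0) * (.v (pv 2) * .v (pv 2))) * .lt (.v (wv 7)) (.v (lv j 1)) with hg
  have hgc : g.cost = 25 := rfl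
  refine ⟨C + 100, ?_⟩
  intro D P k ok ob v τ μG K hj hI hτ hμ hτW hbW hK hK0 hob
  subst hj
  have hS := ok.S
  set v0 := (v.set (wv 6) 0).set (wv 7) 0 with hv0
  let I : St → Prop := fun v' => PInv D k v' ∧ Fr (PsX D.j) (PsY D.j) v v' ∧
    v'.r (wv 6) ≤ D.blocks ∧ K (v'.r (wv 6)) v' ∧ v'.r (wv 7) ≤ τ + μG ∧
    v'.r (wv 7) ≤ v'.r (wv 6) * (M.μ D.N + D.N * D.N + 1)
  have F0 : Fr (fun x => x.1 = 7 ∨ x.1 = 10) (fun b => b = bCnt D.j) v v0 :=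
    ((Fr.refl _ _ v).set (x := wv 6) (by simp) _).set (x := wv 7) (by simp) _
  have I0 : I v0 := by
    refine ⟨hI.of_fr F0, F0.mono (fun x hx => ?_) fun x hx => by simp [PsY, hx], by simp [hv0], ?_, by simp [hv0], by simp [hv0]⟩
    · rcases hx with hx | hx <;> simp [PsX, hx]
    · rw [show v0.r (wv 6) = 0 by simp [hv0]]
      exact hK 0 v v0 (outs_congr (by simp [hv0]) (by simp [hv0])) (by simp [hv0]) hK0
  have hgv : ∀ v', I v' → (g.eval v' ≠ 0 ↔ v'.r (wv 6) < D.blocks ∧ v'.r (wv 7) < τ) := by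
    rintro v' ⟨h1, h2, -⟩
    have hτ' : v'.r (lv D.j 1) = τ := by rw [h2.r _ (by simp [PsX]; omega), hτ]
    simp only [hg, Ex.eval_mul, Ex.eval_lt, Ex.eval_div, Ex.eval_v, h1.holds.Q, h1.holds.N, h1.holds.r, hτ', PD.blocks]
    split_ifs <;> simp [*]
  have key := Tri.whileE (P := P) (c := blk M D.j md ob) (x := g) (v := v0)
    (fun v' => (C + 40) * (τ + μG - v'.r (wv 7))) (fun _ => 0) I (Q := fun v' =>
      PInv D k v' ∧ Fr (PsX D.j) (PsY D.j) v v' ∧ v'.r (wv 6) ≤ D.blocks ∧ K (v'.r (wv 6)) v' ∧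
      (D.blocks * (M.μ D.N + D.N * D.N + 1) ≤ τ → v'.r (wv 6) = D.blocks))
    (by simp [hg]; omega) I0 ?_ ?_
  · refine ((Tri.sl (P := P) (v := v) (Q := (· = v0))
      (by simp [SL.size]; omega) (fun _ => by simp [SL.ok]) fun _ => rfl).seq fun v' _ h' => by
      subst h'; exact key).le ?_ (by simp)
    rw [show v0.r (wv 7) = 0 by simp [hv0], hgc, Nat.sub_zero]
    change 7 + _ + 1 ≤ _; nlinarith
  · rintro v' hI' hs hz
    obtain ⟨h1, h2⟩ := (hgv v' hI').1 hz
    obtain ⟨i1, i2, i3, i4, i5, i6⟩ := hI'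
    obtain ⟨Δ, hΔ1, hΔ, ht⟩ := hC D ok ob (K (v'.r (wv 6) + 1)) rfl i1 rfl rfl (by omega) (by omega)
      (fun v3 v4 => hK _ v3 v4) fun v2 hs2 hp => hob _ v' v2 h1 i4 i2 hs2 hp
    obtain ⟨d, hd⟩ := exists_eq_add_of_le (show v'.r (wv 7) + Δ ≤ τ + μG by omega)
    have e1 : τ + μG - v'.r (wv 7) = Δ + d := by omega
    refine ⟨C * Δ, 0, ?_, le_rfl, ht.post ?_⟩
    · simp only [e1, hgc]; nlinarith
    · rintro v'' - ⟨j1, j2, j3, j4, j5⟩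
      refine ⟨⟨j1, i2.trans j2, by omega, by rwa [j3], by omega, ?_⟩, ?_, le_rfl⟩
      · rw [j3, j4]; nlinarith
      · have e2 : τ + μG - (v'.r (wv 7) + Δ) = d := by omega
        simp only [e1, hgc, j4, e2]; nlinarith
  · intro v' hI' hs hz
    have h1 := mt (hgv v' hI').2 (not_not.2 hz)
    obtain ⟨i1, i2, i3, i4, i5, i6⟩ := hI'
    refine ⟨i1, i2, i3, i4, fun hc => ?_⟩
    by_contra hne
    have h2 : v'.r (wv 6) < D.blocks := by omega
    have h3 : τ ≤ v'.r (wv 7) := by by_contra h; exact h1 ⟨h2, by omega⟩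
    have h4 : (v'.r (wv 6) + 1) * (M.μ D.N + D.N * D.N + 1) ≤ τ := (Nat.mul_le_mul_right _ h2).trans hc
    nlinarith

/-! ### Listing passes -/

namespace PD
variable (D : PD)

/-- The tuple of a candidate together with the vertices `V j, V (j + 1), …` that have been chosen. -/
def full (V : ℕ → ℕ) (row col x i : ℕ) : ℕ := if i < D.j then D.tup row col x i else V i

/-- The candidate is output if it is a clique. -/
def Emitted (k : ℕ) (V : ℕ → ℕ) (row col x : ℕ) (l : List (Finset ℕ)) : Prop :=
  (∀ b < k, ∀ a < b, D.G.Adj (D.full V row col x a) (D.full V row col x b)) → (range k).image (D.full V row col x) ∈ l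

/-- The code is the only one in its block that gives a clique with `row` and `col`. -/
def Isol (row col b z : ℕ) : Prop := D.clq row col (D.code b z) ∧ ∀ z' < D.N, z' ≠ z → ¬ D.clq row col (D.code b z')

theorem Emitted.congr {V V' : ℕ → ℕ} {row col x : ℕ} {l : List (Finset ℕ)} (h : D.Emitted k V row col x l)
    (hV : ∀ i, D.j ≤ i → V i = V' i) : D.Emitted k V' row col x l := by
  have e : D.full V row col x = D.full V' row col x := funext fun i => ite_congr rfl (fun _ => rfl) fun h => hV i (not_lt.1 h)
  rwa [PD.Emitted, ← e]

theorem prod_of_isol (hj : 2 ≤ D.j) {b I J u y z : ℕ} (hz : z < D.N) (h : D.Isol (I * D.N + u) (J * D.N + y) b z) :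
    ∑ z ∈ range D.N, D.matA true b I u z * D.matB b J z y = z + 1 := by
  have hA := ((D.clq_iff hj _ _ _).1 h.1)
  rw [Finset.sum_eq_single z]
  · rw [matA, if_pos hA.1, matB, if_pos hA.2.1]; simp [wt]
  · intro z' hz' hne
    have := mt (D.clq_iff hj _ _ _).2 (h.2 z' (mem_range.1 hz') hne)
    unfold matA matB
    split_ifs with h1 h2
    · exact absurd ⟨h1, h2, hA.2.2⟩ this
    all_goals simp
  · intro h'; exact absurd (mem_range.2 hz) h'

end PD

/-- Output the candidate that belongs to the entry `wv 8` of the product. -/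
def listBody (j k : ℕ) : Cmd := .seq (SL.seq (dec j (.ld (20, 2) (.v (wv 8)) - 1))
    (.seq (.asg (vV 0) (.ld (bL j) (.v (wv 4) * .v (pv 0) + .v (wv 8) / .v (pv 0))))
      (.asg (vV 1) (.ld (bL j) (.v (wv 5) * .v (pv 0) + .v (wv 8) % .v (pv 0)))))).cmd (emit k).cmd

theorem listBody_tri (j k : ℕ) : ∃ C, ∀ (D : PD) {M : MMProg} {P : Par} (_ : D.Ok M P k) {b I J : ℕ} {v v2 : St},
    D.j = j → (∀ i, j ≤ i → i < k → v.r (vV i) < D.n) → ObPre D k true b I J v v2 →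
    Tri P (forE (wv 8) (.v (pv 0) * .v (pv 0)) (listBody j k)) v2 (C * (D.N * D.N + 1)) 0 fun v3 =>
      Fr (ObX j) EmY v2 v3 ∧ Env D.n k D.G.Adj v3 ∧ outs k v ⊆ outs k v3 ∧
      ∀ u < D.N, ∀ y < D.N, ∀ z < D.N, D.Isol (I * D.N + u) (J * D.N + y) b z →
        D.Emitted k (fun i => v.r (vV i)) (I * D.N + u) (J * D.N + y) (D.code b z) (outs k v3) := by
  set p := (SL.seq (dec j (.ld (20, 2) (.v (wv 8)) - 1)) (.seq (.asg (vV 0) (.ld (bL j) (.v (wv 4) * .v (pv 0) + .v (wv 8) / .v (pv 0))))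
      (.asg (vV 1) (.ld (bL j) (.v (wv 5) * .v (pv 0) + .v (wv 8) % .v (pv 0)))))) with hp
  refine ⟨p.cost + (emit k).cost + 100, ?_⟩
  intro D M P ok b I J v v2 hj hV pre
  subst hj
  have hS := ok.S
  have hj3 := ok.j
  have hps : p.size ≤ 10 := by
    have := dec_size D.j (.ld (20, 2) (.v (wv 8)) - 1)
    simp only [hp, SL.size, Ex.size_mod, Ex.size_mul, Ex.size_v, Ex.size_div, Ex.size_ld, Ex.size_add,
      Ex.size_sub, Ex.size_ofNat, sup_le_iff] at *
    omega
  let K : ℕ → St → Prop := fun i v' => v'.r (wv 8) = i ∧ Fr (ObX D.j) EmY v2 v' ∧ Env D.n k D.G.Adj v' ∧ outs k v ⊆ outs k v' ∧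
      ∀ u < D.N, ∀ y < D.N, ∀ z < D.N, u * D.N + y < i → D.Isol (I * D.N + u) (J * D.N + y) b z →
        D.Emitted k (fun i => v.r (vV i)) (I * D.N + u) (J * D.N + y) (D.code b z) (outs k v')
  have F0 : Fr (ObX D.j) EmY v2 (v2.set (wv 8) 0) := (Fr.refl _ _ _).set (by simp [ObX]) _
  have t := Tri.forE (x := wv 8) (b := .v (pv 0) * .v (pv 0)) (v := v2) (e := 0)
    (T := p.cost + (emit k).cost + 1) (c := listBody D.j k) (D.N * D.N) K (by simp; omega)
    ⟨by simp, F0, pre.env.set (by simp) (by simp) (by simp) _, by rw [outs_set (by simp), pre.out]; exact fun _ h => h, by simp⟩ ok.NN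
    (fun i v' h' => h'.1) (fun i v' h' => ?_) (by omega) fun i v' hi h' hs => ?_
  · refine t.mono ?_ (by simp) fun v3 _ h => ⟨h.2.1, h.2.2.1, h.2.2.2.1, fun u hu y hy z hz hI =>
      h.2.2.2.2 u hu y hy z hz (mul_add_lt_mul hu hy) hI⟩
    rw [show forCost (.v (pv 0) * .v (pv 0)) = 40 from rfl]; nlinarith
  · rw [Ex.eval_mul, Ex.eval_v, h'.2.1.r _ (by simp [ObX, DecX]), pre.holds.N]
  · obtain ⟨h8, hF, hE, hO, hD⟩ := h'
    have hH : D.Holds v' := pre.holds.of_fr (hF.mono (fun _ h => h.psX) fun x hx => by simp [PsY, hx])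
    obtain ⟨a1, a2, -, a4⟩ := dec_exec D (by omega) ok.Q hs hH (.ld (20, 2) (.v (wv 8)) - 1)
    set v1 := (dec D.j (.ld (20, 2) (.v (wv 8)) - 1)).exec v' with hv1
    have e0 : (Ex.ld (20, 2) (.v (wv 8)) - 1).eval v' = v2.a (20, 2) i - 1 := by
      rw [Ex.eval_sub, Ex.eval_ld, Ex.eval_v, h8, hF.a _ (by simp only [EmY, Prod.mk.injEq]; omega)]; rfl
    have h3 : v'.r (wv 3) = b := by rw [hF.r _ (by simp [ObX, DecX]), pre.hb]
    rw [e0, h3] at a2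
    set x := D.code b (v2.a (20, 2) i - 1) with hx
    set row := I * D.N + i / D.N with hrow
    set col := J * D.N + i % D.N with hcol
    have hL1 : v1.a (bL D.j) = D.L := by rw [a1.a _ not_false, hH.L]
    have e1 : (Ex.ld (bL D.j) (.v (wv 4) * .v (pv 0) + .v (wv 8) / .v (pv 0))).eval v1 = D.L row := by
      simp only [Ex.eval_ld, Ex.eval_add, Ex.eval_mul, Ex.eval_div, Ex.eval_v, hL1]
      rw [a1.r (wv 4) (by simp [DecX]), a1.r (wv 8) (by simp [DecX]), a1.r (pv 0) (by simp [DecX]), h8, hH.N,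
        hF.r (wv 4) (by simp [ObX, DecX]), pre.hI]
    set v3 := v1.set (vV 0) (D.L row) with hv3
    have e2 : (Ex.ld (bL D.j) (.v (wv 5) * .v (pv 0) + .v (wv 8) % .v (pv 0))).eval v3 = D.L col := by
      simp only [Ex.eval_ld, Ex.eval_add, Ex.eval_mul, Ex.eval_mod, Ex.eval_v, hv3, St.set_a, hL1]
      rw [St.set_ne (by simp), St.set_ne (by simp), St.set_ne (by simp)]
      rw [a1.r (wv 5) (by simp [DecX]), a1.r (wv 8) (by simp [DecX]), a1.r (pv 0) (by simp [DecX]), h8, hH.N,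
        hF.r (wv 5) (by simp [ObX, DecX]), pre.hJ]
    set v4 := v3.set (vV 1) (D.L col) with hv4
    have he : p.exec v' = v4 := by simp only [hp, SL.exec, ← hv1, e1, ← hv3, e2, ← hv4]
    have F4 : Fr (DecX D.j) (fun _ => False) v' v4 :=
      (a1.set (x := vV 0) (by simp [DecX]; omega) _).set (x := vV 1) (by simp [DecX]; omega) _
    have hlow : ∀ c, D.L c ≤ P.W := fun c => by rw [← hH.L]; exact hs.2 _ _
    have hV4 : ∀ i < k, v4.r (vV i) = D.full (fun i => v.r (vV i)) row col x i := fun i' hi' => by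
      unfold PD.full
      split_ifs with hij
      · rcases Nat.lt_or_ge i' 2 with h2 | h2
        · rcases (show i' = 0 ∨ i' = 1 by omega) with rfl | rfl
          · simp [hv4, hv3, PD.tup]
          · simp [hv4, PD.tup]
        · rw [hv4, St.set_ne (by simp; omega), hv3, St.set_ne (by simp; omega), a2 i' h2 hij row col]
      · rw [F4.r _ (by simp [DecX]; omega), hF.r _ (by simp [ObX, DecX]; omega), pre.V _ (by omega)]
    have hVn : ∀ i < k, v4.r (vV i) < D.n := fun i' hi' => by
      rw [hV4 i' hi', PD.full]
      split_ifs with hij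
      · exact hH.lt _
      · exact hV i' (by omega) hi'
    have E4 : Env D.n k D.G.Adj v4 := hE.congr (F4.r _ (by simp [DecX])) (F4.r _ (by simp [DecX]))
      (F4.r _ (by simp [DecX])) (F4.a _ not_false) (F4.a _ not_false) (F4.a _ not_false)
    have O4 : outs k v4 = outs k v' := outs_congr (F4.r _ (by simp [DecX])) (F4.a _ not_false)
    refine ((Tri.sl (P := P) (p := p) (v := v') (Q := (· = v4)) (hps.trans (by omega)) (fun _ => ?_) fun _ => he).seq fun v5 _ h5 => by
        subst h5; exact emit_tri (by omega) ok.W E4 hVn).mono le_rfl (by simp) ?_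
    · simp only [hp, SL.ok, SL.exec, ← hv1, e1, ← hv3, e2]
      exact ⟨a4, hlow _, hlow _⟩
    · rintro v5 - ⟨c1, c2, c3, c4⟩
      have F5 : Fr (ObX D.j) EmY v2 v5 := by
        refine hF.trans ((F4.mono (fun _ h => Or.inl h) fun _ h => h.elim).trans (c2.mono (fun x hx => ?_) fun b hb => hb))
        rcases hx with rfl | rfl | rfl <;> simp [ObX]
      have O5 : outs k v' ⊆ outs k v5 := by rw [← O4]; exact c3
      refine ⟨by rw [c2.r _ (by simp [EmX]), F4.r _ (by simp [DecX]), h8], by simp, F5.set (by simp [ObX]) _,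
        c1.set (by simp) (by simp) (by simp) _, ?_, ?_⟩
      · rw [outs_set (by simp)]; exact fun _ h => O5 (hO h)
      · rw [outs_set (by simp)]
        intro u hu y hy z hz hlt hI hA
        rcases lt_succ_iff_lt_or_eq.1 hlt with h | h
        · exact O5 (hD u hu y hy z hz h hI hA)
        · have hdm := mul_add_div_mod (u := u) hy
          rw [h] at hdm
          have hxz : x = D.code b z := by rw [hx, ← h, pre.prod u hu y hy, D.prod_of_isol (by omega) hz hI]; rfl
          rw [← hdm.1, ← hdm.2] at hA ⊢; rw [← hrow, ← hcol, ← hxz] at hA ⊢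
          have := c4 fun b hb a ha => by rw [hV4 a (by omega), hV4 b hb]; exact hA b hb a ha
          rwa [image_congr (g := D.full (fun i => v.r (vV i)) row col x) fun i hi => hV4 i (by simpa using hi)] at this

theorem listPass_tri (M : MMProg) (j k : ℕ) : ∃ C, ∀ (D : PD) {P : Par} (_ : D.Ok M P k) {v : St}
    {τ μG : ℕ}, D.j = j → PInv D k v → (∀ i, j ≤ i → i < k → v.r (vV i) < D.n) → D.m ≤ D.r * D.N →
    v.r (lv j 1) = τ → M.μ D.N + D.N * D.N + 1 ≤ μG → τ + μG ≤ P.W → D.blocks + 1 ≤ P.W →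
    Tri P (pass M j true (listBody j k)) v (C * (τ + μG)) 0 fun v' =>
      PInv D k v' ∧ Fr (PsX j) (PsY j) v v' ∧ v'.a (bCnt j) = v.a (bCnt j) ∧ outs k v ⊆ outs k v' ∧
      (D.blocks * (M.μ D.N + D.N * D.N + 1) ≤ τ → v'.r (wv 6) = D.blocks) ∧
      (v'.r (wv 6) = D.blocks → ∀ row col b z, b < D.Q / D.N → z < D.N → D.Isol row col b z →
        D.Emitted k (fun i => v.r (vV i)) row col (D.code b z) (outs k v')) := by
  obtain ⟨Cob, hCob⟩ := listBody_tri j k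
  obtain ⟨C, hC⟩ := pass_tri M j true Cob
  refine ⟨C, ?_⟩
  intro D P ok v τ μG hj hI hV hm hτ hμ hτW hbW
  let K : ℕ → St → Prop := fun w v' => (v'.a (bCnt j) = v.a (bCnt j) ∧ outs k v ⊆ outs k v') ∧ ∀ w' < w, ∀ u < D.N, ∀ y < D.N, ∀ z < D.N,
    D.Isol (w' % (D.r * D.r) / D.r * D.N + u) (w' % (D.r * D.r) % D.r * D.N + y) (w' / (D.r * D.r)) z →
    D.Emitted k (fun i => v.r (vV i)) (w' % (D.r * D.r) / D.r * D.N + u)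
      (w' % (D.r * D.r) % D.r * D.N + y) (D.code (w' / (D.r * D.r)) z) (outs k v')
  refine (hC D ok (listBody j k) K hj hI hτ hμ hτW hbW (fun w v3 v4 h3 h4 h => ?_) ⟨⟨rfl, fun _ h => h⟩, by simp⟩
    fun w v1 v2 hw hK hF hs pre => ?_).post ?_
  · exact ⟨by rw [h3, h4]; exact h.1, by rw [h3]; exact h.2⟩
  · have hVV : ∀ i, j ≤ i → v1.r (vV i) = v.r (vV i) := fun i hi => hF.r _ (by simp [PsX]; omega)
    refine (hCob D ok hj (fun i hi hik => by rw [hVV i hi]; exact hV i hi hik) pre).post ?_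
    rintro v3 - ⟨g1, g2, g3, g4⟩
    refine ⟨g1.mono (fun _ h => h) fun _ h => Or.inl h, g2, ⟨?_, fun _ h => g3 (hK.1.2 h)⟩, fun w' hw' u hu y hy z hz hI hA => ?_⟩
    · subst hj
      rw [g1.a _ (by simp only [EmY, Prod.mk.injEq]; omega), pre.cnt, hK.1.1]
    rcases lt_succ_iff_lt_or_eq.1 hw' with h | rfl
    · exact g3 (hK.2 w' h u hu y hy z hz hI hA)
    · exact PD.Emitted.congr D (g4 u hu y hy z hz hI) (fun i hi => hVV i (hj ▸ hi)) hA
  · rintro v' - ⟨g1, g2, g3, g4, g5⟩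
    refine ⟨g1, g2, g4.1.1, g4.1.2, g5, fun hw row col b z hb hz hI => ?_⟩
    have hN := ok.N
    have hI1 : row / D.N < D.r := Nat.div_lt_of_lt_mul (hI.1.1.trans_le (hm.trans_eq (mul_comm _ _)))
    have hJ1 : col / D.N < D.r := Nat.div_lt_of_lt_mul (hI.1.2.1.trans_le (hm.trans_eq (mul_comm _ _)))
    have hlt : row / D.N * D.r + col / D.N < D.r * D.r := mul_add_lt_mul hI1 hJ1
    obtain ⟨d1, d2⟩ := mul_add_div_mod (u := b) hlt
    obtain ⟨d3, d4⟩ := mul_add_div_mod (u := row / D.N) hJ1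
    have := g4.2 (b * (D.r * D.r) + (row / D.N * D.r + col / D.N)) (by
      rw [hw, PD.blocks]; exact mul_add_lt_mul hb hlt) (row % D.N) (Nat.mod_lt _ hN) (col % D.N)
      (Nat.mod_lt _ hN) z hz
    rw [d1, d2, d3, d4, Nat.div_add_mod', Nat.div_add_mod'] at this; exact this hI

/-! ### Counting passes -/

namespace PD
variable (D : PD)

open Classical in
/-- The number of codes below `q` that give a clique with `row` and `col`. -/
def cntUpTo (q row col : ℕ) : ℕ := ∑ x ∈ range q, if D.clq row col x then 1 else 0

theorem cntUpTo_le (q row col : ℕ) : D.cntUpTo q row col ≤ q := by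
  classical
  rw [cntUpTo, ← card_filter]
  exact (card_filter_le _ _).trans (by simp)

theorem code_eq (ha : D.a = 1) (hQ : D.N ∣ D.Q) {b z : ℕ} (hb : b < D.Q / D.N) (hz : z < D.N) : D.code b z = b * D.N + z := by
  rw [code, ha, one_mul, Nat.mod_eq_of_lt]
  have := mul_add_lt_mul hb hz
  rwa [Nat.div_mul_cancel hQ] at this

open Classical in
theorem cntUpTo_succ (hj : 2 ≤ D.j) (ha : D.a = 1) (hQ : D.N ∣ D.Q) {b u y : ℕ} (hb : b < D.Q / D.N) :
    D.cntUpTo ((b + 1) * D.N) u y = D.cntUpTo (b * D.N) u y + (∑ z ∈ range D.N, D.matA false b 0 u z * D.matB b 0 z y) *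
        if D.G.Adj (D.L u) (D.L y) then 1 else 0 := by
  rw [cntUpTo, add_mul, one_mul, Finset.sum_range_add, cntUpTo, sum_mul]
  congr 1
  refine sum_congr rfl fun z hz => ?_
  have hc := D.code_eq ha hQ hb (mem_range.1 hz)
  have := D.clq_iff hj u y (b * D.N + z)
  simp only [matA, matB, hc, zero_mul, zero_add, this, wt]
  by_cases h1 : D.star 0 u (b * D.N + z) <;> by_cases h2 : D.star 1 y (b * D.N + z) <;>
    by_cases h3 : D.G.Adj (D.L u) (D.L y) <;> simp [h1, h2, h3]

end PD

/-- Add the number of cliques in a block to the counter with index `wv 8`. -/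
def countBody (j : ℕ) : SL := .sto (bCnt j) (.v (wv 8)) (.ld (bCnt j) (.v (wv 8)) + .ld (20, 2) (.v (wv 8)) *
    .ld bA (.ld (bL j) (.v (wv 8) / .v (pv 0)) * .v vn + .ld (bL j) (.v (wv 8) % .v (pv 0))))

/-- Count the cliques on all pairs of vertices. -/
def countPass (M : MMProg) (j : ℕ) : Cmd := .seq (forE (wv 8) (.v (pv 0) * .v (pv 0)) (SL.sto (bCnt j) (.v (wv 8)) 0).cmd)
    (pass M j false (countBody j).cmd)

theorem countBody_tri (j : ℕ) : ∃ C, ∀ (D : PD) {M : MMProg} {P : Par} {k : ℕ} (_ : D.Ok M P k) {w : ℕ}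
    {v1 v2 : St}, D.j = j → D.a = 1 → D.r = 1 → D.N ∣ D.Q → D.Q ≤ P.W → w < D.blocks →
    (∀ u < D.N, ∀ y < D.N, v1.a (bCnt j) (u * D.N + y) = D.cntUpTo (w * D.N) u y) →
    ObPre D k false (w / (D.r * D.r)) (w % (D.r * D.r) / D.r) (w % (D.r * D.r) % D.r) v1 v2 →
    Tri P (forE (wv 8) (.v (pv 0) * .v (pv 0)) (countBody j).cmd) v2 (C * (D.N * D.N + 1)) 0 fun v3 =>
      Fr (ObX j) (ObY j) v2 v3 ∧ Env D.n k D.G.Adj v3 ∧ outs k v3 = outs k v1 ∧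
      ∀ u < D.N, ∀ y < D.N, v3.a (bCnt j) (u * D.N + y) = D.cntUpTo ((w + 1) * D.N) u y := by
  classical
  refine ⟨(countBody j).cost + 100, ?_⟩
  intro D M P k ok w v1 v2 hj ha hr hdvd hQW hw hcnt pre
  subst hj
  have hS := ok.S
  have hj3 := ok.j
  have hN := ok.N
  simp only [hr, mul_one, Nat.div_one, Nat.mod_one] at pre
  rw [PD.blocks, hr, mul_one, mul_one] at hw
  let K : ℕ → St → Prop := fun i v' => v'.r (wv 8) = i ∧ Fr (fun x => x = wv 8) (fun b => b = bCnt D.j) v2 v' ∧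
    ∀ u < D.N, ∀ y < D.N, v'.a (bCnt D.j) (u * D.N + y) = if u * D.N + y < i then
      D.cntUpTo ((w + 1) * D.N) u y else D.cntUpTo (w * D.N) u y
  have t := Tri.forE (x := wv 8) (b := .v (pv 0) * .v (pv 0)) (v := v2) (e := 0)
    (T := (countBody D.j).cost) (c := (countBody D.j).cmd) (D.N * D.N) K (by simp; omega)
    ⟨by simp, (Fr.refl (fun x => x = wv 8) (fun b => b = bCnt D.j) v2).set (x := wv 8) rfl _, fun u hu y hy => by
      rw [St.set_a, pre.cnt, hcnt u hu y hy, if_neg (Nat.not_lt_zero _)]⟩ ok.NN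
    (fun i v' h' => h'.1) (fun i v' h' => ?_) (by omega) fun i v' hi h' hs => ?_
  · refine t.mono ?_ (by simp) fun v3 _ h => ⟨h.2.1.mono (fun x hx => by simp [ObX, hx])
      fun b hb => by simp [ObY, hb], ?_, ?_, fun u hu y hy => by rw [h.2.2 u hu y hy, if_pos (mul_add_lt_mul hu hy)]⟩
    · rw [show forCost (.v (pv 0) * .v (pv 0)) = 40 from rfl]; nlinarith
    · exact pre.env.congr (h.2.1.r _ (by simp)) (h.2.1.r _ (by simp)) (h.2.1.r _ (by simp))
        (h.2.1.a _ (by simp only [Prod.mk.injEq]; omega)) (h.2.1.a _ (by simp only [Prod.mk.injEq]; omega))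
        (h.2.1.a _ (by simp only [Prod.mk.injEq]; omega))
    · rw [← pre.out]
      exact outs_congr (h.2.1.r _ (by simp)) (h.2.1.a _ (by simp only [Prod.mk.injEq]; omega))
  · rw [Ex.eval_mul, Ex.eval_v, h'.2.1.r _ (by simp), pre.holds.N]
  · obtain ⟨h8, hF, hc⟩ := h'
    have hm1 : i % D.N < D.N := Nat.mod_lt _ hN
    have hd1 : i / D.N < D.N := Nat.div_lt_of_lt_mul hi
    have hdm : i / D.N * D.N + i % D.N = i := Nat.div_add_mod' _ _
    have e : (Ex.ld (bCnt D.j) (.v (wv 8)) + .ld (20, 2) (.v (wv 8)) *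
        .ld bA (.ld (bL D.j) (.v (wv 8) / .v (pv 0)) * .v vn + .ld (bL D.j) (.v (wv 8) % .v (pv 0)))).eval v' =
        D.cntUpTo ((w + 1) * D.N) (i / D.N) (i % D.N) := by
      simp only [Ex.eval_add, Ex.eval_ld, Ex.eval_mul, Ex.eval_div, Ex.eval_mod, Ex.eval_v, h8]
      rw [hF.a bA (by simp only [Prod.mk.injEq]; omega), hF.a (bL D.j) (by simp),
        hF.a (20, 2) (by simp), hF.r vn (by simp), hF.r (pv 0) (by simp), pre.holds.N,
        pre.holds.L, pre.env.n_eq, pre.env.adj _ (pre.holds.lt _) _ (pre.holds.lt _),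
        D.cntUpTo_succ (by omega) ha hdvd hw]
      have h1 := hc _ hd1 _ hm1
      have h2 := pre.prod _ hd1 _ hm1
      rw [hdm] at h1 h2; rw [h1, h2, if_neg (lt_irrefl _)]
    have hle : D.cntUpTo ((w + 1) * D.N) (i / D.N) (i % D.N) ≤ P.W := by
      refine (D.cntUpTo_le _ _ _).trans ((Nat.mul_le_mul_right _ hw).trans ?_)
      rw [Nat.div_mul_cancel hdvd]; exact hQW
    refine Tri.sl (p := countBody D.j) (by simp [countBody, SL.size]; omega) (fun _ => e.trans_le hle) fun _ => ?_
    have he : (countBody D.j).exec v' = v'.put (bCnt D.j) i (D.cntUpTo ((w + 1) * D.N) (i / D.N) (i % D.N)) := by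
      simp only [countBody, SL.exec, e, Ex.eval_v, h8]
    rw [he]
    refine ⟨h8, by simp, (hF.put rfl _ _).set rfl _, fun u hu y hy => ?_⟩
    rw [St.set_a, St.put_a]
    by_cases hi' : u * D.N + y = i
    · obtain ⟨q1, q2⟩ := mul_add_div_mod (u := u) hy
      rw [if_pos ⟨rfl, hi'⟩, if_pos (by omega), ← hi', q1, q2]
    · rw [if_neg (by simp [hi']), hc u hu y hy]
      simp only [show u * D.N + y < i + 1 ↔ u * D.N + y < i by omega]

theorem countPass_tri (M : MMProg) (j : ℕ) : ∃ C, ∀ (D : PD) {P : Par} {k : ℕ} (_ : D.Ok M P k) {v : St}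
    {τ μG : ℕ}, D.j = j → D.a = 1 → D.r = 1 → D.N ∣ D.Q → D.Q ≤ P.W → PInv D k v →
    v.r (lv j 1) = τ → M.μ D.N + D.N * D.N + 1 ≤ μG → τ + μG ≤ P.W → D.Q / D.N + 1 ≤ P.W →
    Tri P (countPass M j) v (C * (τ + μG)) 0 fun v' =>
      PInv D k v' ∧ Fr (PsX j) (PsY j) v v' ∧ outs k v' = outs k v ∧
      (D.Q / D.N * (M.μ D.N + D.N * D.N + 1) ≤ τ → v'.r (wv 6) = D.Q / D.N) ∧
      (v'.r (wv 6) = D.Q / D.N → ∀ row < D.N, ∀ col < D.N, v'.a (bCnt j) (row * D.N + col) = D.cntUpTo D.Q row col) := by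
  obtain ⟨Cob, hCob⟩ := countBody_tri j
  obtain ⟨C, hC⟩ := pass_tri M j false Cob
  refine ⟨C + 200, ?_⟩
  intro D P k ok v τ μG hj ha hr hdvd hQW hI hτ hμ hτW hbW
  subst hj
  have hS := ok.S
  have hbl : D.blocks = D.Q / D.N := by rw [PD.blocks, hr, mul_one, mul_one]
  have t1 := Tri.forE (x := wv 8) (b := .v (pv 0) * .v (pv 0)) (v := v) (e := 0)
    (T := 10) (c := (SL.sto (bCnt D.j) (.v (wv 8)) 0).cmd) (D.N * D.N) (fun i v' => v'.r (wv 8) = i ∧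
      Fr (fun x => x.1 = 7 ∨ x.1 = 10) (fun b => b = bCnt D.j) v v' ∧ ∀ c < i, v'.a (bCnt D.j) c = 0)
    (by simp; omega) ⟨by simp, (Fr.refl _ _ _).set (x := wv 8) (by simp) _, by simp⟩ ok.NN
    (fun i v' h' => h'.1) (fun i v' h' => by rw [Ex.eval_mul, Ex.eval_v, h'.2.1.r _ (by simp), hI.holds.N]) (by omega)
    fun i v' hi ⟨h8, hF, hc⟩ hs => by
      refine (Tri.sl (P := P) (p := SL.sto (bCnt D.j) (.v (wv 8)) 0) (by simp [SL.size]; omega)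
        (fun _ => by simp [SL.ok]) fun _ => ⟨h8, by simp, (hF.put rfl _ _).set (x := wv 8) (by simp) _,
          fun c hc' => ?_⟩).time (show 1 + 1 + 3 ≤ 10 by decide)
      simp only [SL.exec, Ex.eval_v, h8, St.set_a, St.put_a, Ex.eval_ofNat, true_and]
      split_ifs with h
      · rfl
      · exact hc c (by omega)
  refine (t1.seq (e' := 0) (T' := C * (τ + μG)) fun v1 _ ⟨_, hF, hc⟩ => ?_).le ?_ (by simp)
  · have hF' : Fr (PsX D.j) (PsY D.j) v v1 := hF.mono (fun x hx => by rcases hx with hx | hx <;> simp [PsX, hx]) fun b hb => by simp [PsY, hb]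
    have O1 : outs k v1 = outs k v := outs_congr (hF.r _ (by simp)) (hF.a _ (by simp only [Prod.mk.injEq]; omega))
    refine (hC D ok (countBody D.j).cmd (v := v1) (fun w v' => outs k v' = outs k v ∧
      ∀ u < D.N, ∀ y < D.N, v'.a (bCnt D.j) (u * D.N + y) = D.cntUpTo (w * D.N) u y) rfl (hI.of_fr hF)
      (by rw [hF.r _ (by simp; omega), hτ]) hμ hτW (by rwa [hbl])
      (fun w v3 v4 h3 h4 h => by rwa [h3, h4]) ⟨O1, fun u hu y hy => ?_⟩ fun w v1 v2 hw hK _ hs pre => ?_).post ?_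
    · rw [hc _ (mul_add_lt_mul hu hy), zero_mul]; simp [PD.cntUpTo]
    · refine (hCob D ok rfl ha hr hdvd hQW hw hK.2 pre).post fun v3 _ h => ⟨h.1, h.2.1, ?_, h.2.2.2⟩
      rw [h.2.2.1, hK.1]
    · rintro v' - ⟨g1, g2, g3, g4, g5⟩
      rw [hbl] at g5
      refine ⟨g1, hF'.trans g2, g4.1, g5, fun hw row hr col hc => ?_⟩
      rw [g4.2 row hr col hc, hw, Nat.div_mul_cancel hdvd]
  · rw [show forCost (.v (pv 0) * .v (pv 0)) = 40 from rfl]; nlinarith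

/-! ### Isolation by random multiplication -/

open Classical in
theorem card_collide (q N : ℕ) (d : ℤ) (hd : ¬ (2 : ℤ) ^ q ∣ d) :
    ((range (2 ^ q)).filter fun u : ℕ => ∃ δ : ℤ, |δ| < N ∧ (2 : ℤ) ^ q ∣ (2 * u + 1) * δ - d).card ≤ 4 * N := by
  classical
  set g : ℕ := Int.gcd d (2 ^ q) with hg
  obtain ⟨e, he, hge⟩ := (Nat.dvd_prime_pow Nat.prime_two).1 (show g ∣ 2 ^ q by
      have := Int.gcd_dvd_right d (2 ^ q)
      exact_mod_cast this)
  have heq : e < q := by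
    refine lt_of_le_of_ne he fun h => hd ?_
    have := Int.gcd_dvd_left d (2 ^ q)
    rw [← hg, hge, h] at this
    exact_mod_cast this
  obtain ⟨m, rfl⟩ := Nat.exists_eq_add_of_lt heq
  have hg0 : 0 < g := hge ▸ pow_pos two_pos e
  have key : ∀ (u : ℕ) (δ : ℤ), (2 : ℤ) ^ (e + m + 1) ∣ (2 * u + 1) * δ - d → ∃ t : ℤ, δ = g * t ∧ IsCoprime t 2 := by
    intro u δ h
    have hcop : IsCoprime (2 * (u : ℤ) + 1) (2 ^ (e + m + 1)) := IsCoprime.pow_right ⟨1, -u, by ring⟩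
    have h1 : Int.gcd ((2 * u + 1) * δ) (2 ^ (e + m + 1)) = g := by
      obtain ⟨c, hc⟩ := h
      rw [hg, show (2 * (u : ℤ) + 1) * δ = d + 2 ^ (e + m + 1) * c by linarith]
      simp
    have h2 : Int.gcd δ (2 ^ (e + m + 1)) = g := by
      rw [← h1, Int.gcd_comm, Int.gcd_comm _ (2 ^ _)]
      exact (Int.gcd_mul_right_right_of_gcd_eq_one (Int.isCoprime_iff_gcd_eq_one.1 hcop.symm)).symm
    obtain ⟨t, ht⟩ : (g : ℤ) ∣ δ := h2 ▸ Int.gcd_dvd_left δ _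
    refine ⟨t, ht, ?_⟩
    rw [isCoprime_comm, Int.isCoprime_iff_gcd_eq_one]
    by_contra hne
    have h3 : (2 : ℤ) ∣ t := by
      have : Int.gcd 2 t ∣ 2 := by have := Int.gcd_dvd_left 2 t; exact_mod_cast this
      rcases (Nat.dvd_prime Nat.prime_two).1 this with h | h
      · exact absurd h hne
      · have h4 := Int.gcd_dvd_right 2 t
        rw [h] at h4; exact_mod_cast h4
    have h4 : ((2 ^ (e + 1) : ℕ) : ℤ) ∣ Int.gcd δ (2 ^ (e + m + 1)) := by
      refine Int.dvd_coe_gcd ?_ ?_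
      · rw [ht, hge]; push_cast; rw [pow_succ]; exact mul_dvd_mul_left _ h3
      · push_cast; exact pow_dvd_pow _ (by omega)
    rw [h2, hge, Int.natCast_dvd_natCast] at h4
    have := Nat.le_of_dvd (pow_pos two_pos _) h4
    rw [pow_succ] at this
    have := Nat.pow_pos (n := e) two_pos
    omega
  choose! δ hδ1 hδ2 using fun (u : ℕ) (h : ∃ δ : ℤ, |δ| < N ∧ (2 : ℤ) ^ (e + m + 1) ∣ (2 * u + 1) * δ - d) => h
  choose! t ht1 ht2 using fun (u : ℕ) (h : ∃ δ : ℤ, |δ| < N ∧ (2 : ℤ) ^ (e + m + 1) ∣ (2 * u + 1) * δ - d) => key u _ (hδ2 u h)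
  set M : ℕ := N / g with hM
  set T : Finset ℤ := (Icc (-M : ℤ) M).erase 0 with hT
  have hTc : T.card = 2 * M := by
    rw [hT, Finset.card_erase_of_mem (mem_Icc.2 ⟨neg_nonpos.2 (Int.natCast_nonneg M), Int.natCast_nonneg M⟩), Int.card_Icc]
    clear_value M
    omega
  calc _ ≤ (T ×ˢ range (2 * g)).card := by
        refine Finset.card_le_card_of_injOn (fun u => (t u, u / 2 ^ m)) ?_ ?_
        · intro u hu
          rw [mem_coe, mem_filter, mem_range] at hu
          obtain ⟨hu, h⟩ := hu
          simp only [Finset.coe_product, Set.mem_prod, mem_coe, mem_range, hT, Finset.mem_erase, mem_Icc]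
          refine ⟨⟨?_, ?_⟩, ?_⟩
          · intro h0
            have := ht2 u h
            rw [h0, isCoprime_zero_left] at this; exact absurd this (by decide)
          · rw [← abs_le]
            have h1 := hδ1 u h
            rw [ht1 u h, abs_mul, Nat.abs_cast, Int.abs_eq_natAbs] at h1; rw [Int.abs_eq_natAbs, hM]
            have h2 : g * (t u).natAbs < N := by exact_mod_cast h1
            exact_mod_cast (Nat.le_div_iff_mul_le hg0).2 (by rw [mul_comm]; exact h2.le)
          · rw [Nat.div_lt_iff_lt_mul (pow_pos two_pos _), hge]
            calc u < 2 ^ (e + m + 1) := hu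
              _ = _ := by ring
        · intro u hu u' hu' huu
          rw [mem_coe, mem_filter, mem_range] at hu hu'; simp only [Prod.mk.injEq] at huu
          obtain ⟨h1, h2⟩ := huu
          have a1 := hδ2 u hu.2
          have a2 := hδ2 u' hu'.2
          rw [ht1 u hu.2] at a1; rw [ht1 u' hu'.2, ← h1] at a2
          have a3 := dvd_sub a1 a2
          rw [show (2 * (u : ℤ) + 1) * (g * t u) - d - ((2 * u' + 1) * (g * t u) - d) =
            2 ^ (e + 1) * (t u * (u - u')) by rw [hge]; push_cast; ring,
            show (2 : ℤ) ^ (e + m + 1) = 2 ^ (e + 1) * 2 ^ m by ring] at a3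
          have a4 := (mul_dvd_mul_iff_left (by positivity)).1 a3
          have a5 := ((ht2 u hu.2).symm.pow_left).dvd_of_dvd_mul_left a4
          have a6 : u % 2 ^ m = u' % 2 ^ m := by
            have : (u' : ℤ) ≡ u [ZMOD (2 ^ m : ℕ)] := Int.modEq_iff_dvd.2 (by push_cast; exact a5)
            exact ((Int.natCast_modEq_iff).1 this).symm
          rw [← Nat.div_add_mod u (2 ^ m), ← Nat.div_add_mod u' (2 ^ m), h2, a6]
    _ = 4 * (M * g) := by rw [Finset.card_product, hTc, card_range]; ring
    _ ≤ 4 * N := Nat.mul_le_mul_left _ (Nat.div_mul_le_self N g)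

/-- The same data with another multiplier. -/
abbrev PD.mul (D : PD) (u : ℕ) : PD := { D with a := 2 * u + 1 }

/-- The code is isolated in its block. -/
def PD.Good (D : PD) (row col x : ℕ) : Prop := ∃ b z, b < D.Q / D.N ∧ z < D.N ∧ D.code b z = x ∧ D.Isol row col b z

open Classical in
theorem PD.card_not_good (D : PD) {q : ℕ} (hQ : D.Q = 2 ^ q) (hN : 1 ≤ D.N) (hdvd : D.N ∣ D.Q)
    {row col x : ℕ} (hx : x < D.Q) (hc : D.clq row col x) :
    ((range (2 ^ q)).filter fun u => ¬ (D.mul u).Good row col x).card ≤ 4 * D.N * D.cntUpTo D.Q row col := by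
  set X := (range D.Q).filter fun x' => D.clq row col x' ∧ x' ≠ x with hX
  have hXc : X.card ≤ D.cntUpTo D.Q row col := by
    rw [PD.cntUpTo, ← card_filter]
    exact card_le_card fun x' h => by
      rw [hX, mem_filter] at h; exact mem_filter.2 ⟨h.1, h.2.1⟩
  have hsub : ((range (2 ^ q)).filter fun u => ¬ (D.mul u).Good row col x) ⊆
      X.biUnion fun x' => (range (2 ^ q)).filter fun u : ℕ => ∃ δ : ℤ, |δ| < D.N ∧ (2 : ℤ) ^ q ∣ (2 * u + 1) * δ - ((x : ℤ) - x') := by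
    intro u hu; rw [mem_filter] at hu
    obtain ⟨hu, hbad⟩ := hu
    have hcop : Nat.Coprime (2 * u + 1) (2 ^ q) := Nat.Coprime.pow_right _ (by simp)
    have hQ0 : 0 < D.Q := by omega
    obtain ⟨Z, hZ, hZx⟩ : ∃ Z < D.Q, (2 * u + 1) * Z % D.Q = x := by
      have hinj : Set.InjOn (fun Z => (2 * u + 1) * Z % D.Q) (range D.Q) := by
        intro Z hZ Z' hZ' h; simp only [coe_range, Set.mem_Iio] at hZ hZ'
        have : (2 * u + 1) * Z ≡ (2 * u + 1) * Z' [MOD D.Q] := h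
        have := Nat.ModEq.cancel_left_of_coprime (by rw [hQ, Nat.gcd_comm]; exact hcop) this
        rwa [Nat.ModEq, Nat.mod_eq_of_lt hZ, Nat.mod_eq_of_lt hZ'] at this
      have hmaps : Set.MapsTo (fun Z => (2 * u + 1) * Z % D.Q) (range D.Q) (range D.Q) := fun Z _ => by simpa using Nat.mod_lt _ hQ0
      have := Finset.surjOn_of_injOn_of_card_le _ hmaps hinj le_rfl
      obtain ⟨Z, hZ, h⟩ := this (show x ∈ _ by simpa using hx)
      exact ⟨Z, by simpa using hZ, h⟩
    have hcode : (D.mul u).code (Z / D.N) (Z % D.N) = x := by simp only [PD.code, Nat.div_add_mod']; exact hZx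
    have hb : Z / D.N < D.Q / D.N := Nat.div_lt_div_of_lt_of_dvd hdvd hZ
    have hz : Z % D.N < D.N := Nat.mod_lt _ hN
    have : ∃ z' < D.N, z' ≠ Z % D.N ∧ D.clq row col ((D.mul u).code (Z / D.N) z') := by
      by_contra hno
      push Not at hno
      exact hbad ⟨Z / D.N, Z % D.N, hb, hz, hcode, by rw [hcode]; exact hc, fun z' h1 h2 => hno z' h1 h2⟩
    obtain ⟨z', hz', hne, hcl⟩ := this
    set x' := (D.mul u).code (Z / D.N) z' with hx'
    have hxQ : x' < D.Q := Nat.mod_lt _ hQ0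
    have hdiv : (2 : ℤ) ^ q ∣ (2 * u + 1) * ((Z % D.N : ℕ) - (z' : ℤ)) - ((x : ℤ) - x') := by
      have e1 : (x : ℤ) ≡ (2 * u + 1) * ((Z / D.N : ℕ) * D.N + (Z % D.N : ℕ)) [ZMOD (D.Q : ℕ)] := by
        rw [← hcode, PD.code]; push_cast; exact Int.mod_modEq _ _
      have e2 : (x' : ℤ) ≡ (2 * u + 1) * ((Z / D.N : ℕ) * D.N + z') [ZMOD (D.Q : ℕ)] := by
        rw [hx', PD.code]; push_cast; exact Int.mod_modEq _ _
      have := (e1.sub e2).dvd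
      rw [hQ] at this; push_cast at this ⊢
      convert this using 1
      ring
    refine Finset.mem_biUnion.2 ⟨x', mem_filter.2 ⟨mem_range.2 hxQ, hcl, fun h => ?_⟩, mem_filter.2 ⟨hu, _, ?_, hdiv⟩⟩
    · rw [h, sub_self, sub_zero] at hdiv
      have hcop' : IsCoprime ((2 : ℤ) ^ q) (2 * u + 1) :=
        (IsCoprime.pow_right (⟨1, -u, by ring⟩ : IsCoprime (2 * (u : ℤ) + 1) 2)).symm
      have h1 := hcop'.dvd_of_dvd_mul_left hdiv
      have h2 : ((Z % D.N : ℕ) : ℤ) - z' = 0 := by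
        refine Int.eq_zero_of_abs_lt_dvd h1 ?_
        have h3 : D.N ≤ 2 ^ q := hQ ▸ Nat.le_of_dvd hQ0 hdvd
        have h4 : (D.N : ℤ) ≤ 2 ^ q := by exact_mod_cast h3
        rw [abs_lt]; constructor <;> omega
      omega
    · rw [abs_lt]; constructor <;> omega
  refine (card_le_card hsub).trans (Finset.card_biUnion_le.trans ?_)
  calc _ ≤ ∑ x' ∈ X, 4 * D.N := by
        refine sum_le_sum fun x' hx' => card_collide q D.N _ fun h => ?_
        rw [hX, mem_filter, mem_range] at hx'
        have := Int.eq_zero_of_abs_lt_dvd h (by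
          have h1 : (x : ℤ) < 2 ^ q := by rw [hQ] at hx; exact_mod_cast hx
          have h2 : (x' : ℤ) < 2 ^ q := by have := hx'.1; rw [hQ] at this; exact_mod_cast this
          rw [abs_lt]; constructor <;> omega)
        omega
    _ = X.card * (4 * D.N) := by rw [sum_const, smul_eq_mul]
    _ ≤ _ := by rw [mul_comm]; exact Nat.mul_le_mul_left _ hXc

/-! ### Listing with all block sizes -/

theorem St.set_set (v : St) (x : Var) (a b : ℕ) : (v.set x a).set x b = v.set x b := by simp [St.set]

/-- The smallest power of two that is not smaller than `e`. -/
def pow2 (x : Var) (e : Ex) : Cmd := .seq (asg x 1) (whileE (.lt (.v x) e) (asg x (2 * .v x)))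

theorem pow2_tri {x : Var} {e : Ex} (he : e.size + 4 ≤ P.S) (hx : ∀ a, e.eval (v.set x a) = e.eval v) (hW : 2 * e.eval v ≤ P.W) :
    Tri P (pow2 x e) v ((clog 2 (e.eval v) + 1) * (e.cost + 20)) 0 (· = v.set x (2 ^ clog 2 (e.eval v))) := by
  set V := e.eval v with hV
  have c1 : (Ex.lt (.v x) e).cost = e.cost + 4 := by simp [Ex.lt, Ex.cost]; omega
  have key := Tri.whileE (P := P) (v := v.set x 1) (x := .lt (.v x) e) (c := asg x (2 * .v x)) (Q := (· = v.set x (2 ^ clog 2 V)))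
    (fun v' => (clog 2 V - Nat.log 2 (v'.r x)) * (e.cost + 20)) (fun _ => 0)
    (fun v' => ∃ i ≤ clog 2 V, v' = v.set x (2 ^ i)) (by simp; omega) ⟨0, Nat.zero_le _, by simp⟩ ?_ ?_
  · refine ((Tri.asg (x := x) (e := 1) (Q := (· = v.set x 1)) (by simp; omega)
      (by have := P.hW; simp; omega) rfl).seq fun v' _ h' => by subst h'; exact key).le ?_ (by simp)
    have : Ex.cost 1 = 1 := rfl
    rw [this, c1]; simp only [St.set_r, if_true, Nat.log_one_right, Nat.sub_zero]; nlinarith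
  · rintro v' ⟨i, hi, rfl⟩ hs hz
    simp only [Ex.eval_lt, Ex.eval_v, St.set_r, if_true, hx, ne_eq, ite01_eq_zero, not_not] at hz
    have hlt : i < clog 2 V := (Nat.lt_clog_iff_pow_lt one_lt_two).2 hz
    obtain ⟨d, hd⟩ := Nat.exists_eq_add_of_lt hlt
    have ev : (2 * Ex.v x).eval (v.set x (2 ^ i)) = 2 ^ (i + 1) := by simp [pow_succ, mul_comm]
    refine ⟨7, 0, ?_, le_rfl, (Tri.asg (by simp; omega) (fun _ => ?_) ?_).time (show 1 + 1 + 3 + 2 ≤ 7 by decide)⟩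
    · simp only [St.set_r, if_true, Nat.log_pow one_lt_two, c1, hd, show i + d + 1 - i = d + 1 by omega]
      nlinarith
    · rw [ev, pow_succ]; omega
    · rw [ev, St.set_set]
      refine ⟨⟨i + 1, hlt, rfl⟩, ?_, le_rfl⟩
      simp only [St.set_r, if_true, Nat.log_pow one_lt_two, c1, hd, show i + d + 1 - i = d + 1 by omega,
        show i + d + 1 - (i + 1) = d by omega]
      nlinarith
  · rintro v' ⟨i, hi, rfl⟩ hs hz
    simp only [Ex.eval_lt, Ex.eval_v, St.set_r, if_true, hx, ite01_eq_zero, not_lt] at hz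
    rw [le_antisymm hi ((Nat.clog_le_iff_le_pow one_lt_two).2 hz)]

abbrev vR : Var := (1, 1)

/-- The part of the invariant of a pass that does not depend on its parameters. -/
structure LInv (D : PD) (k : ℕ) (v : St) : Prop where
  m : v.r (lv D.j 0) = D.m
  Q : v.r (lv D.j 4) = D.Q
  L : v.a (bL D.j) = D.L
  lt : ∀ i, D.L i < D.n
  env : Env D.n k D.G.Adj v
  zero : MMZero v

theorem LInv.pinv (h : LInv D k v) (hN : v.r (pv 0) = D.N) (ha : v.r (pv 1) = D.a) (hr : v.r (pv 2) = D.r) : PInv D k v :=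
  ⟨⟨h.m, h.Q, hN, ha, hr, h.L, h.lt⟩, h.env, h.zero⟩

theorem PInv.linv (h : PInv D k v) : LInv D k v := ⟨h.holds.m, h.holds.Q, h.holds.L, h.holds.lt, h.env, h.zero⟩

theorem LInv.set (h : LInv D k v) {x : Var}
    (hx : x.1 = 11 ∨ x.1 = 30 + D.j ∧ x.2 ≠ 0 ∧ x.2 ≠ 4) (n : ℕ) : LInv D k (v.set x n) := by
  have h1 : x.1 ≠ 0 ∧ x.1 ≠ 1 ∧ x.1 ≠ 22 ∧ x.1 ≠ 21 := by omega
  have h2 : lv D.j 0 ≠ x ∧ lv D.j 4 ≠ x := by constructor <;> rintro rfl <;> simp at hx <;> omega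
  exact ⟨by rw [St.set_r, if_neg h2.1, h.m], by rw [St.set_r, if_neg h2.2, h.Q], h.L, h.lt,
    h.env.set h1.1 (Or.inl h1.2.1) h1.2.2.1 n, h.zero.1, fun r => by rw [St.set_ne (by rintro rfl; exact h1.2.2.2 rfl), h.zero.2]⟩

/-- Listing passes with `vR` random multipliers. -/
def inner (M : MMProg) (j k : ℕ) : Cmd := .seq (asg (pv 4) 1) (forE (pv 3) (.v vR)
    (.seq (SL.seq (.asg (pv 1) (2 * .ld bRnd (.v (pv 3)) + 1)) (.asg (pv 2) (.v (lv j 5) / .v (pv 0)))).cmd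
      (.seq (pass M j true (listBody j k)) (SL.ite (.eq (.v (wv 6)) (.v (lv j 4) / .v (pv 0) * (.v (pv 2) * .v (pv 2))))
          .skip (.asg (pv 4) 0)).cmd)))

def InX (j : ℕ) (x : Var) : Prop := PsX j x ∨ (x.1 = 11 ∧ x.2 ≠ 0)
def InY (b : Var) : Prop := b.1 = 20 ∨ b.1 = 23 ∨ EmY b

theorem inner_tri (M : MMProg) (j k : ℕ) : ∃ C, ∀ (D : PD) {P : Par} (_ : D.Ok M P k) {v : St}
    {τ μG R : ℕ}, D.j = j → LInv D k v → (∀ i, j ≤ i → i < k → v.r (vV i) < D.n) → D.m ≤ D.r * D.N →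
    v.r (pv 0) = D.N → v.r (lv j 5) / D.N = D.r → v.r vR = R → 2 * D.Q ≤ P.W → (∀ ρ < R, v.a bRnd ρ < D.Q) →
    v.r (lv j 1) = τ → M.μ D.N + D.N * D.N + 1 ≤ μG → τ + μG ≤ P.W → D.blocks + 1 ≤ P.W →
    Tri P (inner M j k) v (C * (R + 1) * (τ + μG)) 0 fun v' =>
      Fr (InX j) InY v v' ∧ LInv D k v' ∧ outs k v ⊆ outs k v' ∧
      (D.blocks * (M.μ D.N + D.N * D.N + 1) ≤ τ → v'.r (pv 4) = 1) ∧
      (v'.r (pv 4) ≠ 0 → ∀ ρ < R, ∀ row col x, (D.mul (v.a bRnd ρ)).Good row col x →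
        D.Emitted k (fun i => v.r (vV i)) row col x (outs k v')) := by
  obtain ⟨C, hC⟩ := listPass_tri M j k
  refine ⟨C + 300, ?_⟩
  intro D P ok v τ μG R hj hI hV hm hN hN0 hR hQW hrnd hτ hμ hτW hbW
  subst hj
  have hS := ok.S
  have hj3 := ok.j
  have hW2 := P.hW
  let K : ℕ → St → Prop := fun i v' => v'.r (pv 3) = i ∧ Fr (InX D.j) InY v v' ∧ LInv D k v' ∧
    outs k v ⊆ outs k v' ∧ (D.blocks * (M.μ D.N + D.N * D.N + 1) ≤ τ → v'.r (pv 4) = 1) ∧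
    (v'.r (pv 4) ≠ 0 → ∀ ρ < i, ∀ row col x, (D.mul (v.a bRnd ρ)).Good row col x → D.Emitted k (fun i => v.r (vV i)) row col x (outs k v'))
  refine Tri.of_small fun hs0 => ?_
  refine ((Tri.asg (x := pv 4) (e := 1) (v := v) (Q := (· = v.set (pv 4) 1)) (by simp; omega)
    (by simp; omega) rfl).seq (e' := 0) (T' := R * (C * (τ + μG) + 100 + 32) + 32) fun v0 _ h0 => ?_).le ?_ (by simp)
  swap
  · rw [show Ex.cost 1 = 1 from rfl]
    have : 1 ≤ τ + μG := by omega
    have : 1 * R ≤ (τ + μG) * R := Nat.mul_le_mul_right _ this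
    nlinarith [Nat.zero_le (C * (τ + μG))]
  subst h0
  refine (Tri.forE (x := pv 3) (b := .v vR) (v := v.set (pv 4) 1) (e := 0)
    (T := C * (τ + μG) + 100) R K (by simp; omega) ⟨by simp, ?_, ?_, ?_, by simp, by simp⟩ ?_
    (fun i v' h' => h'.1) (fun i v' h' => ?_) (by omega) fun i v' hi h' hs => ?_).mono le_rfl (by simp) fun v' _ h' => h'.2
  · exact ((Fr.refl _ _ v).set (by simp [InX]) _).set (by simp [InX]) _
  · exact (hI.set (by simp) _).set (by simp) _
  · rw [outs_set (by simp), outs_set (by simp)]; exact fun _ h => h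
  · exact hR ▸ hs0.1 vR
  · rw [Ex.eval_v, h'.2.1.r _ (by simp [InX, PsX]), hR]
  · obtain ⟨h3, hF, hL, hO, hc, hE⟩ := h'
    set u := v.a bRnd i with hu
    have hub := hrnd i hi
    have hrW : D.r ≤ P.W := hN0 ▸ (Nat.div_le_self _ _).trans (hs0.1 _)
    have np : ∀ c, c ≠ 0 → InX D.j (pv c) := fun c hc => Or.inr ⟨rfl, hc⟩
    have nN : ¬ InX D.j (pv 0) := by simp [InX, PsX]
    have n5 : ∀ c, ¬ InX D.j (lv D.j c) := fun c => by simp [InX, PsX]; omega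
    have e1 : (2 * Ex.ld bRnd (.v (pv 3)) + 1).eval v' = 2 * u + 1 := by
      simp only [Ex.eval_add, Ex.eval_mul, Ex.eval_ld, Ex.eval_v, Ex.eval_ofNat, h3]
      rw [hF.a bRnd (by simp [InY, EmY])]
    have e2 : (Ex.v (lv D.j 5) / .v (pv 0)).eval (v'.set (pv 1) (2 * u + 1)) = D.r := by
      simp only [Ex.eval_div, Ex.eval_v]
      rw [St.set_ne (by simp), St.set_ne (by simp), hF.r _ (n5 5), hF.r _ nN, hN, hN0]
    set v1 := (v'.set (pv 1) (2 * u + 1)).set (pv 2) D.r with hv1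
    have F1 : Fr (InX D.j) InY v v1 := (hF.set (np 1 one_ne_zero) _).set (np 2 two_ne_zero) _
    have L1 : LInv D k v1 := (hL.set (by simp) _).set (by simp) _
    have O1 : outs k v1 = outs k v' := by rw [hv1, outs_set (by simp), outs_set (by simp)]
    have I1 : PInv (D.mul u) k v1 := LInv.pinv (D := D.mul u) ⟨L1.m, L1.Q, L1.L, L1.lt, L1.env, L1.zero⟩
      (by rw [F1.r _ nN, hN]) (by simp [hv1]) (by simp [hv1])
    have ok1 : (D.mul u).Ok M P k := ⟨ok.j, ok.jk, ok.Q, ok.m, ok.N, ok.r, ok.W, ok.rN, ok.NN, ok.c, ok.μ, ok.S⟩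
    refine ((Tri.sl (P := P) (Q := (· = v1)) (by simp [SL.size]; omega) (fun _ => ?_) fun _ => ?_).seq
      (e' := 0) (T' := C * (τ + μG) + 40) fun v2 _ h2 => ?_).le ?_ (by simp)
    · simp only [SL.ok, SL.exec, e1, e2]; omega
    · simp only [SL.exec, e1, e2, ← hv1]
    · subst h2
      refine ((hC (D.mul u) ok1 rfl I1 (fun i hi hik => by
        rw [F1.r _ (by simp [InX, PsX]; omega)]; exact hV i hi hik) hm (by rw [F1.r _ (n5 1), hτ]) hμ hτW hbW).seq
          (e' := 0) (T' := 38) fun v2 _ ⟨g1, g2, g3, g4, g5, g6⟩ => ?_).le (by omega) (by simp)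
      have F2 : Fr (InX D.j) InY v v2 := by
        refine F1.trans ⟨fun x hx => g2.r x fun h => hx (Or.inl h), fun b hb => ?_⟩
        by_cases hbc : b = bCnt D.j
        · rw [hbc, g3]
        · exact g2.a b fun h => by
            rcases h with h | h | h | h
            · exact hb (Or.inl h)
            · exact hb (Or.inr (Or.inl h))
            · exact hb (Or.inr (Or.inr h))
            · exact hbc h
      have p2 : ∀ c, v2.r (pv c) = v1.r (pv c) := fun c => g2.r _ (by simp [PsX])
      have hL2 : LInv D k v2 := let h := g1.linv; ⟨h.m, h.Q, h.L, h.lt, h.env, h.zero⟩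
      have e3 : (Ex.eq (.v (wv 6)) (.v (lv D.j 4) / .v (pv 0) * (.v (pv 2) * .v (pv 2)))).eval v2 =
          if v2.r (wv 6) = D.blocks then 1 else 0 := by
        simp only [Ex.eval_eq, Ex.eval_mul, Ex.eval_div, Ex.eval_v, hL2.Q, F2.r _ nN, hN, p2 2]
        simp only [hv1, St.set_r, if_true, PD.blocks]
        congr
      have hold : ∀ w, outs k v2 ⊆ outs k w → v2.r (pv 4) ≠ 0 → ∀ ρ < i, ∀ row col x, (D.mul (v.a bRnd ρ)).Good row col x →
            D.Emitted k (fun i => v.r (vV i)) row col x (outs k w) := fun w hw h4 ρ hρ row col x hG hA =>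
        hw (g4 (O1 ▸ hE (by rwa [p2, hv1, St.set_ne (by simp), St.set_ne (by simp)] at h4) ρ hρ row col x hG hA))
      have hp3 : v2.r (pv 3) = i := by simp [p2, hv1, h3]
      have hp4 : v2.r (pv 4) = v'.r (pv 4) := by simp [p2, hv1]
      have hO2 : outs k v ⊆ outs k v2 := fun _ h => g4 (O1 ▸ hO h)
      refine (Tri.sl (P := P) (by simp [SL.size]; omega) (fun _ => ?_) fun _ => ?_).time (show 22 ≤ 38 by decide)
      · simp only [SL.ok, Ex.eval_ofNat]; split_ifs <;> simp
      · simp only [SL.exec, e3, Ex.eval_ofNat]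
        by_cases hb : v2.r (wv 6) = D.blocks
        · rw [if_pos hb, if_pos one_ne_zero]
          refine ⟨hp3, by simp, F2.set (np 3 (by simp)) _, hL2.set (by simp) _, ?_, fun h => ?_, fun h4 ρ hρ row col x hG => ?_⟩
          · rwa [outs_set (by simp)]
          · simp [hp4, hc h]
          · rw [outs_set (by simp)]
            rw [St.set_ne (by simp)] at h4
            rcases lt_succ_iff_lt_or_eq.1 hρ with h | rfl
            · exact hold v2 (fun _ h => h) h4 ρ h row col x hG
            · obtain ⟨b, z, hbQ, hz, rfl, hI⟩ := hG
              exact PD.Emitted.congr D (g6 hb row col b z hbQ hz hI) fun i hi => F1.r _ (by simp [InX, PsX]; omega)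
        · rw [if_neg hb, if_neg (by simp)]
          refine ⟨by rw [St.set_ne (by simp), hp3], by simp, (F2.set (np 4 (by simp)) _).set (np 3 (by simp)) _,
            (hL2.set (by simp) _).set (by simp) _, ?_, fun h => absurd (g5 h) hb, fun h4 => ?_⟩
          · rwa [outs_set (by simp), outs_set (by simp)]
          · exact absurd (by simp) h4
    · have : SL.cost (SL.seq (.asg (pv 1) (2 * .ld bRnd (.v (pv 3)) + 1)) (.asg (pv 2) (.v (lv D.j 5) / .v (pv 0)))) = 21 := rfl
      omega

/-- The data with blocks of size `2 ^ i`. -/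
abbrev PD.lvl (D : PD) (c i : ℕ) : PD := { D with N := 2 ^ i, r := 2 ^ (c - i) }

/-- Listing passes with all block sizes; `lv j 3` is the size of the last complete one. -/
def outer (M : MMProg) (j k : ℕ) : Cmd := .seq (SL.seq (.asg (lv j 3) (.v (lv j 4))) (.asg (pv 0) (.v (lv j 5)))).cmd
    (whileE (.v (pv 0)) (.seq (inner M j k)
      (SL.seq (.ite (.v (pv 4)) (.asg (lv j 3) (.v (pv 0))) .skip) (.asg (pv 0) (.v (pv 0) / 2))).cmd))

def OuX (j : ℕ) (x : Var) : Prop := PsX j x ∨ x.1 = 11 ∨ x = lv j 3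

theorem size_two_pow_half (s : ℕ) : Nat.size (2 ^ s / 2) = s := by
  cases s with
  | zero => simp
  | succ s => rw [pow_succ, Nat.mul_div_cancel _ two_pos, Nat.size_pow]

theorem LInv.congr {D' : PD} (h : LInv D k v) (hj : D'.j = D.j) (hm : D'.m = D.m)
    (hQ : D'.Q = D.Q) (hL : D'.L = D.L) (hn : D'.n = D.n) (hG : D'.G = D.G) : LInv D' k v :=
  ⟨by rw [hj, hm, h.m], by rw [hj, hQ, h.Q], by rw [hj, hL, h.L], by rw [hL, hn]; exact h.lt, by rw [hn, hG]; exact h.env, h.zero⟩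

theorem outer_tri (M : MMProg) (j k : ℕ) : ∃ C, ∀ (D : PD) {P : Par} {c q : ℕ}
    (_ : ∀ i ≤ c, (D.lvl c i).Ok M P k) {v : St} {τ μG R : ℕ}, D.j = j → LInv D k v →
    (∀ i, j ≤ i → i < k → v.r (vV i) < D.n) → D.m ≤ 2 ^ c → v.r (lv j 5) = 2 ^ c →
    D.Q = 2 ^ q → c ≤ q → v.r vR = R → 2 * D.Q ≤ P.W → (∀ ρ < R, v.a bRnd ρ < D.Q) →
    v.r (lv j 1) = τ → (∀ i ≤ c, M.μ (2 ^ i) + 2 ^ i * 2 ^ i + 1 ≤ μG) → τ + μG ≤ P.W →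
    D.Q * (2 ^ c * 2 ^ c) + 1 ≤ P.W →
    Tri P (outer M j k) v (C * (c + 1) * (R + 1) * (τ + μG)) 0 fun v' =>
      Fr (OuX j) InY v v' ∧ LInv D k v' ∧ outs k v ⊆ outs k v' ∧
      (∀ i ≤ c, (D.lvl c i).blocks * (M.μ (2 ^ i) + 2 ^ i * 2 ^ i + 1) ≤ τ → v'.r (lv j 3) ≤ 2 ^ i) ∧
      (v'.r (lv j 3) = D.Q ∨ ∃ i ≤ c, v'.r (lv j 3) = 2 ^ i ∧ ∀ ρ < R, ∀ row col x, ((D.lvl c i).mul (v.a bRnd ρ)).Good row col x →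
        D.Emitted k (fun i => v.r (vV i)) row col x (outs k v')) := by
  obtain ⟨C, hC⟩ := inner_tri M j k
  refine ⟨C + 100, ?_⟩
  intro D P c q ok v τ μG R hj hI hV hm h5 hQ hcq hR hQW hrnd hτ hμ hτW hbW
  subst hj
  refine Tri.of_small fun hs0 => ?_
  have hS := (ok 0 (Nat.zero_le _)).S
  have hj3 := (ok 0 (Nat.zero_le _)).j
  simp only at hj3
  set T := C * (R + 1) * (τ + μG) + 40 with hT
  let v1 := (v.set (lv D.j 3) D.Q).set (pv 0) (2 ^ c)
  let I : St → Prop := fun v' => ∃ s ≤ c + 1, v'.r (pv 0) = 2 ^ s / 2 ∧ Fr (OuX D.j) InY v v' ∧ LInv D k v' ∧ outs k v ⊆ outs k v' ∧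
      (∀ i ≤ c, s ≤ i → (D.lvl c i).blocks * (M.μ (2 ^ i) + 2 ^ i * 2 ^ i + 1) ≤ τ → v'.r (lv D.j 3) ≤ 2 ^ i) ∧
      (v'.r (lv D.j 3) = D.Q ∨ ∃ i ≤ c, s ≤ i ∧ v'.r (lv D.j 3) = 2 ^ i ∧ ∀ ρ < R, ∀ row col x,
        ((D.lvl c i).mul (v.a bRnd ρ)).Good row col x →
        D.Emitted k (fun i => v.r (vV i)) row col x (outs k v'))
  have cx : ∀ c, OuX D.j (pv c) := fun c => Or.inr (Or.inl rfl)
  have inou : ∀ x, InX D.j x → OuX D.j x := fun x hx => hx.imp_right fun h => Or.inl h.1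
  refine ((Tri.sl (P := P) (v := v) (Q := (· = v1)) (by simp [SL.size]; omega) (fun _ => ?_) fun _ => ?_).seq
    (T' := (c + 1) * T + 1 + 3) (e' := 0) fun v' _ h' => ?_).le ?_ (by simp)
  · simp only [SL.ok, SL.exec, Ex.eval_v]
    exact ⟨hs0.1 _, by rw [St.set_r]; split_ifs <;> exact hs0.1 _⟩
  · simp only [SL.exec, Ex.eval_v, v1, hI.Q]
    rw [St.set_ne (by simp), h5]
  · subst h'
    have hz : v1.r (pv 0) = 2 ^ (c + 1) / 2 := by simp [v1, pow_succ]
    refine (Tri.whileE (v := v1) (fun v' => Nat.size (v'.r (pv 0)) * T) (fun _ => 0) I (by simp; omega)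
      ⟨c + 1, le_rfl, hz, ((Fr.refl _ _ _).set (Or.inr (Or.inr rfl)) _).set (cx 0) _,
        (hI.set (by simp) _).set (by simp) _, ?_, fun i hi h => by omega, Or.inl (by simp [v1])⟩ ?_ ?_).time ?_
    · rw [outs_set (by simp), outs_set (by simp)]; exact fun _ h => h
    · rintro v' ⟨s, hs, hp, hF, hL, hO, hN, hE⟩ hsm hz
      obtain ⟨i, rfl⟩ : ∃ i, s = i + 1 := Nat.exists_eq_succ_of_ne_zero fun h => by subst h; simp [hp] at hz
      have hic : i ≤ c := by omega
      rw [pow_succ, Nat.mul_div_cancel _ two_pos] at hp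
      have h2c : 2 ^ c = 2 ^ (c - i) * 2 ^ i := by rw [← pow_add, Nat.sub_add_cancel hic]
      have hrnd' : ∀ ρ, v'.a bRnd ρ = v.a bRnd ρ := fun ρ => by rw [hF.a _ (by simp [InY, EmY])]
      have hVV : ∀ i, D.j ≤ i → v'.r (vV i) = v.r (vV i) := fun i hi => hF.r _ (by simp [OuX, PsX]; omega)
      have hf : ∀ c, c ≠ 3 → v'.r (lv D.j c) = v.r (lv D.j c) := fun c hc => hF.r _ (by simp [OuX, PsX, hc]; omega)
      refine ⟨_, 0, ?_, le_rfl, (hC (D.lvl c i) (ok i hic) (R := R) rfl (hL.congr rfl rfl rfl rfl rfl rfl)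
        (fun i hi hik => by rw [hVV i hi]; exact hV i hi hik) (by rw [← h2c]; exact hm) hp
        (by rw [hf 5 (by simp), h5, h2c, Nat.mul_div_cancel _ (by positivity)])
        (by rw [hF.r _ (by simp [OuX, PsX]), hR]) hQW (fun ρ hρ => by rw [hrnd']; exact hrnd ρ hρ)
        (by rw [hf 1 (by simp), hτ]) (hμ i hic) hτW ?_).seq (T' := 30) (e' := 0) fun v2 hs2 ⟨g1, g2, g3, g4, g5⟩ => ?_⟩
      · rw [hp, Nat.size_pow, Ex.cost]
        nlinarith
      · refine le_trans (Nat.succ_le_succ ?_) hbW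
        simp only [PD.blocks]
        exact Nat.mul_le_mul (Nat.div_le_self _ _) (Nat.mul_le_mul (Nat.pow_le_pow_right two_pos (by omega))
          (Nat.pow_le_pow_right two_pos (by omega)))
      · have hp2 : v2.r (pv 0) = 2 ^ i := by rw [g1.r _ (by simp [InX, PsX]), hp]
        have hL2 : LInv D k v2 := g2.congr rfl rfl rfl rfl rfl rfl
        have F2 := hF.trans (g1.mono inou fun _ h => h)
        have h32 : v2.r (lv D.j 3) = v'.r (lv D.j 3) := g1.r _ (by simp [InX, PsX]; omega)
        have hsz : Nat.size (2 ^ i / 2) * T + T ≤ Nat.size (2 ^ i) * T := by rw [size_two_pow_half, Nat.size_pow]; nlinarith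
        refine (Tri.sl (P := P) (by simp [SL.size]; omega) (fun _ => ?_) fun _ => ?_).time (show 14 ≤ 30 by decide)
        · simp only [SL.ok, SL.exec, Ex.eval_v, Ex.eval_div, hp2]
          refine ⟨by split_ifs; exact hp2 ▸ hs2.1 _, (Nat.div_le_self _ _).trans ?_⟩
          split_ifs
          · rw [St.set_ne (by simp)]; exact hs2.1 _
          · exact hs2.1 _
        · by_cases h4 : v2.r (pv 4) = 0
          · simp only [SL.exec, Ex.eval_v, h4, ne_eq, not_true, if_false, Ex.eval_div, Ex.eval_ofNat, hp2]
            refine ⟨⟨i, by omega, by simp, F2.set (cx 0) _, hL2.set (by simp) _, ?_, ?_, ?_⟩, ?_, by simp⟩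
            · rw [outs_set (by simp)]; exact fun _ h => g3 (hO h)
            · intro i' hi' hle hb
              rw [St.set_ne (by simp), h32]
              rcases hle.lt_or_eq with h | rfl
              · exact hN i' hi' h hb
              · exact absurd (g4 hb) (by omega)
            · rw [St.set_ne (by simp), h32, outs_set (by simp)]
              rcases hE with h | ⟨i', hi', h1, h2, h3⟩
              · exact Or.inl h
              · exact Or.inr ⟨i', hi', by omega, h2, fun ρ hρ row col x hG hA => g3 (h3 ρ hρ row col x hG hA)⟩
            · simp only [St.set_r, if_true, hp, Ex.cost]; omega
          · simp only [SL.exec, Ex.eval_v, h4, ne_eq, not_false_eq_true, if_true, Ex.eval_div, Ex.eval_ofNat, hp2]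
            rw [St.set_ne (by simp), hp2]
            refine ⟨⟨i, by omega, by simp, (F2.set (Or.inr (Or.inr rfl)) _).set (cx 0) _,
              (hL2.set (by simp) _).set (by simp) _, ?_, ?_, ?_⟩, ?_, by simp⟩
            · rw [outs_set (by simp), outs_set (by simp)]; exact fun _ h => g3 (hO h)
            · intro i' hi' hle hb
              rw [St.set_ne (by simp), St.set_r, if_pos rfl]; exact Nat.pow_le_pow_right two_pos hle
            · rw [St.set_ne (by simp), St.set_r, if_pos rfl, outs_set (by simp), outs_set (by simp)]
              refine Or.inr ⟨i, hic, le_rfl, rfl, fun ρ hρ row col x hG => ?_⟩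
              exact PD.Emitted.congr D (g5 h4 ρ hρ row col x (by rw [hrnd']; exact hG)) hVV
            · simp only [St.set_r, if_true, hp, Ex.cost]; omega
    · rintro v' ⟨s, hs, hp, hF, hL, hO, hN, hE⟩ hsm hz
      obtain rfl : s = 0 := by
        have := size_two_pow_half s
        rw [← hp, show v'.r (pv 0) = 0 from hz] at this; simpa using this.symm
      refine ⟨hF, hL, hO, fun i hi => hN i hi (Nat.zero_le _), ?_⟩
      rcases hE with h | ⟨i, hi, -, h2, h3⟩
      exacts [Or.inl h, Or.inr ⟨i, hi, h2, h3⟩]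
    · rw [hz, size_two_pow_half, Ex.cost]
  · have : SL.cost (SL.seq (.asg (lv D.j 3) (.v (lv D.j 4))) (.asg (pv 0) (.v (lv D.j 5)))) = 7 := rfl
    rw [this, hT]
    have h1 := hμ 0 (Nat.zero_le _)
    have h2 : 1 ≤ (R + 1) * (τ + μG) := Nat.mul_pos (by omega) (by omega)
    have h3 : (c + 1) * 1 ≤ (c + 1) * ((R + 1) * (τ + μG)) := Nat.mul_le_mul_left _ h2
    have e : (C + 100) * (c + 1) * (R + 1) * (τ + μG) = (c + 1) * (C * (R + 1) * (τ + μG)) +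
      100 * ((c + 1) * ((R + 1) * (τ + μG))) := by ring
    rw [e, mul_add]; omega

/-- Listing with random multipliers and all block sizes. -/
def listAll (M : MMProg) (j k : ℕ) : Cmd := .seq (pickVec (lv j 4) vR) (outer M j k)

theorem listAll_tri (M : MMProg) (j k : ℕ) : ∃ C, ∀ (D : PD) {P : Par} {c q : ℕ}
    (_ : ∀ i ≤ c, (D.lvl c i).Ok M P k) {v : St} {τ μG R : ℕ}, D.j = j → LInv D k v →
    (∀ i, j ≤ i → i < k → v.r (vV i) < D.n) → D.m ≤ 2 ^ c → v.r (lv j 5) = 2 ^ c →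
    D.Q = 2 ^ q → c ≤ q → D.m ^ (j - 2) ≤ D.Q → v.r vR = R → 2 * D.Q ≤ P.W →
    v.r (lv j 1) = τ → (∀ i ≤ c, M.μ (2 ^ i) + 2 ^ i * 2 ^ i + 1 ≤ μG) → τ + μG ≤ P.W →
    D.Q * (2 ^ c * 2 ^ c) + 1 ≤ P.W → (((c + 1) * D.m ^ j : ℕ) : ℝ≥0∞) * ((2 : ℝ≥0∞) ^ R)⁻¹ ≤ P.ε →
    Tri P (listAll M j k) v (C * (q + 1) * (R + 1) * (τ + μG)) 1 fun v' =>
      Fr (OuX j) (fun b => b = bRnd ∨ InY b) v v' ∧ LInv D k v' ∧ outs k v ⊆ outs k v' ∧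
      (∀ i ≤ c, (D.lvl c i).blocks * (M.μ (2 ^ i) + 2 ^ i * 2 ^ i + 1) ≤ τ → v'.r (lv j 3) ≤ 2 ^ i) ∧
      (v'.r (lv j 3) ≤ D.Q ∧ 1 ≤ v'.r (lv j 3)) ∧
      ∀ row col x, D.clq row col x → 8 * v'.r (lv j 3) * D.cntUpTo D.Q row col ≤ D.Q →
        D.Emitted k (fun i => v.r (vV i)) row col x (outs k v') := by
  classical
  obtain ⟨C, hC⟩ := outer_tri M j k
  refine ⟨C + 200, ?_⟩
  intro D P c q ok v τ μG R hj hI hV hm h5 hQ hcq hmQ hR hQW hτ hμ hτW hbW hε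
  subst hj
  have hS := (ok 0 (Nat.zero_le _)).S
  have hjk : D.j ≤ k := (ok 0 (Nat.zero_le _)).jk
  have hj3 : 3 ≤ D.j := (ok 0 (Nat.zero_le _)).j
  let E : Finset (ℕ × ℕ × ℕ × ℕ) := (range (c + 1) ×ˢ range D.m ×ˢ range D.m ×ˢ
    range (D.m ^ (D.j - 2))).filter fun e => D.clq e.2.1 e.2.2.1 e.2.2.2 ∧ 8 * 2 ^ e.1 * D.cntUpTo D.Q e.2.1 e.2.2.1 ≤ D.Q
  have hEc : E.card ≤ (c + 1) * D.m ^ D.j := by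
    refine (card_filter_le _ _).trans ?_
    simp only [Finset.card_product, card_range]
    have : D.m ^ D.j = D.m * (D.m * D.m ^ (D.j - 2)) := by rw [← pow_succ', ← pow_succ']; congr 1; omega
    rw [this]
  have t1 := pickVec_tri (by omega) (x := lv D.j 4) (y := vR) (by simp; omega) (by simp) (v := v) (w := q) (R := R) (by rw [hI.Q, hQ]) hR E
    (fun e u => ((D.lvl c e.1).mul u).Good e.2.1 e.2.2.1 e.2.2.2) (fun e he => ?_)
    ((mul_le_mul_left (Nat.cast_le.2 hEc) _).trans hε)
  · refine (t1.seq (T' := C * (c + 1) * (R + 1) * (τ + μG)) (e' := 0) fun v1 _ ⟨F1, h1, h2⟩ => ?_).le ?_ (by simp)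
    · have hL1 : LInv D k v1 := by
        refine ⟨by rw [F1.r _ (by simp; omega), hI.m], by rw [F1.r _ (by simp; omega), hI.Q],
          by rw [F1.a _ (by simp; omega), hI.L], hI.lt, hI.env.congr (F1.r _ (by simp)) (F1.r _ (by simp))
          (F1.r _ (by simp)) (F1.a _ (by simp)) (F1.a _ (by simp)) (F1.a _ (by simp)),
          fun b i => by rw [F1.a _ (by simp), hI.zero.1], fun r => by rw [F1.r _ (by simp), hI.zero.2]⟩
      have hVV : ∀ i, v1.r (vV i) = v.r (vV i) := fun i => F1.r _ (by simp)
      have O1 : outs k v1 = outs k v := outs_congr (F1.r _ (by simp)) (F1.a _ (by simp))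
      refine (hC D ok rfl hL1 (fun i hi hik => by rw [hVV]; exact hV i hi hik) hm
        (by rw [F1.r _ (by simp; omega), h5]) hQ hcq (by rw [F1.r _ (by simp), hR]) hQW (by rwa [hQ])
        (by rw [F1.r _ (by simp; omega), hτ]) hμ hτW hbW).post fun v2 hs2 ⟨g1, g2, g3, g4, g5⟩ => ?_
      rw [O1] at g3; simp only [hVV] at g5
      refine ⟨(F1.mono (fun x hx => Or.inl (Or.inl hx)) fun b hb => Or.inl hb).trans
        (g1.mono (fun _ h => h) fun b hb => Or.inr hb), g2, g3, g4, ?_, fun row col x hc hcnt => ?_⟩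
      · rcases g5 with h | ⟨i, hi, h, -⟩
        · exact ⟨h.le, h ▸ (ok 0 (Nat.zero_le _)).Q⟩
        · rw [h, hQ]
          exact ⟨Nat.pow_le_pow_right two_pos (by omega), one_le_two_pow⟩
      · have hx : x < D.m ^ (D.j - 2) := hc.2.2.1
        have hpos : 1 ≤ D.cntUpTo D.Q row col := by
          refine le_trans ?_ (Finset.single_le_sum (f := fun x => if D.clq row col x then 1 else 0)
            (fun _ _ => Nat.zero_le _) (mem_range.2 (hx.trans_le hmQ)))
          simp [hc]
        rcases g5 with h | ⟨i, hi, h, h'⟩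
        · rw [h] at hcnt
          have : 1 ≤ D.Q := (ok 0 (Nat.zero_le _)).Q
          nlinarith
        · rw [h] at hcnt
          obtain ⟨ρ, hρ, hG⟩ := h2 (i, row, col, x) (mem_filter.2 ⟨by
            simp only [mem_product, mem_range]; exact ⟨by omega, hc.1, hc.2.1, hx⟩, hc, hcnt⟩)
          exact h' ρ hρ row col x hG
    · have h1 := hμ 0 (Nat.zero_le _)
      have e : (C + 200) * (q + 1) * (R + 1) * (τ + μG) = (C * (R + 1) * (τ + μG)) * (q + 1) +
        200 * ((q + 1) * (R + 1) * (τ + μG)) := by ring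
      have h2 : (60 * q + 100) * (R + 1) + 1 ≤ 200 * ((q + 1) * (R + 1) * 1) := by nlinarith
      have h3 : (q + 1) * (R + 1) * 1 ≤ (q + 1) * (R + 1) * (τ + μG) := Nat.mul_le_mul_left _ (by omega)
      have h4 : (C * (R + 1) * (τ + μG)) * (c + 1) ≤ (C * (R + 1) * (τ + μG)) * (q + 1) := Nat.mul_le_mul_left _ (by omega)
      have h5 : C * (c + 1) * (R + 1) * (τ + μG) = (C * (R + 1) * (τ + μG)) * (c + 1) := by ring
      rw [e, h5]; omega
  · obtain ⟨h1, h2, h3⟩ := mem_filter.1 he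
    simp only [mem_product, mem_range] at h1
    have := (D.lvl c e.1).card_not_good hQ one_le_two_pow
      (by change 2 ^ e.1 ∣ D.Q; rw [hQ]; exact pow_dvd_pow _ (by omega)) (h1.2.2.2.trans_le hmQ) h2
    have h4 : (D.lvl c e.1).cntUpTo (D.lvl c e.1).Q e.2.1 e.2.2.1 = D.cntUpTo D.Q e.2.1 e.2.2.1 := rfl
    rw [h4] at this; rw [hQ] at h3
    refine (Nat.mul_le_mul_left 2 this).trans (le_trans (le_of_eq ?_) h3)
    rw [hQ]; ring

/-! ### Counting clique tuples -/

theorem exists_digits {l : ℕ} (φ : ℕ → ℕ) (hφ : ∀ i < l, φ i < m) : ∃ x < m ^ l, ∀ i < l, x / m ^ i % m = φ i := by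
  let g : Fin l → Fin m := fun i => ⟨φ i, hφ i i.2⟩
  refine ⟨finFunctionFinEquiv g, (finFunctionFinEquiv g).2, fun i hi => ?_⟩
  rw [← finFunctionFinEquiv_symm_apply_val _ ⟨i, hi⟩, Equiv.symm_apply_apply]

open Classical in
/-- The number of `j`-tuples of indices below `m` whose vertices form a clique. -/
def tcount (G : SimpleGraph ℕ) (L : ℕ → ℕ) (m j : ℕ) : ℕ :=
  (univ.filter fun g : Fin j → Fin m => ∀ a b, a < b → G.Adj (L (g a)) (L (g b))).card

theorem tcount_le {L L' : ℕ → ℕ} {m' : ℕ} (ψ : ℕ → ℕ) (hψ : ∀ d < m', ψ d < m)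
    (hinj : ∀ d < m', ∀ d' < m', ψ d = ψ d' → d = d') (hL : ∀ d < m', L' d = L (ψ d)) :
    tcount G L' m' j ≤ tcount G L m j := by
  classical
  refine Finset.card_le_card_of_injOn (fun g a => ⟨ψ (g a), hψ _ (g a).2⟩) (fun g hg => ?_) fun g _ g' _ h => ?_
  · simp only [mem_coe, mem_filter, mem_univ, true_and] at hg ⊢
    intro a b hab; rw [← hL _ (g a).2, ← hL _ (g b).2]; exact hg a b hab
  · funext a
    have := congrArg Fin.val (congrFun h a)
    exact Fin.ext (hinj _ (g a).2 _ (g' a).2 this)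

namespace PD
variable (D : PD)

/-- The number of cliques with a given first vertex. -/
def rowCnt (row : ℕ) : ℕ := ∑ col ∈ range D.m, D.cntUpTo D.Q row col

open Classical in
theorem rowCnt_eq {l : ℕ} (hj : D.j = l + 2) (hQ : D.m ^ l ≤ D.Q) (row : Fin D.m) :
    D.rowCnt row = (univ.filter fun g : Fin (l + 2) → Fin D.m => g 0 = row ∧ ∀ a b, a < b → D.G.Adj (D.L (g a)) (D.L (g b))).card := by
  have e1 : D.rowCnt row = ((range D.m ×ˢ range D.Q).filter fun p => D.clq row p.1 p.2).card := by
    rw [rowCnt, card_filter, Finset.sum_product]; rfl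
  have hj2 : D.j - 2 = l := by omega
  have htup : ∀ (g : Fin (l + 2) → Fin D.m) (x : ℕ), (∀ b : Fin l, x / D.m ^ (b : ℕ) % D.m = g b.succ.succ) →
      ∀ a : Fin (l + 2), D.tup (g 0) (g 1) x a = D.L (g a) := by
    intro g x hx a; unfold tup; congr 1
    refine Fin.cases rfl (fun a => Fin.cases (by simp) (fun a => ?_) a) a
    simpa using hx a
  have hclq : ∀ (g : Fin (l + 2) → Fin D.m) (x : ℕ), (∀ b : Fin l, x / D.m ^ (b : ℕ) % D.m = g b.succ.succ) →
      x < D.m ^ l → (D.clq (g 0) (g 1) x ↔ ∀ a b, a < b → D.G.Adj (D.L (g a)) (D.L (g b))) := by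
    intro g x hx hxl; rw [clq, hj2, hj]; simp only [(g 0).2, (g 1).2, hxl, true_and]
    constructor
    · intro h a b hab
      rw [← htup g x hx, ← htup g x hx]; exact h b b.2 a hab
    · intro h b hb a ha
      simpa [← htup g x hx] using h ⟨a, by omega⟩ ⟨b, hb⟩ ha
  rw [e1]
  symm
  refine Finset.card_bij (fun g _ => ((g 1 : ℕ), (finFunctionFinEquiv fun b : Fin l => g b.succ.succ : ℕ)))
    (fun g hg => ?_) (fun g hg g' hg' h => ?_) fun p hp => ?_
  · simp only [mem_filter, mem_univ, true_and] at hg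
    simp only [mem_filter, mem_product, mem_range]
    refine ⟨⟨(g 1).2, (Fin.is_lt _).trans_le hQ⟩, ?_⟩
    rw [← hg.1]
    exact (hclq g _ (fun b => by rw [← finFunctionFinEquiv_symm_apply_val, Equiv.symm_apply_apply]) (Fin.is_lt _)).2 hg.2
  · simp only [mem_filter, mem_univ, true_and] at hg hg'
    simp only [Prod.mk.injEq] at h
    have h2 := congrFun (finFunctionFinEquiv.injective (Fin.ext h.2))
    funext a
    refine Fin.cases (hg.1.trans hg'.1.symm) (fun a => Fin.cases (Fin.ext h.1) (fun a => h2 a) a) a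
  · simp only [mem_filter, mem_product, mem_range] at hp
    have hx : p.2 < D.m ^ l := by have := hp.2.2.2.1; rwa [hj2] at this
    let g : Fin (l + 2) → Fin D.m := Fin.cons row (Fin.cons ⟨p.1, hp.1.1⟩ (finFunctionFinEquiv.symm ⟨p.2, hx⟩))
    have hg1 : (g 1 : ℕ) = p.1 := rfl
    refine ⟨g, ?_, ?_⟩
    · exact mem_filter.2 ⟨mem_univ _, rfl, (hclq g p.2 (fun b => by simp [g]) hx).1 hp.2⟩
    · refine Prod.ext hg1 ?_
      have : (fun b : Fin l => g b.succ.succ) = finFunctionFinEquiv.symm ⟨p.2, hx⟩ := by funext b; simp [g]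
      simp only [this, Equiv.apply_symm_apply]

theorem sum_rowCnt {l : ℕ} (hj : D.j = l + 2) (hQ : D.m ^ l ≤ D.Q) : ∑ row ∈ range D.m, D.rowCnt row = tcount D.G D.L D.m D.j := by
  classical
  rw [Finset.sum_range, sum_congr rfl fun row _ => D.rowCnt_eq hj hQ row, hj, tcount,
    Finset.card_eq_sum_card_fiberwise (f := fun g => g 0) (t := univ) fun _ _ => by simp]
  refine sum_congr rfl fun row _ => ?_
  rw [Finset.filter_filter]
  congr 1
  ext g
  simp [and_comm]

theorem tcount_le_rowCnt {l : ℕ} (hj : D.j = l + 2) (hQ : D.m ^ l ≤ D.Q) {row : ℕ} (hrow : row < D.m)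
    {L' : ℕ → ℕ} {m' : ℕ} (ψ : ℕ → ℕ) (hψ : ∀ d < m', ψ d < D.m)
    (hinj : ∀ d < m', ∀ d' < m', ψ d = ψ d' → d = d') (hL : ∀ d < m', L' d = D.L (ψ d))
    (hadj : ∀ d < m', D.G.Adj (D.L row) (D.L (ψ d))) : tcount D.G L' m' (l + 1) ≤ D.rowCnt row := by
  classical
  rw [show row = ((⟨row, hrow⟩ : Fin D.m) : ℕ) from rfl, D.rowCnt_eq hj hQ]
  refine Finset.card_le_card_of_injOn (fun g => Fin.cons ⟨row, hrow⟩ fun a => ⟨ψ (g a), hψ _ (g a).2⟩) (fun g hg => ?_) fun g _ g' _ h => ?_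
  · simp only [mem_coe, mem_filter, mem_univ, true_and] at hg ⊢
    refine ⟨rfl, fun a b => ?_⟩
    refine Fin.cases (fun hab => absurd hab (by simp)) (fun b => ?_) b
    refine Fin.cases (fun _ => ?_) (fun a hab => ?_) a
    · exact hadj _ (g b).2
    · have := hg a b (by simpa using hab)
      rwa [hL _ (g a).2, hL _ (g b).2] at this
  · funext a
    have := congrArg Fin.val (congrFun (Fin.cons_right_injective _ h) a)
    exact Fin.ext (hinj _ (g a).2 _ (g' a).2 this)

/-- Pairs with many cliques. -/
def heavy (s row col : ℕ) : Prop := D.Q < 8 * s * D.cntUpTo D.Q row col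

open Classical in
/-- The number of heavy pairs in a row. -/
def deg (s row : ℕ) : ℕ := count (D.heavy s row) D.m

theorem sum_deg_mul_le (s : ℕ) : (∑ row ∈ range D.m, D.deg s row) * D.Q ≤ 8 * s * ∑ row ∈ range D.m, D.rowCnt row := by
  classical
  rw [sum_mul, mul_sum]
  refine sum_le_sum fun row _ => ?_
  rw [deg, rowCnt, Nat.count_eq_card_filter_range, card_filter, sum_mul, mul_sum]
  refine sum_le_sum fun col _ => ?_
  split_ifs with h
  · rw [one_mul]; exact h.le
  · simp

/-- Rows with few heavy pairs and few cliques. -/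
def low (s row : ℕ) : Prop := D.deg s row * D.m ≤ 4 * ∑ i ∈ range D.m, D.deg s i ∧ D.rowCnt row * D.m ≤ 4 * ∑ i ∈ range D.m, D.rowCnt i

theorem card_large (m : ℕ) (f : ℕ → ℕ) : 4 * ((range m).filter fun i => ¬ f i * m ≤ 4 * ∑ i ∈ range m, f i).card ≤ m := by
  set s := ∑ i ∈ range m, f i with hs
  set A := (range m).filter fun i => ¬ f i * m ≤ 4 * s
  have h1 : A.card * (4 * s + 1) ≤ s * m := by
    rw [hs, sum_mul, ← smul_eq_mul, ← sum_const]
    refine (sum_le_sum fun i hi => ?_).trans (Finset.sum_le_sum_of_subset (Finset.filter_subset (fun i => ¬ f i * m ≤ 4 * s) _))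
    have := (mem_filter.1 hi).2
    omega
  rcases Nat.eq_zero_or_pos s with h | h
  · rw [h] at h1; omega
  · have : s * (4 * A.card) ≤ s * m := by nlinarith
    exact Nat.le_of_mul_le_mul_left this h

open Classical in
theorem count_not_low (s : ℕ) : 2 * count (fun i => ¬ D.low s i) D.m ≤ D.m := by
  have h1 := card_large D.m (D.deg s)
  have h2 := card_large D.m D.rowCnt
  rw [Nat.count_eq_card_filter_range]
  have : ((range D.m).filter fun i => ¬ D.low s i) ⊆ ((range D.m).filter fun i => ¬ D.deg s i * D.m ≤ 4 * ∑ i ∈ range D.m, D.deg s i) ∪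
      ((range D.m).filter fun i => ¬ D.rowCnt i * D.m ≤ 4 * ∑ i ∈ range D.m, D.rowCnt i) := by
    intro i hi
    obtain ⟨hi, h⟩ := mem_filter.1 hi
    rw [Finset.mem_union, mem_filter, mem_filter]; exact (not_and_or.1 h).imp (⟨hi, ·⟩) (⟨hi, ·⟩)
  have := (card_le_card this).trans (Finset.card_union_le _ _)
  omega

theorem adj_of_heavy (hj : 2 ≤ D.j) {s row col : ℕ} (h : D.heavy s row col) : D.G.Adj (D.L row) (D.L col) := by
  classical
  have : D.cntUpTo D.Q row col ≠ 0 := fun h0 => by simp [heavy, h0] at h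
  obtain ⟨x, -, hx⟩ := Finset.exists_ne_zero_of_sum_ne_zero this
  have hx : D.clq row col x := by by_contra h; simp [h] at hx
  simpa [tup] using hx.2.2.2 1 (by omega) 0 one_pos

theorem deg_le (s row : ℕ) : D.deg s row ≤ D.m := by classical exact Nat.count_le _

end PD

/-! ### Heavy neighbours -/

/-- The state contains the table of the numbers of cliques on pairs and the bound `s` for heavy pairs. -/
structure Tab (D : PD) (s : ℕ) (v : St) : Prop where
  m : v.r (lv D.j 0) = D.m
  s : v.r (lv D.j 3) = s
  Q : v.r (lv D.j 4) = D.Q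
  N : v.r (lv D.j 5) = D.N
  L : v.a (bL D.j) = D.L
  cnt : ∀ row < D.N, ∀ col < D.N, v.a (bCnt D.j) (row * D.N + col) = D.cntUpTo D.Q row col

theorem Tab.of_fr {s : ℕ} {X Y : Var → Prop} (h : Tab D s v) (F : Fr X Y v v')
    (hX : ∀ c, c = 0 ∨ c = 3 ∨ c = 4 ∨ c = 5 → ¬ X (lv D.j c)) (hL : ¬ Y (bL D.j)) (hY : ¬ Y (bCnt D.j)) :
    Tab D s v' :=
  ⟨by rw [F.r _ (hX 0 (by simp)), h.m], by rw [F.r _ (hX 3 (by simp)), h.s],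
    by rw [F.r _ (hX 4 (by simp)), h.Q], by rw [F.r _ (hX 5 (by simp)), h.N], by rw [F.a _ hL, h.L],
    fun row hr col hc => by rw [F.a _ hY, h.cnt row hr col hc]⟩

def scanBody (j : ℕ) : SL := .seq (.asg (lv j 11) (.ld (bCnt j) (.v (lv j 2) * .v (lv j 5) + .v (lv j 10))))
    (.seq (.asg (lv j 9) (.v (lv j 9) + .v (lv j 11))) (.ite (.lt (.v (lv j 4)) (8 * .v (lv j 3) * .v (lv j 11)))
        (.seq (.sto (bL (j - 1)) (.v (lv j 8)) (.ld (bL j) (.v (lv j 10)))) (.asg (lv j 8) (.v (lv j 8) + 1)))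
        .skip))

/-- Collect the heavy neighbours of the vertex with index `lv j 2` at level `j - 1`, their number in `lv j 8`
and the number of cliques in `lv j 9`. -/
def rowScan (j : ℕ) : Cmd := .seq (SL.seq (.asg (lv j 8) 0) (.asg (lv j 9) 0)).cmd (forE (lv j 10) (.v (lv j 0)) (scanBody j).cmd)

def RsX (j : ℕ) (x : Var) : Prop := x.1 = 30 + j ∧ 8 ≤ x.2 ∧ x.2 ≤ 11

theorem RsX.lv {c : ℕ} (h : 8 ≤ c) (h' : c ≤ 11) : RsX j (lv j c) := ⟨rfl, h, h'⟩

theorem RsX.not {c : ℕ} (h : c < 8 ∨ 11 < c) : ¬ RsX j (CliqueListing.lv j c) := fun h' => by have := h'.2; simp only at this; omega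

theorem rowScan_tri {s : ℕ} {row : ℕ} (hj : 1 ≤ D.j) (hS : 20 ≤ P.S)
    (h : Tab D s v) (hr : v.r (lv D.j 2) = row) (hrow : row < D.m) (hmN : D.m ≤ D.N) (hW : D.m * D.Q ≤ P.W)
    (hmW : D.m ≤ P.W) (hn : ∀ i, D.L i < D.n) (hn' : ∀ i, v.a (bL (D.j - 1)) i < D.n) :
    Tri P (rowScan D.j) v (200 * (D.m + 1)) 0 fun v' => Fr (RsX D.j) (· = bL (D.j - 1)) v v' ∧
      v'.r (lv D.j 8) = D.deg s row ∧ v'.r (lv D.j 9) = D.rowCnt row ∧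
      (∀ i, v'.a (bL (D.j - 1)) i < D.n) ∧ ∃ ψ : ℕ → ℕ,
        (∀ d < D.deg s row, ψ d < D.m ∧ D.heavy s row (ψ d) ∧ v'.a (bL (D.j - 1)) d = D.L (ψ d)) ∧
        (∀ d < D.deg s row, ∀ d' < D.deg s row, ψ d = ψ d' → d = d') ∧
        ∀ c < D.m, D.heavy s row c → ∃ d < D.deg s row, ψ d = c := by
  classical
  set p := D.heavy s row with hp
  have hne : bL (D.j - 1) ≠ bL D.j := by simp; omega
  let K : ℕ → St → Prop := fun i v' => v'.r (lv D.j 10) = i ∧ Fr (RsX D.j) (· = bL (D.j - 1)) v v' ∧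
    v'.r (lv D.j 8) = count p i ∧ v'.r (lv D.j 9) = ∑ col ∈ range i, D.cntUpTo D.Q row col ∧ (∀ i, v'.a (bL (D.j - 1)) i < D.n) ∧
      ∀ d < count p i, ∃ c < i, p c ∧ count p c = d ∧ v'.a (bL (D.j - 1)) d = D.L c
  let v1 := (v.set (lv D.j 8) 0).set (lv D.j 9) 0
  have F1 : Fr (RsX D.j) (· = bL (D.j - 1)) v v1 := ((Fr.refl _ _ v).set (RsX.lv le_rfl (by omega)) _).set (RsX.lv (by omega) (by omega)) _
  refine ((Tri.sl (P := P) (v := v) (Q := (· = v1)) (by simp [SL.size]; omega)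
    (fun _ => by simp [SL.ok]) fun _ => by simp [SL.exec, v1]).seq (e' := 0)
      (T' := D.m * (100 + 32) + 32) fun v' _ h' => ?_).le ?_ (by simp)
  swap
  · rw [show SL.cost (.seq (.asg (lv D.j 8) 0) (.asg (lv D.j 9) 0)) = 7 from rfl]; omega
  subst h'
  refine (Tri.forE (x := lv D.j 10) (b := .v (lv D.j 0)) (v := v1) (e := 0) (T := 100) (c := (scanBody D.j).cmd) D.m K (by simp; omega)
    ⟨by simp, F1.set (RsX.lv (by omega) (by omega)) _, by simp [v1], by simp [v1], hn', by simp⟩ hmW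
    (fun i v' h' => h'.1) (fun i v' h' => by rw [Ex.eval_v, h'.2.1.r _ (RsX.not (by omega)), h.m]) (by omega)
    fun i v' hi h' hs => ?_).mono le_rfl (by simp) fun v' _ h' => ?_
  · obtain ⟨hi', hF, h8, h9, hL, hc⟩ := h'
    have hT := h.of_fr hF (fun c hc => RsX.not (by omega)) (Ne.symm hne) (by simp)
    set x := D.cntUpTo D.Q row i with hx
    have e1 : (Ex.ld (bCnt D.j) (.v (lv D.j 2) * .v (lv D.j 5) + .v (lv D.j 10))).eval v' = x := by
      simp only [Ex.eval_ld, Ex.eval_add, Ex.eval_mul, Ex.eval_v, hi', hT.N]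
      rw [hF.r _ (RsX.not (by omega)), hr, hT.cnt _ (by omega) _ (by omega)]
    set t := ∑ col ∈ range i, D.cntUpTo D.Q row col with ht
    have hsum : t + x ≤ P.W := by
      rw [ht, hx, ← sum_range_succ]
      refine (sum_le_card_nsmul _ _ D.Q fun c _ => D.cntUpTo_le _ _ _).trans ?_
      rw [card_range, smul_eq_mul]; exact (Nat.mul_le_mul_right _ hi).trans hW
    set v2 := v'.set (lv D.j 11) x with hv2
    have e2 : (Ex.v (lv D.j 9) + .v (lv D.j 11)).eval v2 = t + x := by simp [hv2, h9]
    set v3 := v2.set (lv D.j 9) (t + x) with hv3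
    have F3 : Fr (RsX D.j) (· = bL (D.j - 1)) v v3 := (hF.set (RsX.lv (by omega) (by omega)) _).set (RsX.lv (by omega) (by omega)) _
    have e3 : (Ex.lt (.v (lv D.j 4)) (8 * .v (lv D.j 3) * .v (lv D.j 11))).eval v3 = if p i then 1 else 0 := by
      simp only [Ex.eval_lt, Ex.eval_mul, Ex.eval_v, Ex.eval_ofNat, hv3, hv2]; simp only [St.set_r, Prod.mk.injEq]
      simp only [true_and, Nat.reduceEqDiff, if_false, if_true, hT.Q, hT.s]; exact if_congr Iff.rfl rfl rfl
    have hcnt : count p i ≤ i := Nat.count_le _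
    refine (Tri.sl (P := P) (p := scanBody D.j) (by simp [scanBody, SL.size]; omega) (fun _ => ?_) fun _ => ?_).time
      (show 52 ≤ 100 by decide)
    · simp only [scanBody, SL.ok, SL.exec, e1, ← hv2, e2, ← hv3, e3]
      refine ⟨by omega, hsum, ?_⟩
      by_cases hpi : p i
      · simp only [hpi, if_true, ne_eq, one_ne_zero, not_false_eq_true]
        refine ⟨?_, ?_⟩
        · simp only [Ex.eval_ld, hv3, hv2, St.set_a]; exact hs.2 _ _
        · simp only [Ex.eval_add, Ex.eval_v, Ex.eval_ofNat, St.put_r, hv3, hv2]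
          simp [h8]; omega
      · simp [hpi]
    · simp only [scanBody, SL.exec, e1, ← hv2, e2, ← hv3, e3]
      by_cases hpi : p i
      · have e4 : (Ex.ld (bL D.j) (.v (lv D.j 10))).eval v3 = D.L i := by simp [hv3, hv2, hi', hT.L]
        have e5 : (Ex.v (lv D.j 8)).eval v3 = count p i := by simp [hv3, hv2, h8]
        simp only [hpi, if_true, ne_eq, one_ne_zero, not_false_eq_true, e4, e5]
        have e6 : (Ex.v (lv D.j 8) + 1).eval (v3.put (bL (D.j - 1)) (count p i) (D.L i)) = count p i + 1 := by simp [hv3, hv2, h8]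
        rw [e6]
        refine ⟨by simp [hv3, hv2, hi'], by simp, ?_, by simp [Nat.count_succ, hpi], ?_, fun d => ?_, ?_⟩
        · exact ((F3.put rfl _ _).set (RsX.lv le_rfl (by omega)) _).set (RsX.lv (by omega) (by omega)) _
        · simp [hv3, sum_range_succ, ht, hx]
        · simp only [St.set_a, St.put_a, hv3, hv2]
          split_ifs
          exacts [hn _, hL _]
        · intro d hd
          simp only [St.set_a, St.put_a, hv3, hv2, true_and]; rw [Nat.count_succ, if_pos hpi] at hd
          split_ifs with hd'
          · exact ⟨i, by omega, hpi, hd'.symm, rfl⟩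
          · obtain ⟨c, h1, h2, h3, h4⟩ := hc d (by omega)
            exact ⟨c, by omega, h2, h3, h4⟩
      · simp only [hpi, if_false, ne_eq, not_true]
        refine ⟨by simp [hv3, hv2, hi'], by simp, F3.set (RsX.lv (by omega) (by omega)) _,
          by simp [Nat.count_succ, hpi, hv3, hv2, h8], ?_, hL, fun d hd => ?_⟩
        · simp [hv3, sum_range_succ, ht, hx]
        · rw [Nat.count_succ, if_neg hpi, add_zero] at hd
          obtain ⟨c, h1, h2, h3, h4⟩ := hc d hd
          exact ⟨c, by omega, h2, h3, h4⟩
  · obtain ⟨-, hF, h8, h9, hL, hc⟩ := h'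
    choose! ψ hψ using hc
    refine ⟨hF, h8, h9, hL, ψ, fun d hd => ⟨(hψ d hd).1, (hψ d hd).2.1, (hψ d hd).2.2.2⟩, fun d hd d' hd' he => ?_, fun c hcm hpc => ?_⟩
    · rw [← (hψ d hd).2.2.1, he, (hψ d' hd').2.2.1]
    · have hlt : count p c < count p D.m := Nat.count_strict_mono hpc hcm
      exact ⟨_, hlt, Nat.count_injective (hψ _ hlt).2.1 hpc (hψ _ hlt).2.2.1⟩

def sums (j : ℕ) : Cmd := .seq (SL.seq (.asg (lv j 6) 0) (.asg (lv j 7) 0)).cmd (forE (lv j 2) (.v (lv j 0)) (.seq (rowScan j)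
      (SL.seq (.asg (lv j 6) (.v (lv j 6) + .v (lv j 8))) (.asg (lv j 7) (.v (lv j 7) + .v (lv j 9)))).cmd))

def SuX (j : ℕ) (x : Var) : Prop := x.1 = 30 + j ∧ (x.2 = 2 ∨ 6 ≤ x.2)

theorem SuX.lv {c : ℕ} (h : c = 2 ∨ 6 ≤ c) : SuX j (lv j c) := ⟨rfl, h⟩

theorem SuX.not {c : ℕ} (h : c = 0 ∨ c = 1 ∨ c = 3 ∨ c = 4 ∨ c = 5) : ¬ SuX j (CliqueListing.lv j c) := fun h' => by
  have := h'.2; simp only at this; omega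

theorem sums_tri {s : ℕ} (hj : 1 ≤ D.j) (hS : 20 ≤ P.S)
    (h : Tab D s v) (hmN : D.m ≤ D.N) (hQ : 1 ≤ D.Q) (hW : D.m * (D.m * D.Q) ≤ P.W)
    (hmW : D.m ≤ P.W) (hn : ∀ i, D.L i < D.n) (hn' : ∀ i, v.a (bL (D.j - 1)) i < D.n) :
    Tri P (sums D.j) v (300 * ((D.m + 1) * (D.m + 1))) 0 fun v' => Fr (SuX D.j) (· = bL (D.j - 1)) v v' ∧
      v'.r (lv D.j 6) = ∑ i ∈ range D.m, D.deg s i ∧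
      v'.r (lv D.j 7) = ∑ i ∈ range D.m, D.rowCnt i ∧ ∀ i, v'.a (bL (D.j - 1)) i < D.n := by
  have hne : bL (D.j - 1) ≠ bL D.j := by simp; omega
  let K : ℕ → St → Prop := fun i v' => v'.r (lv D.j 2) = i ∧ Fr (SuX D.j) (· = bL (D.j - 1)) v v' ∧
    v'.r (lv D.j 6) = ∑ i ∈ range i, D.deg s i ∧ v'.r (lv D.j 7) = ∑ i ∈ range i, D.rowCnt i ∧ ∀ i, v'.a (bL (D.j - 1)) i < D.n
  let v1 := (v.set (lv D.j 6) 0).set (lv D.j 7) 0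
  have F1 : Fr (SuX D.j) (· = bL (D.j - 1)) v v1 := ((Fr.refl _ _ v).set (SuX.lv (by omega)) _).set (SuX.lv (by omega)) _
  refine ((Tri.sl (P := P) (v := v) (Q := (· = v1)) (by simp [SL.size]; omega)
    (fun _ => by simp [SL.ok]) fun _ => by simp [SL.exec, v1]).seq (e' := 0)
      (T' := D.m * (200 * (D.m + 1) + 20 + 32) + 32) fun v' _ h' => ?_).le ?_ (by simp)
  swap
  · rw [show SL.cost (.seq (.asg (lv D.j 6) 0) (.asg (lv D.j 7) 0)) = 7 from rfl]; nlinarith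
  subst h'
  refine (Tri.forE (x := lv D.j 2) (b := .v (lv D.j 0)) (v := v1) (e := 0) (T := 200 * (D.m + 1) + 20) D.m K (by simp; omega)
    ⟨by simp, F1.set (SuX.lv (by omega)) _, by simp [v1], by simp [v1], hn'⟩ hmW
    (fun i v' h' => h'.1) (fun i v' h' => by rw [Ex.eval_v, h'.2.1.r _ (SuX.not (by omega)), h.m]) (by omega)
    fun i v' hi h' hs => ?_).mono le_rfl (by simp) fun v' _ h' => h'.2
  obtain ⟨hi', hF, h6, h7, hL⟩ := h'
  have hT := h.of_fr hF (fun c hc => SuX.not (by omega)) (Ne.symm hne) (by simp)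
  have hmQ : D.m * D.Q ≤ P.W := le_trans (Nat.le_mul_of_pos_left _ (by omega)) hW
  refine ((rowScan_tri hj hS hT hi' hi hmN hmQ hmW hn hL).seq (e' := 0) (T' := 19)
    fun v2 _ ⟨g1, g2, g3, g4, _⟩ => ?_).le (by omega) (by simp)
  have q6 : v2.r (lv D.j 6) = ∑ i ∈ range i, D.deg s i := by rw [g1.r _ (RsX.not (by omega)), h6]
  have q7 : v2.r (lv D.j 7) = ∑ i ∈ range i, D.rowCnt i := by rw [g1.r _ (RsX.not (by omega)), h7]
  have F2 : Fr (SuX D.j) (· = bL (D.j - 1)) v v2 := hF.trans (g1.mono (fun x hx => ⟨hx.1, Or.inr (by have := hx.2; omega)⟩) fun _ h => h)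
  refine (Tri.sl (P := P) (by simp [SL.size]; omega) (fun _ => ?_) fun _ => ?_).time (show 15 ≤ 19 by decide)
  · simp only [SL.ok, SL.exec, Ex.eval_add, Ex.eval_v, q6, g2]
    rw [St.set_ne (by simp), St.set_ne (by simp), q7, g3, ← sum_range_succ, ← sum_range_succ]
    constructor
    · refine (sum_le_card_nsmul _ _ D.m fun c _ => D.deg_le _ _).trans ?_
      rw [card_range, smul_eq_mul]
      refine (Nat.mul_le_mul hi (Nat.le_mul_of_pos_right _ hQ)).trans hW
    · refine (sum_le_card_nsmul _ _ (D.m * D.Q) fun c _ => ?_).trans ?_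
      · refine (sum_le_card_nsmul _ _ D.Q fun c _ => D.cntUpTo_le _ _ _).trans ?_
        rw [card_range, smul_eq_mul]
      · rw [card_range, smul_eq_mul]
        exact (Nat.mul_le_mul_right _ hi).trans hW
  · simp only [SL.exec, Ex.eval_add, Ex.eval_v, q6, g2]
    refine ⟨by simp [g1.r _ (RsX.not (j := D.j) (c := 2) (by omega)), hi'], by simp,
      ((F2.set (SuX.lv (by omega)) _).set (SuX.lv (by omega)) _).set (SuX.lv (by omega)) _, ?_, ?_, g4⟩
    · simp [sum_range_succ]
    · simp [q7, g3, sum_range_succ]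

/-- Replace the list of vertices by the one in `(30 + j, 2)`. -/
def copyBack (j : ℕ) : Cmd := .seq (forE (lv j 2) (.v (lv j 12)) (SL.sto (bL j) (.v (lv j 2)) (.ld (30 + j, 2) (.v (lv j 2)))).cmd)
    (asg (lv j 0) (.v (lv j 12)))

theorem copyBack_tri (hS : 20 ≤ P.S) (hm : v.r (lv j 12) = m) (hn : ∀ i, v.a (bL j) i < n) (hn' : ∀ i, v.a (30 + j, 2) i < n) :
    Tri P (copyBack j) v (100 * (m + 1)) 0 fun v' => Fr (fun x => x = lv j 2 ∨ x = lv j 0) (· = bL j) v v' ∧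
      v'.r (lv j 0) = m ∧ (∀ i, v'.a (bL j) i < n) ∧ ∀ i < m, v'.a (bL j) i = v.a (30 + j, 2) i := by
  refine Tri.of_small fun hs => ?_
  have t := Tri.forE (x := lv j 2) (b := .v (lv j 12)) (v := v) (e := 0) (T := 10)
    (c := (SL.sto (bL j) (.v (lv j 2)) (.ld (30 + j, 2) (.v (lv j 2)))).cmd) m (fun i v' =>
      v'.r (lv j 2) = i ∧ Fr (· = lv j 2) (· = bL j) v v' ∧ (∀ i, v'.a (bL j) i < n) ∧
        ∀ c < i, v'.a (bL j) c = v.a (30 + j, 2) c) (by simp; omega)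
    ⟨by simp, (Fr.refl (· = lv j 2) (· = bL j) v).set (x := lv j 2) rfl _, hn, by simp⟩ (hm ▸ hs.1 _) (fun i v' h' => h'.1)
    (fun i v' h' => by rw [Ex.eval_v, h'.2.1.r _ (by simp), hm]) (by omega) fun i v' hi ⟨h1, h2, h3, h4⟩ hs => by
      refine (Tri.sl (P := P) (by simp [SL.size]; omega) (fun hs => ?_) fun _ => ?_).time (show 7 ≤ 10 by decide)
      · simp only [SL.ok, Ex.eval_ld]; exact hs.2 _ _
      · simp only [SL.exec, Ex.eval_ld, Ex.eval_v, h1]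
        rw [h2.a (30 + j, 2) (by simp)]
        refine ⟨h1, by simp, (h2.put rfl _ _).set rfl _, fun c => ?_, fun c hc => ?_⟩
        · rw [St.set_a, St.put_a]; split_ifs; exacts [hn' _, h3 _]
        · rw [St.set_a, St.put_a]
          split_ifs with h
          · rw [h.2]
          · exact h4 c (by
              have : c ≠ i := fun h' => h ⟨rfl, h'⟩
              omega)
  refine (t.seq (e' := 0) (T' := 3) fun v1 _ ⟨_, h2, h3, h4⟩ => Tri.asg (by simp; omega) (fun hs => hs.1 _)
    ⟨?_, ?_, h3, h4⟩).le ?_ (by simp)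
  · rw [show forCost (.v (lv j 12)) = 32 from rfl]; nlinarith
  · exact (h2.mono (X' := fun x => x = lv j 2 ∨ x = lv j 0) (fun _ h => Or.inl h) fun _ h => h).set (x := lv j 0) (Or.inr rfl) _
  · rw [Ex.eval_v, St.set_r, if_pos rfl, h2.r _ (by simp), hm]

/-! ### The recursion -/

/-- The flag for an insufficient time budget. -/
abbrev vFail : Var := (1, 2)

/-- The global assumptions. -/
structure Glob (M : MMProg) (P : Par) (k n R μG τm ℓ : ℕ) : Prop where
  n_pos : 1 ≤ n
  W : 8 * n ^ k + 1 ≤ P.W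
  c : ∀ N ≤ 2 * n, (N + 2) ^ M.c ≤ P.W
  μ : ∀ N ≤ 2 * n, M.μ N + N * N + 1 ≤ μG
  τ : τm + μG ≤ P.W
  S : 2 * k + 20 ≤ P.S
  ε : (((n + 2) ^ (k + 1) : ℕ) : ℝ≥0∞) * ((2 : ℝ≥0∞) ^ R)⁻¹ ≤ P.ε
  R : R + 1 ≤ ℓ
  q : clog 2 (n ^ k) + 1 ≤ ℓ

/-- The global invariant. -/
structure GInv (n k R : ℕ) (G : SimpleGraph ℕ) (v : St) : Prop where
  env : Env n k G.Adj v
  zero : MMZero v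
  R : v.r vR = R
  L : ∀ l c i, c ≠ 1 → v.a (30 + l, c) i < n

def GX (j : ℕ) (x : Var) : Prop := x.1 = 7 ∨ x.1 = 10 ∨ x.1 = 11 ∨ x.1 = 21 ∨ x = vTick ∨ x = vC ∨ x = vFail ∨
  (x.1 = 2 ∧ x.2 < j) ∨ (30 ≤ x.1 ∧ x.1 ≤ 30 + j)
def GY (j : ℕ) (b : Var) : Prop := b.1 = 20 ∨ b.1 = 23 ∨ EmY b ∨ b = bRnd ∨ (30 ≤ b.1 ∧ b.1 ≤ 30 + j)

/-- All cliques with the first `j` vertices among `L 0, …, L (m - 1)`, and the others given by `V`, are in `l`. -/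
def Cov (G : SimpleGraph ℕ) (k j m : ℕ) (L V : ℕ → ℕ) (l : List (Finset ℕ)) : Prop :=
  ∀ f : ℕ → ℕ, (∀ b < k, ∀ a < b, G.Adj (f a) (f b)) → (∀ i < j, ∃ c < m, f i = L c) →
    (∀ i, j ≤ i → i < k → f i = V i) → (range k).image f ∈ l

/-- `S i m t τ` is a sufficient condition for the time budget `τ` at level `i + 2` with `m` vertices and
`t` clique tuples. -/
structure Suffices (M : MMProg) (k n : ℕ) (S : ℕ → ℕ → ℕ → ℕ → Prop) : Prop where
  base : ∀ m t τ, S 0 m t τ → m * m ≤ τ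
  count : ∀ i m t τ, i + 3 ≤ k → 1 ≤ m → m ≤ n → S (i + 1) m t τ → 2 ^ clog 2 (m ^ (i + 1)) / 2 ^ clog 2 m *
      (M.μ (2 ^ clog 2 m) + 2 ^ clog 2 m * 2 ^ clog 2 m + 1) ≤ τ
  mono : ∀ i m t τ m' t', S i m t τ → m' ≤ m → t' ≤ t → S i m' t' τ
  step : ∀ i m t τ s H m' t', i + 3 ≤ k → 1 ≤ m → m ≤ n → S (i + 1) m t τ → t ≤ m ^ (i + 3) → s ≤ 2 ^ clog 2 (m ^ (i + 1)) →
    (∀ a ≤ clog 2 m, 2 ^ clog 2 (m ^ (i + 1)) / 2 ^ a *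
      (2 ^ (clog 2 m - a) * 2 ^ (clog 2 m - a)) * (M.μ (2 ^ a) + 2 ^ a * 2 ^ a + 1) ≤ τ → s ≤ 2 ^ a) →
    H * 2 ^ clog 2 (m ^ (i + 1)) ≤ 8 * s * t → m' * m ≤ 4 * H → t' * m ≤ 4 * t → m' ≤ m →
    S i m' t' (τ / m)

/-- The result of level `i + 2`. -/
structure GPost (M : MMProg) (k n R i : ℕ) (G : SimpleGraph ℕ) (v v' : St) : Prop where
  fr : Fr (GX (i + 2)) (GY (i + 2)) v v'
  inv : GInv n k R G v'
  out : outs k v ⊆ outs k v'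
  fail : v.r vFail ≠ 0 → v'.r vFail ≠ 0
  cov : v'.r vFail = 0 → Cov G k (i + 2) (v.r (lv (i + 2) 0)) (v.a (bL (i + 2))) (fun a => v.r (vV a)) (outs k v')
  suff : ∀ S, Suffices M k n S → S i (v.r (lv (i + 2) 0))
    (tcount G (v.a (bL (i + 2))) (v.r (lv (i + 2) 0)) (i + 2)) (v.r (lv (i + 2) 1)) → v'.r vFail = v.r vFail

/-- The time that may exceed the budget. -/
def slack (n μG : ℕ) : ℕ → ℕ
  | 0 => 1
  | i + 1 => n ^ i * μG

def errs (ℓ n : ℕ) : ℕ → ℕ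
  | 0 => 0
  | i + 1 => ℓ * (1 + n * errs ℓ n i)

/-- The specification of a program for level `i + 2`. -/
def GenSpec (M : MMProg) (k i : ℕ) (c : Cmd) : Prop :=
  ∃ C, ∀ {P : Par} {n R μG τm ℓ : ℕ} (_ : Glob M P k n R μG τm ℓ) {G : SimpleGraph ℕ} {v : St}, i + 2 ≤ k →
    GInv n k R G v → v.r (lv (i + 2) 0) ≤ n → v.r (lv (i + 2) 1) ≤ τm →
    (∀ a, i + 2 ≤ a → a < k → v.r (vV a) < n) →
    Tri P c v (C * ℓ ^ (3 * i) * (v.r (lv (i + 2) 1) + slack n μG i)) (errs ℓ n i) (GPost M k n R i G v)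

def genBase (k : ℕ) : Cmd := ifE (.lt (.v (lv 2 1)) (.v (lv 2 0) * .v (lv 2 0))) (asg vFail 1) (forE (lv 2 2) (.v (lv 2 0) * .v (lv 2 0))
      (.seq (SL.seq (.asg (vV 0) (.ld (bL 2) (.v (lv 2 2) / .v (lv 2 0))))
        (.asg (vV 1) (.ld (bL 2) (.v (lv 2 2) % .v (lv 2 0))))).cmd (emit k).cmd))

theorem GInv.of_fr {X Y : Var → Prop} (h : GInv n k R G v)
    (F : Fr X Y v v') (hX : ∀ x, X x → x ≠ vC ∧ x ≠ vn ∧ x ≠ vOne ∧ x ≠ vR ∧ x.1 ≠ 21)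
    (hY : ∀ b, Y b → b ≠ bA ∧ b ≠ bOut ∧ b ≠ bMark ∧ b.1 ≠ 20)
    (hL : ∀ l c, c ≠ 1 → Y (30 + l, c) → ∀ i, v'.a (30 + l, c) i < n) : GInv n k R G v' := by
  have hx : ∀ x, (x = vC ∨ x = vn ∨ x = vOne ∨ x = vR ∨ x.1 = 21) → v'.r x = v.r x := fun x h => F.r x fun h' => by have := hX x h'; tauto
  have hy : ∀ b, (b = bA ∨ b = bOut ∨ b = bMark ∨ b.1 = 20) → v'.a b = v.a b := fun x h => F.a x fun h' => by have := hY x h'; tauto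
  refine ⟨h.env.congr (hx _ (by simp)) (hx _ (by simp)) (hx _ (by simp)) (hy _ (by simp)) (hy _ (by simp))
    (hy _ (by simp)), ⟨fun b i => by rw [hy _ (by simp), h.zero.1], fun r => by rw [hx _ (by simp), h.zero.2]⟩,
    by rw [hx _ (by simp), h.R], fun l c i hc => ?_⟩
  by_cases hY' : Y (30 + l, c)
  · exact hL l c hc hY' i
  · rw [F.a _ hY']; exact h.L l c i hc

theorem genBase_spec (M : MMProg) (k : ℕ) : GenSpec M k 0 (genBase k) := by
  refine ⟨(emit k).cost + 200, ?_⟩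
  intro P n R μG τm ℓ g G v hk hI hm hτ hV
  simp only [zero_add] at *
  set m := v.r (lv 2 0) with hmd
  set L := v.a (bL 2) with hL
  have hS := g.S
  have hW := g.W
  have hnk : n ^ k ≥ 1 := Nat.pow_pos g.n_pos
  have c1 : Ex.cost (.lt (.v (lv 2 1)) (.v (lv 2 0) * .v (lv 2 0))) = 9 := rfl
  have hmm : m * m ≤ n ^ k := (Nat.mul_le_mul hm hm).trans (by
    rw [← pow_two]; exact Nat.pow_le_pow_right g.n_pos hk)
  refine (Tri.ifE (T := ((emit k).cost + 100) * (v.r (lv 2 1) + 1)) (e := 0) (by simp; omega) (fun hz => ?_) fun hz => ?_).le ?_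
    (Nat.zero_le _)
  · simp only [Ex.eval_lt, Ex.eval_mul, Ex.eval_v, ← hmd, ne_eq, ite01_eq_zero, not_not] at hz
    refine (Tri.asg (by simp; omega) (by simp; omega) ?_).time ?_
    · have F : Fr (· = vFail) (fun _ => False) v (v.set vFail 1) := (Fr.refl (· = vFail) (fun _ => False) v).set (x := vFail) rfl 1
      refine ⟨F.mono (by simp [GX]) (by simp), hI.of_fr F (by simp) (by simp) (by simp), ?_, by simp, by simp, fun S hS h => ?_⟩
      · rw [show (1 : Ex).eval v = 1 from rfl, outs_set (by simp)]; exact fun _ h => h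
      · exact absurd (hS.base _ _ _ h) (not_le.2 hz)
    · rw [show Ex.cost 1 = 1 from rfl]; nlinarith
  · simp only [Ex.eval_lt, Ex.eval_mul, Ex.eval_v, ← hmd, ite01_eq_zero, not_lt] at hz
    let K : ℕ → St → Prop := fun i v' => v'.r (lv 2 2) = i ∧
      Fr (fun x => EmX x ∨ x = lv 2 2 ∨ (x.1 = 2 ∧ x.2 < 2)) EmY v v' ∧ Env n k G.Adj v' ∧ outs k v ⊆ outs k v' ∧
      ∀ c < i, ∀ f : ℕ → ℕ, (∀ b < k, ∀ a < b, G.Adj (f a) (f b)) → f 0 = L (c / m) → f 1 = L (c % m) →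
        (∀ i, 2 ≤ i → i < k → f i = v.r (vV i)) → (range k).image f ∈ outs k v'
    have c2 : forCost (.v (lv 2 0) * .v (lv 2 0)) = 40 := rfl
    refine (Tri.forE (x := lv 2 2) (b := .v (lv 2 0) * .v (lv 2 0)) (v := v) (e := 0) (T := (emit k).cost + 30) (m * m) K (by simp; omega)
      ⟨by simp, (Fr.refl _ _ v).set (by simp) _, hI.env.set (by simp) (by simp) (by simp) _, ?_, by simp⟩ (by omega)
      (fun i v' h' => h'.1) (fun i v' h' => by rw [Ex.eval_mul, Ex.eval_v, h'.2.1.r _ (by simp [EmX])]) (by omega)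
      fun i v' hi h' hs => ?_).mono ?_ (by simp) fun v' _ h' => ?_
    · rw [outs_set (by simp)]; exact fun _ h => h
    · obtain ⟨h1, hF, hE, hO, hc⟩ := h'
      have hm' : v'.r (lv 2 0) = m := hF.r _ (by simp [EmX])
      have e1 : (Ex.ld (bL 2) (.v (lv 2 2) / .v (lv 2 0))).eval v' = L (i / m) := by
        simp only [Ex.eval_ld, Ex.eval_div, Ex.eval_v, h1, hm', hF.a (bL 2) (by simp [EmY]), hL]
      have e2 : (Ex.ld (bL 2) (.v (lv 2 2) % .v (lv 2 0))).eval (v'.set (vV 0) (L (i / m))) = L (i % m) := by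
        simp only [Ex.eval_ld, Ex.eval_mod, Ex.eval_v, St.set_a, St.set_r, Prod.mk.injEq]
        simp only [false_and, if_false, h1, hm', hF.a (bL 2) (by simp [EmY]), hL, Nat.reduceAdd, Nat.reduceEqDiff]
      set v1 := (v'.set (vV 0) (L (i / m))).set (vV 1) (L (i % m)) with hv1
      have hLn := fun c => hI.L 2 0 c (by simp)
      have F1 : Fr (fun x => EmX x ∨ x = lv 2 2 ∨ (x.1 = 2 ∧ x.2 < 2)) EmY v v1 :=
        (hF.set (x := vV 0) (by simp) _).set (x := vV 1) (by simp) _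
      have E1 : Env n k G.Adj v1 := (hE.set (by simp) (by simp) (by simp) _).set (by simp) (by simp) (by simp) _
      have O1 : outs k v1 = outs k v' := by rw [hv1, outs_set (by simp), outs_set (by simp)]
      have V1 : ∀ a, 2 ≤ a → v1.r (vV a) = v.r (vV a) := fun a ha => F1.r _ (by simp [EmX]; omega)
      have V10 : v1.r (vV 0) = L (i / m) := by simp [hv1]
      have V11 : v1.r (vV 1) = L (i % m) := by simp [hv1]
      have V1n : ∀ a < k, v1.r (vV a) < n := fun
        | 0, _ => V10 ▸ hLn _
        | 1, _ => V11 ▸ hLn _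
        | a + 2, ha => by rw [V1 _ (by omega)]; exact hV _ (by omega) ha
      refine ((Tri.sl (P := P) (v := v') (Q := (· = v1)) (by simp [SL.size]; omega) (fun _ => ?_) fun _ => ?_).seq
        (e' := 0) fun v2 _ h2 => by
          subst h2; exact emit_tri (n := n) (k := k) (G := G) (by omega) (by omega) E1 V1n).mono
          (show 19 + (emit k).cost + 1 ≤ _ by omega) (by simp) ?_
      · simp only [SL.ok, e1, SL.exec, e2]
        have h1 := hs.2 (bL 2)
        rw [hF.a (bL 2) (by simp [EmY])] at h1
        exact ⟨h1 _, h1 _⟩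
      · simp only [SL.exec, e1, e2, ← hv1]
      · rintro v3 - ⟨g1, g2, g3, g4⟩
        refine ⟨by rw [g2.r _ (by simp [EmX])]; simp [hv1, h1], by simp,
          (F1.trans (g2.mono (fun _ h => Or.inl h) fun _ h => h)).set (by simp) _,
          g1.set (by simp) (by simp) (by simp) _, ?_, ?_⟩
        · rw [outs_set (by simp)]; exact fun _ h => g3 (O1 ▸ hO h)
        · rw [outs_set (by simp)]
          intro c hc' f hf f0 f1 f2
          rcases lt_succ_iff_lt_or_eq.1 hc' with h | rfl
          · exact g3 (O1 ▸ hc c h f hf f0 f1 f2)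
          · have : ∀ a < k, f a = v1.r (vV a) := fun
              | 0, _ => f0.trans V10.symm
              | 1, _ => f1.trans V11.symm
              | a + 2, ha => by rw [V1 _ (by omega), f2 _ (by omega) ha]
            rw [image_congr fun a ha => this a (by simpa using ha)]
            exact g4 fun b hb a ha => by rw [← this b hb, ← this a (by omega)]; exact hf b hb a ha
    · rw [c2]; nlinarith
    · obtain ⟨h1, hF, hE, hO, hc⟩ := h'
      refine ⟨hF.mono ?_ ?_, ⟨hE, ?_, ?_, ?_⟩, hO, ?_, fun _ f hf h0 h2 => ?_, fun _ _ _ => hF.r _ (by simp [EmX])⟩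
      · rintro x ((rfl | rfl | rfl) | rfl | h) <;> simp [GX] <;> omega
      · intro b hb; simp [GY, hb]
      · exact ⟨fun b i => by rw [hF.a _ (by simp [EmY]), hI.zero.1], fun r => by rw [hF.r _ (by simp [EmX]), hI.zero.2]⟩
      · rw [hF.r _ (by simp [EmX]), hI.R]
      · intro l c i hc; rw [hF.a _ (by simp [EmY]; omega)]; exact hI.L l c i hc
      · rw [hF.r _ (by simp [EmX])]; exact id
      · obtain ⟨c0, hc0, e0⟩ := h0 0 (by omega)
        obtain ⟨c1, hc1, e1⟩ := h0 1 (by omega)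
        obtain ⟨d1, d2⟩ := mul_add_div_mod (u := c0) hc1
        exact hc (c0 * m + c1) (mul_add_lt_mul hc0 hc1) f hf (by rw [d1, e0]) (by rw [d2, e1]) h2
  · rw [c1, slack, pow_zero]; nlinarith

theorem ite_mul_ite_ne_zero {p q : Prop} [Decidable p] [Decidable q] : (if p then 1 else 0) * (if q then 1 else 0) ≠ 0 ↔ p ∧ q := by
  split_ifs <;> simp_all

/-- The condition that the current vertex is low. -/
def lowE (j : ℕ) : Ex := .lt (.v (lv j 8) * .v (lv j 0)) (4 * .v (lv j 6) + 1) * .lt (.v (lv j 9) * .v (lv j 0)) (4 * .v (lv j 7) + 1)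

def enter (i : ℕ) : SL := .seq (.asg (vV (i + 2)) (.ld (bL (i + 3)) (.v (lv (i + 3) 2))))
    (.seq (.asg (lv (i + 2) 0) (.v (lv (i + 3) 8))) (.asg (lv (i + 2) 1) (.v (lv (i + 3) 1) / .v (lv (i + 3) 0))))

def keep (j : ℕ) : SL := .seq (.sto (30 + j, 2) (.v (lv j 12)) (.ld (bL j) (.v (lv j 2)))) (.asg (lv j 12) (.v (lv j 12) + 1))

/-- Apply `c` to the low vertices, and collect the others. -/
def scanRec (i : ℕ) (c : Cmd) : Cmd := .seq (asg (lv (i + 3) 12) 0) (forE (lv (i + 3) 2) (.v (lv (i + 3) 0))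
    (.seq (rowScan (i + 3)) (ifE (lowE (i + 3)) (.seq (enter i).cmd c) (keep (i + 3)).cmd)))

def ScX (i : ℕ) (x : Var) : Prop := GX (i + 2) x ∨ x = vV (i + 2) ∨ (x.1 = 33 + i ∧ (x.2 = 2 ∨ 8 ≤ x.2))
def ScY (i : ℕ) (b : Var) : Prop := GY (i + 2) b ∨ b = (33 + i, 2)

theorem ScX.not_lv {c : ℕ} (h : c ≠ 2 ∧ c < 8) : ¬ ScX i (lv (i + 3) c) := by simp [ScX, GX]; omega

/-- All cliques that contain the vertex with index `row` in position `j - 1` are in `l`. -/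
def PD.CovRow (D : PD) (s k : ℕ) (V : ℕ → ℕ) (row : ℕ) (l : List (Finset ℕ)) : Prop :=
  ∀ f : ℕ → ℕ, (∀ b < k, ∀ a < b, D.G.Adj (f a) (f b)) → f (D.j - 1) = D.L row → (∀ b < D.j - 1, ∃ d < D.m, D.heavy s row d ∧ f b = D.L d) →
    (∀ b, D.j ≤ b → b < k → f b = V b) → (range k).image f ∈ l

open Classical in
/-- The state after `a` steps of `scanRec`. -/
structure ScInv (D : PD) (M : MMProg) (k n R i s τ : ℕ) (v : St) (a : ℕ) (v' : St) : Prop where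
  fr : Fr (ScX i) (ScY i) v v'
  inv : GInv n k R D.G v'
  out : outs k v ⊆ outs k v'
  fail : v.r vFail ≠ 0 → v'.r vFail ≠ 0
  num : v'.r (lv (i + 3) 12) = count (fun b => ¬ D.low s b) a
  new : ∀ d < count (fun b => ¬ D.low s b) a, ∃ b < a, ¬ D.low s b ∧ count (fun b => ¬ D.low s b) b = d ∧ v'.a (33 + i, 2) d = D.L b
  cov : v'.r vFail = 0 → ∀ row < a, D.low s row → D.CovRow s k (fun b => v.r (vV b)) row (outs k v')
  suff : ∀ S, Suffices M k n S → (∀ row < D.m, D.low s row → ∀ t' ≤ D.rowCnt row, S i (D.deg s row) t' (τ / D.m)) → v'.r vFail = v.r vFail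

theorem ScInv.set {s : ℕ} {a : ℕ}
    (h : ScInv D M k n R i s τ v a v') (x : ℕ) : ScInv D M k n R i s τ v a (v'.set (lv (i + 3) 2) x) := by
  refine ⟨h.fr.set (Or.inr (Or.inr ⟨by simp; omega, Or.inl rfl⟩)) _,
    h.inv.of_fr ((Fr.refl (· = lv (i + 3) 2) (fun _ => False) v').set (x := lv (i + 3) 2) rfl x)
      (by rintro x rfl; simp; omega) (by simp) (by simp), ?_, ?_, ?_, h.new, ?_, ?_⟩
  · rw [outs_set (by simp)]; exact h.out
  · rw [St.set_ne (by simp; omega)]; exact h.fail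
  · rw [St.set_ne (by simp)]; exact h.num
  · rw [St.set_ne (by simp; omega), outs_set (by simp)]; exact h.cov
  · rw [St.set_ne (by simp; omega)]; exact h.suff

set_option maxHeartbeats 2000000 in
theorem scanRec_tri {c : Cmd} (hc : GenSpec M k i c) : ∃ C, ∀ {P : Par} {n R μG τm ℓ : ℕ}
    (_ : Glob M P k n R μG τm ℓ) {D : PD} {s τ : ℕ} {v : St}, i + 3 ≤ k → D.j = i + 3 → D.n = n → Tab D s v →
    GInv n k R D.G v → D.m ≤ n → D.m ≤ D.N → 1 ≤ D.Q → D.m ^ (i + 1) ≤ D.Q → D.m * (D.m * D.Q) ≤ P.W →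
    v.r (lv (i + 3) 1) = τ → τ ≤ τm → v.r (lv (i + 3) 6) = ∑ b ∈ range D.m, D.deg s b →
    v.r (lv (i + 3) 7) = ∑ b ∈ range D.m, D.rowCnt b → (∀ a, i + 3 ≤ a → a < k → v.r (vV a) < n) →
    Tri P (scanRec i c) v (C * ℓ ^ (3 * i) * (τ + n * slack n μG i + μG)) (n * errs ℓ n i) (ScInv D M k n R i s τ v D.m) := by
  classical
  obtain ⟨C, hC⟩ := hc
  refine ⟨C + 3000, ?_⟩
  intro P n R μG τm ℓ g D s τ v hk hj hn hT hI hm hmN hQ1 hmQ hW hτ hτm h6 h7 hV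
  have hS := g.S
  have hmQW : D.m * D.Q ≤ P.W := by
    rcases Nat.eq_zero_or_pos D.m with h | h
    · simp [h]
    · exact (Nat.le_mul_of_pos_left _ h).trans hW
  have hmW : D.m ≤ P.W := (Nat.le_mul_of_pos_right _ hQ1).trans hmQW
  have hLn : ∀ c, D.L c < D.n := fun c => by rw [← hT.L, hn]; exact hI.L D.j 0 c (by simp)
  have lvX : ∀ c, c = 2 ∨ 8 ≤ c → ScX i (lv (i + 3) c) := fun c hc => Or.inr (Or.inr ⟨by simp; omega, hc⟩)
  have rsX : ∀ x, RsX (i + 3) x → ScX i x := fun x hx => Or.inr (Or.inr ⟨by rw [hx.1]; omega, Or.inr hx.2.1⟩)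
  have bLY : ∀ b, b = bL (i + 2) → ScY i b := fun b hb => Or.inl (by subst hb; simp [GY])
  have I0 : ScInv D M k n R i s τ v 0 (v.set (lv (i + 3) 12) 0) := by
    refine ⟨(Fr.refl _ _ _).set (lvX _ (by omega)) _,
      hI.of_fr ((Fr.refl (· = lv (i + 3) 12) (fun _ => False) v).set (x := lv (i + 3) 12) rfl 0)
      (by rintro x rfl; simp; omega) (by simp) (by simp), ?_, ?_, by simp, by simp, by simp, ?_⟩
    · rw [outs_set (by simp)]; exact fun _ h => h
    · rw [St.set_ne (by simp)]; exact id
    · rw [St.set_ne (by simp)]; exact fun _ _ _ => rfl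
  set Tc := C * ℓ ^ (3 * i) * (τ / D.m + slack n μG i) with hTc
  refine ((Tri.asg (x := lv (i + 3) 12) (e := 0) (v := v) (Q := (· = v.set (lv (i + 3) 12) 0)) (by simp; omega)
    (by simp) rfl).seq (e' := n * errs ℓ n i) (T' := D.m * (200 * (D.m + 1) + (Tc + 25 + 37 + 2) + 1 + 32) + 32) fun v0 _ h0 => ?_).le
      ?_ (by omega)
  swap
  · rw [show Ex.cost 0 = 1 from rfl]
    have h1 := g.μ D.m (by omega)
    have hmm : D.m ≤ D.m * D.m := Nat.le_mul_self _
    have h2 : D.m * Tc ≤ C * ℓ ^ (3 * i) * (τ + n * slack n μG i) := by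
      rw [hTc, show D.m * (C * ℓ ^ (3 * i) * (τ / D.m + slack n μG i)) = C * ℓ ^ (3 * i) * (D.m * (τ / D.m) + D.m * slack n μG i) by ring]
      exact Nat.mul_le_mul_left _ (Nat.add_le_add (Nat.mul_div_le _ _) (Nat.mul_le_mul_right _ hm))
    have h3 : 1 ≤ ℓ ^ (3 * i) := Nat.pow_pos (by have := g.R; omega)
    have h4 : μG ≤ ℓ ^ (3 * i) * μG := Nat.le_mul_of_pos_left _ h3
    have h5 : (C + 3000) * ℓ ^ (3 * i) * (τ + n * slack n μG i + μG) = C * ℓ ^ (3 * i) * (τ + n * slack n μG i) +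
      3000 * (ℓ ^ (3 * i) * μG) + (C * ℓ ^ (3 * i) * μG + 3000 * ℓ ^ (3 * i) * (τ + n * slack n μG i)) := by ring
    rw [h5]; nlinarith [Nat.zero_le (C * ℓ ^ (3 * i) * μG + 3000 * ℓ ^ (3 * i) * (τ + n * slack n μG i))]
  subst h0
  refine (Tri.forE (x := lv (i + 3) 2) (b := .v (lv (i + 3) 0)) (v := v.set (lv (i + 3) 12) 0)
    (e := errs ℓ n i) (T := 200 * (D.m + 1) + (Tc + 25 + 37 + 2) + 1) D.m (fun a v' => v'.r (lv (i + 3) 2) = a ∧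
      ScInv D M k n R i s τ v a v') (by simp; omega) ⟨by simp, I0.set 0⟩ hmW (fun a v' h => h.1)
      (fun a v' h => ?_) (by omega) fun a v' ha h hs => ?_).mono le_rfl (Nat.mul_le_mul_right _ hm) fun v' _ h => h.2
  · have := hT.m
    rw [hj] at this; rw [Ex.eval_v, h.2.fr.r _ (ScX.not_lv (by omega)), this]
  obtain ⟨h2, I⟩ := h
  have hT' : Tab D s v' := hT.of_fr I.fr (fun c hc => by rw [hj]; exact ScX.not_lv (by omega))
    (by rw [hj]; simp [ScY, GY, EmY]; omega) (by rw [hj]; simp [ScY, GY, EmY]; omega)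
  have hR := rowScan_tri (row := a) (by omega) (by omega) hT' (by rw [hj]; exact h2) ha hmN hmQW hmW hLn
    (fun c => by rw [hj, hn]; exact I.inv.L (i + 2) 0 c (by simp))
  rw [hj, hn] at hR
  have hTm := hT'.m
  have hTL := hT'.L
  rw [hj] at hTm hTL
  refine (hR.seq (T' := Tc + 25 + 37 + 2) (e' := errs ℓ n i)
    fun v1 hs1 ⟨f1, d8, d9, dn, ψ, w1, w2, w3⟩ => ?_).le le_rfl (by omega)
  simp only [Nat.add_succ_sub_one] at f1 dn w1
  have F1 : Fr (ScX i) (ScY i) v v1 := I.fr.trans (f1.mono rsX bLY)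
  have G1 : GInv n k R D.G v1 := I.inv.of_fr f1 (fun x hx => by
      have := hx.1
      refine ⟨?_, ?_, ?_, ?_, by omega⟩ <;> rintro rfl <;> simp at this <;> omega)
    (by rintro b rfl; simp; omega) (fun l c hc hb x => by rw [hb]; exact dn x)
  have O1 : outs k v1 = outs k v' := outs_congr (f1.r _ (by simp [RsX])) (f1.a _ (by simp))
  have q0 : v1.r (lv (i + 3) 0) = D.m := by rw [f1.r _ (RsX.not (by omega)), hTm]
  have q2 : v1.r (lv (i + 3) 2) = a := by rw [f1.r _ (RsX.not (by omega)), h2]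
  have q12 : v1.r (lv (i + 3) 12) = v'.r (lv (i + 3) 12) := f1.r _ (RsX.not (by omega))
  have qF : v1.r vFail = v'.r vFail := f1.r _ (by simp [RsX])
  have qL : v1.a (bL (i + 3)) = D.L := by rw [f1.a _ (by simp), hTL]
  have qN : v1.a (33 + i, 2) = v'.a (33 + i, 2) := f1.a _ (by simp)
  have elow : (lowE (i + 3)).eval v1 ≠ 0 ↔ D.low s a := by
    simp only [lowE, Ex.eval_mul, Ex.eval_lt, Ex.eval_v, Ex.eval_add, Ex.eval_ofNat, d8, d9, q0,
      F1.r _ (ScX.not_lv (i := i) (c := 6) (by omega)), F1.r _ (ScX.not_lv (i := i) (c := 7) (by omega)), h6, h7,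
      PD.low, Nat.lt_succ_iff]
    exact ite_mul_ite_ne_zero
  have cl : (lowE (i + 3)).cost = 37 := rfl
  have e1 : (Ex.ld (bL (i + 3)) (.v (lv (i + 3) 2))).eval v1 = D.L a := by simp [q2, qL]
  refine (Tri.ifE (T := Tc + 25) (e := errs ℓ n i) (by simp [lowE]; omega) (fun hz => ?_) fun hz => ?_).time (by rw [cl])
  · have hlow := elow.1 hz
    set v2 := ((v1.set (vV (i + 2)) (D.L a)).set (lv (i + 2) 0) (D.deg s a)).set (lv (i + 2) 1) (τ / D.m) with hv2
    have e2 : (Ex.v (lv (i + 3) 8)).eval (v1.set (vV (i + 2)) (D.L a)) = D.deg s a := by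
      rw [Ex.eval_v, St.set_ne (by simp; omega), d8]
    have e3 : (Ex.v (lv (i + 3) 1) / .v (lv (i + 3) 0)).eval ((v1.set (vV (i + 2)) (D.L a)).set (lv (i + 2) 0) (D.deg s a)) = τ / D.m := by
      simp [q0, F1.r _ (ScX.not_lv (i := i) (c := 1) (by omega)), hτ]
    have lX : ∀ c, ScX i (lv (i + 2) c) := fun c => Or.inl (by simp [GX])
    have F2 : Fr (ScX i) (ScY i) v v2 := ((F1.set (x := vV (i + 2)) (by simp [ScX]) _).set (lX 0) _).set (lX 1) _
    have G2 : GInv n k R D.G v2 := G1.of_fr (X := fun x => x = vV (i + 2) ∨ x = lv (i + 2) 0 ∨ x = lv (i + 2) 1)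
      (Y := fun _ => False) ((((Fr.refl _ _ _).set (by simp) _).set (by simp) _).set (by simp) _)
      (by rintro x (rfl | rfl | rfl) <;> simp <;> omega) (by simp) (by simp)
    have O2 : outs k v2 = outs k v' := by rw [hv2, outs_set (by simp), outs_set (by simp), outs_set (by simp), O1]
    have r0 : v2.r (lv (i + 2) 0) = D.deg s a := by simp [hv2]
    have r1 : v2.r (lv (i + 2) 1) = τ / D.m := by simp [hv2]
    have V2 : ∀ b, i + 3 ≤ b → v2.r (vV b) = v.r (vV b) := fun b hb => F2.r _ (by simp [ScX, GX]; omega)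
    have Vi : v2.r (vV (i + 2)) = D.L a := by simp [hv2]
    have qF2 : v2.r vFail = v'.r vFail := by simp [hv2, qF]
    have main := hC g (v := v2) (by omega) G2 (by rw [r0]; exact (D.deg_le _ _).trans hm)
      (by rw [r1]; exact (Nat.div_le_self _ _).trans hτm) fun b hb hbk => by
        rcases hb.lt_or_eq with h | rfl
        · rw [V2 b h]; exact hV b h hbk
        · rw [Vi, ← hn]; exact hLn a
    rw [r1, ← hTc] at main
    refine ((Tri.sl (P := P) (v := v1) (p := enter i) (Q := (· = v2)) (by simp [enter, SL.size]; omega) (fun _ => ?_)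
      fun _ => ?_).seq (e' := errs ℓ n i) (T' := Tc) fun v3 _ h3 => by subst h3; exact main).mono (show 17 + Tc + 1 ≤ Tc + 25 by omega) (by omega)
        fun v3 _ p => ?_
    · simp only [enter, SL.ok, SL.exec, e1, e2, e3]
      refine ⟨?_, (D.deg_le _ _).trans hmW, (Nat.div_le_self _ _).trans (hτm.trans (by have := g.τ; omega))⟩
      rw [← qL]; exact hs1.2 _ _
    · simp only [enter, SL.exec, e1, e2, e3, ← hv2]
    · have pr : ∀ c, v3.r (lv (i + 3) c) = v2.r (lv (i + 3) c) := fun c => p.fr.r _ (by simp [GX]; omega)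
      have pN : v3.a (33 + i, 2) = v'.a (33 + i, 2) := by rw [p.fr.a _ (by simp [GY, EmY]; omega), ← qN]; rfl
      have O3 : outs k v' ⊆ outs k v3 := O2 ▸ p.out
      have cnt : count (fun b => ¬ D.low s b) (a + 1) = count (fun b => ¬ D.low s b) a := by
        rw [Nat.count_succ, if_neg (not_not.2 hlow), add_zero]
      refine ⟨by rw [pr, hv2]; simp [q2]; omega, by simp, ScInv.set (x := a + 1) ⟨F2.trans (p.fr.mono (fun _ h => Or.inl h) fun _ h => Or.inl h),
        p.inv, fun _ h => O3 (I.out h), fun h => p.fail (by rw [qF2]; exact I.fail h), ?_, ?_, ?_, ?_⟩⟩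
      · rw [pr, hv2]; simp only [cnt, ← I.num, ← q12]; simp; omega
      · rw [cnt, pN]
        intro d hd
        obtain ⟨b, hb, h⟩ := I.new d hd
        exact ⟨b, by omega, h⟩
      · intro h0 row hrow hl
        rcases lt_succ_iff_lt_or_eq.1 hrow with h | rfl
        · have hf : v'.r vFail = 0 := by by_contra hne; exact p.fail (by rwa [qF2]) h0
          exact fun f f1 f2 f3 f4 => O3 (I.cov hf row h hl f f1 f2 f3 f4)
        · intro f f1 f2 f3 f4
          rw [hj] at f2 f3 f4
          refine p.cov h0 f f1 (fun b hb => ?_) fun b hb hbk => ?_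
          · obtain ⟨d, hd, hh, hf⟩ := f3 b hb
            obtain ⟨d', hd', rfl⟩ := w3 d hd hh
            rw [r0]; exact ⟨d', hd', by rw [hf]; exact ((w1 d' hd').2.2).symm⟩
          · rcases hb.lt_or_eq with h | rfl
            · simp only [V2 b h]; exact f4 b h hbk
            · simp only [Vi]; exact f2
      · intro S hS hrow
        rw [← I.suff S hS hrow, ← qF2]
        refine p.suff S hS ?_
        rw [r0, r1]
        exact hrow a ha hlow _ (D.tcount_le_rowCnt (l := i + 1) (by omega) hmQ ha ψ (fun d hd => (w1 d hd).1) w2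
          (fun d hd => (w1 d hd).2.2) fun d hd => D.adj_of_heavy (by omega) (w1 d hd).2.1)
  · have hlow : ¬ D.low s a := fun h => elow.2 h hz
    have e2 : (Ex.v (lv (i + 3) 12)).eval v1 = count (fun b => ¬ D.low s b) a := by rw [Ex.eval_v, q12, I.num]
    set ct := count (fun b => ¬ D.low s b) a with hct
    have hca : ct ≤ a := Nat.count_le _
    have e3 : (Ex.v (lv (i + 3) 12) + 1).eval (v1.put (30 + (i + 3), 2) ct (D.L a)) = ct + 1 := by simp [q12, I.num, hct]
    have hbY : ScY i (30 + (i + 3), 2) := Or.inr (by simp; omega)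
    have h33 : 33 + i = 30 + (i + 3) := by omega
    refine (Tri.sl (P := P) (by simp [keep, SL.size]; omega) (fun hs => ?_) fun _ => ?_).le
      (show 15 ≤ Tc + 25 by omega) (Nat.zero_le _)
    · simp only [keep, SL.ok, SL.exec, e1, e2, e3]
      refine ⟨?_, by omega⟩
      rw [← qL]; exact hs.2 _ _
    · simp only [keep, SL.exec, e1, e2, e3]
      set v2 := (v1.put (30 + (i + 3), 2) ct (D.L a)).set (lv (i + 3) 12) (ct + 1) with hv2
      have F2 : Fr (ScX i) (ScY i) v v2 := (F1.put hbY _ _).set (lvX _ (by omega)) _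
      have cnt : count (fun b => ¬ D.low s b) (a + 1) = ct + 1 := by rw [Nat.count_succ, if_pos hlow]
      have O2 : outs k v2 = outs k v' := by
        rw [hv2, outs_set (by simp), ← O1]; exact outs_congr rfl (St.put_a_ne _ _ _ _ _ (by simp))
      refine ⟨by simp [hv2, q2], by simp, ScInv.set (x := a + 1) ⟨F2, ?_, ?_, ?_, ?_, ?_, ?_, ?_⟩⟩
      · refine G1.of_fr (X := (· = lv (i + 3) 12)) (Y := (· = (30 + (i + 3), 2)))
          (((Fr.refl (· = lv (i + 3) 12) (· = (30 + (i + 3), 2)) v1).put rfl _ _).set (x := lv (i + 3) 12) rfl _) (by rintro x rfl; simp; omega) (by rintro x rfl; simp; omega) fun l c hc hb x => ?_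
        rw [hb, hv2, St.set_a, St.put_a]
        split_ifs
        · rw [← hn]; exact hLn _
        · exact G1.L _ _ _ (by simp)
      · rw [O2]; exact I.out
      · rw [hv2, St.set_ne (by simp), St.put_r, qF]; exact I.fail
      · rw [cnt]; simp [hv2]
      · intro d hd
        rw [cnt] at hd; rw [h33, hv2, St.set_a, St.put_a]
        split_ifs with h
        · exact ⟨a, by omega, hlow, h.2.symm, rfl⟩
        · obtain ⟨b, hb, g1, g2, g3⟩ := I.new d (by
            have : d ≠ ct := fun h' => h ⟨rfl, h'⟩
            omega)
          refine ⟨b, by omega, g1, g2, ?_⟩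
          rw [← g3, ← qN, h33]
      · rw [O2, hv2, St.set_ne (by simp), St.put_r, qF]
        intro h0 row hrow hl
        rcases lt_succ_iff_lt_or_eq.1 hrow with h | rfl
        · exact I.cov h0 row h hl
        · exact absurd hl hlow
      · rw [hv2, St.set_ne (by simp), St.put_r, qF]; exact I.suff

theorem image_perm {σ : Equiv.Perm ℕ} (hσ : ∀ x < k, σ x < k) (f : ℕ → ℕ) : (range k).image (fun x => f (σ x)) = (range k).image f := by
  have : (range k).image σ = range k := Finset.eq_of_subset_of_card_le (fun x hx => by
      obtain ⟨y, hy, rfl⟩ := mem_image.1 hx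
      exact mem_range.2 (hσ y (mem_range.1 hy)))
      (Finset.card_image_of_injective _ σ.injective).ge
  conv_rhs => rw [← this, Finset.image_image]
  rfl

theorem adj_perm {f : ℕ → ℕ} (hf : ∀ b < k, ∀ a < b, G.Adj (f a) (f b))
    {σ : Equiv.Perm ℕ} (hσ : ∀ x < k, σ x < k) : ∀ b < k, ∀ a < b, G.Adj (f (σ a)) (f (σ b)) := by
  intro b hb a ha
  rcases lt_trichotomy (σ a) (σ b) with h | h | h
  · exact hf _ (hσ b hb) _ h
  · exact absurd (σ.injective h) ha.ne
  · exact (hf _ (hσ a (by omega)) _ h).symm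

theorem swap_lt {a b x : ℕ} (ha : a < k) (hb : b < k) (hx : x < k) : Equiv.swap a b x < k := by
  rw [Equiv.swap_apply_def]; split_ifs <;> assumption

/-- The heavy and light cases cover all cliques. -/
theorem PD.cover {s : ℕ} {V : ℕ → ℕ} {l : List (Finset ℕ)} (hj : 3 ≤ D.j) (hk : D.j ≤ k)
    (hem : ∀ row col x, D.clq row col x → 8 * s * D.cntUpTo D.Q row col ≤ D.Q → D.Emitted k V row col x l)
    (hrow : ∀ row < D.m, D.low s row → D.CovRow s k V row l) {f : ℕ → ℕ}
    (hf : ∀ b < k, ∀ a < b, D.G.Adj (f a) (f b)) (hL : ∀ b < D.j, ∃ c < D.m, f b = D.L c)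
    (hV : ∀ b, D.j ≤ b → b < k → f b = V b) :
    (range k).image f ∈ l ∨ ∀ b < D.j, ∃ c < D.m, ¬ D.low s c ∧ f b = D.L c := by
  choose! φ hφ using hL
  by_cases hlt : ∃ a < D.j, ∃ b < D.j, a ≠ b ∧ ¬ D.heavy s (φ a) (φ b)
  · obtain ⟨a, ha, b, hb, hab, hh⟩ := hlt
    refine Or.inl ?_
    set σ : Equiv.Perm ℕ := (Equiv.swap 1 (Equiv.swap 0 a b)).trans (Equiv.swap 0 a) with hσ
    have h0b : Equiv.swap 0 a b ≠ 0 := fun h => hab (by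
      have := congrArg (Equiv.swap 0 a) h; rw [Equiv.swap_apply_self, Equiv.swap_apply_left] at this; exact this.symm)
    have σ0 : σ 0 = a := by
      simp only [hσ, Equiv.trans_apply]; rw [Equiv.swap_apply_of_ne_of_ne zero_ne_one h0b.symm, Equiv.swap_apply_left]
    have σ1 : σ 1 = b := by simp only [hσ, Equiv.trans_apply, Equiv.swap_apply_left, Equiv.swap_apply_self]
    have σlt : ∀ k', D.j ≤ k' → ∀ x < k', σ x < k' := fun k' hk' x hx => by
      simp only [hσ, Equiv.trans_apply]
      exact swap_lt (by omega) (ha.trans_le hk') (swap_lt (by omega) (swap_lt (by omega) (ha.trans_le hk') (hb.trans_le hk')) hx)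
    have σge : ∀ x, D.j ≤ x → σ x = x := fun x hx => by
      simp only [hσ, Equiv.trans_apply]
      have : Equiv.swap 0 a b < D.j := swap_lt (by omega) ha hb
      have h1 : Equiv.swap 1 (Equiv.swap 0 a b) x = x := Equiv.swap_apply_of_ne_of_ne (by omega) (by omega)
      rw [h1, Equiv.swap_apply_of_ne_of_ne (by omega) (by omega)]
    obtain ⟨x, hx, hd⟩ := exists_digits (m := D.m) (l := D.j - 2) (fun i => φ (σ (i + 2))) fun i hi => (hφ _ (σlt _ le_rfl _ (by omega))).1
    have htup : ∀ i < D.j, D.tup (φ a) (φ b) x i = f (σ i) := fun i hi => by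
      rw [(hφ _ (σlt _ le_rfl _ hi)).2, PD.tup]
      split_ifs with h h'
      · rw [h, σ0]
      · rw [h', σ1]
      · rw [hd (i - 2) (by omega), show i - 2 + 2 = i by omega]
    have hfull : ∀ i < k, D.full V (φ a) (φ b) x i = f (σ i) := fun i hi => by
      unfold PD.full
      split_ifs with h
      · exact htup i h
      · rw [σge i (by omega), hV i (by omega) hi]
    have hadj := adj_perm hf (σlt k hk)
    have := hem (φ a) (φ b) x ⟨(hφ a ha).1, (hφ b hb).1, hx, fun b hb a ha => by
      rw [htup a (by omega), htup b hb]; exact hadj b (by omega) a ha⟩ (not_lt.1 hh) fun b hb a ha => by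
        rw [hfull a (by omega), hfull b hb]; exact hadj b hb a ha
    rwa [image_congr fun i hi => hfull i (by simpa using hi), image_perm (σlt k hk)] at this
  · push Not at hlt
    by_cases hlow : ∃ a < D.j, D.low s (φ a)
    · obtain ⟨a, ha, hl⟩ := hlow
      refine Or.inl ?_
      set σ : Equiv.Perm ℕ := Equiv.swap a (D.j - 1) with hσ
      have σlt : ∀ k', D.j ≤ k' → ∀ x < k', σ x < k' := fun k' hk' x hx => swap_lt (by omega) (by omega) hx
      rw [← image_perm (σlt k hk)]
      refine hrow _ (hφ a ha).1 hl _ (adj_perm hf (σlt k hk)) ?_ (fun b hb => ?_) fun b hb hbk => ?_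
      · rw [hσ, Equiv.swap_apply_right, (hφ a ha).2]
      · have hb' := σlt _ le_rfl b (by omega)
        refine ⟨_, (hφ _ hb').1, hlt a ha _ hb' fun h => ?_, (hφ _ hb').2⟩
        have : σ (σ b) = σ a := by rw [← h]
        rw [hσ, Equiv.swap_apply_self, Equiv.swap_apply_left] at this; omega
      · rw [hσ, Equiv.swap_apply_of_ne_of_ne (by omega) (by omega)]
        exact hV b hb hbk
    · push Not at hlow
      exact Or.inr fun b hb => ⟨φ b, (hφ b hb).1, hlow b hb, (hφ b hb).2⟩

theorem two_pow_clog_le {x : ℕ} (hx : 1 ≤ x) : 2 ^ clog 2 x ≤ 2 * x := by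
  rcases hx.lt_or_eq with h | rfl
  · have h1 := Nat.pow_pred_clog_lt_self one_lt_two h
    have h2 : 0 < clog 2 x := Nat.clog_pos one_lt_two h
    obtain ⟨c, hc⟩ := Nat.exists_eq_succ_of_ne_zero h2.ne'
    rw [hc, Nat.pred_succ] at h1; rw [hc, pow_succ]; omega
  · simp

namespace Glob

theorem ok (g : Glob M P k n R μG τm ℓ) (hj : 3 ≤ D.j) (hk : D.j ≤ k) (hn : D.n = n) (hQ : 1 ≤ D.Q)
    (hm : 1 ≤ D.m) (hN : 1 ≤ D.N) (hr : 1 ≤ D.r) (hrN : D.r * D.N ≤ 2 * n) : D.Ok M P k := by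
  have hN2 : D.N ≤ 2 * n := (Nat.le_mul_of_pos_left _ hr).trans hrN
  have h2 : n ^ 2 ≤ n ^ k := Nat.pow_le_pow_right g.n_pos (by omega)
  have h1 : n ≤ n ^ 2 := Nat.le_self_pow two_ne_zero n
  have hW := g.W
  have hμ := g.μ D.N hN2
  have hτ := g.τ
  exact ⟨hj, hk, hQ, hm, hN, hr, by rw [hn]; omega, by omega, (Nat.mul_le_mul hN2 hN2).trans (by nlinarith), g.c _ hN2, by omega, g.S⟩

theorem size_le (g : Glob M P k n R μG τm ℓ) (hk : 1 ≤ k) (hm : m ≤ n) : Nat.size m ≤ ℓ := by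
  rw [Nat.size_le]
  calc m ≤ n ^ k := hm.trans (Nat.le_self_pow (by omega) n)
    _ ≤ 2 ^ clog 2 (n ^ k) := Nat.le_pow_clog one_lt_two _
    _ < 2 ^ ℓ := Nat.pow_lt_pow_right one_lt_two g.q

end Glob

def powE (x : Var) : ℕ → Ex
  | 0 => 1
  | i + 1 => powE x i * .v x

theorem powE_eval (x : Var) (v : St) (i : ℕ) : (powE x i).eval v = v.r x ^ i := by
  induction i with
  | zero => rfl
  | succ i ih => simp [powE, ih, pow_succ]

theorem powE_size (x : Var) (i : ℕ) : (powE x i).size ≤ i + 2 := by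
  induction i with
  | zero => exact le_rfl
  | succ i ih => simp [powE]; omega

/-- The data of the counting pass. -/
def PD.of (n j m : ℕ) (G : SimpleGraph ℕ) (L : ℕ → ℕ) : PD := ⟨n, j, m, 2 ^ clog 2 m, 1, 2 ^ clog 2 (m ^ (j - 2)), 1, L, G⟩

/-- Compute the sizes and count the cliques on pairs. -/
def prep (M : MMProg) (i : ℕ) : Cmd :=
  .seq (pow2 (lv (i + 3) 5) (.v (lv (i + 3) 0))) (.seq (pow2 (lv (i + 3) 4) (powE (lv (i + 3) 0) (i + 1)))
    (.seq (SL.seq (.asg (pv 0) (.v (lv (i + 3) 5))) (.seq (.asg (pv 1) 1) (.asg (pv 2) 1))).cmd (countPass M (i + 3))))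

theorem Glob.sizes (g : Glob M P k n R μG τm ℓ) (hk : i + 3 ≤ k) (hm1 : 1 ≤ m) (hm : m ≤ n) :
    2 ^ clog 2 m ≤ 2 * n ∧ m ^ (i + 1) ≤ 2 ^ clog 2 (m ^ (i + 1)) ∧ clog 2 m ≤ clog 2 (m ^ (i + 1)) ∧
    clog 2 (m ^ (i + 1)) + 1 ≤ ℓ ∧ 2 ^ clog 2 (m ^ (i + 1)) * (2 * n * (2 * n)) + 1 ≤ P.W := by
  have h1 := two_pow_clog_le hm1
  have h2 := two_pow_clog_le (Nat.pow_pos (n := i + 1) hm1)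
  have hp : m ^ (i + 1) ≤ n ^ (i + 1) := Nat.pow_le_pow_left hm _
  have hpk : n ^ (i + 1) ≤ n ^ k := Nat.pow_le_pow_right g.n_pos (by omega)
  refine ⟨by omega, Nat.le_pow_clog one_lt_two _, Nat.clog_mono_right 2 (Nat.le_self_pow (by omega) m), ?_, ?_⟩
  · exact (Nat.succ_le_succ (Nat.clog_mono_right 2 (hp.trans hpk))).trans g.q
  · have h3 : n ^ (i + 3) ≤ n ^ k := Nat.pow_le_pow_right g.n_pos hk
    have h4 : n ^ (i + 3) = n ^ (i + 1) * (n * n) := by rw [pow_add n (i + 1) 2, pow_two]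
    have h5 : 2 ^ clog 2 (m ^ (i + 1)) * (2 * n * (2 * n)) ≤ 2 * n ^ (i + 1) * (2 * n * (2 * n)) :=
      Nat.mul_le_mul_right _ (h2.trans (Nat.mul_le_mul_left _ hp))
    have h6 : 2 * n ^ (i + 1) * (2 * n * (2 * n)) = 8 * n ^ (i + 3) := by rw [h4]; ring
    have := g.W
    omega

def PrX (j : ℕ) (x : Var) : Prop := PsX j x ∨ x.1 = 11 ∨ x = lv j 4 ∨ x = lv j 5

theorem prep_tri (M : MMProg) (i : ℕ) : ∃ C, ∀ {P : Par} {k n R μG τm ℓ : ℕ}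
    (_ : Glob M P k n R μG τm ℓ) {G : SimpleGraph ℕ} {m τ : ℕ} {v : St}, i + 3 ≤ k → GInv n k R G v → 1 ≤ m → m ≤ n →
    v.r (lv (i + 3) 0) = m → v.r (lv (i + 3) 1) = τ → τ ≤ τm →
    let D := PD.of n (i + 3) m G (v.a (bL (i + 3)))
    Tri P (prep M i) v (C * ℓ * (τ + μG)) 0 fun v' => Fr (PrX (i + 3)) (PsY (i + 3)) v v' ∧ LInv D k v' ∧
      v'.r (lv (i + 3) 5) = D.N ∧ GInv n k R G v' ∧ outs k v' = outs k v ∧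
      (D.Q / D.N * (M.μ D.N + D.N * D.N + 1) ≤ τ → v'.r (wv 6) = D.Q / D.N) ∧
      (v'.r (wv 6) = D.Q / D.N → ∀ row < D.N, ∀ col < D.N, v'.a (bCnt (i + 3)) (row * D.N + col) = D.cntUpTo D.Q row col) := by
  obtain ⟨C, hC⟩ := countPass_tri M (i + 3)
  refine ⟨C + (powE (lv (i + 3) 0) (i + 1)).cost + 200, ?_⟩
  intro P k n R μG τm ℓ g G m τ v hk hI hm1 hm h0 h1 hτ D
  obtain ⟨z1, z2, z3, z4, z5⟩ := g.sizes hk hm1 hm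
  have hS := g.S
  set N := 2 ^ clog 2 m with hN
  set Q := 2 ^ clog 2 (m ^ (i + 1)) with hQ
  have hDQ : D.Q = Q := rfl
  have hQ1 : 1 ≤ Q := one_le_two_pow
  have hn1 := g.n_pos
  have hmN : m ≤ N := Nat.le_pow_clog one_lt_two _
  have hQW : 4 * Q + 1 ≤ P.W := by
    have h4 : Q * 4 ≤ Q * (2 * n * (2 * n)) := Nat.mul_le_mul_left _ (by nlinarith)
    omega
  have hnW : 4 * n + 1 ≤ P.W := by
    have := Nat.le_self_pow (show k ≠ 0 by omega) n
    have := g.W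
    omega
  have ps := powE_size (lv (i + 3) 0) (i + 1)
  set v1 := v.set (lv (i + 3) 5) N with hv1
  set v2 := v1.set (lv (i + 3) 4) Q with hv2
  set v3 := ((v2.set (pv 0) N).set (pv 1) 1).set (pv 2) 1 with hv3
  have F3 : Fr (fun x => x.1 = 11 ∨ x = lv (i + 3) 4 ∨ x = lv (i + 3) 5) (fun _ => False) v v3 :=
    (((((Fr.refl _ _ v).set (by simp) _).set (by simp) _).set (by simp) _).set (by simp) _).set (by simp) _
  have t1 := pow2_tri (P := P) (x := lv (i + 3) 5) (e := .v (lv (i + 3) 0)) (v := v) (by simp; omega) (fun a => by simp) (by simp [h0]; omega)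
  have t2 := pow2_tri (P := P) (x := lv (i + 3) 4) (e := powE (lv (i + 3) 0) (i + 1)) (v := v1) (by omega)
    (fun a => by simp [powE_eval]) (by rw [powE_eval, hv1, St.set_ne (by simp), h0]; omega)
  rw [Ex.eval_v, h0] at t1
  rw [powE_eval, show v1.r (lv (i + 3) 0) = m by simp [hv1, h0]] at t2
  have G3 : GInv n k R G v3 := hI.of_fr F3 (fun x hx => by
    refine ⟨?_, ?_, ?_, ?_, ?_⟩ <;> rcases hx with hx | rfl | rfl <;> simp <;> (try rintro rfl) <;> simp at * <;> omega) (by simp) (by simp)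
  have O3 : outs k v3 = outs k v := by simp only [hv3, hv2, hv1]; simp [outs_set]
  have ok : D.Ok M P k := g.ok (by simp [D, PD.of]) (by simpa [D, PD.of] using hk) rfl (by rw [hDQ]; exact hQ1) hm1
    one_le_two_pow le_rfl (by simpa [D, PD.of] using z1)
  have I3 : PInv D k v3 := by
    refine ⟨⟨?_, ?_, ?_, ?_, ?_, rfl, fun c => hI.L (i + 3) 0 c (by simp)⟩, G3.env, G3.zero⟩
    · rw [F3.r _ (by simp [D, PD.of]; omega)]; exact h0
    all_goals simp [hv3, hv2, D, PD.of, hQ, hN]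
  have hdvd : D.N ∣ D.Q := pow_dvd_pow 2 z3
  have hμ := g.μ _ z1
  have hgτ := g.τ
  have t4 := hC D ok (v := v3) rfl rfl rfl hdvd (by rw [hDQ]; omega) I3 (by rw [F3.r _ (by simp; omega), h1]) hμ
    (show τ + μG ≤ P.W by omega) (by have := Nat.div_le_self D.Q D.N; rw [hDQ] at *; omega)
  refine (t1.seq (e' := 0) (T' := (clog 2 (m ^ (i + 1)) + 1) * ((powE (lv (i + 3) 0) (i + 1)).cost + 20) + (20 + C * (τ + μG)) + 1) fun w _ hw => ?_).le ?_ (by simp)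
  · subst hw
    refine t2.seq (e' := 0) (T' := 20 + C * (τ + μG)) fun w _ hw => ?_
    subst hw
    refine ((Tri.sl (P := P) (v := v2) (Q := (· = v3)) (by simp [SL.size]; omega) (fun _ => ?_) fun _ => ?_).seq
      (e' := 0) fun w _ hw => by subst hw; exact t4).mono (show 11 + _ + 1 ≤ _ by omega) (by simp) ?_
    · simp only [SL.ok, SL.exec, Ex.eval_v, Ex.eval_ofNat]
      rw [hv2, St.set_ne (by simp), hv1, St.set_r, if_pos rfl]; omega
    · simp only [SL.exec, Ex.eval_v, Ex.eval_ofNat]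
      rw [hv3, show v2.r (lv (i + 3) 5) = N by simp [hv2, hv1]]
    · rintro v' - ⟨g1, g2, g3, g4, g5⟩
      have F4 : Fr (PrX (i + 3)) (PsY (i + 3)) v v' :=
        (F3.mono (fun x hx => Or.inr hx) fun _ h => h.elim).trans (g2.mono (fun _ h => Or.inl h) fun _ h => h)
      refine ⟨F4, g1.linv, ?_, ⟨g1.env, g1.zero, ?_, fun l c x hc => ?_⟩, by rw [g3, O3], g4, g5⟩
      · rw [g2.r _ (by simp [PsX]; omega)]; simp [hv3, hv2, hv1, D, PD.of, hN]
      · rw [F4.r _ (by simp [PrX, PsX]), hI.R]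
      · rw [F4.a _ (by simp [PsY, EmY, hc]; omega)]; exact hI.L l c x hc
  · have hc : clog 2 m + 1 ≤ ℓ := by omega
    set c := (powE (lv (i + 3) 0) (i + 1)).cost
    have hμ1 : 1 ≤ τ + μG := by omega
    have h5 : ℓ * 1 ≤ ℓ * (τ + μG) := Nat.mul_le_mul_left _ hμ1
    have h6 : (clog 2 m + 1) * 21 ≤ ℓ * 21 := Nat.mul_le_mul_right _ hc
    have h7 : (clog 2 (m ^ (i + 1)) + 1) * (c + 20) ≤ ℓ * (c + 20) := Nat.mul_le_mul_right _ z4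
    have h8 : C * (τ + μG) ≤ C * (ℓ * (τ + μG)) := Nat.mul_le_mul_left _ (Nat.le_mul_of_pos_left _ (by omega))
    have h9 : ℓ * 1 * (c + 20) ≤ ℓ * (τ + μG) * (c + 20) := Nat.mul_le_mul_right _ h5
    have h10 : (C + c + 200) * ℓ * (τ + μG) = C * (ℓ * (τ + μG)) + ℓ * (τ + μG) * (c + 20) + 180 * (ℓ * (τ + μG)) := by ring
    rw [mul_one] at h5 h9
    have h11 := h7.trans h9
    rw [show (Ex.v _).cost = 1 from rfl, h10]
    generalize (clog 2 (m ^ (i + 1)) + 1) * (c + 20) = A1 at *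
    generalize ℓ * (τ + μG) * (c + 20) = A2 at *
    generalize C * (ℓ * (τ + μG)) = A3 at *
    generalize ℓ * (τ + μG) = A4 at *
    omega

/-- The effect of one round at level `i + 3`. -/
structure StPost (M : MMProg) (k n R i : ℕ) (G : SimpleGraph ℕ) (v v' : St) : Prop where
  fr : Fr (GX (i + 3)) (GY (i + 3)) v v'
  inv : GInv n k R G v'
  out : outs k v ⊆ outs k v'
  fail : v.r vFail ≠ 0 → v'.r vFail ≠ 0
  le : v'.r (lv (i + 3) 0) ≤ v.r (lv (i + 3) 0)
  tau : v'.r (lv (i + 3) 1) = v.r (lv (i + 3) 1)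
  cov : v'.r vFail = 0 → ∀ f : ℕ → ℕ, (∀ b < k, ∀ a < b, G.Adj (f a) (f b)) →
    (∀ b < i + 3, ∃ c < v.r (lv (i + 3) 0), f b = v.a (bL (i + 3)) c) →
    (∀ b, i + 3 ≤ b → b < k → f b = v.r (vV b)) → (range k).image f ∈ outs k v' ∨
      ∀ b < i + 3, ∃ c < v'.r (lv (i + 3) 0), f b = v'.a (bL (i + 3)) c
  suff : ∀ S, Suffices M k n S → S (i + 1) (v.r (lv (i + 3) 0))
    (tcount G (v.a (bL (i + 3))) (v.r (lv (i + 3) 0)) (i + 3)) (v.r (lv (i + 3) 1)) →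
      v'.r vFail = v.r vFail ∧ S (i + 1) (v'.r (lv (i + 3) 0))
        (tcount G (v'.a (bL (i + 3))) (v'.r (lv (i + 3) 0)) (i + 3)) (v'.r (lv (i + 3) 1))

theorem GX.not_vV {b : ℕ} (h : j ≤ b) : ¬ GX j (vV b) := by simp [GX]; omega

theorem tcount_le_pow (G : SimpleGraph ℕ) (L : ℕ → ℕ) (m j : ℕ) : tcount G L m j ≤ m ^ j := by
  classical
  exact (card_filter_le _ _).trans (by simp)

theorem PsX.gx {x : Var} (h : PsX j x) : GX j x := by rcases h with h | h | h | h | h | h <;> simp [GX, h]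

theorem GX.mono {j' : ℕ} {x : Var} (h : GX j x) (hj : j ≤ j') : GX j' x := by
  rcases h with h | h | h | h | h | h | h | h | h <;> simp [GX, h] <;> omega

theorem GY.mono {j' : ℕ} {b : Var} (h : GY j b) (hj : j ≤ j') : GY j' b := by rcases h with h | h | h | h | h <;> simp [GY, h] <;> omega

theorem StPost.trans {v'' : St} (h : StPost M k n R i G v v')
    (h' : StPost M k n R i G v' v'') : StPost M k n R i G v v'' := by
  refine ⟨h.fr.trans h'.fr, h'.inv, fun _ hx => h'.out (h.out hx), fun hx => h'.fail (h.fail hx),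
    h'.le.trans h.le, h'.tau.trans h.tau, fun h0 f f1 f2 f3 => ?_, fun S hS hx => ?_⟩
  · have h0' : v'.r vFail = 0 := by by_contra hne; exact h'.fail hne h0
    rcases h.cov h0' f f1 f2 f3 with h1 | h1
    · exact Or.inl (h'.out h1)
    · exact h'.cov h0 f f1 h1 fun b hb hbk => by rw [h.fr.r _ (GX.not_vV hb)]; exact f3 b hb hbk
  · obtain ⟨h1, h2⟩ := h.suff S hS hx
    obtain ⟨h3, h4⟩ := h'.suff S hS h2
    exact ⟨h3.trans h1, h4⟩

/-- List the light cliques, treat the low vertices, and keep the others. -/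
def roundMain (M : MMProg) (k i : ℕ) (c : Cmd) : Cmd :=
  .seq (listAll M (i + 3) k) (.seq (sums (i + 3)) (.seq (scanRec i c) (copyBack (i + 3))))

theorem slack_step (hn : 1 ≤ n) (hμ : n ≤ μG) (i : ℕ) : n * slack n μG i ≤ slack n μG (i + 1) ∧ μG ≤ slack n μG (i + 1) := by
  refine ⟨?_, Nat.le_mul_of_pos_left _ (Nat.pow_pos hn)⟩
  cases i with
  | zero => simpa [slack] using hμ
  | succ i => simp only [slack, pow_succ]; exact le_of_eq (by ring)

theorem Glob.le_μG (g : Glob M P k n R μG τm ℓ) (hm : m ≤ n) : m * m + 1 ≤ μG ∧ n ≤ μG := by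
  have h1 := g.μ m (by omega)
  have h2 := g.μ n (by omega)
  have h3 := Nat.le_mul_self n
  omega

set_option maxHeartbeats 1000000 in
theorem roundMain_tri {c : Cmd} (hc : GenSpec M k i c) : ∃ C, ∀ {P : Par} {n R μG τm ℓ : ℕ}
    (_ : Glob M P k n R μG τm ℓ) {G : SimpleGraph ℕ} {m τ : ℕ} {L : ℕ → ℕ} {v : St}, i + 3 ≤ k → GInv n k R G v →
    1 ≤ m → m ≤ n → LInv (PD.of n (i + 3) m G L) k v → v.r (lv (i + 3) 5) = (PD.of n (i + 3) m G L).N →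
    v.r (lv (i + 3) 1) = τ → τ ≤ τm → (∀ a, i + 3 ≤ a → a < k → v.r (vV a) < n) →
    (∀ row < (PD.of n (i + 3) m G L).N, ∀ col < (PD.of n (i + 3) m G L).N, v.a (bCnt (i + 3)) (row * (PD.of n (i + 3) m G L).N + col) =
        (PD.of n (i + 3) m G L).cntUpTo (PD.of n (i + 3) m G L).Q row col) →
    Tri P (roundMain M k i c) v (C * ℓ ^ (3 * i + 2) * (τ + slack n μG (i + 1))) (1 + n * errs ℓ n i) fun v' =>
      StPost M k n R i G v v' ∧ 2 * v'.r (lv (i + 3) 0) ≤ m := by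
  classical
  obtain ⟨C1, hC1⟩ := listAll_tri M (i + 3) k
  obtain ⟨C2, hC2⟩ := scanRec_tri hc
  refine ⟨C1 + 2 * C2 + 3000, ?_⟩
  intro P n R μG τm ℓ g G m τ L v hk hI hm1 hm hLI h5 h1 hτ hV hcnt
  set D := PD.of n (i + 3) m G L with hD
  obtain ⟨z1, z2, z3, z4, z5⟩ := g.sizes hk hm1 hm
  obtain ⟨gm, gn⟩ := g.le_μG hm
  have hS := g.S
  have hgτ := g.τ
  have hn1 := g.n_pos
  have hDj : D.j = i + 3 := rfl
  have hDm : D.m = m := rfl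
  have hQ1 : 1 ≤ D.Q := one_le_two_pow
  have hmN : D.m ≤ D.N := Nat.le_pow_clog one_lt_two _
  have hQW : 2 * D.Q ≤ P.W := by
    have h4 : D.Q * 4 ≤ D.Q * (2 * n * (2 * n)) := Nat.mul_le_mul_left _ (by nlinarith)
    have : D.Q * (2 * n * (2 * n)) + 1 ≤ P.W := z5
    omega
  have lvl : ∀ a ≤ clog 2 m, 2 ^ a ≤ 2 * n := fun a ha => (Nat.pow_le_pow_right two_pos ha).trans z1
  have t1 := hC1 D (c := clog 2 m) (q := clog 2 (m ^ (i + 1))) (fun a ha =>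
    g.ok (by simp [hD, PD.of]) (by simpa [hD, PD.of] using hk) rfl hQ1 hm1 one_le_two_pow one_le_two_pow (by
      change 2 ^ (clog 2 m - a) * 2 ^ a ≤ 2 * n
      rw [← pow_add, Nat.sub_add_cancel ha]; exact z1)) (v := v) (τ := τ) (μG := μG) (R := R) rfl hLI hV hmN h5 rfl z3 z2 hI.R hQW h1
    (fun a ha => g.μ _ (lvl a ha)) (by omega)
    ((Nat.succ_le_succ (Nat.mul_le_mul_left _ (Nat.mul_le_mul z1 z1))).trans z5) ?_
  swap
  · refine le_trans (mul_le_mul_left (Nat.cast_le.2 ?_) _) g.ε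
    have e1 : clog 2 m ≤ m := (Nat.clog_le_iff_le_pow one_lt_two).2 Nat.lt_two_pow_self.le
    calc (clog 2 m + 1) * m ^ (i + 3) ≤ (n + 2) * (n + 2) ^ k := Nat.mul_le_mul (by omega)
          ((Nat.pow_le_pow_left (by omega) _).trans (Nat.pow_le_pow_right (by omega) hk))
      _ = (n + 2) ^ (k + 1) := by ring
  refine (t1.seq (T' := 300 * ((D.m + 1) * (D.m + 1)) + (C2 * ℓ ^ (3 * i) * (τ + n * slack n μG i + μG) +
    100 * (m + 1) + 1) + 1) (e' := n * errs ℓ n i) fun v2 _ ⟨f2, l2, o2, a1, ⟨a2, a3⟩, a4⟩ => ?_).le ?_ le_rfl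
  swap
  · obtain ⟨s1, s2⟩ := slack_step (μG := μG) hn1 gn i
    have r1 := g.R
    have p0 : 1 ≤ ℓ ^ (3 * i) := Nat.pow_pos (by omega)
    have p2 : 1 ≤ ℓ * ℓ := Nat.mul_pos (by omega) (by omega)
    set X := slack n μG (i + 1)
    have e2 : ℓ ^ (3 * i + 2) = ℓ ^ (3 * i) * (ℓ * ℓ) := by rw [pow_add, pow_two]
    have b1 : C1 * (clog 2 (m ^ (i + 1)) + 1) * (R + 1) * (τ + μG) ≤ C1 * ℓ ^ (3 * i + 2) * (τ + X) := by
      rw [mul_assoc C1]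
      refine Nat.mul_le_mul (Nat.mul_le_mul_left _ ?_) (by omega)
      rw [e2]; exact (Nat.mul_le_mul z4 r1).trans (Nat.le_mul_of_pos_left _ p0)
    have p3 : ℓ ^ (3 * i) ≤ ℓ ^ (3 * i + 2) := by rw [e2]; exact Nat.le_mul_of_pos_right _ p2
    have b2 : C2 * ℓ ^ (3 * i) * (τ + n * slack n μG i + μG) ≤ C2 * ℓ ^ (3 * i + 2) * (2 * (τ + X)) :=
      Nat.mul_le_mul (Nat.mul_le_mul_left _ p3) (by omega)
    have b3 : 300 * ((m + 1) * (m + 1)) + 100 * (m + 1) + 3 ≤ 3000 * (ℓ ^ (3 * i + 2) * (τ + X)) := by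
      have : 300 * ((m + 1) * (m + 1)) + 100 * (m + 1) + 3 ≤ 3000 * μG := by nlinarith
      refine this.trans (Nat.mul_le_mul_left _ ?_)
      exact le_trans (by omega) (Nat.le_mul_of_pos_left _ (p0.trans p3))
    have e3 : (C1 + 2 * C2 + 3000) * ℓ ^ (3 * i + 2) * (τ + X) = C1 * ℓ ^ (3 * i + 2) * (τ + X) +
      C2 * ℓ ^ (3 * i + 2) * (2 * (τ + X)) + 3000 * (ℓ ^ (3 * i + 2) * (τ + X)) := by ring
    rw [hDm, e3]; omega
  set s := v2.r (lv (i + 3) 3) with hs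
  have nO : ∀ c, c ≠ 3 → ¬ OuX (i + 3) (lv (i + 3) c) := fun c hc => by simp [OuX, PsX, hc]; omega
  have T2 : Tab D s v2 := by
    refine ⟨l2.m, rfl, l2.Q, by rw [← h5]; exact f2.r _ (nO 5 (by simp)), l2.L, fun row hr col hc => ?_⟩
    rw [f2.a (bCnt D.j) (by simp [InY, EmY]; omega)]
    exact hcnt row hr col hc
  have G2 : GInv n k R G v2 := ⟨l2.env, l2.zero, by rw [f2.r _ (by simp [OuX, PsX]), hI.R],
    fun l c x hc => by rw [f2.a _ (by simp [InY, EmY]; omega)]; exact hI.L l c x hc⟩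
  have hW3 : D.m * (D.m * D.Q) ≤ P.W := by
    have e : D.m * (D.m * D.Q) = D.Q * (m * m) := by rw [hDm]; ring
    have e' : D.Q * (m * m) ≤ D.Q * (2 * n * (2 * n)) := Nat.mul_le_mul_left _ (Nat.mul_le_mul (by omega) (by omega))
    have : D.Q * (2 * n * (2 * n)) + 1 ≤ P.W := z5
    omega
  have hmW : D.m ≤ P.W := by
    have := Nat.le_self_pow (show k ≠ 0 by omega) n
    have := g.W
    omega
  have hLn : ∀ x, D.L x < D.n := fun x => by rw [← l2.L]; exact G2.L (i + 3) 0 x (by simp)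
  have t2 := sums_tri (D := D) (by omega) (by omega) T2 hmN hQ1 hW3 hmW hLn (fun x => G2.L (i + 2) 0 x (by simp))
  refine t2.seq (e := 0) (e' := n * errs ℓ n i) (fun v3 _ ⟨f3, q6, q7, b3⟩ => ?_) |>.le le_rfl (by omega)
  have lvS : ∀ c, c = 0 ∨ c = 1 ∨ c = 3 ∨ c = 4 ∨ c = 5 → v3.r (lv (i + 3) c) = v2.r (lv (i + 3) c) := fun c hc => f3.r _ (SuX.not hc)
  have T3 : Tab D s v3 := T2.of_fr f3 (fun c hc => SuX.not (by omega)) (by simp; omega) (by simp)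
  have G3 : GInv n k R G v3 := G2.of_fr f3 (fun x hx => by
      have := hx.1
      refine ⟨?_, ?_, ?_, ?_, by omega⟩ <;> rintro rfl <;> simp at this <;> omega)
    (by rintro b rfl; simp; omega) (fun l c hc hb x => by rw [hb]; exact b3 x)
  have f23 : ∀ x : Var, x.1 < 7 → x ≠ vC → ¬ (x.1 = 2 ∧ x.2 < i + 3) → v3.r x = v.r x := fun x h7 hC h2 => by
    have e : x ≠ vTick := by rintro rfl; simp at h7
    have e' : x ≠ lv (i + 3) 3 := by rintro rfl; simp at h7; omega
    rw [f3.r _ (fun h => by have := h.1; omega), f2.r _ (by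
      rintro ((h | h | h | h | h | h) | h | h) <;> first | omega | exact absurd h ‹_›)]
  have V3 : ∀ a, i + 3 ≤ a → v3.r (vV a) = v.r (vV a) := fun a ha => f23 _ (by simp) (by simp) (by simp; omega)
  have t3 := hC2 g (D := D) (τ := τ) (v := v3) hk rfl rfl T3 G3 hm hmN hQ1 z2 hW3
    (by rw [lvS 1 (by simp), f2.r _ (nO 1 (by simp)), h1]) hτ q6 q7 fun a ha hak => by rw [V3 a ha]; exact hV a ha hak
  refine (t3.seq (e' := 0) (T' := 100 * (m + 1)) fun v4 _ p => ?_).le (by omega) (by omega)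
  set m' := count (fun b => ¬ D.low s b) D.m with hm'
  have hm'm : 2 * m' ≤ m := D.count_not_low s
  refine (copyBack_tri (j := i + 3) (n := n) (by omega) p.num (fun x => p.inv.L (i + 3) 0 x (by simp))
    (fun x => p.inv.L (i + 3) 2 x (by simp))).mono (by omega) le_rfl fun v5 _ ⟨f5, c1, c2, c3⟩ => ?_
  have O23 : outs k v3 = outs k v2 := outs_congr (f3.r _ (by simp [SuX])) (f3.a _ (by simp))
  have O5 : outs k v5 = outs k v4 := outs_congr (f5.r _ (by simp)) (f5.a _ (by simp))
  have O24 : outs k v2 ⊆ outs k v4 := O23 ▸ p.out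
  have F5 : v5.r vFail = v4.r vFail := f5.r _ (by simp; omega)
  have F3 : v3.r vFail = v.r vFail := f23 _ (by simp) (by simp) (by simp)
  have new : ∀ d < m', ∃ b < m, ¬ D.low s b ∧ count (fun b => ¬ D.low s b) b = d ∧ v5.a (bL (i + 3)) d = D.L b := fun d hd => by
      obtain ⟨b, h1, h2, h3, h4⟩ := p.new d hd
      refine ⟨b, h1, h2, h3, ?_⟩
      rw [c3 d hd, ← h4, show 30 + (i + 3) = 33 + i by omega]
  have hvm : v.r (lv (i + 3) 0) = m := hLI.m
  have hvL : v.a (bL (i + 3)) = L := hLI.L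
  have h51 : v5.r (lv (i + 3) 1) = τ := by
    rw [f5.r _ (by simp), p.fr.r _ (ScX.not_lv (by omega)), lvS 1 (by simp), f2.r _ (nO 1 (by simp)), h1]
  refine ⟨⟨?_, ?_, ?_, ?_, by omega, h51.trans h1.symm, ?_, ?_⟩, by omega⟩
  · refine (f2.mono ?_ ?_).trans ((f3.mono ?_ ?_).trans ((p.fr.mono ?_ ?_).trans (f5.mono ?_ ?_)))
    · rintro x (h | h | rfl)
      · exact h.gx
      all_goals simp [GX, *]
    · rintro b (rfl | h)
      · simp [GY]
      · unfold InY at h; unfold GY; tauto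
    · intro x hx; have := hx.1; simp only [GX]; omega
    · rintro b rfl; simp [GY]; omega
    · rintro x (h | rfl | h)
      · exact h.mono (by omega)
      · simp [GX]
      · have := h.1; simp only [GX]; omega
    · rintro b (h | rfl)
      · exact h.mono (by omega)
      · simp only [GY]; omega
    · rintro x (rfl | rfl) <;> simp [GX]
    · rintro b rfl; simp [GY]
  · refine p.inv.of_fr f5 ?_ (by rintro b rfl; simp; omega) fun l c hc hb x => by rw [hb]; exact c2 x
    rintro x (rfl | rfl) <;> simp <;> omega
  · rw [O5]; exact fun _ h => O24 (o2 h)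
  · rw [F5, ← F3]; exact p.fail
  · intro h0 f f1 fL fV
    rw [O5, c1]; rw [hvm, hvL] at fL
    refine (PD.cover (D := D) (s := s) (V := fun b => v.r (vV b)) (by omega) (by omega)
      (fun row col x hcl hl hA => O24 (a4 row col x hcl hl hA)) (fun row hrow hl f g1 g2 g3 g4 => ?_) f1 fL fV).imp id
      fun h b hb => ?_
    · exact p.cov (by rwa [← F5]) row hrow hl f g1 g2 g3 fun b hb hbk => by simp only [V3 b hb]; exact g4 b hb hbk
    · obtain ⟨c, hc, hl, hf⟩ := h b hb
      have hlt : count (fun b => ¬ D.low s b) c < m' := Nat.count_strict_mono (p := fun b => ¬ D.low s b) hl hc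
      obtain ⟨b', hb', hl', he, hL'⟩ := new _ hlt
      obtain rfl : b' = c := Nat.count_injective (p := fun b => ¬ D.low s b) hl' hl he
      exact ⟨_, hlt, by rw [hL', hf]⟩
  · intro S hS hx
    rw [hvm, hvL, h1] at hx; rw [F5, c1, h51]
    have hsum : ∑ row ∈ range D.m, D.rowCnt row = tcount G L m (i + 3) := D.sum_rowCnt (l := i + 1) rfl z2
    refine ⟨(p.suff S hS fun row hrow hl t' ht' => ?_).trans F3, ?_⟩
    · refine hS.step i m _ τ s (∑ b ∈ range D.m, D.deg s b) _ _ hk hm1 hm hx (tcount_le_pow _ _ _ _) a2 a1 ?_ hl.1 ?_ (D.deg_le _ _)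
      · rw [← hsum]; exact D.sum_deg_mul_le s
      · rw [← hsum]; exact (Nat.mul_le_mul_right _ ht').trans hl.2
    · choose! ψ hψ using new
      refine hS.mono _ _ _ _ _ _ hx (by omega) (tcount_le ψ (fun d hd => (hψ d hd).1) (fun d hd d' hd' he => ?_)
        fun d hd => (hψ d hd).2.2.2)
      rw [← (hψ d hd).2.2.1, he, (hψ d' hd').2.2.1]

def round (M : MMProg) (k i : ℕ) (c : Cmd) : Cmd :=
  .seq (prep M i) (ifE (.eq (.v (wv 6)) (.v (lv (i + 3) 4) / .v (lv (i + 3) 5))) (roundMain M k i c)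
    (SL.seq (.asg vFail 1) (.asg (lv (i + 3) 0) 0)).cmd)

/-- The program for level `i + 2`. -/
def gen (M : MMProg) (k : ℕ) : ℕ → Cmd
  | 0 => genBase k
  | i + 1 => whileE (.v (lv (i + 3) 0)) (round M k i (gen M k i))

theorem round_tri {c : Cmd} (hc : GenSpec M k i c) : ∃ C, ∀ {P : Par} {n R μG τm ℓ : ℕ}
    (_ : Glob M P k n R μG τm ℓ) {G : SimpleGraph ℕ} {m τ : ℕ} {v : St}, i + 3 ≤ k → GInv n k R G v →
    1 ≤ m → m ≤ n → v.r (lv (i + 3) 0) = m → v.r (lv (i + 3) 1) = τ → τ ≤ τm →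
    (∀ a, i + 3 ≤ a → a < k → v.r (vV a) < n) →
    Tri P (round M k i c) v (C * ℓ ^ (3 * i + 2) * (τ + slack n μG (i + 1))) (1 + n * errs ℓ n i) fun v' =>
      StPost M k n R i G v v' ∧ 2 * v'.r (lv (i + 3) 0) ≤ m := by
  obtain ⟨C1, hC1⟩ := prep_tri M i
  obtain ⟨C2, hC2⟩ := roundMain_tri hc
  refine ⟨C1 + C2 + 40, ?_⟩
  intro P n R μG τm ℓ g G m τ v hk hI hm1 hm h0 h1 hτ hV
  obtain ⟨gm, gn⟩ := g.le_μG hm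
  obtain ⟨s1, s2⟩ := slack_step (μG := μG) g.n_pos gn i
  set X := slack n μG (i + 1)
  have hS := g.S
  have hW := g.W
  refine ((hC1 g hk hI hm1 hm h0 h1 hτ).seq (T' := (C2 * ℓ ^ (3 * i + 2) * (τ + X) + 7) + 9 + 2)
    (e' := 1 + n * errs ℓ n i) fun v1 _ ⟨f1, l1, n1, i1, o1, d1, d2⟩ => ?_).le ?_ (by omega)
  swap
  · have r1 := g.R
    have p1 : 1 ≤ ℓ ^ (3 * i + 2) := Nat.pow_pos (by omega)
    have p2 : ℓ ≤ ℓ ^ (3 * i + 2) := Nat.le_self_pow (by omega) ℓ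
    have b1 : C1 * ℓ * (τ + μG) ≤ C1 * ℓ ^ (3 * i + 2) * (τ + X) := Nat.mul_le_mul (Nat.mul_le_mul_left _ p2) (by omega)
    have b2 : 1 * 1 ≤ ℓ ^ (3 * i + 2) * (τ + X) := Nat.mul_le_mul p1 (by omega)
    have e3 : (C1 + C2 + 40) * ℓ ^ (3 * i + 2) * (τ + X) = C1 * ℓ ^ (3 * i + 2) * (τ + X) +
      C2 * ℓ ^ (3 * i + 2) * (τ + X) + 40 * (ℓ ^ (3 * i + 2) * (τ + X)) := by ring
    rw [e3]; omega
  set D := PD.of n (i + 3) m G (v.a (bL (i + 3))) with hD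
  have fr1 : Fr (GX (i + 3)) (GY (i + 3)) v v1 := f1.mono (fun x hx => by
      rcases hx with h | h | rfl | rfl
      · exact h.gx
      all_goals simp [GX, *]) fun b hb => by rcases hb with h | h | h | rfl <;> simp [GY, *]
  have nP : ∀ c, c ≠ 4 → c ≠ 5 → v1.r (lv (i + 3) c) = v.r (lv (i + 3) c) := fun c h4 h5 => f1.r _ (by simp [PrX, PsX, h4, h5]; omega)
  have q0 : v1.r (lv (i + 3) 0) = m := by rw [nP 0 (by simp) (by simp), h0]
  have q1 : v1.r (lv (i + 3) 1) = τ := by rw [nP 1 (by simp) (by simp), h1]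
  have qF : v1.r vFail = v.r vFail := f1.r _ (by simp [PrX, PsX])
  have qV : ∀ a, i + 3 ≤ a → v1.r (vV a) = v.r (vV a) := fun a ha => fr1.r _ (GX.not_vV ha)
  have qL : v1.a (bL (i + 3)) = v.a (bL (i + 3)) := l1.L
  have qQ : v1.r (lv (i + 3) 4) = D.Q := l1.Q
  refine (Tri.ifE (T := C2 * ℓ ^ (3 * i + 2) * (τ + X) + 7) (e := 1 + n * errs ℓ n i) (by simp; omega) (fun hz => ?_)
    fun hz => ?_).time (show _ + 9 + 2 ≤ _ from le_rfl)
  · simp only [Ex.eval_eq, Ex.eval_div, Ex.eval_v, n1, qQ, ne_eq, ite01_eq_zero, not_not] at hz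
    refine (hC2 g hk i1 hm1 hm l1 n1 q1 hτ (fun a ha hak => by rw [qV a ha]; exact hV a ha hak) (d2 hz)).mono
      (Nat.le_add_right _ _) le_rfl fun v2 _ ⟨p, hp⟩ => ⟨?_, hp⟩
    have p1 : StPost M k n R i G v v1 := by
      refine ⟨fr1, i1, by rw [o1]; exact fun _ h => h, by rw [qF]; exact id, by rw [q0, h0], by rw [q1, h1],
        fun _ f _ hL _ => Or.inr ?_, fun S hS h => ⟨qF, ?_⟩⟩
      · rwa [q0, qL, ← h0]
      · rwa [q0, qL, q1, ← h0, ← h1]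
    exact p1.trans p
  · simp only [Ex.eval_eq, Ex.eval_div, Ex.eval_v, n1, qQ, ite01_eq_zero] at hz
    set v2 := (v1.set vFail 1).set (lv (i + 3) 0) 0 with hv2
    have f2 : Fr (fun x => x = vFail ∨ x = lv (i + 3) 0) (fun _ => False) v1 v2 := ((Fr.refl _ _ v1).set (by simp) _).set (by simp) _
    refine (Tri.sl (P := P) (by simp [SL.size]; omega) (fun _ => by simp [SL.ok]; omega) fun _ => ?_).le
      (show 7 ≤ _ by omega) (Nat.zero_le _)
    have he : (SL.seq (.asg vFail 1) (.asg (lv (i + 3) 0) 0)).exec v1 = v2 := rfl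
    rw [he]
    have m2 : v2.r (lv (i + 3) 0) = 0 := by simp [hv2]
    have hF2 : v2.r vFail = 1 := by rw [hv2, St.set_ne (by simp)]; simp
    refine ⟨⟨fr1.trans (f2.mono ?_ fun _ h => h.elim), i1.of_fr f2 ?_ (by simp) (by simp), ?_, by omega, by omega,
      ?_, by omega, fun S hS h => absurd (d1 ?_) hz⟩, by omega⟩
    · rintro x (rfl | rfl) <;> simp [GX]
    · rintro x (rfl | rfl) <;> simp; omega
    · rw [hv2, outs_set (by simp), outs_set (by simp), o1]; exact fun _ h => h
    · rw [f2.r _ (by simp), q1, h1]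
    · exact hS.count i m _ τ hk hm1 hm (by rwa [h0, h1] at h)

theorem gen_spec (M : MMProg) (k i : ℕ) : GenSpec M k i (gen M k i) := by
  induction i with
  | zero => exact genBase_spec M k
  | succ i ih =>
    obtain ⟨C, hC⟩ := round_tri ih
    refine ⟨C + 20, ?_⟩
    intro P n R μG τm ℓ g G v hk hI hm hτ hV
    change v.r (lv (i + 3) 0) ≤ n at hm
    change v.r (lv (i + 3) 1) ≤ τm at hτ
    change ∀ a, i + 3 ≤ a → a < k → v.r (vV a) < n at hV
    change Tri P _ v ((C + 20) * ℓ ^ (3 * (i + 1)) * (v.r (lv (i + 3) 1) + slack n μG (i + 1))) _ _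
    obtain ⟨gm, gn⟩ := g.le_μG hm
    obtain ⟨s1, s2⟩ := slack_step (μG := μG) g.n_pos gn i
    have hS := g.S
    set X := slack n μG (i + 1)
    set τ := v.r (lv (i + 3) 1) with hτd
    set T := C * ℓ ^ (3 * i + 2) * (τ + X) + 4 with hT
    set E := 1 + n * errs ℓ n i with hE
    have hsz := g.size_le (by omega) hm
    have refl : StPost M k n R i G v v := ⟨Fr.refl _ _ _, hI, fun _ h => h, id, le_rfl, rfl, fun _ _ _ h _ => Or.inr h,
      fun S hS h => ⟨rfl, h⟩⟩
    refine (Tri.whileE (v := v) (fun v' => Nat.size (v'.r (lv (i + 3) 0)) * T)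
      (fun v' => Nat.size (v'.r (lv (i + 3) 0)) * E) (StPost M k n R i G v) (by simp; omega) refl
      (fun v' p hs hz => ?_) fun v' p hs hz => ?_).le ?_ (Nat.mul_le_mul_right _ hsz)
    · set m := v'.r (lv (i + 3) 0) with hmd
      have hm1 : 1 ≤ m := Nat.one_le_iff_ne_zero.2 hz
      have key : ∀ m', 2 * m' ≤ m → Nat.size m' + 1 ≤ Nat.size m := fun m' h => by
        have h1 : 0 < Nat.size m := Nat.size_pos.2 hm1
        obtain ⟨s, hs⟩ := Nat.exists_eq_succ_of_ne_zero h1.ne'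
        have h2 : m < 2 ^ (s + 1) := by rw [← Nat.succ_eq_add_one, ← hs]; exact Nat.lt_size_self m
        have : Nat.size m' ≤ s := Nat.size_le.2 (by rw [pow_succ] at h2; omega)
        omega
      have k0 := key 0 (by omega)
      simp only [Nat.size_zero] at k0
      refine ⟨_, E, ?_, Nat.le_mul_of_pos_left _ k0, (hC g (by omega) p.inv hm1 (p.le.trans hm) rfl p.tau hτ
        fun a ha hak => by rw [p.fr.r _ (GX.not_vV ha)]; exact hV a ha hak).post fun v2 _ ⟨p2, h2⟩ => ⟨p.trans p2, ?_, ?_⟩⟩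
      · exact Nat.le_mul_of_pos_left T k0
      · have := Nat.mul_le_mul_right T (key _ h2)
        rw [Ex.cost, add_mul, one_mul] at *; omega
      · have := Nat.mul_le_mul_right E (key _ h2)
        rwa [add_mul, one_mul] at this
    · rw [Ex.eval_v] at hz
      refine ⟨p.fr, p.inv, p.out, p.fail, fun h0 f f1 f2 f3 => (p.cov h0 f f1 f2 f3).resolve_right fun h => ?_,
        fun S hS h => (p.suff S hS h).1⟩
      obtain ⟨c, hc, -⟩ := h 0 (by omega)
      omega
    · have r1 := g.R
      have p1 : 1 ≤ ℓ ^ (3 * (i + 1)) := Nat.pow_pos (by omega)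
      have p2 : ℓ ≤ ℓ ^ (3 * (i + 1)) := Nat.le_self_pow (by omega) ℓ
      have h1 : Nat.size (v.r (lv (i + 3) 0)) * T ≤ ℓ * T := Nat.mul_le_mul_right _ hsz
      have e1 : ℓ * T = C * ℓ ^ (3 * (i + 1)) * (τ + X) + 4 * ℓ := by rw [hT, show 3 * (i + 1) = 3 * i + 2 + 1 by ring, pow_succ]; ring
      have e2 : (C + 20) * ℓ ^ (3 * (i + 1)) * (τ + X) = C * ℓ ^ (3 * (i + 1)) * (τ + X) + 20 * (ℓ ^ (3 * (i + 1)) * (τ + X)) := by ring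
      have h2 : ℓ ^ (3 * (i + 1)) * 1 ≤ ℓ ^ (3 * (i + 1)) * (τ + X) := Nat.mul_le_mul_left _ (by omega)
      rw [Ex.cost, e2]; omega

/-! ### A sufficient time budget -/

/-- The ratios `α_j / j` for `j = i + 2`, in terms of `s = 3 - ω`. -/
def bt (s : ℝ) : ℕ → ℝ
  | 0 => 1
  | i + 1 => ((i + 2) - (i + 1) * s) * bt s i / (s + (i + 2) * bt s i)

theorem bt_pos_le {s : ℝ} (h0 : 0 ≤ s) (h1 : s ≤ 1) (i : ℕ) : 0 < bt s i ∧ bt s i ≤ 1 := by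
  induction i with
  | zero => simp [bt]
  | succ i ih =>
    have hi : (0 : ℝ) ≤ i := i.cast_nonneg
    have hd : 0 < s + (i + 2) * bt s i := by nlinarith
    have hc : 0 < ((i : ℝ) + 2) - (i + 1) * s := by nlinarith
    refine ⟨div_pos (mul_pos hc ih.1) hd, (div_le_one hd).2 ?_⟩
    nlinarith [mul_nonneg (mul_nonneg (add_nonneg hi zero_le_one) h0) ih.1.le]

theorem bt_lt_one {s : ℝ} (h0 : 0 < s) (h1 : s ≤ 1) (i : ℕ) : bt s (i + 1) < 1 := by
  have ih := bt_pos_le h0.le h1 i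
  have hi : (0 : ℝ) ≤ i := i.cast_nonneg
  refine (div_lt_one (by nlinarith)).2 ?_
  nlinarith [mul_nonneg (mul_nonneg (add_nonneg hi zero_le_one) h0.le) ih.1.le]

theorem bt_balance {s : ℝ} (h0 : 0 < s) (h1 : s ≤ 1) (i : ℕ) :
    (1 - bt s (i + 1)) / s * ((i + 2) * bt s i + s) = (i + 2) * bt s i + 1 - bt s i := by
  have ih := bt_pos_le h0.le h1 i
  have hi : (0 : ℝ) ≤ i := i.cast_nonneg
  have hd : s + (i + 2) * bt s i ≠ 0 := by nlinarith
  rw [bt]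
  field_simp
  ring

/-- The time bound up to polylogarithmic factors. -/
def timeU (s : ℝ) (i m t : ℕ) : ℝ := (m : ℝ) ^ ((i : ℝ) + 2 - s) + (m : ℝ) ^ (((i : ℝ) + 2) * bt s i) * (t : ℝ) ^ (1 - bt s i)

theorem timeU_mono {s : ℝ} (h0 : 0 ≤ s) (h1 : s ≤ 1) (i : ℕ) {m' t t' : ℕ} (hm : m' ≤ m) (ht : t' ≤ t) :
    timeU s i m' t' ≤ timeU s i m t := by
  have hi : (0 : ℝ) ≤ i := i.cast_nonneg
  obtain ⟨b0, b1⟩ := bt_pos_le h0 h1 i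
  unfold timeU
  gcongr
  linarith

/-- The constants in the time budget. -/
def kap : ℕ → ℝ
  | 0 => 1
  | i + 1 => 9 + (1 + 4 * 128 ^ (i + 2)) * kap i

theorem kap_nonneg (i : ℕ) : 1 ≤ kap i := by
  induction i with
  | zero => exact le_rfl
  | succ i ih => simp only [kap]; nlinarith [show (0 : ℝ) < 128 ^ (i + 2) by positivity]

theorem clique_factor_le {m D E s b' b J x t' : ℝ} (hm : 1 ≤ m) (hD : 1 ≤ D) (hE : 1 ≤ E) (hs : 0 < s) (hb' : 0 < b')
    (hb1 : b' ≤ 1) (hJ : 0 ≤ J) (hbal : (1 - b) / s * (J * b' + s) = J * b' + 1 - b') (hED : E ≤ D ^ ((1 - b) / s))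
    (hx0 : 0 ≤ x) (hx : x ≤ 128 * E * m / D) (ht0 : 0 ≤ t') (ht : t' ≤ 4 * m ^ J / D) :
    x ^ (J * b') * t' ^ (1 - b') ≤ 4 * 128 ^ J * (m ^ J * E ^ (-s)) := by
  have m0 : 0 < m := by linarith
  have D0 : 0 < D := by linarith
  have E0 : 0 < E := by linarith
  have hmJ : 0 < m ^ J := Real.rpow_pos_of_pos m0 J
  calc x ^ (J * b') * t' ^ (1 - b') ≤ (128 * E * m / D) ^ (J * b') * (4 * m ^ J / D) ^ (1 - b') := by gcongr
    _ ≤ _ := by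
      rw [← Real.log_le_log_iff (by positivity) (by positivity), log_mul, log_rpow, log_rpow, Real.log_div, Real.log_div, log_mul, log_mul, log_mul, log_mul,
        log_mul, log_mul, log_rpow m0, log_rpow, log_rpow E0] <;> try positivity
      have h1 := Real.log_le_log E0 hED
      rw [log_rpow D0] at h1
      have h2 : log E * (J * b' + s) ≤ (J * b' + 1 - b') * log D := by
        have := mul_le_mul_of_nonneg_right h1 (show 0 ≤ J * b' + s by positivity)
        rw [mul_right_comm, hbal] at this; exact this
      have h3 : b' * J * log 128 ≤ 1 * J * log 128 := by gcongr
      have h4 : (1 - b') * log 4 ≤ 1 * log 4 := by gcongr; linarith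
      nlinarith

theorem exists_balance {m D s b : ℝ} (hm : 1 ≤ m) (hD : 1 ≤ D) (hs : 0 < s) (hb : b ≤ 1) : ∃ E, 1 ≤ E ∧ E ≤ m ∧
    E ≤ D ^ ((1 - b) / s) ∧ (E ^ (-s) = m ^ (-s) ∨ E ^ (-s) = D ^ (-(1 - b))) := by
  rcases le_total m (D ^ ((1 - b) / s)) with h | h
  · exact ⟨m, hm, le_rfl, h, Or.inl rfl⟩
  · refine ⟨_, one_le_rpow hD (div_nonneg (by linarith) hs.le), h, le_rfl, Or.inr ?_⟩
    rw [← rpow_mul (by linarith)]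
    congr 1; field_simp

/-- The sufficient condition for the time budget. -/
def suffU (s Λ : ℝ) (i m t τ : ℕ) : Prop := kap i * Λ * timeU s i m t ≤ τ

theorem suffices_suffU (M : MMProg) {s Λ : ℝ} (h0 : 0 ≤ s) (h1 : s ≤ 1) (hk : 3 ≤ k → 0 < s) (hΛ : 1 ≤ Λ)
    (hM : ∀ N : ℕ, 1 ≤ N → N ≤ 2 * n → ((M.μ N + N * N + 1 : ℕ) : ℝ) ≤ Λ * (N : ℝ) ^ (3 - s)) :
    Suffices M k n (suffU s Λ) := by
  constructor
  · intro m t τ h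
    simp only [suffU, timeU, bt, kap] at h
    norm_num at h
    have e : (m : ℝ) ^ (2 - s) ≥ 0 := by positivity
    have h3 : ((m * m : ℕ) : ℝ) ≤ τ := by push_cast; nlinarith
    exact_mod_cast h3
  · intro i m t τ hik hm1 hmn h
    have hs := hk (by omega)
    set N := 2 ^ clog 2 m with hN
    set Q := 2 ^ clog 2 (m ^ (i + 1)) with hQ
    have hN1 : 1 ≤ N := one_le_two_pow
    have hNm := two_pow_clog_le hm1
    have hQm := two_pow_clog_le (Nat.one_le_pow (i + 1) m hm1)
    rw [← Nat.cast_le (α := ℝ)]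
    refine le_trans ?_ h
    have hm0 : (0 : ℝ) < m := Nat.cast_pos.2 hm1
    have hN0 : (0 : ℝ) < N := Nat.cast_pos.2 hN1
    have e1 : (N : ℝ) ^ (3 - s) = N * N ^ (2 - s) := by rw [show 3 - s = 1 + (2 - s) by ring, rpow_add hN0, Real.rpow_one]
    have e2 : (N : ℝ) ^ (2 - s) ≤ 4 * m ^ (2 - s) := by
      calc (N : ℝ) ^ (2 - s) ≤ (2 * m : ℝ) ^ (2 - s) := by gcongr; linarith; exact_mod_cast hNm
        _ = 2 ^ (2 - s) * m ^ (2 - s) := mul_rpow (by norm_num) hm0.le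
        _ ≤ 2 ^ (2 : ℝ) * m ^ (2 - s) := by gcongr; norm_num; linarith
        _ = _ := by norm_num
    have e3 : (m : ℝ) ^ (((i + 1 : ℕ) : ℝ) + 2 - s) = m ^ (i + 1) * m ^ (2 - s) := by rw [← rpow_natCast, ← rpow_add hm0]; congr 1; ring
    have e4 : (Q : ℝ) ≤ 2 * m ^ (i + 1) := by exact_mod_cast hQm
    have hk1 := kap_nonneg i
    calc ((Q / N * (M.μ N + N * N + 1) : ℕ) : ℝ) = ((Q / N : ℕ) : ℝ) * ((M.μ N + N * N + 1 : ℕ) : ℝ) := Nat.cast_mul _ _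
      _ ≤ (Q / N) * (Λ * (N : ℝ) ^ (3 - s)) := by
        gcongr
        · exact Nat.cast_div_le
        · exact hM N hN1 (by omega)
      _ = Λ * Q * N ^ (2 - s) := by rw [e1]; field_simp
      _ ≤ Λ * (2 * m ^ (i + 1)) * (4 * m ^ (2 - s)) := by gcongr
      _ = 8 * (Λ * (m : ℝ) ^ (((i + 1 : ℕ) : ℝ) + 2 - s)) := by rw [e3]; ring
      _ ≤ kap (i + 1) * (Λ * (m : ℝ) ^ (((i + 1 : ℕ) : ℝ) + 2 - s)) := by
        gcongr
        rw [kap]; nlinarith [show (0 : ℝ) < 128 ^ (i + 2) by positivity]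
      _ ≤ _ := by
        rw [mul_assoc, timeU]
        have := kap_nonneg (i + 1)
        gcongr
        exact le_add_of_nonneg_right (by positivity)
  · intro i m t τ m' t' h hm ht
    have := kap_nonneg i
    exact le_trans (by gcongr; exact timeU_mono h0 h1 i hm ht) h
  · intro i m t τ σ H m' t' hik hm1 hmn h htm hσQ hσ hHQ hm'H ht'm hm'm
    have hs := hk (by omega)
    obtain ⟨b0, b1⟩ := bt_pos_le h0 h1 i
    obtain ⟨c0, c1⟩ := bt_pos_le h0 h1 (i + 1)
    have hi : (0 : ℝ) ≤ i := i.cast_nonneg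
    have hm0 : (0 : ℝ) < m := Nat.cast_pos.2 hm1
    have hm1' : (1 : ℝ) ≤ m := Nat.one_le_cast.2 hm1
    have hQ := Nat.le_pow_clog one_lt_two (m ^ (i + 1))
    have hQm := two_pow_clog_le (Nat.one_le_pow (i + 1) m hm1)
    have hNm := two_pow_clog_le hm1
    set Q := 2 ^ clog 2 (m ^ (i + 1)) with hQd
    rcases Nat.eq_zero_or_pos m' with rfl | hm'1
    · have : timeU s i 0 t' = 0 := by rw [timeU, Nat.cast_zero, Real.zero_rpow (by linarith), Real.zero_rpow (by positivity)]; simp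
      rw [suffU, this, mul_zero]; positivity
    have hH1 : 1 ≤ H := by
      by_contra hh
      rw [show H = 0 by omega] at hm'H
      have := Nat.mul_pos hm'1 hm1
      omega
    have ht1 : 1 ≤ t := by
      by_contra hh
      rw [show t = 0 by omega, mul_zero] at hHQ
      have := Nat.mul_pos hH1 (Nat.pow_pos hm1 |>.trans_le hQ : 0 < Q)
      omega
    have ht0 : (0 : ℝ) < t := Nat.cast_pos.2 ht1
    set D : ℝ := m ^ (i + 3) / t with hD
    have hD1 : 1 ≤ D := (one_le_div ht0).2 (by exact_mod_cast htm)
    have hD0 : 0 < D := by linarith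
    obtain ⟨E, hE1, hEm, hED, hEs⟩ := exists_balance hm1' hD1 hs c1
    have hE0 : 0 < E := by linarith
    set U := timeU s (i + 1) m t with hU
    have hUE : (m : ℝ) ^ (i + 3) * E ^ (-s) ≤ U := by
      rw [hU, timeU]; push_cast
      rcases hEs with h | h <;> rw [h]
      · refine le_add_of_le_of_nonneg (le_of_eq ?_) (by positivity)
        rw [← rpow_natCast, ← rpow_add hm0]; congr 1; push_cast; ring
      · refine le_add_of_nonneg_of_le (by positivity) (le_of_eq ?_)
        rw [hD, Real.div_rpow (by positivity) ht0.le, Real.rpow_neg ht0.le, div_inv_eq_mul, ← mul_assoc,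
          ← rpow_natCast, ← rpow_mul hm0.le, ← rpow_add hm0]
        congr 2; push_cast; ring
    have hJU : (m : ℝ) ^ ((i : ℝ) + 2 - s) * m ≤ U := by
      rw [hU, timeU]; push_cast
      refine le_add_of_le_of_nonneg (le_of_eq ?_) (by positivity)
      rw [← Real.rpow_add_one hm0.ne']; congr 1; ring
    have hk1 := kap_nonneg i
    set F : ℝ := 4 * 128 ^ (i + 2) with hF
    have hF0 : 0 ≤ F := by positivity
    have hkap : kap (i + 1) = 9 + (1 + F) * kap i := rfl
    have hU0 : 0 ≤ U := le_trans (by positivity) hUE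
    -- the block size
    set a := clog 2 ⌈E⌉₊ with ha
    have hce : ⌈E⌉₊ ≤ m := Nat.ceil_le.2 hEm
    have ha1 : E ≤ ((2 ^ a : ℕ) : ℝ) := (Nat.le_ceil E).trans (by exact_mod_cast Nat.le_pow_clog one_lt_two _)
    have ha2 : ((2 ^ a : ℕ) : ℝ) ≤ 4 * E := by
      have h3 : (2 ^ a : ℕ) ≤ 2 * ⌈E⌉₊ := two_pow_clog_le (Nat.ceil_pos.2 hE0)
      have h4 := Nat.ceil_lt_add_one hE0.le
      have h5 : ((2 ^ a : ℕ) : ℝ) ≤ 2 * ⌈E⌉₊ := by exact_mod_cast h3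
      linarith
    have ham : a ≤ clog 2 m := Nat.clog_mono_right 2 hce
    have hσa : σ ≤ 2 ^ a := by
      refine hσ a ham ?_
      rw [← Nat.cast_le (α := ℝ)]
      refine le_trans ?_ h
      have p0 : (0 : ℝ) < ((2 ^ a : ℕ) : ℝ) := by positivity
      have hsq : (2 ^ (clog 2 m - a) : ℕ) * 2 ^ a = 2 ^ clog 2 m := by rw [← pow_add, Nat.sub_add_cancel ham]
      have hsq' : ((2 ^ (clog 2 m - a) : ℕ) : ℝ) * ((2 ^ a : ℕ) : ℝ) ≤ 2 * m := by exact_mod_cast hsq.le.trans hNm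
      have hpm : 2 ^ a ≤ 2 * n := (Nat.pow_le_pow_right two_pos ham).trans (by omega)
      have hM' := hM (2 ^ a) one_le_two_pow hpm
      have hQr : (Q : ℝ) ≤ 2 * m ^ (i + 1) := by exact_mod_cast hQm
      rw [Nat.cast_mul, Nat.cast_mul, Nat.cast_mul]
      set p : ℝ := ((2 ^ a : ℕ) : ℝ)
      set r : ℝ := ((2 ^ (clog 2 m - a) : ℕ) : ℝ)
      have hr0 : 0 ≤ r := Nat.cast_nonneg _
      have e1 : p ^ (3 - s) = p ^ 3 * p ^ (-s) := by rw [← rpow_natCast, ← rpow_add p0]; congr 1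
      have e2 : p ^ (-s) ≤ E ^ (-s) := Real.rpow_le_rpow_of_nonpos hE0 ha1 (by linarith)
      calc ((Q / 2 ^ a : ℕ) : ℝ) * (r * r) * _ ≤ (Q / p) * (r * r) * (Λ * p ^ (3 - s)) := by
            gcongr
            exact Nat.cast_div_le
        _ = Q * Λ * ((r * p) * (r * p)) * p ^ (-s) := by rw [e1]; field_simp
        _ ≤ (2 * m ^ (i + 1)) * Λ * ((2 * m) * (2 * m)) * E ^ (-s) := by gcongr
        _ = 8 * (Λ * (m ^ (i + 3) * E ^ (-s))) := by ring
        _ ≤ kap (i + 1) * (Λ * U) := by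
          have : 8 ≤ kap (i + 1) := by rw [hkap]; nlinarith [mul_nonneg hF0 (zero_le_one.trans hk1)]
          gcongr
        _ = _ := by ring
    -- the bound for the subproblem
    have hx : (m' : ℝ) ≤ 128 * E * m / D := by
      have h3 : H * m ^ (i + 1) ≤ 8 * σ * t := (Nat.mul_le_mul_left _ hQ).trans hHQ
      have h4 : m' * m * m ^ (i + 1) ≤ 4 * (8 * σ * t) := by nlinarith
      have h5 : (m' : ℝ) * m * m ^ (i + 1) ≤ 4 * (8 * σ * t) := by exact_mod_cast h4
      have h6 : (σ : ℝ) ≤ 4 * E := le_trans (by exact_mod_cast hσa) ha2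
      rw [le_div_iff₀ hD0, hD, mul_div_assoc', div_le_iff₀ ht0]
      have h7 : (σ : ℝ) * t ≤ 4 * E * t := by gcongr
      calc (m' : ℝ) * m ^ (i + 3) = m' * m * m ^ (i + 1) * m := by ring
        _ ≤ 4 * (8 * σ * t) * m := by gcongr
        _ ≤ 4 * (8 * (4 * E * t)) * m := by
          gcongr ?_ * _
          linarith
        _ = _ := by ring
    have hJ : (m : ℝ) ^ ((i : ℝ) + 2) = m ^ (i + 2) := by rw [← rpow_natCast]; push_cast; rfl
    have hT : (t' : ℝ) ≤ 4 * (m : ℝ) ^ ((i : ℝ) + 2) / D := by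
      have h3 : (t' : ℝ) * m ≤ 4 * t := by exact_mod_cast ht'm
      rw [le_div_iff₀ hD0, hD, mul_div_assoc', div_le_iff₀ ht0, hJ]
      calc (t' : ℝ) * m ^ (i + 3) = t' * m * m ^ (i + 2) := by ring
        _ ≤ 4 * t * m ^ (i + 2) := by gcongr
        _ = _ := by ring
    have hB := clique_factor_le hm1' hD1 hE1 hs b0 b1 (by positivity) (bt_balance hs h1 i) hED (Nat.cast_nonneg m') hx
      (Nat.cast_nonneg t') hT
    have h128 : (128 : ℝ) ^ ((i : ℝ) + 2) = 128 ^ (i + 2) := by rw [← rpow_natCast]; push_cast; rfl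
    rw [h128, ← hF, hJ] at hB
    have hA : (m' : ℝ) ^ ((i : ℝ) + 2 - s) ≤ m ^ ((i : ℝ) + 2 - s) := by
      gcongr
      linarith
    have key : timeU s i m' t' * m ≤ (1 + F) * U := by
      rw [timeU, add_mul _ _ (m : ℝ), add_mul 1 F, one_mul]
      refine add_le_add (le_trans (by gcongr) hJU) ?_
      calc _ ≤ F * (m ^ (i + 2) * E ^ (-s)) * m := by gcongr
        _ = F * (m ^ (i + 3) * E ^ (-s)) := by ring
        _ ≤ F * U := by gcongr
    have hUm : (m : ℝ) ≤ U := by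
      exact le_trans (le_mul_of_one_le_left hm0.le (one_le_rpow hm1' (by linarith))) hJU
    have hfl : (τ : ℝ) ≤ ((τ / m : ℕ) : ℝ) * m + m := by
      have : τ ≤ τ / m * m + m := by
        have := Nat.div_add_mod' τ m
        have := Nat.mod_lt τ hm1
        omega
      exact_mod_cast this
    rw [suffU, hkap, ← hU] at h; rw [suffU]
    have h9 : kap i * Λ * (timeU s i m' t' * m) ≤ kap i * Λ * ((1 + F) * U) := by gcongr
    have h10 : U ≤ 9 * Λ * U := le_mul_of_one_le_left hU0 (by linarith)
    refine le_of_mul_le_mul_right ?_ hm0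
    linarith

/-! ### The main program -/

/-- The time budget. -/
abbrev vTau : Var := (1, 3)
/-- A counter. -/
abbrev vI : Var := (1, 4)

/-- All cliques have been output. -/
def AllOut (G : SimpleGraph ℕ) (k n : ℕ) (v : St) : Prop := ∀ f : ℕ → ℕ, (∀ b < k, ∀ a < b, G.Adj (f a) (f b)) →
  (∀ b < k, f b < n) → (range k).image f ∈ outs k v

/-- Try a time budget, and double it. -/
def attempt (M : MMProg) (i : ℕ) : Cmd :=
  .seq (SL.seq (.asg (lv (i + 2) 0) (.v vn)) (.seq (.asg (lv (i + 2) 1) (.v vTau)) (.asg vFail 0))).cmd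
    (.seq (forE vI (.v vn) (SL.sto (bL (i + 2)) (.v vI) (.v vI)).cmd) (.seq (gen M (i + 2) i) (asg vTau (2 * .v vTau))))

theorem attempt_tri (M : MMProg) (i : ℕ) : ∃ C, ∀ {P : Par} {n R μG τm ℓ : ℕ}
    (_ : Glob M P (i + 2) n R μG τm ℓ) {G : SimpleGraph ℕ} {τ : ℕ} {v : St}, GInv n (i + 2) R G v →
    v.r vTau = τ → τ ≤ τm → 2 * τ ≤ P.W →
    Tri P (attempt M i) v (C * ℓ ^ (3 * i) * (τ + slack n μG i + n)) (errs ℓ n i) fun v' => GInv n (i + 2) R G v' ∧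
      v'.r vTau = 2 * τ ∧ (v'.r vFail = 0 → AllOut G (i + 2) n v') ∧
      ∀ S, Suffices M (i + 2) n S → S i n (tcount G id n (i + 2)) τ → v'.r vFail = 0 := by
  obtain ⟨C, hC⟩ := gen_spec M (i + 2) i
  refine ⟨C + 200, ?_⟩
  intro P n R μG τm ℓ g G τ v hI h1 hτ h2
  have hS := g.S
  have hn := hI.env.n_eq
  have hn1 := g.n_pos
  have hnW : n ≤ P.W := by
    have := g.W
    have := Nat.le_self_pow (show i + 2 ≠ 0 by omega) n
    omega
  set v1 := ((v.set (lv (i + 2) 0) n).set (lv (i + 2) 1) τ).set vFail 0 with hv1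
  set X : Var → Prop := fun x => x = lv (i + 2) 0 ∨ x = lv (i + 2) 1 ∨ x = vFail ∨ x = vI with hX
  set Y : Var → Prop := fun b => b = bL (i + 2) with hY
  have F1 : Fr X Y v v1 := (((Fr.refl X Y v).set (by simp [hX]) _).set (by simp [hX]) _).set (by simp [hX]) _
  have hp : ℓ ^ (3 * i) ≥ 1 := Nat.pow_pos (by have := g.R; omega)
  refine ((Tri.sl (P := P) (v := v) (Q := (· = v1)) (by simp [SL.size]; omega) (fun _ => ?_) fun _ => ?_).seq
    (T' := (n * (5 + forCost (.v vn)) + forCost (.v vn)) + (C * ℓ ^ (3 * i) * (τ + slack n μG i) + 7 + 1) + 1)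
    (e' := 0 + (errs ℓ n i + 0)) fun v2 _ h2 => ?_).le ?_ (by simp)
  · simp [SL.ok, SL.exec, hn, h1, hnW]; omega
  · simp only [SL.exec, Ex.eval_v, hn]
    rw [St.set_ne (by simp), h1]; rfl
  · subst h2
    refine (Tri.forE (T := 5) (e := 0) n (fun c v' => v'.r vI = c ∧ Fr X Y v v' ∧ v'.r (lv (i + 2) 0) = n ∧
      v'.r (lv (i + 2) 1) = τ ∧ v'.r vFail = 0 ∧ (∀ d < c, v'.a (bL (i + 2)) d = d) ∧ ∀ d, v'.a (bL (i + 2)) d < n)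
      (by simp; omega) ⟨by simp, F1.set (x := vI) (by simp [hX]) _, ?_, ?_, ?_, by simp, fun d => hI.L (i + 2) 0 d (by simp)⟩ hnW
      (fun c v' h => h.1) (fun c v' h => by rw [Ex.eval_v, h.2.1.r _ (by simp [hX]; omega), hn]) (by omega)
      fun c v' hc ⟨q1, q2, q3, q4, q5, q6, q7⟩ hs => ?_).seq (e := n * 0) (e' := errs ℓ n i + 0) (fun v2 _ ⟨q1, q2, q3, q4, q5, q6, q7⟩ => ?_)
      |>.le le_rfl (by simp)
    all_goals simp [hv1]
    · refine Tri.sl (P := P) (p := .sto (bL (i + 2)) (.v vI) (.v vI)) (by simp [SL.size]; omega) (fun _ => show v'.r vI ≤ P.W by rw [q1]; exact hc.le.trans hnW) fun _ => ?_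
      simp only [SL.exec, Ex.eval_v, q1]
      refine ⟨q1, (q2.put (b := bL (i + 2)) rfl _ _).set (x := vI) (by simp [hX]) _, q3, q4, q5, fun d hd => ?_, fun d => ?_⟩
      · rw [St.put_a]; split_ifs with h
        · exact h.2.symm
        · exact q6 d (by simp at h; omega)
      · rw [St.put_a]; split_ifs
        · exact hc
        · exact q7 d
    · have I2 : GInv n (i + 2) R G v2 := hI.of_fr q2 (by rintro x (rfl | rfl | rfl | rfl) <;> simp <;> omega)
        (by rintro b rfl; simp; omega) fun l c hc hb d => by rw [show ((30 + l, c) : Var) = bL (i + 2) from hb]; exact q7 d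
      have t := hC g (v := v2) le_rfl I2 (by rw [q3]) (by rw [q4]; exact hτ) fun a h1 h2 => absurd h2 (not_lt.2 h1)
      rw [q4] at t
      refine t.seq (e' := 0) fun v3 _ p => ?_
      have h3 : v3.r vTau = τ := by rw [p.fr.r _ (by simp [GX]), q2.r _ (by simp [hX]), h1]
      have e3 : (2 * Ex.v vTau).eval v3 = 2 * τ := by rw [← h3]; rfl
      refine Tri.asg (by simp [show (2 * Ex.v vTau).size = 4 from rfl]; omega) (fun _ => by rw [e3]; exact h2) ?_
      rw [e3]
      have F3 : Fr (· = vTau) (fun _ => False) v3 (v3.set vTau (2 * τ)) := (Fr.refl (· = vTau) (fun _ => False) v3).set (x := vTau) rfl _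
      refine ⟨p.inv.of_fr F3 (by simp) (by simp) (by simp), by simp, fun h0 f f1 f2 => ?_, fun S hS h => ?_⟩
      · rw [outs_set (by simp)]
        refine p.cov (by simpa using h0) f f1 (fun b hb => ⟨f b, by rw [q3]; exact f2 b hb, (q6 _ (f2 b hb)).symm⟩)
          fun b h1 h2 => absurd h2 (not_lt.2 h1)
      · rw [St.set_ne (by simp), p.suff S hS, q5]
        rw [q3, q4]; exact hS.mono _ _ _ _ _ _ h le_rfl (tcount_le id (fun _ h => h) (fun _ _ _ _ h => h) q6)
  · have cf : forCost (.v vn) = 32 := rfl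
    have e : (C + 200) * ℓ ^ (3 * i) * (τ + slack n μG i + n) = C * ℓ ^ (3 * i) * (τ + slack n μG i) +
      C * ℓ ^ (3 * i) * n + 200 * (ℓ ^ (3 * i) * (τ + slack n μG i + n)) := by ring
    have h4 := Nat.mul_le_mul_right (τ + slack n μG i + n) hp
    have c0 : SL.cost (.seq (.asg (lv (i + 2) 0) (.v vn)) (.seq (.asg (lv (i + 2) 1) (.v vTau)) (.asg vFail 0))) = 11 := rfl
    rw [e, cf, c0]; omega

/-- Try time budgets until one suffices. -/
def search (M : MMProg) (i : ℕ) : Cmd := whileE (.v vFail) (attempt M i)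

theorem search_tri (M : MMProg) (i : ℕ) : ∃ C, ∀ {P : Par} {n R μG A ℓ : ℕ}
    (_ : Glob M P (i + 2) n R μG (2 ^ (A + 1)) ℓ) {G : SimpleGraph ℕ} {v : St}, GInv n (i + 2) R G v →
    v.r vTau = 1 → v.r vFail = 1 → (∃ S, Suffices M (i + 2) n S ∧ ∀ τ, 2 ^ A ≤ τ → S i n (tcount G id n (i + 2)) τ) →
    Tri P (search M i) v (C * (A + 1) * ℓ ^ (3 * i) * (2 ^ A + slack n μG i + n)) ((A + 1) * errs ℓ n i) fun v' =>
      Env n (i + 2) G.Adj v' ∧ AllOut G (i + 2) n v' := by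
  obtain ⟨C, hC⟩ := attempt_tri M i
  refine ⟨C + 10, ?_⟩
  intro P n R μG A ℓ g G v hI h1 hF ⟨S, hS, hA⟩
  have gS := g.S
  have gτ := g.τ
  have hp : ℓ ^ (3 * i) ≥ 1 := Nat.pow_pos (by have := g.R; omega)
  have cx : (Ex.v vFail).cost = 1 := rfl
  set X := 2 ^ A + slack n μG i + n
  set T := C * ℓ ^ (3 * i) * X + 4 with hT
  set E := errs ℓ n i
  refine (Tri.whileE (v := v) (fun v => if v.r vFail = 0 then 0 else (A + 1 - Nat.log 2 (v.r vTau)) * T)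
    (fun v => if v.r vFail = 0 then 0 else (A + 1 - Nat.log 2 (v.r vTau)) * E)
    (fun v => GInv n (i + 2) R G v ∧ ∃ a, v.r vTau = 2 ^ a ∧ (v.r vFail ≠ 0 → a ≤ A) ∧
      (v.r vFail = 0 → AllOut G (i + 2) n v)) (by simp; omega)
    ⟨hI, 0, h1, fun _ => Nat.zero_le _, fun h => by omega⟩ (fun v ⟨hI, a, ha, hf, _⟩ hs hz => ?_)
    fun v ⟨hI, a, ha, _, hO⟩ hs hz => ⟨hI.env, hO hz⟩).le ?_ ?_
  · rw [Ex.eval_v] at hz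
    have haA := hf hz
    have h2 : 2 ^ a ≤ 2 ^ A := Nat.pow_le_pow_right two_pos haA
    rw [pow_succ] at gτ
    obtain ⟨d, rfl⟩ := Nat.exists_eq_add_of_le haA
    have e1 : ∀ Z, (a + d + 1 - a) * Z = d * Z + Z := fun Z => by rw [show a + d + 1 - a = d + 1 by omega, add_mul, one_mul]
    have hb : C * ℓ ^ (3 * i) * (2 ^ a + slack n μG i + n) ≤ C * ℓ ^ (3 * i) * X := Nat.mul_le_mul_left _ (by omega)
    refine ⟨_, E, ?_, ?_, (hC g hI ha (by rw [pow_succ]; omega) (by omega)).post fun v' _ ⟨p1, p2, p3, p4⟩ =>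
      ⟨⟨p1, a + 1, by rw [p2, pow_succ'], fun h => ?_, p3⟩, ?_, ?_⟩⟩
    · simp only [if_neg hz, ha, Nat.log_pow one_lt_two, e1, cx]; omega
    · simp only [if_neg hz, ha, Nat.log_pow one_lt_two, e1]; omega
    · by_contra hd
      exact h (p4 S hS (hA _ (Nat.pow_le_pow_right two_pos (by omega))))
    · simp only [if_neg hz, ha, p2, ← pow_succ', Nat.log_pow one_lt_two, e1, cx, show a + d + 1 - (a + 1) = d by omega]
      split_ifs <;> omega
    · simp only [if_neg hz, ha, p2, ← pow_succ', Nat.log_pow one_lt_two, e1, show a + d + 1 - (a + 1) = d by omega]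
      split_ifs <;> omega
  · simp only [hF, h1, Nat.log_one_right, one_ne_zero, if_false, cx, Nat.sub_zero]
    have h4 : 1 ≤ ℓ ^ (3 * i) * X := Nat.mul_pos hp (Nat.add_pos_right _ g.n_pos)
    have h5 := Nat.mul_le_mul_left (A + 1) h4
    have e : (C + 10) * (A + 1) * ℓ ^ (3 * i) * X = (A + 1) * (C * ℓ ^ (3 * i) * X) + 10 * ((A + 1) * (ℓ ^ (3 * i) * X)) := by ring
    rw [e, hT, mul_add]; omega
  · simp only [hF, h1, Nat.log_one_right, one_ne_zero, if_false, Nat.sub_zero]; exact le_rfl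

theorem size_half {x : ℕ} (hx : x ≠ 0) : Nat.size (x / 2) + 1 = Nat.size x := by
  have h := Nat.size_bit (b := x.bodd) (n := x.div2) (by rwa [Nat.bit_bodd_div2])
  rw [Nat.bit_bodd_div2, Nat.div2_val] at h
  exact h.symm

/-- Compute the number of random words of every pass. -/
def setR (q : ℕ) : Cmd := .seq (SL.seq (.asg vI (.v vn + 2)) (.asg vR 0)).cmd
    (whileE (.v vI) (SL.seq (.asg vI (.v vI / 2)) (.asg vR (.v vR + .c q))).cmd)

theorem setR_tri {q : ℕ} (hS : q + 10 ≤ P.S) (hn : v.r vn = n) (hW : n + 2 + q * Nat.size (n + 2) ≤ P.W) :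
    Tri P (setR q) v (50 * (Nat.size (n + 2) + 1)) 0 (· = (v.set vI 0).set vR (q * Nat.size (n + 2))) := by
  have e1 : (Ex.v vn + 2).eval v = n + 2 := by rw [← hn]; rfl
  refine ((Tri.sl (P := P) (p := SL.seq (.asg vI (Ex.v vn + 2)) (.asg vR 0)) (v := v) (Q := (· = (v.set vI (n + 2)).set vR 0))
    (by simp [SL.size, show (Ex.v vn + 2).size = 4 from rfl]; omega)
    (fun _ => ⟨show (Ex.v vn + 2).eval v ≤ P.W by rw [e1]; omega, Nat.zero_le _⟩) fun _ => by simp only [SL.exec, e1]; rfl).seq (e' := 0)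
    (T' := Nat.size (n + 2) * 25 + 1 + 3) fun v1 _ h1 => ?_).le
      (show 11 + (Nat.size (n + 2) * 25 + 1 + 3) + 1 ≤ _ by omega) le_rfl
  subst h1
  have cx : (Ex.v vI).cost = 1 := rfl
  refine (Tri.whileE (fun v => Nat.size (v.r vI) * 25) (fun _ => 0) (fun v' => ∃ x r, v' = (v.set vI x).set vR r ∧
    r + q * Nat.size x = q * Nat.size (n + 2) ∧ x ≤ n + 2) (by simp; omega) ⟨n + 2, 0, rfl, by simp, le_rfl⟩ ?_ ?_).le (by simp [cx]) le_rfl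
  · rintro v' ⟨x, r, rfl, h1, h2⟩ hs hz
    have hx : x ≠ 0 := by simpa using hz
    have hh := size_half hx
    have e2 : (Ex.v vI / 2).eval ((v.set vI x).set vR r) = x / 2 := by simp [show (2 : Ex) = .c 2 from rfl, Ex.eval]
    have e3 : (Ex.v vR + .c q).eval (((v.set vI x).set vR r).set vI (x / 2)) = r + q := by
      change (((v.set vI x).set vR r).set vI (x / 2)).r vR + q = r + q; simp
    have h3 : r + q + q * Nat.size (x / 2) = q * Nat.size (n + 2) := by rw [← h1, ← hh]; ring
    have hx' : x / 2 ≤ n + 2 := by omega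
    refine ⟨15, 0, ?_, le_rfl, Tri.sl (P := P) (p := SL.seq (.asg vI (Ex.v vI / 2)) (.asg vR (.v vR + .c q)))
      (by simp [SL.size, Ex.size, show (Ex.v vI / 2).size = 4 from rfl, show (Ex.v vR + .c q).size = 1 + (q + 1) from rfl]; omega)
      (fun _ => ⟨show (Ex.v vI / 2).eval _ ≤ P.W by rw [e2]; omega, ?_⟩) fun _ => ?_⟩
    · simp [cx]; omega
    · change (Ex.v vR + .c q).eval (((v.set vI x).set vR r).set vI ((Ex.v vI / 2).eval _)) ≤ P.W
      rw [e2, e3]; omega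
    · simp only [SL.exec, e2, e3]
      refine ⟨⟨x / 2, r + q, ?_, h3, hx'⟩, ?_, le_rfl⟩
      · ext y
        · simp only [St.set_r]; split_ifs <;> simp_all
        · rfl
      · simp [cx]; omega
  · rintro v' ⟨x, r, rfl, h1, h2⟩ hs hz
    have hx : x = 0 := by simpa using hz
    subst hx; rw [show r = q * Nat.size (n + 2) by simpa using h1]

/-- The listing program. -/
def mainProg (M : MMProg) (i q : ℕ) : Cmd :=
  .seq (SL.seq (.asg vn (.v vC)) (.seq (.asg vC 0) (.seq (.asg vOne 1) (.seq (.asg vFail 1) (.asg vTau 1))))).cmd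
    (.seq (setR q) (search M i))

theorem mainProg_tri (M : MMProg) (i q : ℕ) : ∃ C, ∀ {P : Par} {n μG A ℓ : ℕ}
    (_ : Glob M P (i + 2) n (q * Nat.size (n + 2)) μG (2 ^ (A + 1)) ℓ) {G : SimpleGraph ℕ} {v : St}, q + 10 ≤ P.S →
    n + 2 + q * Nat.size (n + 2) ≤ P.W → v.r vC = n → (∀ x, x ≠ vC → v.r x = 0) → (∀ b, b ≠ bA → ∀ i, v.a b i = 0) →
    (∀ a < n, ∀ b < n, (G.Adj a b → v.a bA (a * n + b) = 1) ∧ (¬ G.Adj a b → v.a bA (a * n + b) = 0)) →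
    (∃ S, Suffices M (i + 2) n S ∧ ∀ τ, 2 ^ A ≤ τ → S i n (tcount G id n (i + 2)) τ) →
    Tri P (mainProg M i q) v (C * (A + 1) * (ℓ ^ (3 * i) * (2 ^ A + slack n μG i + n)) + 50 * Nat.size (n + 2))
      ((A + 1) * errs ℓ n i) fun v' => Env n (i + 2) G.Adj v' ∧ AllOut G (i + 2) n v' := by
  obtain ⟨C, hC⟩ := search_tri M i
  refine ⟨C + 100, ?_⟩
  intro P n μG A ℓ g G v hqS hW hn hr ha hA hS
  have gS := g.S
  set v1 := ((((v.set vn n).set vC 0).set vOne 1).set vFail 1).set vTau 1 with hv1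
  refine ((Tri.sl (P := P) (v := v) (Q := (· = v1)) (by simp [SL.size, show (Ex.size 1) = 2 from rfl]; omega) (fun _ => ?_) fun _ => ?_).seq
    (T' := 50 * (Nat.size (n + 2) + 1) + C * (A + 1) * ℓ ^ (3 * i) * (2 ^ A + slack n μG i + n) + 1) (e' := 0 + (A + 1) * errs ℓ n i) fun v2 _ h2 => ?_).le ?_ (by simp)
  · have h1 := g.n_pos
    simp [SL.ok, SL.exec, hn]; omega
  · simp only [SL.exec, Ex.eval_v, hn]; rfl
  · subst h2
    refine (setR_tri hqS (by simp [hv1]) hW).seq fun v3 _ h3 => ?_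
    have hC0 : v3.r vC = 0 := by simp [h3, hv1]
    have e3 : v3.a = v.a := by rw [h3, hv1]; rfl
    have ho : outs (i + 2) v3 = [] := by simp [outs, hC0]
    have hr3 : ∀ x, x.1 = 21 → v3.r x = 0 := fun x hx => by
      have h : ∀ y : Var, y.1 ≠ 21 → x ≠ y := fun y hy => by rintro rfl; exact hy hx
      rw [h3, hv1]; simp only [St.set_r]
      simp [h vR (by simp), h vI (by simp), h vTau (by simp), h vFail (by simp), h vOne (by simp), h vC (by simp), h vn (by simp), hr x (h vC (by simp))]
    refine hC g ⟨⟨by simp [h3, hv1], by simp [h3, hv1], fun a h1 b h2 => ?_, ?_, ?_, fun f _ _ => ?_⟩, ⟨fun b j => ?_, fun r => hr3 _ rfl⟩,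
      by simp [h3], fun l c j hc => ?_⟩ (by simp [h3, hv1]) (by simp [h3, hv1]) hS
    · rw [e3]; split_ifs with h
      · exact (hA a h1 b h2).1 h
      · exact (hA a h1 b h2).2 h
    iterate 2 rw [ho]; simp
    · rw [ho, e3, ha _ (by simp)]; simp
    · rw [e3, ha _ (by simp)]
    · rw [e3, ha _ (by simp)]; exact g.n_pos
  · have c0 : SL.cost (SL.seq (.asg vn (.v vC)) (.seq (.asg vC 0) (.seq (.asg vOne 1) (.seq (.asg vFail 1) (.asg vTau 1))))) = 19 := rfl
    have hp : ℓ ^ (3 * i) ≥ 1 := Nat.pow_pos (by have := g.R; omega)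
    have h4 : 1 ≤ ℓ ^ (3 * i) * (2 ^ A + slack n μG i + n) := Nat.mul_pos hp (Nat.add_pos_right _ g.n_pos)
    have h5 := Nat.mul_le_mul_left (A + 1) h4
    have e : (C + 100) * (A + 1) * (ℓ ^ (3 * i) * (2 ^ A + slack n μG i + n)) =
      C * (A + 1) * ℓ ^ (3 * i) * (2 ^ A + slack n μG i + n) + 100 * ((A + 1) * (ℓ ^ (3 * i) * (2 ^ A + slack n μG i + n))) := by ring
    rw [c0, e]; omega

/-! ### Correctness of the listing program -/

theorem Tri.failureProb_le {c : Cmd} {T e : ℕ} {Q : St → Prop} {G : State → Prop} {s : State} {t : ℕ}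
    (h : Tri P c s.toSt T e Q) (hs : s.toSt.Small P.W) (hQ : ∀ s' v', Rel P.W s' v' → Q v' → G s') (ht : T ≤ t) :
    failureProb P.B t c s G ≤ e * P.ε := by
  refine (h 0 G [] 0 (fun v' s' hr t _ => le_iInf fun hq => ?_) s (State.rel_toSt hs) t ht).trans (by rw [zero_add])
  rw [failFrom_halted _ _ _ _ (hQ _ _ hr hq)]

theorem flatten_eq (A : Matrix (Fin n) (Fin n) ℕ) {a b : ℕ} (ha : a < n) (hb : b < n) : flatten A (a * n + b) = A ⟨a, ha⟩ ⟨b, hb⟩ := by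
  obtain ⟨d1, d2⟩ := mul_add_div_mod (u := a) hb
  rw [flatten, dif_pos (mul_add_lt_mul ha hb)]
  congr 1 <;> simp [d1, d2]

theorem lists_of_env {G : SimpleGraph (Fin n)} {s : State} (hr : Rel W s v)
    (hE : Env n k (G.map valEmbedding).Adj v) (hA : AllOut (G.map valEmbedding) k n v) : ListsCliques G k s := by
  have ho : outputList k s = outs k v := by rw [outputList, outs, ← hr.reg, ← hr.mem]; rfl
  refine ⟨ho ▸ hE.nodup, fun S => ⟨fun hS => ?_, ?_⟩⟩
  · obtain ⟨h1, h2, h3⟩ := hE.sound S (ho ▸ hS)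
    refine ⟨S.attachFin h2, ⟨fun a ha b hb hab => ?_, by simp [h1]⟩, by simp⟩
    have := h3 a (by simpa using ha) b (by simpa using hb) (fun h => hab (Fin.ext h))
    exact SimpleGraph.map_adj_apply.1 this
  · rintro ⟨K, hK, rfl⟩
    let o := K.orderEmbOfFin hK.card_eq
    let f : ℕ → ℕ := fun b => if h : b < k then (o ⟨b, h⟩ : ℕ) else 0
    have hf : ∀ b (h : b < k), f b = o ⟨b, h⟩ := fun b h => dif_pos h
    rw [ho]
    convert hA f (fun b hb a ha => ?_) fun b hb => by rw [hf b hb]; exact (o _).2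
    · ext x
      simp only [Finset.mem_map, mem_image, mem_range, Fin.valEmbedding_apply]
      constructor
      · rintro ⟨a, ha, rfl⟩
        obtain ⟨b, rfl⟩ : a ∈ Set.range o := by rw [Finset.range_orderEmbOfFin]; exact ha
        exact ⟨b, b.2, hf b b.2⟩
      · rintro ⟨b, hb, rfl⟩
        exact ⟨_, K.orderEmbOfFin_mem hK.card_eq ⟨b, hb⟩, (hf b hb).symm⟩
    · rw [hf b hb, hf a (ha.trans hb)]
      exact SimpleGraph.map_adj_apply.2 (hK.isClique (K.orderEmbOfFin_mem _ _) (K.orderEmbOfFin_mem _ _)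
        fun h => ha.ne (by simpa using o.injective h))

theorem tcount_le_ncard (G : SimpleGraph (Fin n)) (k : ℕ) : tcount (G.map valEmbedding) id n k ≤ k ^ k * (G.cliqueSet k).ncard := by
  classical
  rw [← SimpleGraph.coe_cliqueFinset, Set.ncard_coe_finset, tcount]
  refine (Finset.card_le_mul_card_image_of_maps_to (f := fun g : Fin k → Fin n => univ.image g) (fun g hg => ?_) _ fun K hK => ?_)
  · simp only [mem_filter, mem_univ, true_and, id_eq] at hg
    have hg' : ∀ a b, a ≠ b → G.Adj (g a) (g b) := fun a b hab => by
      rcases hab.lt_or_gt with h | h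
      · exact SimpleGraph.map_adj_apply.1 (hg a b h)
      · exact (SimpleGraph.map_adj_apply.1 (hg b a h)).symm
    refine SimpleGraph.mem_cliqueFinset_iff.2 ⟨?_, ?_⟩
    · intro x hx y hy hxy
      simp only [Finset.coe_image, Finset.coe_univ, Set.image_univ, Set.mem_range] at hx hy
      obtain ⟨a, rfl⟩ := hx
      obtain ⟨b, rfl⟩ := hy
      exact hg' a b fun h => hxy (h ▸ rfl)
    · rw [Finset.card_image_of_injective _ fun a b h => by_contra fun hab => (hg' a b hab).ne h, Finset.card_univ, Fintype.card_fin]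
  · have hc := (SimpleGraph.mem_cliqueFinset_iff.1 hK).card_eq
    calc _ ≤ (Fintype.piFinset fun _ : Fin k => K).card := card_le_card fun g hg => by
          simp only [mem_filter] at hg
          exact Fintype.mem_piFinset.2 fun a => hg.2 ▸ Finset.mem_image_of_mem g (mem_univ a)
      _ = k ^ k := by rw [Fintype.card_piFinset_const, hc]

theorem mainProg_failure (M : MMProg) (i q : ℕ) : ∃ C, ∀ {P : Par} {n μG A ℓ : ℕ}
    (_ : Glob M P (i + 2) n (q * Nat.size (n + 2)) μG (2 ^ (A + 1)) ℓ) (G : SimpleGraph (Fin n)) {t : ℕ}, q + 10 ≤ P.S →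
    n + 2 + q * Nat.size (n + 2) ≤ P.W →
    (∃ S, Suffices M (i + 2) n S ∧ ∀ τ, 2 ^ A ≤ τ → S i n (tcount (G.map valEmbedding) id n (i + 2)) τ) →
    C * (A + 1) * (ℓ ^ (3 * i) * (2 ^ A + slack n μG i + n)) + 50 * Nat.size (n + 2) ≤ t →
    failureProb P.B t (mainProg M i q) (graphInput G) (ListsCliques G (i + 2)) ≤ ((A + 1) * errs ℓ n i : ℕ) * P.ε := by
  classical
  obtain ⟨C, hC⟩ := mainProg_tri M i q
  refine ⟨C, ?_⟩
  intro P n μG A ℓ g G t hS hW hSu ht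
  have hr : ∀ x : Var, x ≠ vC → (graphInput G).toSt.r x = 0 := fun x hx => if_neg fun h => hx (en_inj.1 (h.trans (by rfl)))
  have ha : ∀ b : Var, b ≠ bA → ∀ i, (graphInput G).toSt.a b i = 0 := fun b hb i => if_neg fun h => hb (eb_inj.1 (h.trans (by rfl)))
  have hA : ∀ i, (graphInput G).toSt.a bA i = flatten (G.adjMatrix ℕ) i := fun i => by
    change (if eb bA = 0 then flatten _ i else 0) = _; rw [if_pos (by rfl)]
  have hn : (graphInput G).toSt.r vC = n := if_pos (e := 0) (show en vC = 0 by rfl)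
  refine (hC g hS hW hn hr ha (fun a h1 b h2 => ?_) hSu).failureProb_le ⟨fun x => ?_, fun b j => ?_⟩
    (fun s' v' h1 h2 => lists_of_env h1 h2.1 h2.2) ht
  · rw [hA, flatten_eq _ h1 h2, SimpleGraph.adjMatrix_apply]
    have : (G.map valEmbedding).Adj a b ↔ G.Adj ⟨a, h1⟩ ⟨b, h2⟩ :=
      SimpleGraph.map_adj_apply (f := valEmbedding) (a := ⟨a, h1⟩) (b := ⟨b, h2⟩)
    rw [this]; exact ⟨fun h => if_pos h, fun h => if_neg h⟩
  · by_cases hx : x = vC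
    · rw [hx, hn]; omega
    · rw [hr x hx]; omega
  · by_cases hb : b = bA
    · rw [hb, hA, flatten]
      split_ifs
      · rw [SimpleGraph.adjMatrix_apply]; split_ifs <;> omega
      · omega
    · rw [ha b hb]; omega

/-! ### The running time -/

theorem exists_pow_le_two_pow (a i D w : ℕ) : ∃ q, D ≤ q ∧ w * (q + a) ^ i ≤ 2 ^ (q - D) := by
  have h := ((tendsto_pow_const_div_const_pow_of_one_lt i (one_lt_two (α := ℝ))).comp
    (Filter.tendsto_add_atTop_nat a)).eventually_lt_const (show (0 : ℝ) < 1 / ((w + 1) * 2 ^ (D + a)) by positivity)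
  obtain ⟨q, hq, hD⟩ := (h.and (Filter.eventually_ge_atTop D)).exists
  refine ⟨q, hD, ?_⟩
  obtain ⟨q, rfl⟩ := Nat.exists_eq_add_of_le hD
  simp only [Function.comp] at hq
  rw [div_lt_div_iff₀ (by positivity) (by positivity), one_mul] at hq
  have e : (2 : ℝ) ^ (D + q + a) = 2 ^ q * 2 ^ (D + a) := by rw [← pow_add]; congr 1; omega
  rw [e, ← mul_assoc, mul_lt_mul_iff_left₀ (by positivity)] at hq
  rw [Nat.add_sub_cancel_left, ← Nat.cast_le (α := ℝ)]
  push_cast at hq ⊢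
  nlinarith [pow_nonneg (show (0 : ℝ) ≤ D + q + a by positivity) i]

theorem errs_le (ℓ n i : ℕ) : errs ℓ n i ≤ (ℓ * (n + 1) + 1) ^ i - 1 := by
  induction i with
  | zero => simp [errs]
  | succ i ih =>
    have h : errs ℓ n i + 1 ≤ (ℓ * (n + 1) + 1) ^ i := by
      have := Nat.one_le_pow i (ℓ * (n + 1) + 1) (Nat.succ_pos _)
      omega
    have h2 := Nat.mul_le_mul_right (ℓ * (n + 1) + 1) h
    refine Nat.le_sub_of_add_le (le_trans ?_ (h2.trans_eq (pow_succ _ _).symm))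
    rw [errs]; nlinarith

theorem size_le_log (n : ℕ) (hn : 1 ≤ n) : (Nat.size (n + 2) : ℝ) ≤ 3 * log (n + 2) ∧ 1 ≤ log (n + 2) := by
  have h1 : 1 ≤ log ((n : ℝ) + 2) := by
    rw [Real.le_log_iff_exp_le (by positivity)]
    have : (1 : ℝ) ≤ n := by exact_mod_cast hn
    linarith [Real.exp_one_lt_d9]
  refine ⟨?_, h1⟩
  obtain ⟨m, hm⟩ : ∃ m, Nat.size (n + 2) = m + 1 := Nat.exists_eq_succ_of_ne_zero (Nat.size_pos.2 (by omega)).ne'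
  have h2 : 2 ^ m ≤ n + 2 := Nat.lt_size.1 (by omega)
  have h3 : (m : ℝ) * log 2 ≤ log (n + 2) := by
    rw [← Real.log_pow]; exact Real.log_le_log (by positivity) (by exact_mod_cast h2)
  rw [hm]
  push_cast
  nlinarith [Real.log_two_gt_d9]

set_option maxHeartbeats 2000000 in
theorem listing_of_matMul (i : ℕ) {s : ℝ} (h0 : 0 ≤ s) (h1 : s ≤ 1) (hs : 3 ≤ i + 2 → 0 < s) (hMM : MatMulTime (3 - s))
    (d : ℕ) : ∃ (p : Cmd) (c : ℕ) (C : ℝ) (e : ℕ), 0 ≤ C ∧ ∀ n : ℕ, 1 ≤ n → ∀ (G : SimpleGraph (Fin n)) (T : ℕ),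
      ⌊C * timeU s i n (G.cliqueSet (i + 2)).ncard * log (n + 2) ^ e⌋₊ ≤ T →
        failureProb ((n + 2) ^ c) T p (graphInput G) (ListsCliques G (i + 2)) ≤ ((n : ℝ≥0∞) ^ d)⁻¹ := by
  obtain ⟨p0, c0, C0, e0, hp0⟩ := hMM
  obtain ⟨ρ, hρ⟩ := p0.exists_inRange
  let M : MMProg := ⟨p0, c0, max ρ 2, fun N => ⌊C0 * (N : ℝ) ^ (3 - s) * log (N + 2) ^ e0⌋₊,
    p0.inRange_mono (le_max_left _ _) hρ, le_max_right _ _, hp0⟩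
  set K : ℕ := (⌈|C0|⌉₊ + 2) * 2 ^ e0 with hK
  set κ : ℕ := (i + 2) ^ (i + 2) with hκ
  set c1 : ℕ := ⌈16 * kap i⌉₊ * K with hc1
  set w0 := c1 + e0 + (i + 2) with hw0
  set w1 := 16 * K + e0 + 3 with hw1
  obtain ⟨q, hqD, hq⟩ := exists_pow_le_two_pow (i + 3) i (3 * i + 4 + d) w0
  set w := (i + 2 + 3) + 2 * c0 + (w0 + w1 + 1) + (q + 1) with hw
  set Sz := 2 * (i + 2) + 20 + q with hSz
  clear_value K κ c1 w0 w1 w Sz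
  obtain ⟨C, hC⟩ := mainProg_failure M i q
  have hkap := kap_nonneg i
  refine ⟨mainProg M i q, w * Sz + 1, C * (w0 * 3) * (((q + i + 3 : ℕ) * 3) ^ (3 * i) * ((4 * kap i * κ + 17) * K)) + 150,
    1 + 3 * i + e0, by positivity, fun n hn G T₀ hT₀ => ?_⟩
  set t := (G.cliqueSet (i + 2)).ncard
  set T := tcount (G.map valEmbedding) id n (i + 2) with hT
  set L := log (n + 2) with hL
  obtain ⟨hsz, hL1⟩ := size_le_log n hn
  rw [← hL] at hsz hL1
  set z := Nat.size (n + 2) with hz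
  obtain ⟨b0, b1⟩ := bt_pos_le h0 h1 i
  have hn0 : (1 : ℝ) ≤ n := by exact_mod_cast hn
  have hnp : (0 : ℝ) < n := by linarith
  have hi : (0 : ℝ) ≤ i := i.cast_nonneg
  set x := n + 2 with hx
  have hxr : (x : ℝ) = n + 2 := by rw [hx]; push_cast; rfl
  have hx2 : 2 ≤ x := by omega
  have cx : ∀ c : ℕ, c ≤ x ^ c := fun c => (Nat.lt_pow_self (by omega)).le
  have mx : ∀ {a b : ℕ}, a ≤ b → x ^ a ≤ x ^ b := fun h => Nat.pow_le_pow_right (by omega) h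
  have hLx : L ≤ x := by rw [hL, ← hxr]; exact Real.log_le_self (by positivity)
  have hK2 : (2 : ℝ) ≤ K := by
    have : 2 * 1 ≤ K := hK ▸ Nat.mul_le_mul (by omega) one_le_two_pow
    exact_mod_cast this
  set Λ : ℝ := K * L ^ e0 with hΛ
  have hLe : 1 ≤ L ^ e0 := one_le_pow₀ hL1
  have hΛ1 : 1 ≤ Λ := one_le_mul_of_one_le_of_one_le (by linarith) hLe
  have hΛx : Λ ≤ K * (x : ℝ) ^ e0 := by rw [hΛ]; gcongr
  have hM : ∀ N : ℕ, 1 ≤ N → N ≤ 2 * n → ((M.μ N + N * N + 1 : ℕ) : ℝ) ≤ Λ * (N : ℝ) ^ (3 - s) := by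
    intro N hN hN2
    have hNr : (1 : ℝ) ≤ N := by exact_mod_cast hN
    have hN2r : (N : ℝ) ≤ 2 * n := by exact_mod_cast hN2
    have hlog : log (N + 2) ≤ 2 * L := by
      rw [hL, ← Nat.cast_two, ← Real.log_pow]
      exact Real.log_le_log (by positivity) (by push_cast; nlinarith only [hN2r, hn0])
    have hlog0 : 0 ≤ log (N + 2) := log_nonneg (by linarith)
    have hsq : (N : ℝ) * N ≤ (N : ℝ) ^ (3 - s) := by
      rw [← pow_two, ← rpow_natCast]; exact rpow_le_rpow_of_exponent_le hNr (by push_cast; linarith)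
    have h1N : 1 ≤ (N : ℝ) ^ (3 - s) := one_le_rpow hNr (by linarith)
    have h2L : 1 ≤ (2 * L) ^ e0 := one_le_pow₀ (by linarith)
    have hμ : ((M.μ N : ℕ) : ℝ) ≤ ⌈|C0|⌉₊ * (N : ℝ) ^ (3 - s) * (2 * L) ^ e0 := by
      refine (Nat.cast_le.2 (Nat.floor_le_floor ?_)).trans (Nat.floor_le (by positivity))
      have := (le_abs_self C0).trans (Nat.le_ceil |C0|)
      gcongr
    have hXY : (N : ℝ) ^ (3 - s) ≤ (N : ℝ) ^ (3 - s) * (2 * L) ^ e0 := le_mul_of_one_le_right (by linarith) h2L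
    push_cast
    calc _ ≤ ⌈|C0|⌉₊ * (N : ℝ) ^ (3 - s) * (2 * L) ^ e0 + 2 * ((N : ℝ) ^ (3 - s) * (2 * L) ^ e0) := by linarith
      _ = _ := by rw [hΛ, hK, mul_pow]; push_cast; ring
  set U := timeU s i n t with hU
  have hnU : (n : ℝ) ^ ((i : ℝ) + 2 - s) ≤ U := le_add_of_nonneg_right (by positivity)
  have hnU1 : (n : ℝ) ≤ U := le_trans (by
    conv_lhs => rw [← Real.rpow_one (n : ℝ)]
    exact rpow_le_rpow_of_exponent_le hn0 (by linarith)) hnU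
  have hκ1 : (1 : ℝ) ≤ κ := by rw [hκ]; exact_mod_cast Nat.one_le_pow _ _ (Nat.succ_pos _)
  have hU' : timeU s i n T ≤ κ * U := by
    refine (timeU_mono h0 h1 i le_rfl (tcount_le_ncard G (i + 2))).trans ?_
    rw [hU, timeU, timeU, mul_add, ← hκ, Nat.cast_mul, mul_rpow (by positivity) (by positivity)]
    have e1 : (κ : ℝ) ^ (1 - bt s i) ≤ κ := by
      conv_rhs => rw [← Real.rpow_one (κ : ℝ)]
      exact rpow_le_rpow_of_exponent_le hκ1 (by linarith)
    refine add_le_add (le_mul_of_one_le_left (by positivity) hκ1) ?_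
    rw [mul_left_comm]
    gcongr
  have hU2 : timeU s i n T ≤ 2 * n ^ (i + 2) := by
    refine (timeU_mono h0 h1 i le_rfl (tcount_le_pow _ _ n (i + 2))).trans ?_
    rw [timeU, two_mul, Nat.cast_pow, ← rpow_natCast, ← rpow_mul hnp.le, ← rpow_add hnp]
    refine add_le_add (rpow_le_rpow_of_exponent_le hn0 (by push_cast; linarith)) (le_of_eq ?_)
    congr 1; push_cast; ring
  have hU1 : 1 ≤ timeU s i n T := le_add_of_le_of_nonneg (one_le_rpow hn0 (by linarith)) (by positivity)
  set need := kap i * Λ * timeU s i n T with hneed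
  have hneed1 : 1 ≤ need := one_le_mul_of_one_le_of_one_le (one_le_mul_of_one_le_of_one_le hkap hΛ1) hU1
  set A := clog 2 ⌈need⌉₊ with hA
  have hA1 : need ≤ ((2 ^ A : ℕ) : ℝ) := (Nat.le_ceil _).trans (by exact_mod_cast Nat.le_pow_clog one_lt_two _)
  have hA2 : ((2 ^ A : ℕ) : ℝ) ≤ 4 * need := by
    have h3 : 2 ^ A ≤ 2 * ⌈need⌉₊ := two_pow_clog_le (Nat.ceil_pos.2 (by linarith))
    have h4 := Nat.ceil_lt_add_one (show 0 ≤ need by linarith)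
    have h5 : ((2 ^ A : ℕ) : ℝ) ≤ 2 * ⌈need⌉₊ := by exact_mod_cast h3
    linarith
  have hAx : 2 ^ (A + 1) ≤ x ^ w0 := by
    rw [← Nat.cast_le (α := ℝ), pow_succ', Nat.cast_mul]
    calc ((2 : ℕ) : ℝ) * ((2 ^ A : ℕ) : ℝ) ≤ 2 * (4 * (kap i * (K * (x : ℝ) ^ e0) * (2 * x ^ (i + 2)))) := by
          have : (n : ℝ) ≤ x := by rw [hxr]; linarith
          rw [Nat.cast_ofNat]
          gcongr ?_ * ?_
          refine hA2.trans (mul_le_mul_of_nonneg_left ?_ (by norm_num))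
          rw [hneed]
          gcongr
          exact hU2.trans (by gcongr)
      _ = 16 * kap i * K * x ^ (e0 + (i + 2)) := by rw [pow_add (x : ℝ)]; ring
      _ ≤ (c1 : ℝ) * x ^ (e0 + (i + 2)) := by
        rw [hc1, Nat.cast_mul]
        gcongr
        exact Nat.le_ceil _
      _ ≤ ((x ^ c1 : ℕ) : ℝ) * x ^ (e0 + (i + 2)) := by gcongr; exact cx c1
      _ = _ := by rw [hw0]; push_cast; ring
  have e8 : (2 * (n : ℝ)) ^ (3 - s) ≤ 8 * (n : ℝ) ^ (3 - s) := by
    rw [mul_rpow (by norm_num) hnp.le]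
    gcongr
    calc (2 : ℝ) ^ (3 - s) ≤ 2 ^ (3 : ℝ) := rpow_le_rpow_of_exponent_le (by norm_num) (by linarith)
      _ = 8 := by norm_num
  set μG := ⌈Λ * (2 * (n : ℝ)) ^ (3 - s)⌉₊ with hμG
  have hμ0 : 1 ≤ Λ * (2 * (n : ℝ)) ^ (3 - s) := one_le_mul_of_one_le_of_one_le hΛ1 (one_le_rpow (by linarith) (by linarith))
  have hμ1 : (μG : ℝ) ≤ 16 * Λ * (n : ℝ) ^ (3 - s) := by
    have h4 := Nat.ceil_lt_add_one (show 0 ≤ Λ * (2 * (n : ℝ)) ^ (3 - s) by linarith)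
    have h5 := mul_le_mul_of_nonneg_left e8 (show 0 ≤ Λ by linarith)
    rw [← hμG] at h4; linarith
  have hμx : μG ≤ x ^ w1 := by
    rw [← Nat.cast_le (α := ℝ)]
    calc (μG : ℝ) ≤ 16 * (K * (x : ℝ) ^ e0) * (x : ℝ) ^ 3 := by
          refine hμ1.trans ?_
          have : (n : ℝ) ≤ x := by rw [hxr]; linarith
          gcongr
          calc (n : ℝ) ^ (3 - s) ≤ n ^ (3 : ℝ) := rpow_le_rpow_of_exponent_le hn0 (by linarith)
            _ = (n : ℝ) ^ 3 := by norm_cast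
            _ ≤ _ := by gcongr
      _ = ((16 * K : ℕ) : ℝ) * x ^ (e0 + 3) := by push_cast; ring
      _ ≤ ((x ^ (16 * K) : ℕ) : ℝ) * x ^ (e0 + 3) := by gcongr; exact cx _
      _ = _ := by rw [hw1]; push_cast; ring
  have hzx : z ≤ x := Nat.size_le.2 Nat.lt_two_pow_self
  have hz1 : 1 ≤ z := Nat.size_pos.2 (by omega)
  have hxz : x ≤ 2 ^ z := (Nat.lt_size_self x).le
  have hAz : A + 1 ≤ w0 * z := by
    have := hAx.trans (Nat.pow_le_pow_left hxz w0)
    rw [← pow_mul, mul_comm z] at this; exact (Nat.pow_le_pow_iff_right (by norm_num)).1 this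
  set ℓ := (q + i + 3) * z with hℓ
  have hqz : n + 2 + q * z ≤ x ^ (q + 1) := by
    have h3 : q + 1 ≤ x ^ q := Nat.lt_pow_self (by omega)
    calc n + 2 + q * z ≤ (q + 1) * x := by
          have := Nat.mul_le_mul_left q hzx
          rw [add_mul]; omega
      _ ≤ x ^ q * x := Nat.mul_le_mul_right _ h3
  have hxw : ∀ {a : ℕ}, a ≤ w → x ^ a ≤ x ^ w := mx
  let P : Par := ⟨x ^ w, x ^ (w * Sz + 1), Sz, ((x ^ (i + 2 + 1) : ℕ) : ℝ≥0∞) * ((2 : ℝ≥0∞) ^ (q * z))⁻¹,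
    hx2.trans (Nat.le_self_pow (by omega) x), by omega, by rw [← pow_mul]; exact Nat.pow_lt_pow_right (by omega) (Nat.lt_succ_self _)⟩
  have g : Glob M P (i + 2) n (q * z) μG (2 ^ (A + 1)) ℓ := by
    refine ⟨hn, ?_, fun N hN => ?_, fun N hN => ?_, ?_, show _ ≤ Sz by omega, le_rfl, ?_, ?_⟩
    · refine le_trans ?_ (hxw (show i + 2 + 3 ≤ w by omega))
      have h3 : n ^ (i + 2) ≤ x ^ (i + 2) := Nat.pow_le_pow_left (by omega) _
      have h4 : 27 ≤ x ^ 3 := Nat.pow_le_pow_left (show 3 ≤ x by omega) 3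
      have h5 := Nat.mul_le_mul h3 h4
      have h6 : 1 ≤ n ^ (i + 2) := Nat.one_le_pow _ _ hn
      rw [pow_add x]; omega
    · refine le_trans ?_ (hxw (show 2 * c0 ≤ w by omega))
      rw [pow_mul]
      have h3 := Nat.mul_le_mul_left x hx2
      exact Nat.pow_le_pow_left (by rw [pow_two]; omega) _
    · rw [← Nat.cast_le (α := ℝ)]
      refine le_trans ?_ (Nat.le_ceil _)
      rcases Nat.eq_zero_or_pos N with rfl | hN1
      · have : M.μ 0 = 0 := by
          change ⌊C0 * ((0 : ℕ) : ℝ) ^ (3 - s) * _⌋₊ = 0; rw [Nat.cast_zero, Real.zero_rpow (by linarith)]; simp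
        rw [this]; simpa using hμ0
      · refine (hM N hN1 hN).trans ?_
        have : (N : ℝ) ≤ 2 * n := by exact_mod_cast hN
        gcongr
        linarith
    · refine le_trans ?_ (hxw (show w0 + w1 + 1 ≤ w by omega))
      have h3 := mx (show w0 ≤ w0 + w1 by omega)
      have h4 := mx (show w1 ≤ w0 + w1 by omega)
      have h5 := Nat.mul_le_mul_left (x ^ (w0 + w1)) hx2
      rw [pow_succ x]; omega
    · rw [hℓ, add_mul, add_mul]; omega
    · have : clog 2 (n ^ (i + 2)) ≤ z * (i + 2) := (Nat.clog_le_iff_le_pow one_lt_two).2 (by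
        rw [pow_mul]; exact Nat.pow_le_pow_left (by omega) _)
      rw [mul_add, mul_comm z] at this; rw [hℓ, add_mul, add_mul]; omega
  have hR : ∀ τ, 2 ^ A ≤ τ → suffU s Λ i n T τ := fun τ hτ => hA1.trans (by exact_mod_cast hτ)
  refine (hC g G (show q + 10 ≤ Sz by omega) (hqz.trans (hxw (by omega))) ⟨_, suffices_suffU M h0 h1 hs hΛ1 hM, hR⟩ ?_).trans ?_
  · have hU0 : 1 ≤ U := hn0.trans hnU1
    have hsl : (slack n μG i : ℝ) ≤ 16 * Λ * U := by
      rcases i with _ | j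
      · have := one_le_mul_of_one_le_of_one_le hΛ1 hU0
        simp only [slack, Nat.cast_one]; linarith
      · rw [slack, Nat.cast_mul, Nat.cast_pow]
        calc (n : ℝ) ^ j * μG ≤ n ^ j * (16 * Λ * (n : ℝ) ^ (3 - s)) := by gcongr
          _ = 16 * Λ * (n : ℝ) ^ (((j + 1 : ℕ) : ℝ) + 2 - s) := by
            rw [show ((j + 1 : ℕ) : ℝ) + 2 - s = j + (3 - s) by push_cast; ring, rpow_add hnp, rpow_natCast]
            ring
          _ ≤ _ := by gcongr
    have hsum : (((2 ^ A : ℕ) : ℝ) + slack n μG i + n) ≤ (4 * kap i * κ + 17) * K * L ^ e0 * U := by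
      have h3 : need ≤ kap i * Λ * (κ * U) := mul_le_mul_of_nonneg_left hU' (by positivity)
      have h4 : (n : ℝ) ≤ Λ * U := hnU1.trans (le_mul_of_one_le_left (by linarith) hΛ1)
      have e : (4 * kap i * κ + 17) * K * L ^ e0 * U = 4 * (kap i * Λ * (κ * U)) + 17 * (Λ * U) := by rw [hΛ]; ring
      rw [e]; linarith
    have hA3 : ((A + 1 : ℕ) : ℝ) ≤ w0 * (3 * L) := (Nat.cast_le.2 hAz).trans (by rw [Nat.cast_mul]; gcongr)
    have hℓr : (ℓ : ℝ) ≤ (q + i + 3 : ℕ) * (3 * L) := by rw [hℓ, Nat.cast_mul]; gcongr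
    have hLu : L ≤ U * L ^ (1 + 3 * i + e0) := by
      have h3 : L ≤ L ^ (1 + 3 * i + e0) := le_self_pow₀ hL1 (by omega)
      exact h3.trans (le_mul_of_one_le_left (by positivity) hU0)
    refine (Nat.le_floor ?_).trans hT₀
    calc _ = C * ((A + 1 : ℕ) : ℝ) * ((ℓ : ℝ) ^ (3 * i) * (((2 ^ A : ℕ) : ℝ) + slack n μG i + n)) + 50 * (z : ℝ) := by push_cast; ring
      _ ≤ C * (w0 * (3 * L)) * (((q + i + 3 : ℕ) * (3 * L)) ^ (3 * i) * ((4 * kap i * κ + 17) * K * L ^ e0 * U)) + 50 * (3 * L) := by gcongr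
      _ ≤ C * (w0 * (3 * L)) * (((q + i + 3 : ℕ) * (3 * L)) ^ (3 * i) * ((4 * kap i * κ + 17) * K * L ^ e0 * U)) +
          150 * (U * L ^ (1 + 3 * i + e0)) := by linarith
      _ = _ := by simp only [mul_pow, pow_add, pow_one]; ring
  · have h3 : ((A + 1) * errs ℓ n i) * x ^ (i + 2 + 1) * n ^ d ≤ 2 ^ (q * z) := by
      have h4 : errs ℓ n i ≤ ((q + i + 3) * (x * x)) ^ i := by
        refine (errs_le ℓ n i).trans ((Nat.sub_le _ _).trans (Nat.pow_le_pow_left ?_ i))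
        have h5 : ℓ ≤ (q + i + 3) * x := Nat.mul_le_mul_left _ hzx
        have h6 := Nat.mul_le_mul_right (n + 1) h5
        have h7 : 1 * 1 ≤ (q + i + 3) * x := Nat.mul_le_mul (by omega) (by omega)
        have e : (q + i + 3) * (x * x) = (q + i + 3) * x * (n + 1) + (q + i + 3) * x := by rw [hx]; ring
        omega
      obtain ⟨r, rfl⟩ := Nat.exists_eq_add_of_le hqD
      rw [Nat.add_sub_cancel_left] at hq
      calc _ ≤ w0 * x * ((3 * i + 4 + d + r + i + 3) * (x * x)) ^ i * x ^ (i + 2 + 1) * x ^ d := by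
            gcongr
            · exact hAz.trans (Nat.mul_le_mul_left _ hzx)
            · omega
        _ = w0 * (3 * i + 4 + d + r + (i + 3)) ^ i * x ^ (3 * i + 4 + d) := by rw [mul_pow, ← pow_two, ← pow_mul]; ring
        _ ≤ x ^ r * x ^ (3 * i + 4 + d) := Nat.mul_le_mul_right _ (hq.trans (Nat.pow_le_pow_left hx2 _))
        _ = x ^ (3 * i + 4 + d + r) := by ring
        _ ≤ _ := by rw [mul_comm _ z, pow_mul]; exact Nat.pow_le_pow_left hxz _
    change _ * (_ * _) ≤ _; rw [ENNReal.le_inv_iff_mul_le, ← mul_assoc, mul_right_comm, ← div_eq_mul_inv]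
    refine ENNReal.div_le_of_le_mul ?_
    rw [one_mul]
    exact_mod_cast h3

/-! ### Bounds for the matrix multiplication exponent -/

/-- The value that the schoolbook method adds in one step. -/
def termE : Ex := .ld (0, 0) (.v (2, 0) / (.v (0, 0) * .v (0, 0)) * .v (0, 0) + .v (2, 0) % .v (0, 0)) *
  .ld (0, 1) (.v (2, 0) % .v (0, 0) * .v (0, 0) + .v (2, 0) / .v (0, 0) % .v (0, 0))

def mulStep : SL := .sto (1, 0) (.v (2, 0) / .v (0, 0)) (.ld (1, 0) (.v (2, 0) / .v (0, 0)) + termE)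

def naive : Cmd := forE (2, 0) (.v (0, 0) * .v (0, 0) * .v (0, 0)) mulStep.cmd

theorem matMulTime_three : MatMulTime 3 := by
  refine ⟨naive, 151, 1000, 0, fun n hn A A₂ hA hA₂ => ?_⟩
  let P : Par := ⟨(n + 2) ^ 5, (n + 2) ^ 151, 30, 0, (by omega : 2 ≤ n + 2).trans (Nat.le_self_pow (by omega) _), by omega, by
    rw [← pow_mul]; exact Nat.pow_lt_pow_right (by omega) (by omega)⟩
  set v := (matrixInput A A₂).toSt with hv
  have hr : v.r (0, 0) = n := if_pos (e := 0) (show en (0, 0) = 0 by rfl)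
  have hr0 : ∀ x : Var, x ≠ (0, 0) → v.r x = 0 := fun x hx => if_neg fun h => hx (en_inj.1 (h.trans (by rfl)))
  have h0 : v.a (0, 0) = flatten A := funext fun i => by
    change (if eb (0, 0) = 0 then flatten A i else if eb (0, 0) = 1 then flatten A₂ i else 0) = _; exact if_pos (by rfl)
  have h1 : v.a (0, 1) = flatten A₂ := funext fun _ => rfl
  have h2 : ∀ b : Var, b ≠ (0, 0) → b ≠ (0, 1) → ∀ i, v.a b i = 0 := fun b hb hb' i =>
    (if_neg fun h => hb (eb_inj.1 (h.trans (by rfl)))).trans (if_neg fun h => hb' (eb_inj.1 (h.trans (by rfl))))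
  have hfl : ∀ (X : Matrix (Fin n) (Fin n) ℕ), (∀ i j, X i j ≤ n) → ∀ a, flatten X a ≤ n := fun X hX a => by
    unfold flatten; split_ifs
    · exact hX _ _
    · exact Nat.zero_le _
  have hnW : n ≤ P.W := (show n ≤ n + 2 by omega).trans (Nat.le_self_pow (by omega) _)
  have hnW5 : n * n * n * (n * n) ≤ P.W := by
    calc _ = n ^ 5 := by ring
      _ ≤ _ := Nat.pow_le_pow_left (by omega) 5
  let g : ℕ → ℕ := fun q => flatten A (q / (n * n) * n + q % n) * flatten A₂ (q % n * n + q / n % n)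
  have hg : ∀ q, g q ≤ n * n := fun q => Nat.mul_le_mul (hfl A hA _) (hfl A₂ hA₂ _)
  have key := Tri.forE (x := (2, 0)) (b := .v (0, 0) * .v (0, 0) * .v (0, 0)) (v := v) (T := 67) (e := 0) (c := mulStep.cmd)
    (n * n * n) (fun c v' => v'.r (2, 0) = c ∧ v'.r (0, 0) = n ∧ v'.a (0, 0) = flatten A ∧ v'.a (0, 1) = flatten A₂ ∧
      ∀ a, v'.a (1, 0) a = ∑ q ∈ range c, if q / n = a then g q else 0) (show _ ≤ 30 by simp)
    ⟨by simp, by simp [hr], by simp [h0], by simp [h1], fun a => by simp [h2 (1, 0) (by simp) (by simp)]⟩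
    (le_trans (Nat.le_mul_of_pos_right _ (Nat.mul_pos hn hn)) hnW5) (fun i v h => h.1)
    (fun i v h => by simp [h.2.1]) (show 3 ≤ 30 by omega) fun c v' hc ⟨q1, q2, q3, q4, q5⟩ _ => ?_
  · refine le_antisymm ((key.failureProb_le (G := HoldsMatrix (A * A₂)) (t := ⌊(1000 : ℝ) * (n : ℝ) ^ (3 : ℝ) * log (n + 2) ^ 0⌋₊)
      ⟨fun x => ?_, fun b i => ?_⟩ (fun s' v' hR ⟨_, _, _, _, q⟩ i j => ?_) ?_).trans_eq (mul_zero _)) bot_le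
    · by_cases hx : x = (0, 0)
      · rw [hx, hr]; exact hnW
      · rw [hr0 x hx]; exact Nat.zero_le _
    · by_cases hb : b = (0, 0)
      · rw [hb, h0]; exact (hfl A hA i).trans hnW
      · by_cases hb' : b = (0, 1)
        · rw [hb', h1]; exact (hfl A₂ hA₂ i).trans hnW
        · rw [h2 b hb hb']; exact Nat.zero_le _
    · have hm : s'.mem 2 = v'.a (1, 0) := hR.mem (1, 0)
      have hgl : ∀ l : Fin n, g ((i * n + j : ℕ) * n + l) = A i l * A₂ l j := fun l => by
        obtain ⟨d1, d2⟩ := mul_add_div_mod (u := i * n + j) l.2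
        obtain ⟨d3, d4⟩ := mul_add_div_mod (u := (i : ℕ)) j.2
        simp only [g, ← Nat.div_div_eq_div_mul, d1, d2, d3, d4, flatten_eq _ i.2 l.2, flatten_eq _ l.2 j.2, Fin.eta]
      rw [hm, q, Matrix.mul_apply, ← sum_congr rfl fun l _ => hgl l, Fin.sum_univ_eq_sum_range
        (fun l => g ((i * n + j : ℕ) * n + l)) n, ← Finset.sum_filter]
      refine Finset.sum_nbij' (· % n) (fun l => (i * n + j : ℕ) * n + l) (fun q hq => mem_range.2 (Nat.mod_lt _ hn))
        (fun l hl => ?_) (fun q hq => ?_) (fun l hl => (mul_add_div_mod (mem_range.1 hl)).2) fun q hq => ?_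
      · rw [mem_range] at hl
        exact mem_filter.2 ⟨mem_range.2 (mul_add_lt_mul (mul_add_lt_mul i.2 j.2) hl), (mul_add_div_mod hl).1⟩
      all_goals rw [← (mem_filter.1 hq).2, Nat.div_add_mod']
    · refine Nat.le_floor ?_
      have : 1 ≤ n * n * n := Nat.mul_pos (Nat.mul_pos hn hn) hn
      have h3 : n * n * n * (67 + 48) + 48 ≤ 1000 * (n * n * n) := by omega
      calc _ ≤ ((1000 * (n * n * n) : ℕ) : ℝ) := Nat.cast_le.2 h3
        _ = _ := by push_cast; norm_cast; ring
  · have e1 : (Ex.v (2, 0) / Ex.v (0, 0)).eval v' = c / n := by simp [q1, q2]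
    have e2 : (Ex.ld (1, 0) (.v (2, 0) / .v (0, 0)) + termE).eval v' = ∑ q ∈ range (c + 1), if q / n = c / n then g q else 0 := by
      rw [sum_range_succ, if_pos rfl, ← q5]; simp [termE, q1, q2, q3, q4, g]
    have ex : mulStep.exec v' = v'.put (1, 0) (c / n) (∑ q ∈ range (c + 1), if q / n = c / n then g q else 0) := by
      rw [mulStep, SL.exec, e1, e2]
    refine Tri.sl (P := P) (p := mulStep) (show _ ≤ 30 by decide) (fun _ => ?_) fun _ => ?_
    · rw [mulStep, SL.ok, e2]
      refine ((sum_le_card_nsmul _ _ (n * n) fun q _ => ?_).trans ?_).trans hnW5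
      · split_ifs
        · exact hg q
        · exact Nat.zero_le _
      · rw [card_range]; exact Nat.mul_le_mul_right _ hc
    · rw [ex]
      refine ⟨q1, by simp, q2, q3, q4, fun a => ?_⟩
      rw [St.set_a, St.put_a]
      split_ifs with h
      · rw [h.2]
      · rw [q5, sum_range_succ, if_neg fun h' => h ⟨rfl, h'.symm⟩, add_zero]

theorem runFalse_cells {B : ℕ} (T : ℕ) : ∀ {c c' : Config}, runFalse B T (some c) = some c' →
    ∃ F : Finset ℕ, F.card ≤ T ∧ ∀ a ∉ F, c'.state.mem 2 a = c.state.mem 2 a := by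
  induction T with
  | zero => rintro c c' h; cases h; exact ⟨∅, by simp, fun _ _ => rfl⟩
  | succ T ih =>
    intro c c' h; rw [runFalse, Option.bind_some] at h
    rcases hc : step B false c with _ | c1
    · rw [hc] at h
      have : ∀ T, runFalse B T none = none := fun T => by induction T with
        | zero => rfl
        | succ T ih => exact ih
      rw [this] at h; cases h
    · rw [hc] at h
      obtain ⟨F, h1, h2⟩ := ih h
      have h3 : ∃ a, ∀ x ≠ a, c1.state.mem 2 x = c.state.mem 2 x := by
        rcases c with ⟨_ | ⟨_ | _ | _ | _ | ⟨b, x, y⟩ | _ | _ | _ | _, K⟩, s⟩ <;>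
          simp only [step, State.writeReg, Option.map_eq_some_iff, Option.ite_none_right_eq_some, Option.some.injEq] at hc
        case cons.store =>
          subst hc
          refine ⟨s.reg x, fun a ha => ?_⟩
          simp only [State.writeMem, update_apply]
          split_ifs <;> simp_all
        all_goals first
          | (subst hc; exact ⟨0, fun _ _ => rfl⟩)
          | (obtain ⟨_, ⟨_, rfl⟩, rfl⟩ := hc; exact ⟨0, fun _ _ => rfl⟩)
      obtain ⟨a, ha⟩ := h3
      refine ⟨insert a F, (Finset.card_insert_le _ _).trans (by omega), fun x hx => ?_⟩
      rw [Finset.mem_insert, not_or] at hx; rw [h2 x hx.2, ha x hx.1]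

theorem MatMulTime.two_le {τ : ℝ} (h : MatMulTime τ) : 2 ≤ τ := by
  obtain ⟨p, c, C, e, h⟩ := h
  by_contra! hτ
  have key : ∀ n : ℕ, 1 ≤ n → (n : ℝ) ^ 2 ≤ |C| * (n : ℝ) ^ τ * log (n + 2) ^ e := fun n hn => by
    obtain ⟨f, hf, hG⟩ := runFalse_of_failFrom _ _ (h n hn (Matrix.of fun _ _ => 1) (Matrix.of fun _ _ => 1) (fun _ _ => hn) fun _ _ => hn)
    obtain ⟨F, h1, h2⟩ := runFalse_cells _ hf
    have h3 : range (n * n) ⊆ F := fun a ha => by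
      by_contra haF
      have ha' : a < n * n := mem_range.1 ha
      have h4 : f.mem 2 (a / n * n + a % n) = _ := hG ⟨a / n, Nat.div_lt_of_lt_mul ha'⟩ ⟨a % n, Nat.mod_lt _ hn⟩
      rw [Nat.div_add_mod', h2 a haF, Matrix.mul_apply] at h4; simp [matrixInput] at h4; omega
    have h4 := (card_le_card h3).trans h1
    rw [card_range, Nat.le_floor_iff' (Nat.mul_pos hn hn).ne'] at h4
    have hl : 0 ≤ log ((n : ℝ) + 2) := log_nonneg (by linarith [n.cast_nonneg (α := ℝ)])
    calc (n : ℝ) ^ 2 = ((n * n : ℕ) : ℝ) := by push_cast; ring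
      _ ≤ _ := h4
      _ ≤ _ := by gcongr; exact le_abs_self C
  have hδ : 0 < 2 - τ := by linarith
  have ho := (isLittleO_log_rpow_rpow_atTop (e : ℝ) hδ).def (show 0 < 1 / (2 * 3 ^ (2 - τ) * (|C| + 1)) by positivity)
  obtain ⟨n, h1, h2⟩ := (((Filter.tendsto_atTop_add_const_right _ (2 : ℝ) tendsto_natCast_atTop_atTop).eventually ho).and
    (Filter.eventually_ge_atTop 1)).exists
  have hn : (1 : ℝ) ≤ n := by exact_mod_cast h2
  have hn0 : (0 : ℝ) < n := by linarith
  have hl : 0 ≤ log ((n : ℝ) + 2) := log_nonneg (by linarith)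
  rw [rpow_natCast, Real.norm_of_nonneg (by positivity), Real.norm_of_nonneg (by positivity)] at h1
  have k := key n h2
  have e1 : (n : ℝ) ^ 2 = n ^ τ * n ^ (2 - τ) := by rw [← rpow_add hn0, ← rpow_natCast]; congr 1; push_cast; ring
  have e2 : ((n : ℝ) + 2) ^ (2 - τ) ≤ 3 ^ (2 - τ) * n ^ (2 - τ) := by
    rw [← mul_rpow (by norm_num) hn0.le]
    exact Real.rpow_le_rpow (by positivity) (by linarith) hδ.le
  rw [e1, mul_right_comm, mul_comm (|C| * _), mul_le_mul_iff_right₀ (by positivity)] at k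
  set X := log (n + 2) ^ e
  have hp : (0 : ℝ) < 3 ^ (2 - τ) := by positivity
  rw [one_div, inv_mul_eq_div, le_div_iff₀ (by positivity)] at h1
  have hX : 0 ≤ X := by positivity
  have hnp : 0 < (n : ℝ) ^ (2 - τ) := by positivity
  have h5 : 3 ^ (2 - τ) * (X * (2 * (|C| + 1))) ≤ 3 ^ (2 - τ) * (n : ℝ) ^ (2 - τ) := by linarith
  have h6 := le_of_mul_le_mul_left h5 hp
  nlinarith [abs_nonneg C]

/-! ### The exponents -/

theorem xNum_yDen (s : ℝ) (i : ℕ) : xNum (3 - s) (i + 3) = (i + 3) * ((i + 2) - (i + 1) * s) * (xNum (3 - s) (i + 2) / (i + 2)) ∧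
    yDen (3 - s) (i + 3) = s * yDen (3 - s) (i + 2) + xNum (3 - s) (i + 2) := by
  constructor
  · rw [xNum, xNum, Finset.prod_Icc_succ_top (by omega : 2 ≤ i + 2 + 1)]
    generalize ∏ j ∈ Icc 2 (i + 2), (_ : ℝ) = p
    push_cast; rw [mul_div_cancel_left₀ _ (by positivity : (i : ℝ) + 2 ≠ 0)]
    ring
  · rw [yDen, yDen, show i + 3 - 1 = i + 1 + 1 by omega, Finset.sum_Icc_succ_top (by omega), show i + 2 - 1 = i + 1 by omega,
      mul_add, mul_sum, show i + 3 - 2 = i + 2 - 2 + 1 by omega, pow_succ', show i + 1 + 1 - (i + 1 + 1) = 0 by omega,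
      pow_zero, one_mul, sub_sub_cancel]
    refine (add_assoc _ _ _).symm.trans (congrArg (· + _) ((add_right_inj _).2 ?_))
    refine sum_congr rfl fun j hj => ?_
    rw [mem_Icc] at hj; rw [show i + 1 + 1 - j = i + 1 - j + 1 by omega, pow_succ', mul_assoc]

theorem alpha_eq {s : ℝ} (h0 : 0 ≤ s) (h1 : s ≤ 1) (i : ℕ) : alpha (3 - s) (i + 2) = (i + 2) * bt s i := by
  have key : 0 < yDen (3 - s) (i + 2) ∧ xNum (3 - s) (i + 2) = (i + 2) * bt s i * yDen (3 - s) (i + 2) := by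
    induction i with
    | zero => norm_num [xNum, yDen, bt]
    | succ i ih =>
      obtain ⟨hy, hx⟩ := ih
      obtain ⟨e1, e2⟩ := xNum_yDen s i
      have hb := (bt_pos_le h0 h1 i).1
      have hd : s + (i + 2) * bt s i ≠ 0 := by positivity
      rw [show i + 1 + 2 = i + 3 by ring, e1, e2, hx]
      refine ⟨by positivity, ?_⟩
      rw [bt]; push_cast; field_simp; ring
  rw [alpha, key.2, mul_div_cancel_right₀ _ key.1.ne']

theorem timeU_le {s s' ε : ℝ} (h0 : 0 ≤ s) (h1 : s ≤ 1) (h0' : 0 ≤ s') (i : ℕ) (h : i = 0 ∨ (0 < s ∧ s - s' ≤ ε)) (hε : 0 ≤ ε)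
    (hb : ((i : ℝ) + 2) * |bt s' i - bt s i| ≤ ε) {n t : ℕ} (hn : 1 ≤ n) (ht : t ≤ n ^ (i + 2))
    (hγ : (n : ℝ) ^ gamma (3 - s) (i + 2) ≤ t) :
    timeU s' i n t ≤ 2 * ((n : ℝ) ^ (alpha (3 - s) (i + 2) + ε) * (t : ℝ) ^ (1 - alpha (3 - s) (i + 2) / (i + 2 : ℕ))) := by
  have hn1 : (1 : ℝ) ≤ n := by exact_mod_cast hn
  have hn0 : (0 : ℝ) < n := by linarith
  have ht0 : (0 : ℝ) < t := (Real.rpow_pos_of_pos hn0 _).trans_le hγ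
  have ht1 : (1 : ℝ) ≤ t := by exact_mod_cast Nat.one_le_iff_ne_zero.2 fun h => by simp [h] at ht0
  have hi : (0 : ℝ) < i + 2 := by positivity
  obtain ⟨b0, b1⟩ := bt_pos_le h0 h1 i
  have e1 : alpha (3 - s) (i + 2) / (i + 2 : ℕ) = bt s i := by rw [alpha_eq h0 h1]; push_cast; field_simp
  have hexp : ∀ {a b : ℝ}, a ≤ b → (n : ℝ) ^ a ≤ (n : ℝ) ^ b := rpow_le_rpow_of_exponent_le hn1
  rw [e1, alpha_eq h0 h1, two_mul, timeU]
  refine add_le_add ?_ ?_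
  · rcases i with _ | i
    · simp only [bt, sub_self, Real.rpow_zero, mul_one]
      exact hexp (by linarith)
    · obtain ⟨hs, hss⟩ := h.resolve_left (by omega)
      have hb1 := bt_lt_one hs h1 i
      set b := bt s (i + 1)
      have e2 : gamma (3 - s) (i + 1 + 2) * (1 - b) = ((i + 1 : ℕ) + 2) * (1 - b) - s := by
        have : 1 - b ≠ 0 := by linarith
        rw [gamma, if_neg (by omega), alpha_eq h0 h1]
        have : (((i + 1 + 2 : ℕ) : ℝ) - (((i + 1 : ℕ) : ℝ) + 2) * b) = ((i + 1 : ℕ) + 2) * (1 - b) := by push_cast; ring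
        rw [this]; push_cast; field_simp; ring
      have h2 := Real.rpow_le_rpow (by positivity) hγ (show 0 ≤ 1 - b by linarith)
      rw [← rpow_mul hn0.le, e2] at h2
      refine le_trans ?_ (mul_le_mul_of_nonneg_left h2 (by positivity))
      rw [← rpow_add hn0]; exact hexp (by linarith)
  · have e3 : (t : ℝ) ^ (1 - bt s' i) = t ^ (1 - bt s i) * t ^ (bt s i - bt s' i) := by rw [← rpow_add ht0]; congr 1; ring
    rw [e3, mul_left_comm, mul_comm]
    refine mul_le_mul_of_nonneg_right ?_ (by positivity)
    rcases le_total (bt s' i) (bt s i) with hle | hle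
    · calc _ ≤ (n : ℝ) ^ (((i : ℝ) + 2) * bt s' i) * ((n : ℝ) ^ (i + 2)) ^ (bt s i - bt s' i) := by
            have : (t : ℝ) ≤ (n : ℝ) ^ (i + 2) := by exact_mod_cast ht
            gcongr
        _ = (n : ℝ) ^ (((i : ℝ) + 2) * bt s i) := by rw [← rpow_natCast, ← rpow_mul hn0.le, ← rpow_add hn0]; congr 1; push_cast; ring
        _ ≤ _ := hexp (by linarith)
    · rw [abs_of_nonneg (by linarith)] at hb
      refine (mul_le_of_le_one_right (by positivity) (Real.rpow_le_one_of_one_le_of_nonpos ht1 (by linarith))).trans (hexp ?_)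
      linarith

theorem continuousOn_bt (i : ℕ) : ContinuousOn (fun s => bt s i) (Set.Icc 0 1) := by
  induction i with
  | zero => exact continuousOn_const
  | succ i ih =>
    refine ContinuousOn.div (by fun_prop) (by fun_prop) fun s hs => ?_
    have := (bt_pos_le hs.1 hs.2 i).1
    have := hs.1
    positivity

theorem ncard_lt {n : ℕ} (hn : 1 ≤ n) (G : SimpleGraph (Fin n)) (i : ℕ) : (G.cliqueSet (i + 2)).ncard < n ^ (i + 2) := by
  classical
  rw [← SimpleGraph.coe_cliqueFinset, Set.ncard_coe_finset]
  have h := G.card_cliqueFinset_le (n := i + 2)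
  rw [Fintype.card_fin] at h
  exact h.trans_lt (Nat.choose_lt_pow (by omega) (by omega))

theorem CliqueListTime.of_timeU {i : ℕ} {s γ D : ℝ} {f : ℕ → ℕ → ℝ} (h0 : 0 ≤ s) (h1 : s ≤ 1) (hs : 3 ≤ i + 2 → 0 < s)
    (hM : MatMulTime (3 - s)) (hf : ∀ n t : ℕ, 1 ≤ n → t ≤ n ^ (i + 2) → (n : ℝ) ^ γ ≤ t → timeU s i n t ≤ D * f n t) :
    CliqueListTime (i + 2) γ f := fun d => by
  obtain ⟨p, c, C, e, hC, h⟩ := listing_of_matMul i h0 h1 hs hM d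
  refine ⟨p, c, C * D, e, fun n hn G t ht htγ => h n hn G _ (Nat.floor_le_floor ?_)⟩
  subst ht
  have : 0 ≤ log ((n : ℝ) + 2) := log_nonneg (by linarith [n.cast_nonneg (α := ℝ)])
  have hL := pow_nonneg this e
  rw [mul_assoc C D]
  exact mul_le_mul_of_nonneg_right (mul_le_mul_of_nonneg_left (hf n _ hn (ncard_lt hn G i).le htγ) hC) hL

theorem cliqueListTime_of_matMulTime (i : ℕ) {ω : ℝ} (h2 : 2 ≤ ω) (h3 : ω < 3) (hM : MatMulTime ω) :
    CliqueListTime (i + 2) (gamma ω (i + 2)) fun n t => (n : ℝ) ^ alpha ω (i + 2) * (t : ℝ) ^ (1 - alpha ω (i + 2) / (i + 2 : ℕ)) := by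
  obtain ⟨s, rfl⟩ : ∃ s, ω = 3 - s := ⟨3 - ω, by ring⟩
  refine .of_timeU (by linarith) (by linarith) (fun _ => by linarith) hM fun n t hn ht hγ =>
    (timeU_le (ε := 0) (by linarith) (by linarith) (by linarith) i (Or.inr ⟨by linarith, by simp⟩) le_rfl (by simp) hn ht hγ).trans_eq
      (by rw [add_zero])

theorem cliqueListTime_exponent (i : ℕ) {ε : ℝ} (hε : 0 < ε) :
    CliqueListTime (i + 2) (gamma matMulExponent (i + 2)) fun n t => (n : ℝ) ^ (alpha matMulExponent (i + 2) + ε) *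
      (t : ℝ) ^ (1 - alpha matMulExponent (i + 2) / (i + 2 : ℕ)) := by
  have hb : 2 ≤ matMulExponent := le_csInf ⟨3, matMulTime_three⟩ fun _ h => h.two_le
  have h3 : matMulExponent ≤ 3 := csInf_le ⟨2, fun _ h => h.two_le⟩ matMulTime_three
  obtain ⟨s, hs⟩ : ∃ s, matMulExponent = 3 - s := ⟨3 - matMulExponent, by ring⟩
  rw [hs] at hb h3 ⊢
  have h0 : 0 ≤ s := by linarith
  have h1 : s ≤ 1 := by linarith
  rcases Nat.eq_zero_or_pos i with rfl | hi
  · exact .of_timeU le_rfl zero_le_one (by omega) (by simpa using matMulTime_three) fun n t hn ht hγ =>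
      timeU_le h0 h1 le_rfl 0 (Or.inl rfl) hε.le (by simpa [bt] using hε.le) hn ht hγ
  rcases h0.eq_or_lt with rfl | hs0
  · refine fun d => ⟨.skip, 0, 0, 0, fun n hn G t ht hγ => absurd (ncard_lt hn G i) (not_lt.2 ?_)⟩
    rw [gamma, if_neg (by omega), ← ht] at *; simp only [sub_zero, sub_self, zero_div, mul_one, rpow_natCast] at hγ
    exact_mod_cast hγ
  · have hc := (continuousOn_bt i) s ⟨h0, h1⟩
    obtain ⟨δ, hδ, hc⟩ := Metric.continuousWithinAt_iff.1 hc (ε / (i + 2)) (by positivity)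
    obtain ⟨ω, hω, hlt⟩ := exists_lt_of_csInf_lt ⟨3, matMulTime_three⟩
      (show matMulExponent < 3 - s + min (min δ ε) s by rw [hs]; simp [hδ, hε, hs0])
    have hle : 3 - s ≤ ω := hs ▸ csInf_le ⟨2, fun _ h => h.two_le⟩ hω
    obtain ⟨s', rfl⟩ : ∃ s, ω = 3 - s := ⟨3 - ω, by ring⟩
    have m1 : min (min δ ε) s ≤ δ := (min_le_left _ _).trans (min_le_left _ _)
    have m2 : min (min δ ε) s ≤ ε := (min_le_left _ _).trans (min_le_right _ _)
    have m3 : min (min δ ε) s ≤ s := min_le_right _ _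
    have hs' : 0 < s' := by linarith
    have hd := hc (x := s') ⟨hs'.le, by linarith⟩ (by rw [Real.dist_eq, abs_lt]; constructor <;> linarith)
    rw [Real.dist_eq, lt_div_iff₀ (by positivity), mul_comm] at hd
    exact .of_timeU hs'.le (by linarith) (fun _ => hs') hω fun n t hn ht hγ =>
      timeU_le h0 h1 hs'.le i (Or.inr ⟨hs0, by linarith⟩) hε.le hd.le hn ht hγ

theorem xNum_two (k : ℕ) : xNum 2 k = k := by rw [xNum, Finset.prod_eq_one fun j _ => by ring, mul_one]

theorem yDen_two {k : ℕ} (hk : 2 ≤ k) : yDen 2 k = k * (k - 1) / 2 := by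
  obtain ⟨i, rfl⟩ := Nat.exists_eq_add_of_le' hk
  have h3 : (3 : ℝ) - 1 = 2 := by norm_num
  induction i with
  | zero => norm_num [yDen]
  | succ i ih =>
    have := (xNum_yDen 1 i).2
    rw [h3, ih (by omega), xNum_two] at this; rw [show i + 1 + 2 = i + 3 by ring, this]
    push_cast; ring

theorem alpha_two {k : ℕ} (hk : 2 ≤ k) : alpha 2 k = 2 / ((k : ℝ) - 1) := by
  have : (2 : ℝ) ≤ k := by exact_mod_cast hk
  have : (k : ℝ) - 1 ≠ 0 := by linarith
  rw [alpha, xNum_two, yDen_two hk]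
  field_simp

theorem gamma_two {k : ℕ} (hk : 3 ≤ k) : gamma 2 k = k - 1 - 2 / ((k : ℝ) ^ 2 - k - 2) := by
  have h3 : (3 : ℝ) ≤ k := by exact_mod_cast hk
  have h1 : (k : ℝ) - 1 ≠ 0 := by linarith
  have h2 : (k : ℝ) ^ 2 - k - 2 ≠ 0 := by nlinarith
  have e : (k : ℝ) - 2 / (k - 1) = (k ^ 2 - k - 2) / (k - 1) := by field_simp
  rw [gamma, if_neg (by omega), alpha_two (by omega), e]
  generalize hq : (k : ℝ) ^ 2 - k - 2 = q at h2
  field_simp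
  rw [← hq]
  ring

end

end CliqueListing

open CliqueListing
theorem mainTheorem3 (k : ℕ) (hk : 2 ≤ k) :
    -- if matrices can be multiplied in `Õ(n ^ ω)` time
    (∀ ω : ℝ, 2 ≤ ω → ω < 3 → MatMulTime ω →
      CliqueListTime k (gamma ω k)
        (fun n t => (n : ℝ) ^ alpha ω k * (t : ℝ) ^ (1 - alpha ω k / k))) ∧
    -- with the exponent, which need not be attained, up to factors `n ^ ε`
    (∀ ε : ℝ, 0 < ε →
      CliqueListTime k (gamma matMulExponent k)
        (fun n t => (n : ℝ) ^ (alpha matMulExponent k + ε) *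
          (t : ℝ) ^ (1 - alpha matMulExponent k / k))) ∧
    -- the case `ω = 2`
    xNum 2 k = k ∧ yDen 2 k = k * (k - 1) / 2 ∧
    (3 ≤ k →
      (MatMulTime 2 →
        CliqueListTime k (k - 1 - 2 / ((k : ℝ) ^ 2 - k - 2))
          (fun n t => (n : ℝ) ^ (2 / ((k : ℝ) - 1)) * (t : ℝ) ^ (1 - 2 / ((k : ℝ) * (k - 1))))) ∧
      (matMulExponent = 2 → ∀ ε : ℝ, 0 < ε →
        CliqueListTime k (k - 1 - 2 / ((k : ℝ) ^ 2 - k - 2))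
          (fun n t => (n : ℝ) ^ (2 / ((k : ℝ) - 1) + ε) *
            (t : ℝ) ^ (1 - 2 / ((k : ℝ) * (k - 1)))))) := by
  obtain ⟨i, rfl⟩ := Nat.exists_eq_add_of_le' hk
  have h1 := fun ω h2 h3 => cliqueListTime_of_matMulTime i (ω := ω) h2 h3
  have h2 := fun ε => cliqueListTime_exponent i (ε := ε)
  refine ⟨h1, h2, xNum_two _, yDen_two hk, fun hk3 => ?_⟩
  have hk3' : (3 : ℝ) ≤ (i + 2 : ℕ) := by exact_mod_cast hk3
  have e : (2 : ℝ) / (((i + 2 : ℕ) : ℝ) - 1) / (i + 2 : ℕ) = 2 / (((i + 2 : ℕ) : ℝ) * ((i + 2 : ℕ) - 1)) := by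
    rw [div_div, mul_comm]
  refine ⟨fun hM => ?_, fun hM ε hε => ?_⟩
  · have := h1 2 le_rfl (by norm_num) hM
    rwa [gamma_two hk3, alpha_two hk, e] at this
  · have := h2 ε hε
    rwa [hM, gamma_two hk3, alpha_two hk, e] at this
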